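/- **Setting.** Let $n$ be a positive integer or $\infty$, let $\varphi_i:\mathbb C\to\mathbb C$ ($1\le i\le n$, $i<\infty$) be deterministic functions with $\varphi_i(\mathbb R)\subset\mathbb R$, and let $(\xi_i)_{1\le i\le n}$ and $(\tilde\xi_i)_{1\le i\le n}$ be two sequences of real random variables (possibly on different probability spaces). Put $F_n=\sum_{i=1}^n\xi_i\varphi_i$ and $\tilde F_n=\sum_{i=1}^n\tilde\xi_i\varphi_i$; for $n=\infty$ the series are pointwise limits of partial sums. Let $0<\delta_n<1$ and $D_n\subset\mathbb C$. $B(z,r)$ is the open disk, $A+B=\{a+b\}$ for sets, and $\mathbb C_+=\{\Im z>0\}$. Roots are listed with multiplicity; a function vanishing identically near a point has, by convention, no roots there. **Condition C1** (constants $N_0,\tau>0$, $0<\varepsilon<1$). (i) The $\xi_i$ are independent, have variance $1$, and $\mathbb E|\xi_i-\mathbb E\xi_i|^{2+\varepsilon}\le\tau$; likewise the $\tilde\xi_i$. (ii) For $i\ge N_0$ and $a,b\in\{0,1,2\}$ with $a+b\le 2$, $\mathbb E(\Re\xi_i)^a(\Im\xi_i)^b=\mathbb E(\Re\tilde\xi_i)^a(\Im\tilde\xi_i)^b$;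 for $i<N_0$, $|\mathbb E\xi_i-\mathbb E\tilde\xi_i|\le\tau$. **Condition C2** with positive parameters $(m,C_1,\alpha_1,A,c_1,C)$, for $F_n$: (1) for every $z\in D_n$, almost surely the sum defining $F_n$ converges at every point of $B(z,2)$ and $F_n$ is analytic on $B(z,2)$; and $\mathbb E\,N^{m+2}\mathbf 1_{N\ge\delta_n^{-C_1}}\le C$, where $N$ is the number of roots of $F_n$ in $B(z,1)$; (2) for every $z\in D_n$, with probability at least $1-C\delta_n^A$ there is $z'\in B(z,1/100)$ with $|F_n(z')|\ge\exp(-\delta_n^{-c_1})$; (3) for every $z\in D_n$, with probability at least $1-C\delta_n^A$, $|F_n(w)|\le\exp(\delta_n^{-c_1})$ for all $w\in B(z,2)$; (4) for every $z\in D_n+B(0,1)$, $\sum_j|\varphi_j(z)|^2<\infty$ and, for every $i$, $|\varphi_i(z)|\le C\delta_n^{\alpha_1}\big(\sum_{j=1}^n|\varphi_j(z)|^2\big)^{1/2}$; (5) for every real $x\in D_n+B(0,1)$, $$\sum_{j=1}^n|\varphi_j'(x)|^2\le C\delta_n^{-c_1}\sum_{j=1}^n|\varphi_j(x)|^2,\qquad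 \sum_{j=1}^n\sup_{z\in B(x,1)}|\varphi_j''(z)|^2\le C\delta_n^{-c_1}\sum_{j=1}^n|\varphi_j(x)|^2,$$ $$\sum_{j=1}^n|\mathbb E\xi_j|\sup_{z\in B(x,1)}|\varphi_j''(z)|\le C\delta_n^{-c_1}\Big(\sum_{j=1}^n|\varphi_j(x)|^2\Big)^{1/2}.$$ For $\tilde F_n$ the condition is the same with $\tilde\xi_i$ in place of $\xi_i$. For $G:\mathbb R^k\times\mathbb C^l\to\mathbb C$, $\|\nabla^aG\|_\infty$ is the supremum over all points of the absolute values of all partial derivatives of total order $a$ of the real and imaginary parts of $G$, regarded as functions on $\mathbb R^{k+2l}$ through $(x,u,v)\mapsto G(x,u+iv)$. **Theorem (General real universality).** Let $N_0,\tau>0$, $0<\varepsilon<1$, $\alpha_1,C_1,C>0$, let $k,l\ge0$ be integers with $k+l\ge1$, and set $$A=2(k+l+2)(C_1+2)+\frac{\alpha_1\varepsilon}{60},\qquad c_1=\frac{\alpha_1\varepsilon}{10^9(k+l)^4}.$$ There are constants $C',c>0$ depending only on $k,l,N_0,\tau,\varepsilon,\alpha_1,C_1,C$ (not on $n,\delta_n,D_n$,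 the $\varphi_i$ or the random variables) such that the following holds. Suppose that the real sequences $(\xi_i),(\tilde\xi_i)$ satisfy C1 with constants $N_0,\tau,\varepsilon$, that $\varphi_i(\mathbb R)\subset\mathbb R$ for all $i$, and that both $F_n$ and $\tilde F_n$ satisfy C2 with parameters $(k+l,C_1,\alpha_1,A,c_1,C)$. Then for all real $x_1,\dots,x_k$ and complex $z_1,\dots,z_l$, all in $D_n$, and every $G:\mathbb R^k\times\mathbb C^l\to\mathbb C$ supported on $\prod_{i=1}^k[x_i-\frac1{100},x_i+\frac1{100}]\times\prod_{j=1}^lB(z_j,\frac1{100})$, with continuous derivatives up to order $2(k+l)+4$ and $\|\nabla^aG\|_\infty\le1$ for $0\le a\le2(k+l)+4$, both sums below are integrable and $$\Big|\mathbb E\sum G(\zeta_{i_1},\dots,\zeta_{i_k},\zeta_{j_1},\dots,\zeta_{j_l})-\mathbb E\sum G(\tilde\zeta_{i_1},\dots,\tilde\zeta_{i_k},\tilde\zeta_{j_1},\dots,\tilde\zeta_{j_l})\Big|\le C'\delta_n^{\,c},$$ where the first sum runs over all $(k+l)$-tuples in $\mathbb R^k\times\mathbb C_+^l$ of (not necessarily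 distinct) roots $\zeta_1,\zeta_2,\dots$ of $F_n$, and the second over all such tuples of roots $\tilde\zeta_1,\tilde\zeta_2,\dots$ of $\tilde F_n$. -/

import Mathlib

open MeasureTheory ProbabilityTheory Filter Topology
open scoped ENNReal Pointwise

namespace RandomRoots

/-! ### The random function `F_n = ∑_{i=1}^n ξ_i φ_i`, for `n` a natural number or `∞` -/

/-- The index set `{i : 1 ≤ i ≤ n}`, where `n = ∞` is allowed.  Sequences of functions or of random
variables are indexed by `ℕ`; only their terms with index in `indices n` are ever used. -/
def indices (n : ℕ∞) : Set ℕ := {i | 1 ≤ i ∧ (i : ℕ∞) ≤ n}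

/-- The partial sum `∑_{1 ≤ i ≤ min(m, n)} c_i φ_i(z)`. -/
noncomputable def partialSum (n : ℕ∞) (φ : ℕ → ℂ → ℂ) (c : ℕ → ℂ) (m : ℕ) (z : ℂ) : ℂ :=
  ∑ i ∈ Finset.range (m + 1), (indices n).indicator (fun i => c i * φ i z) i

/-- The function `∑_{i=1}^n c_i φ_i`.  For finite `n` the partial sums are eventually constant, so
this is the finite sum; for `n = ∞` it is the limit of the partial sums at every point where they
converge (convergence is part of the analyticity condition in `CondC2` below). -/
noncomputable def linComb (n : ℕ∞) (φ : ℕ → ℂ → ℂ) (c : ℕ → ℂ) (z : ℂ) : ℂ :=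
  limUnder atTop (fun m => partialSum n φ c m z)

/-! ### Roots, listed with multiplicity -/

/-- The roots `ζ_1, ζ_2, …` of `f`, each repeated according to its multiplicity.  The natural number
`analyticOrderNatAt f ζ` is the order of vanishing of `f` at `ζ`; it is `0` if `f` is identically
zero near `ζ`, so that the zero function has, by convention, no roots. -/
abbrev Root (f : ℂ → ℂ) : Type := Σ ζ : ℂ, Fin (analyticOrderNatAt f ζ)

/-- The location of a root. -/
def Root.loc {f : ℂ → ℂ} (r : Root f) : ℂ := r.1

/-- The real roots of `f`. -/
abbrev RealRoot (f : ℂ → ℂ) : Type := {r : Root f // r.loc.im = 0}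

/-- The roots of `f` in the open upper half plane `ℂ₊`. -/
abbrev UpperRoot (f : ℂ → ℂ) : Type := {r : Root f // 0 < r.loc.im}

/-- The number of roots of `f` in `U`, counted with multiplicity. -/
noncomputable def rootCount (f : ℂ → ℂ) (U : Set ℂ) : ℕ∞ := {r : Root f | r.loc ∈ U}.encard

/-- `∑ G(ζ_{i_1}, …, ζ_{i_k}, ζ_{j_1}, …, ζ_{j_l})` over all `(k+l)`-tuples, in `ℝ^k × ℂ₊^l`, of
roots of `f` (indices may coincide, and roots are repeated according to multiplicity). -/
noncomputable def correlationSum {k l : ℕ} (G : (Fin k → ℝ) × (Fin l → ℂ) → ℂ) (f : ℂ → ℂ) : ℂ :=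
  ∑' p : (Fin k → RealRoot f) × (Fin l → UpperRoot f),
    G (fun i => (p.1 i).1.loc.re, fun j => (p.2 j).1.loc)

/-! ### Sup norms of derivatives of the test function -/

/-- For `f : ℝ^ι → ℝ`, the supremum over all points of the absolute values of all partial
derivatives of total order `a` (the directions `s 0, …, s (a-1)` are coordinate directions). -/
noncomputable def partialsSup {ι : Type*} [Fintype ι] [DecidableEq ι] (a : ℕ)
    (f : (ι → ℝ) → ℝ) : ℝ≥0∞ :=
  ⨆ (t : ι → ℝ) (s : Fin a → ι), ‖iteratedFDeriv ℝ a f t (fun m => Pi.single (s m) 1)‖ₑ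

/-- `(x, u, v) ↦ (x, u + i v)` from `ℝ^{k+2l}` to `ℝ^k × ℂ^l`. -/
def ofRealCoords {k l : ℕ} (t : Fin k ⊕ (Fin l ⊕ Fin l) → ℝ) : (Fin k → ℝ) × (Fin l → ℂ) :=
  (fun i => t (Sum.inl i), fun j => ⟨t (Sum.inr (Sum.inl j)), t (Sum.inr (Sum.inr j))⟩)

/-- `‖∇^a G‖_∞` for `G : ℝ^k × ℂ^l → ℂ`: the maximum of the corresponding quantities for the real
and imaginary parts of `G`, seen as functions on `ℝ^{k+2l}`. -/
noncomputable def nablaNorm {k l : ℕ} (a : ℕ) (G : (Fin k → ℝ) × (Fin l → ℂ) → ℂ) : ℝ≥0∞ :=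
  max (partialsSup a (fun t => (G (ofRealCoords t)).re))
    (partialsSup a (fun t => (G (ofRealCoords t)).im))

/-! ### The two conditions -/

/-- The moment and independence condition on one sequence `(ξ_i)_{1 ≤ i ≤ n}`: independent random
variables with variance `E|ξ_i - Eξ_i|² = 1` and `E|ξ_i - Eξ_i|^{2+ε} ≤ τ`. -/
structure BoundedMoments (n : ℕ∞) (τ ε : ℝ) {Ω : Type*} [MeasurableSpace Ω] (μ : Measure Ω)
    (ξ : ℕ → Ω → ℂ) : Prop where
  measurable : ∀ i ∈ indices n, Measurable (ξ i)
  indep : iIndepFun (fun i : indices n => ξ i) μ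
  memLp : ∀ i ∈ indices n, MemLp (ξ i) (ENNReal.ofReal (2 + ε)) μ
  variance : ∀ i ∈ indices n, ∫ ω, ‖ξ i ω - ∫ ω', ξ i ω' ∂μ‖ ^ 2 ∂μ = 1
  moment : ∀ i ∈ indices n, ∫ ω, ‖ξ i ω - ∫ ω', ξ i ω' ∂μ‖ ^ (2 + ε) ∂μ ≤ τ

/-- Condition C1 with constants `N₀, τ, ε` for two sequences, which may live on different
probability spaces. -/
structure CondC1 (n : ℕ∞) (N₀ : ℕ) (τ ε : ℝ) {Ω Ω' : Type*} [MeasurableSpace Ω]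
    [MeasurableSpace Ω'] (μ : Measure Ω) (μ' : Measure Ω') (ξ : ℕ → Ω → ℂ) (ξ' : ℕ → Ω' → ℂ) :
    Prop where
  left : BoundedMoments n τ ε μ ξ
  right : BoundedMoments n τ ε μ' ξ'
  /-- the moments of order at most two of real and imaginary parts agree from `N₀` on -/
  matching : ∀ i ∈ indices n, N₀ ≤ i → ∀ a b : ℕ, a + b ≤ 2 →
    ∫ ω, (ξ i ω).re ^ a * (ξ i ω).im ^ b ∂μ = ∫ ω, (ξ' i ω).re ^ a * (ξ' i ω).im ^ b ∂μ'
  exceptions : ∀ i ∈ indices n, i < N₀ → ‖(∫ ω, ξ i ω ∂μ) - ∫ ω, ξ' i ω ∂μ'‖ ≤ τ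

/-- Condition C2 with parameters `(k, C₁, α₁, A, c₁, C)` for the random function
`F = ∑_{i=1}^n ξ_i φ_i`, relative to `δ` and the region `D`.  The deterministic sums in the last
two items are sums of nonnegative terms with values in `[0, ∞]`. -/
structure CondC2 (n : ℕ∞) (δ : ℝ) (D : Set ℂ) (φ : ℕ → ℂ → ℂ) {Ω : Type*} [MeasurableSpace Ω]
    (μ : Measure Ω) (ξ : ℕ → Ω → ℂ) (k : ℕ) (C₁ α₁ A c₁ C : ℝ) : Prop where
  /-- almost surely the series converges on `B(z, 2)` to an analytic function -/
  analytic : ∀ z ∈ D, ∀ᵐ ω ∂μ,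
    (∀ w ∈ Metric.ball z 2, ∃ v : ℂ,
      Tendsto (fun m => partialSum n φ (fun i => ξ i ω) m w) atTop (𝓝 v)) ∧
    AnalyticOnNhd ℂ (linComb n φ (fun i => ξ i ω)) (Metric.ball z 2)
  /-- `E N^{k+2} 1_{N ≥ δ^{-C₁}} ≤ C`, with `N` the number of roots in `B(z, 1)` -/
  rootMoment : ∀ z ∈ D,
    ∫⁻ ω, {ω | ENNReal.ofReal (δ ^ (-C₁)) ≤
          (rootCount (linComb n φ (fun i => ξ i ω)) (Metric.ball z 1) : ℝ≥0∞)}.indicator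
        (fun ω => (rootCount (linComb n φ (fun i => ξ i ω)) (Metric.ball z 1) : ℝ≥0∞) ^ (k + 2)) ω
      ∂μ ≤ ENNReal.ofReal C
  antiConcentration : ∀ z ∈ D,
    1 - C * δ ^ A ≤ μ.real {ω | ∃ z' ∈ Metric.ball z (1 / 100),
      Real.exp (-δ ^ (-c₁)) ≤ ‖linComb n φ (fun i => ξ i ω) z'‖}
  boundedness : ∀ z ∈ D,
    1 - C * δ ^ A ≤ μ.real {ω | ∀ w ∈ Metric.ball z 2,
      ‖linComb n φ (fun i => ξ i ω) w‖ ≤ Real.exp (δ ^ (-c₁))}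
  /-- `∑_j |φ_j(z)|²` is finite on `D + B(0, 1)` (automatic when `n` is finite) -/
  summable : ∀ z ∈ D + Metric.ball (0 : ℂ) 1, ∑' j : indices n, ‖φ j z‖ₑ ^ 2 ≠ ∞
  delocalization : ∀ z ∈ D + Metric.ball (0 : ℂ) 1, ∀ i ∈ indices n,
    ‖φ i z‖ₑ ≤ ENNReal.ofReal (C * δ ^ α₁) * (∑' j : indices n, ‖φ j z‖ₑ ^ 2) ^ (1 / 2 : ℝ)
  derivGrowth₁ : ∀ x : ℝ, (x : ℂ) ∈ D + Metric.ball (0 : ℂ) 1 →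
    ∑' j : indices n, ‖deriv (φ j) x‖ₑ ^ 2 ≤
      ENNReal.ofReal (C * δ ^ (-c₁)) * ∑' j : indices n, ‖φ j x‖ₑ ^ 2
  derivGrowth₂ : ∀ x : ℝ, (x : ℂ) ∈ D + Metric.ball (0 : ℂ) 1 →
    ∑' j : indices n, ⨆ z ∈ Metric.ball (x : ℂ) 1, ‖iteratedDeriv 2 (φ j) z‖ₑ ^ 2 ≤
      ENNReal.ofReal (C * δ ^ (-c₁)) * ∑' j : indices n, ‖φ j x‖ₑ ^ 2
  derivGrowth₃ : ∀ x : ℝ, (x : ℂ) ∈ D + Metric.ball (0 : ℂ) 1 →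
    ∑' j : indices n, ‖∫ ω, ξ j ω ∂μ‖ₑ *
        ⨆ z ∈ Metric.ball (x : ℂ) 1, ‖iteratedDeriv 2 (φ j) z‖ₑ ≤
      ENNReal.ofReal (C * δ ^ (-c₁)) * (∑' j : indices n, ‖φ j x‖ₑ ^ 2) ^ (1 / 2 : ℝ)

end RandomRoots

/-!
Universality of the correlation functions of real roots of random series `F = ∑ ξ_j φ_j`.

By Jensen's formula, the mean of `log |F|` over the circle of radius `R` around `c`, minus its value
at `c`, is a sum over the roots of a kernel concentrated in the disk of radius `R` around `c`.
Integrating a product of such differences against a Lipschitz test function `Γ` gives a smoothed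
sum (`smoothSum`), which differs from the sum of `Γ` over tuples of roots (`rootSum`) by the
Lipschitz constant times `R` times the number of tuples: `norm_rootSum_sub_smoothSum_le`.

The logarithm is then replaced by the bounded smooth function `T sin (log (|F|² + β² V) / (2T))` with
`V = ∑ |φ_j|²` (`truncLog`).  The two differ only where `log |F|` is large, which is controlled by its
second moment in area (`LogBounded.setLIntegral_log_sq_le`, a quantitative form of Jensen's formula
under upper and lower bounds for `|F|`), or where `|F|² ≤ β V`, which has small expected area by a
small ball estimate: no term of the series dominates, so the characteristic function of the sum
decays like that of a Gaussian variable (`IndepNormalized.measureReal_norm_le`).  Expectations of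
products of truncated logarithms of the two series are compared by Lindeberg's exchange of one
variable at a time (`abs_integral_truncLogProd_sub_le`), where the finitely many variables with
different means are handled by the smallness of a single coefficient.

The test function that selects real roots and roots in the upper half plane is discontinuous across
the real axis.  It is replaced by one that varies over a strip of width `γ`; the root sums agree
unless there is a nonreal root in this strip.  As `F` is real on the real axis, such a root comes
with its conjugate, and then `|F|` is of order `γ² sup |F''|` at a nearby point of the real axis. By
the small ball estimate at the points of a grid of mesh `γ` this is unlikely
(`measure_root_near_real_le`).  This needs the `φ_j` to be analytic, which follows from the almost
sure analyticity of the series and the independence of the `ξ_j`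
(`IsAnalyticSeries.analytic_coeff`).

Events of small probability are absorbed by the moment bound for the number of roots
(`HasRootMoment.setLIntegral_le`).  With `γ`, `R`, `T`, `β` suitable powers of `δ`, all errors are
bounded by a positive power of `δ` (`isBigPower_error`).
-/

namespace RandomRoots

/-! ### Roots of an analytic function and Jensen's formula -/

section Roots

open Metric Real

variable {f : ℂ → ℂ} {U : Set ℂ}

lemma divisor_eq_analyticOrderNatAt (hf : AnalyticOnNhd ℂ f U) {u : ℂ} (hu : u ∈ U) :
    MeromorphicOn.divisor f U u = (analyticOrderNatAt f u : ℤ) := by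
  rw [MeromorphicOn.AnalyticOnNhd.divisor_apply hf hu, analyticOrderNatAt]
  cases analyticOrderAt f u <;> simp

lemma finite_setOf_analyticOrderNatAt_ne_zero {z : ℂ} {ρ : ℝ}
    (hf : AnalyticOnNhd ℂ f (closedBall z ρ)) :
    {u | u ∈ closedBall z ρ ∧ analyticOrderNatAt f u ≠ 0}.Finite := by
  refine ((MeromorphicOn.divisor f (closedBall z ρ)).finiteSupport
    (isCompact_closedBall z ρ)).subset ?_
  rintro u ⟨hu, h0⟩
  simpa [divisor_eq_analyticOrderNatAt hf hu] using h0

lemma finite_setOf_root_mem {z : ℂ} {ρ : ℝ} (hf : AnalyticOnNhd ℂ f (closedBall z ρ)) :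
    {r : Root f | r.loc ∈ closedBall z ρ}.Finite := by
  have h := finite_setOf_analyticOrderNatAt_ne_zero hf
  refine (h.toFinset.sigma
    (fun u => (Finset.univ : Finset (Fin (analyticOrderNatAt f u))))).finite_toSet.subset ?_
  rintro ⟨u, i⟩ hu
  simp only [Finset.coe_sigma, Set.Finite.coe_toFinset, Finset.coe_univ]
  refine ⟨⟨hu, fun h0 => ?_⟩, trivial⟩
  have h0' : analyticOrderNatAt f u = 0 := h0
  have := i.2
  omega

/-- The roots of `f` in `K`, as a finite set (empty, by convention, if there are infinitely
many). -/
noncomputable def rootsIn (f : ℂ → ℂ) (K : Set ℂ) : Finset (Root f) :=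
  open Classical in if h : {r : Root f | r.loc ∈ K}.Finite then h.toFinset else ∅

lemma mem_rootsIn {z : ℂ} {ρ : ℝ} (hf : AnalyticOnNhd ℂ f (closedBall z ρ)) {r : Root f} :
    r ∈ rootsIn f (closedBall z ρ) ↔ r.loc ∈ closedBall z ρ := by
  rw [rootsIn, dif_pos (finite_setOf_root_mem hf)]
  simp

lemma Root.apply_loc_eq_zero (r : Root f) : f r.loc = 0 := by
  obtain ⟨u, i⟩ := r
  by_contra h
  have := i.2
  have h0 : analyticOrderAt f u = 0 := by
    rw [analyticOrderAt_eq_zero]; exact Or.inr h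
  simp [analyticOrderNatAt, h0] at this

/-- **Jensen's formula**, with the zeros listed as roots.  Roots outside the disk do not
contribute, as `log⁺` vanishes there. -/
lemma circleAverage_log_norm_eq {c : ℂ} {R : ℝ} (hR : 0 < R)
    (hf : AnalyticOnNhd ℂ f (closedBall c R)) (hc : f c ≠ 0) (S : Finset (Root f))
    (hS : ∀ r : Root f, r.loc ∈ closedBall c R → r ∈ S) :
    circleAverage (fun w => log ‖f w‖) c R
      = log ‖f c‖ + ∑ r ∈ S, log⁺ (R * ‖r.loc - c‖⁻¹) := by
  classical
  have hRa : |R| = R := abs_of_pos hR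
  rw [AnalyticOnNhd.circleAverage_log_norm hR.ne' (by rwa [hRa]) hc, hRa, add_comm]
  congr 1
  have hfin := finite_setOf_analyticOrderNatAt_ne_zero hf
  rw [finsum_eq_sum_of_support_subset (s := hfin.toFinset)]
  · have hout : ∀ r ∈ S, r.loc ∉ closedBall c R → log⁺ (R * ‖r.loc - c‖⁻¹) = 0 := by
      intro r _ hr
      rw [mem_closedBall, dist_eq_norm, not_le] at hr
      rw [posLog_eq_zero_iff, abs_of_nonneg (by positivity), ← div_eq_mul_inv,
        div_le_one (hR.trans hr)]
      exact hr.le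
    have hsub : ∑ r ∈ S, log⁺ (R * ‖r.loc - c‖⁻¹)
        = ∑ r ∈ hfin.toFinset.sigma (fun u => (Finset.univ : Finset (Fin (analyticOrderNatAt f u)))),
          log⁺ (R * ‖Root.loc r - c‖⁻¹) := by
      symm
      refine Finset.sum_subset ?_ ?_
      · intro r hr
        refine hS r ?_
        simp only [Finset.mem_sigma, Set.Finite.mem_toFinset] at hr
        exact hr.1.1
      · intro r hr hr'
        refine hout r hr fun hmem => hr' ?_
        simp only [Finset.mem_sigma, Set.Finite.mem_toFinset, Finset.mem_univ, and_true]
        refine ⟨hmem, fun h0 => ?_⟩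
        have := r.2.2
        omega
    rw [hsub, Finset.sum_sigma]
    refine Finset.sum_congr rfl fun u hu => ?_
    have hu' : u ∈ closedBall c R := by simpa using ((hfin.mem_toFinset).1 hu).1
    rw [divisor_eq_analyticOrderNatAt hf hu']
    simp only [Root.loc, Finset.sum_const, Finset.card_univ, Fintype.card_fin, nsmul_eq_mul,
      Int.cast_natCast]
    congr 1
    rw [norm_sub_rev]
    by_cases huc : u = c
    · simp [huc]
    · rw [posLog_eq_log]
      rw [mem_closedBall, dist_eq_norm] at hu'
      have : 0 < ‖u - c‖ := by simpa [sub_eq_zero] using huc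
      rw [abs_of_nonneg (by positivity), ← div_eq_mul_inv, le_div_iff₀ this]
      linarith
  · intro u hu
    rw [Function.mem_support] at hu
    have hu1 : MeromorphicOn.divisor f (closedBall c R) u ≠ 0 := fun h => hu (by simp [h])
    have hu2 : u ∈ closedBall c R := by
      by_contra h
      exact hu1 (Function.locallyFinsuppWithin.apply_eq_zero_of_notMem _ h)
    rw [divisor_eq_analyticOrderNatAt hf hu2] at hu1
    simpa using ⟨by simpa using hu2, by simpa using hu1⟩

lemma circleIntegrable_log_norm {c : ℂ} {R : ℝ} (hR : 0 < R)
    (hf : AnalyticOnNhd ℂ f (closedBall c R)) : CircleIntegrable (fun w => log ‖f w‖) c R :=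
  ((hf.mono (by rw [abs_of_pos hR]; exact sphere_subset_closedBall)).meromorphicOn).circleIntegrable_log_norm

/-- Integration over a disk in polar coordinates. -/
lemma setLIntegral_ball_eq (c : ℂ) (R : ℝ) (u : ℂ → ℝ≥0∞) (hu : Measurable u) :
    ∫⁻ w in ball c R, u w =
      ∫⁻ r in Set.Ioo 0 R, ENNReal.ofReal r * ∫⁻ θ in Set.Ioc 0 (2 * π), u (circleMap c r θ) := by
  have hper : ∀ r : ℝ, ∫⁻ θ in Set.Ioc 0 (2 * π), u (circleMap c r θ)
      = ∫⁻ θ in Set.Ioo (-π) π, u (circleMap c r θ) := by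
    intro r
    have hp : Function.Periodic (fun θ => u (circleMap c r θ)) (2 * π) :=
      (periodic_circleMap c r).comp u
    have h1 := isAddFundamentalDomain_Ioc two_pi_pos (0 : ℝ) volume
    have h2 := isAddFundamentalDomain_Ioc two_pi_pos (-π) volume
    have h := h1.setLIntegral_eq h2 (fun θ => u (circleMap c r θ)) hp.map_vadd_zmultiples
    rw [show (0 : ℝ) + 2 * π = 2 * π by ring, show -π + 2 * π = π by ring] at h
    rw [h, restrict_Ioo_eq_restrict_Ioc]
  rw [← lintegral_indicator measurableSet_ball, ← lintegral_add_right_eq_self _ c,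
    ← Complex.lintegral_comp_polarCoord_symm]
  have hm : Measurable fun p : ℝ × ℝ => ENNReal.ofReal p.1 •
      (ball c R).indicator u (Complex.polarCoord.symm p + c) := by
    have h1 : Measurable fun p : ℝ × ℝ => (Complex.polarCoord.symm p : ℂ) := by
      simp only [Complex.polarCoord_symm_apply]
      fun_prop
    exact (ENNReal.measurable_ofReal.comp measurable_fst).smul
      ((hu.indicator measurableSet_ball).comp (h1.add_const c))
  simp only [polarCoord_target, hper]
  rw [Measure.volume_eq_prod, ← Measure.prod_restrict, lintegral_prod _ hm.aemeasurable]
  rw [← lintegral_indicator measurableSet_Ioi, ← lintegral_indicator measurableSet_Ioo]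
  congr 1
  ext r
  by_cases hr0 : 0 < r
  · rw [Set.indicator_of_mem (show r ∈ Set.Ioi (0:ℝ) from hr0)]
    have hmem : ∀ θ : ℝ, Complex.polarCoord.symm (r, θ) + c = circleMap c r θ := by
      intro θ
      simp only [Complex.polarCoord_symm_apply, circleMap, Complex.exp_mul_I, Complex.ofReal_cos,
        Complex.ofReal_sin]
      ring
    simp only [hmem]
    by_cases hrR : r < R
    · rw [Set.indicator_of_mem (show r ∈ Set.Ioo (0:ℝ) R from ⟨hr0, hrR⟩)]
      have : ∀ θ, (ball c R).indicator u (circleMap c r θ) = u (circleMap c r θ) := by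
        intro θ
        refine Set.indicator_of_mem ?_ _
        simp [mem_ball, dist_eq_norm, circleMap, abs_of_pos hr0, hrR]
      simp only [this, smul_eq_mul]
      exact lintegral_const_mul _ (hu.comp (measurable_circleMap c r))
    · rw [Set.indicator_of_notMem (fun h => hrR h.2)]
      have : ∀ θ, (ball c R).indicator u (circleMap c r θ) = 0 := by
        intro θ
        refine Set.indicator_of_notMem ?_ _
        simpa [mem_ball, dist_eq_norm, circleMap, abs_of_pos hr0] using hrR
      simp [this]
  · rw [Set.indicator_of_notMem (show r ∉ Set.Ioi (0:ℝ) from hr0), Set.indicator_of_notMem (fun h => hr0 h.1)]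

end Roots

/-! ### The logarithmic kernel -/

section Kernel

open Metric Real

/-- The kernel `w ↦ log⁺ (1 / |w|)`, which is supported in the closed unit disk. -/
noncomputable def logKernel (w : ℂ) : ℝ := log⁺ ‖w‖⁻¹

lemma logKernel_nonneg (w : ℂ) : 0 ≤ logKernel w := posLog_nonneg

lemma measurable_logKernel : Measurable logKernel :=
  continuous_posLog.measurable.comp (measurable_norm.inv)

lemma logKernel_eq_zero {w : ℂ} (hw : 1 ≤ ‖w‖) : logKernel w = 0 := by
  rw [logKernel, posLog_eq_zero_iff, abs_of_nonneg (by positivity)]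
  exact inv_le_one_of_one_le₀ hw

lemma logKernel_sq_le (w : ℂ) : logKernel w ^ 2 ≤ 4 * ‖w‖⁻¹ := by
  have h0 : 0 ≤ ‖w‖⁻¹ := by positivity
  rcases h0.eq_or_lt with h | h
  · simp [logKernel, ← h]
  · have h1 : log⁺ ‖w‖⁻¹ ≤ 2 * √‖w‖⁻¹ := by
      rw [posLog_apply]
      refine max_le (by positivity) ?_
      have := log_le_rpow_div h0 (ε := 1 / 2) (by norm_num)
      rw [← sqrt_eq_rpow] at this
      linarith
    calc logKernel w ^ 2 ≤ (2 * √‖w‖⁻¹) ^ 2 := pow_le_pow_left₀ posLog_nonneg h1 2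
      _ = 4 * ‖w‖⁻¹ := by rw [mul_pow, sq_sqrt h0]; norm_num

lemma lintegral_logKernel_sq_le : ∫⁻ w, ENNReal.ofReal (logKernel w ^ 2) ≤ ENNReal.ofReal (8 * π) := by
  have h1 : ∫⁻ w, ENNReal.ofReal (logKernel w ^ 2)
      ≤ ∫⁻ w in ball (0 : ℂ) 1, ENNReal.ofReal (4 * ‖w‖⁻¹) := by
    rw [← lintegral_indicator measurableSet_ball]
    refine lintegral_mono fun w => ?_
    by_cases hw : w ∈ ball (0 : ℂ) 1
    · rw [Set.indicator_of_mem hw]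
      exact ENNReal.ofReal_le_ofReal (logKernel_sq_le w)
    · rw [Set.indicator_of_notMem hw, logKernel_eq_zero (by simpa using hw)]
      simp
  refine h1.trans ?_
  rw [setLIntegral_ball_eq 0 1 _ (by fun_prop)]
  calc ∫⁻ r in Set.Ioo (0:ℝ) 1, ENNReal.ofReal r * ∫⁻ θ in Set.Ioc 0 (2 * π),
        ENNReal.ofReal (4 * ‖circleMap 0 r θ‖⁻¹)
      = ∫⁻ r in Set.Ioo (0:ℝ) 1, ENNReal.ofReal (8 * π) := by
        refine setLIntegral_congr_fun measurableSet_Ioo fun r hr => ?_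
        have : ∀ θ, ‖circleMap 0 r θ‖ = r := fun θ => by simp [abs_of_pos hr.1]
        simp only [this, setLIntegral_const, volume_Ioc]
        rw [← ENNReal.ofReal_mul (by have := hr.1; positivity), ← ENNReal.ofReal_mul hr.1.le]
        congr 1
        have := hr.1.ne'
        field_simp
        ring
    _ ≤ ENNReal.ofReal (8 * π) := by simp

lemma integrable_logKernel_sq : Integrable (fun w => logKernel w ^ 2) := by
  refine ⟨(measurable_logKernel.pow_const 2).aestronglyMeasurable, ?_⟩
  rw [hasFiniteIntegral_iff_ofReal (ae_of_all _ fun w => sq_nonneg _)]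
  exact lintegral_logKernel_sq_le.trans_lt ENNReal.ofReal_lt_top

lemma integrable_logKernel : Integrable logKernel := by
  have h1 : IntegrableOn logKernel (ball 0 1) := by
    refine Integrable.mono' ((integrable_logKernel_sq.integrableOn (s := ball 0 1)).add
      (integrableOn_const (C := (1 : ℝ)) (by simp)))
      measurable_logKernel.aestronglyMeasurable (ae_of_all _ fun w => ?_)
    rw [norm_of_nonneg (logKernel_nonneg w)]
    simp only [Pi.add_apply]
    nlinarith [sq_nonneg (logKernel w - 1), logKernel_nonneg w]
  refine (integrableOn_iff_integrable_of_support_subset fun w hw => ?_).1 h1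
  by_contra h
  exact hw (logKernel_eq_zero (by simpa using h))

lemma integral_logKernel_pos : 0 < ∫ w, logKernel w := by
  rw [integral_pos_iff_support_of_nonneg logKernel_nonneg integrable_logKernel]
  have hsub : ball (0 : ℂ) 1 \ {0} ⊆ Function.support logKernel := by
    rintro w ⟨hw, hw0⟩
    have h1 : 0 < ‖w‖ := by simpa using hw0
    have h2 : 1 < ‖w‖⁻¹ := (one_lt_inv₀ h1).2 (by simpa using hw)
    rw [Function.mem_support, logKernel, posLog_eq_log (by rw [abs_of_pos (by positivity)]; exact h2.le)]
    exact (log_pos h2).ne'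
  refine lt_of_lt_of_le ?_ (measure_mono hsub)
  rw [measure_sdiff_null (by simp)]
  exact measure_ball_pos _ _ one_pos

end Kernel

/-! ### Control of `log |f|` by the size of `f` at one point and its maximum -/

section LogBounds

open Metric Real

variable {f : ℂ → ℂ} {z : ℂ} {Q : ℝ}

/-- `f` is analytic on the disk `B(z, 2)`, bounded there by `e ^ Q`, and at least `e ^ (-Q) / 2` in
absolute value somewhere near the centre. -/
structure LogBounded (f : ℂ → ℂ) (z : ℂ) (Q : ℝ) : Prop where
  one_le : 1 ≤ Q
  analytic : AnalyticOnNhd ℂ f (ball z 2)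
  le : ∀ w ∈ ball z 2, ‖f w‖ ≤ exp Q
  exists_le : ∃ z' ∈ ball z (1 / 100), exp (-Q) / 2 ≤ ‖f z'‖

lemma ae_ne_zero_of_analyticOnNhd {U : Set ℂ} (hU : IsOpen U) (hc : IsPreconnected U)
    (hf : AnalyticOnNhd ℂ f U) {w₀ : ℂ} (hw₀ : w₀ ∈ U) (h0 : f w₀ ≠ 0) :
    ∀ᵐ w ∂volume.restrict U, f w ≠ 0 := by
  have h := hf.preimage_zero_mem_codiscreteWithin h0 hw₀ ⟨⟨w₀, hw₀⟩, hc⟩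
  have := ae_restrict_le_codiscreteWithin (μ := (volume : Measure ℂ)) hU.measurableSet h
  filter_upwards [this] with w hw
  simpa using hw

lemma log_norm_le (hQ : 0 ≤ Q) {w : ℂ} (h : ‖f w‖ ≤ exp Q) : log ‖f w‖ ≤ Q := by
  rcases (norm_nonneg (f w)).eq_or_lt with h0 | h0
  · rw [← h0, log_zero]; exact hQ
  · exact (log_le_iff_le_exp h0).2 h

lemma circleAverage_log_norm_le (hQ : 0 ≤ Q) {c : ℂ} {R : ℝ} (hR : 0 < R)
    (hf : AnalyticOnNhd ℂ f (closedBall c R)) (hle : ∀ w ∈ closedBall c R, ‖f w‖ ≤ exp Q) :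
    circleAverage (fun w => log ‖f w‖) c R ≤ Q := by
  refine circleAverage_mono_on_of_le_circle (circleIntegrable_log_norm hR hf) fun w hw => ?_
  rw [abs_of_pos hR] at hw
  exact log_norm_le hQ (hle w (sphere_subset_closedBall hw))

lemma LogBounded.neg_le_log (h : LogBounded f z Q) :
    ∃ z' ∈ ball z (1 / 100), f z' ≠ 0 ∧ -(2 * Q) ≤ log ‖f z'‖ := by
  obtain ⟨z', hz', hle⟩ := h.exists_le
  have hpos : 0 < exp (-Q) / 2 := by positivity
  refine ⟨z', hz', norm_pos_iff.1 (hpos.trans_le hle), ?_⟩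
  have h1 := log_le_log hpos hle
  rw [log_div (by positivity) (by norm_num), log_exp] at h1
  have h2 := log_two_lt_d9
  have := h.one_le
  linarith

lemma LogBounded.card_rootsIn_le (h : LogBounded f z Q) :
    ((rootsIn f (closedBall z (4 / 5))).card : ℝ) ≤ 5 * Q := by
  obtain ⟨z', hz', h0, hlog⟩ := h.neg_le_log
  rw [mem_ball] at hz'
  have hsub : closedBall z' (19 / 10) ⊆ closedBall z (191 / 100) :=
    closedBall_subset_closedBall' (by linarith)
  have hsub2 : closedBall z (191 / 100) ⊆ ball z 2 := closedBall_subset_ball (by norm_num)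
  have han := h.analytic.mono hsub2
  have hQ : 0 ≤ Q := zero_le_one.trans h.one_le
  have hJ := circleAverage_log_norm_eq (R := 19 / 10) (by norm_num) (han.mono hsub) h0
    (rootsIn f (closedBall z (191 / 100))) (fun r hr => (mem_rootsIn han).2 (hsub hr))
  have hle := circleAverage_log_norm_le hQ (R := 19 / 10) (by norm_num) (han.mono hsub)
    (fun w hw => h.le w (hsub2 (hsub hw)))
  have han' : AnalyticOnNhd ℂ f (closedBall z (4 / 5)) :=
    h.analytic.mono (closedBall_subset_ball (by norm_num))
  have hsum : ((rootsIn f (closedBall z (4 / 5))).card : ℝ) * log 2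
      ≤ ∑ r ∈ rootsIn f (closedBall z (191 / 100)), log⁺ (19 / 10 * ‖r.loc - z'‖⁻¹) := by
    rw [← nsmul_eq_mul, ← Finset.sum_const]
    refine (Finset.sum_le_sum (fun r hr => ?_)).trans
      (Finset.sum_le_sum_of_subset_of_nonneg (fun r hr => ?_) fun _ _ _ => posLog_nonneg)
    · have hr' := (mem_rootsIn han').1 hr
      have hpos : 0 < ‖r.loc - z'‖ := by
        rw [norm_pos_iff, sub_ne_zero]
        rintro he
        exact h0 (he ▸ r.apply_loc_eq_zero)
      have hd : ‖r.loc - z'‖ ≤ 81 / 100 := by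
        rw [← dist_eq_norm]
        have := dist_triangle r.loc z z'
        rw [dist_comm z z'] at this
        rw [mem_closedBall] at hr'
        linarith
      refine le_trans ?_ (posLog_apply ▸ le_max_right _ _)
      refine log_le_log (by norm_num) ?_
      rw [← div_eq_mul_inv, le_div_iff₀ hpos]
      linarith
    · exact (mem_rootsIn han).2 (closedBall_subset_closedBall (by norm_num)
        ((mem_rootsIn han').1 hr))
  have h2 := log_two_gt_d9
  have hN : (0 : ℝ) ≤ (rootsIn f (closedBall z (4 / 5))).card := by positivity
  nlinarith

lemma setLIntegral_circleMap_eq {v : ℂ → ℝ} {c : ℂ} {R : ℝ} (hR : 0 < R)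
    (hv : CircleIntegrable v c R) (h0 : ∀ w ∈ sphere c R, 0 ≤ v w) :
    ∫⁻ θ in Set.Ioc 0 (2 * π), ENNReal.ofReal (v (circleMap c R θ))
      = ENNReal.ofReal (2 * π * circleAverage v c R) := by
  rw [circleAverage, smul_eq_mul, mul_inv_cancel_left₀ two_pi_pos.ne',
    intervalIntegral.integral_of_le two_pi_pos.le, ofReal_integral_eq_lintegral_ofReal]
  · exact (intervalIntegrable_iff_integrableOn_Ioc_of_le two_pi_pos.le).1 hv
  · exact ae_of_all _ fun θ => h0 _ (circleMap_mem_sphere c hR.le θ)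

/-- The lower bound for `log |f|` away from the zeros.  The nonnegative function `Q - log |f|` has
small integral over a disk by Jensen's inequality at `z'`; its circle averages around `c` are
therefore not all large, and Jensen's formula at `c` concludes. -/
lemma LogBounded.neg_log_le (h : LogBounded f z Q) {c : ℂ} (hc : c ∈ closedBall z (1 / 5))
    (hfc : f c ≠ 0) :
    |log ‖f c‖| ≤ 200 * Q + ∑ r ∈ rootsIn f (closedBall z (4 / 5)), logKernel (r.loc - c) := by
  obtain ⟨z', hz', h0, hlog⟩ := h.neg_le_log
  have hQ : 0 < Q := zero_lt_one.trans_le h.one_le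
  rw [mem_ball] at hz'
  rw [mem_closedBall] at hc
  have hsumnn : 0 ≤ ∑ r ∈ rootsIn f (closedBall z (4 / 5)), logKernel (r.loc - c) :=
    Finset.sum_nonneg fun _ _ => logKernel_nonneg _
  have hcb : c ∈ ball z 2 := by rw [mem_ball]; linarith
  refine abs_le.2 ⟨?_, by linarith [log_norm_le hQ.le (h.le c hcb)]⟩
  by_contra hcon
  rw [not_le] at hcon
  set g : ℂ → ℂ := (ball z 2).indicator f with hg
  have hgm : Measurable g := by
    classical
    rw [hg, ← Set.piecewise_eq_indicator]
    exact ContinuousOn.measurable_piecewise h.analytic.continuousOn continuousOn_const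
      measurableSet_ball
  have hgf : ∀ w ∈ ball z 2, g w = f w := fun w hw => Set.indicator_of_mem hw _
  set u : ℂ → ℝ≥0∞ := fun w => ENNReal.ofReal (Q - log ‖g w‖) with hu
  have hum : Measurable u := by
    exact (measurable_const.sub (measurable_log.comp hgm.norm)).ennreal_ofReal
  have key : ∀ (a : ℂ) (r : ℝ), 0 < r → closedBall a r ⊆ ball z 2 →
      ∫⁻ θ in Set.Ioc 0 (2 * π), u (circleMap a r θ)
        = ENNReal.ofReal (2 * π * (Q - circleAverage (fun w => log ‖f w‖) a r)) := by
    intro a r hr hsub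
    have hci := circleIntegrable_log_norm hr (h.analytic.mono hsub)
    have h1 : ∀ θ, u (circleMap a r θ) = ENNReal.ofReal (Q - log ‖f (circleMap a r θ)‖) := by
      intro θ
      rw [hu]
      simp only
      rw [hgf _ (hsub (sphere_subset_closedBall (circleMap_mem_sphere a hr.le θ)))]
    simp only [h1]
    rw [setLIntegral_circleMap_eq (v := fun w => Q - log ‖f w‖) hr
      ((circleIntegrable_const Q a r).sub hci)]
    · have h2 := circleAverage_fun_sub (circleIntegrable_const Q a r) hci
      rw [circleAverage_const] at h2
      rw [h2]
    · intro w hw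
      have := log_norm_le hQ.le (h.le w (hsub (sphere_subset_closedBall hw)))
      linarith
  have hup : ∫⁻ w in ball z' (19 / 10), u w ≤ ENNReal.ofReal (24 * π * Q) := by
    rw [setLIntegral_ball_eq _ _ _ hum]
    have hb : ∀ r ∈ Set.Ioo (0:ℝ) (19 / 10), ENNReal.ofReal r *
        ∫⁻ θ in Set.Ioc 0 (2 * π), u (circleMap z' r θ) ≤ ENNReal.ofReal (2 * (6 * π * Q)) := by
      rintro r ⟨hr0, hr1⟩
      have hsub : closedBall z' r ⊆ ball z 2 := closedBall_subset_ball' (by linarith)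
      rw [key z' r hr0 hsub, ← ENNReal.ofReal_mul hr0.le]
      refine ENNReal.ofReal_le_ofReal ?_
      have han : AnalyticOnNhd ℂ f (closedBall z' r) := h.analytic.mono hsub
      have hJ := circleAverage_log_norm_eq hr0 han h0
        (rootsIn f (closedBall z' r)) (fun r hr => (mem_rootsIn han).2 hr)
      have hnn : 0 ≤ ∑ r' ∈ rootsIn f (closedBall z' r), log⁺ (r * ‖r'.loc - z'‖⁻¹) :=
        Finset.sum_nonneg fun _ _ => posLog_nonneg
      have h3 : Q - circleAverage (fun w => log ‖f w‖) z' r ≤ 3 * Q := by linarith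
      calc r * (2 * π * (Q - circleAverage (fun w => log ‖f w‖) z' r))
          ≤ r * (2 * π * (3 * Q)) := by gcongr
        _ ≤ 2 * (2 * π * (3 * Q)) := by gcongr; linarith
        _ = _ := by ring
    calc _ ≤ ∫⁻ r in Set.Ioo (0:ℝ) (19 / 10), ENNReal.ofReal (2 * (6 * π * Q)) :=
          setLIntegral_mono measurable_const hb
      _ = ENNReal.ofReal (2 * (6 * π * Q) * (19 / 10)) := by
          rw [setLIntegral_const, volume_Ioo, ← ENNReal.ofReal_mul (by positivity)]
          norm_num
      _ ≤ _ := ENNReal.ofReal_le_ofReal (by nlinarith [mul_pos pi_pos hQ])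
  have hlow : ENNReal.ofReal (25 * π * Q) ≤ ∫⁻ w in ball c (1 / 2), u w := by
    rw [setLIntegral_ball_eq _ _ _ hum]
    have hb : ∀ r ∈ Set.Ioo (1 / 4 : ℝ) (1 / 2), ENNReal.ofReal (1 / 4 * (2 * π * (200 * Q))) ≤
        ENNReal.ofReal r * ∫⁻ θ in Set.Ioc 0 (2 * π), u (circleMap c r θ) := by
      rintro r ⟨hr0, hr1⟩
      have hr : 0 < r := by linarith
      have hsub1 : closedBall c r ⊆ closedBall z (4 / 5) :=
        closedBall_subset_closedBall' (by linarith)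
      have hsub : closedBall c r ⊆ ball z 2 := hsub1.trans (closedBall_subset_ball (by norm_num))
      rw [key c r hr hsub, ← ENNReal.ofReal_mul hr.le]
      refine ENNReal.ofReal_le_ofReal ?_
      have han : AnalyticOnNhd ℂ f (closedBall c r) := h.analytic.mono hsub
      have han' : AnalyticOnNhd ℂ f (closedBall z (4 / 5)) :=
        h.analytic.mono (closedBall_subset_ball (by norm_num))
      have hJ := circleAverage_log_norm_eq hr han hfc
        (rootsIn f (closedBall z (4 / 5))) (fun r hr => (mem_rootsIn han').2 (hsub1 hr))
      have hs : ∑ r' ∈ rootsIn f (closedBall z (4 / 5)), log⁺ (r * ‖r'.loc - c‖⁻¹)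
          ≤ ∑ r' ∈ rootsIn f (closedBall z (4 / 5)), logKernel (r'.loc - c) := by
        refine Finset.sum_le_sum fun r' _ => posLog_le_posLog (by positivity) ?_
        have : 0 ≤ ‖r'.loc - c‖⁻¹ := by positivity
        nlinarith
      have h3 : 200 * Q ≤ Q - circleAverage (fun w => log ‖f w‖) c r := by linarith
      gcongr
    calc ENNReal.ofReal (25 * π * Q)
        = ∫⁻ r in Set.Ioo (1 / 4 : ℝ) (1 / 2), ENNReal.ofReal (1 / 4 * (2 * π * (200 * Q))) := by
          rw [setLIntegral_const, volume_Ioo, ← ENNReal.ofReal_mul (by positivity)]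
          congr 1; ring
      _ ≤ ∫⁻ r in Set.Ioo (1 / 4 : ℝ) (1 / 2), ENNReal.ofReal r *
            ∫⁻ θ in Set.Ioc 0 (2 * π), u (circleMap c r θ) :=
          setLIntegral_mono' measurableSet_Ioo hb
      _ ≤ _ := lintegral_mono_set (Set.Ioo_subset_Ioo_left (by norm_num))
  have hsub : ball c (1 / 2) ⊆ ball z' (19 / 10) := by
    refine ball_subset_ball' ?_
    have := dist_triangle c z z'
    rw [dist_comm z z'] at this
    linarith
  have hfinal := hlow.trans ((lintegral_mono_set hsub).trans hup)
  rw [ENNReal.ofReal_le_ofReal_iff (by positivity)] at hfinal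
  nlinarith [mul_pos pi_pos hQ]

lemma LogBounded.ae_ne_zero (h : LogBounded f z Q) :
    ∀ᵐ w ∂volume.restrict (ball z 2), f w ≠ 0 := by
  obtain ⟨z', hz', h0, -⟩ := h.neg_le_log
  exact ae_ne_zero_of_analyticOnNhd isOpen_ball (convex_ball z 2).isPreconnected h.analytic
    (ball_subset_ball (by norm_num) hz') h0

lemma LogBounded.setLIntegral_log_sq_le (h : LogBounded f z Q) :
    ∫⁻ w in ball z (1 / 5), ENNReal.ofReal (log ‖f w‖ ^ 2) ≤ ENNReal.ofReal (10 ^ 6 * Q ^ 2) := by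
  have hQ : 0 < Q := zero_lt_one.trans_le h.one_le
  set S := rootsIn f (closedBall z (4 / 5)) with hS
  have hcard : (S.card : ℝ) ≤ 5 * Q := h.card_rootsIn_le
  have hptw : ∀ w ∈ ball z (1 / 5), f w ≠ 0 →
      log ‖f w‖ ^ 2 ≤ 80000 * Q ^ 2 + ∑ r ∈ S, 10 * Q * logKernel (r.loc - w) ^ 2 := by
    intro w hw hfw
    have h1 := h.neg_log_le (ball_subset_closedBall hw) hfw
    have h2 : (∑ r ∈ S, logKernel (r.loc - w)) ^ 2 ≤ S.card * ∑ r ∈ S, logKernel (r.loc - w) ^ 2 :=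
      sq_sum_le_card_mul_sum_sq
    have h3 : 0 ≤ ∑ r ∈ S, logKernel (r.loc - w) ^ 2 := Finset.sum_nonneg fun _ _ => sq_nonneg _
    have h4 := sq_le_sq' (by linarith [abs_nonneg (log ‖f w‖)]) h1
    rw [sq_abs] at h4
    rw [← Finset.mul_sum]
    nlinarith [sq_nonneg (200 * Q - ∑ r ∈ S, logKernel (r.loc - w)),
      mul_le_mul_of_nonneg_right hcard h3]
  have hae : ∀ᵐ w ∂volume.restrict (ball z (1 / 5)), f w ≠ 0 :=
    ae_mono (Measure.restrict_mono (ball_subset_ball (by norm_num)) le_rfl) h.ae_ne_zero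
  have hk : ∀ r : Root f, Measurable fun w : ℂ => ENNReal.ofReal (10 * Q * logKernel (r.loc - w) ^ 2) :=
    fun r => (((measurable_logKernel.comp (measurable_const.sub measurable_id)).pow_const
      2).const_mul _).ennreal_ofReal
  calc ∫⁻ w in ball z (1 / 5), ENNReal.ofReal (log ‖f w‖ ^ 2)
      ≤ ∫⁻ w in ball z (1 / 5), (ENNReal.ofReal (80000 * Q ^ 2) +
          ∑ r ∈ S, ENNReal.ofReal (10 * Q * logKernel (r.loc - w) ^ 2)) := by
        refine lintegral_mono_ae ?_
        filter_upwards [hae, ae_restrict_mem measurableSet_ball] with w hw0 hw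
        rw [← ENNReal.ofReal_sum_of_nonneg (fun _ _ => by positivity),
          ← ENNReal.ofReal_add (by positivity) (Finset.sum_nonneg fun _ _ => by positivity)]
        exact ENNReal.ofReal_le_ofReal (hptw w hw hw0)
    _ = ENNReal.ofReal (80000 * Q ^ 2) * volume (ball z (1 / 5)) +
          ∑ r ∈ S, ∫⁻ w in ball z (1 / 5), ENNReal.ofReal (10 * Q * logKernel (r.loc - w) ^ 2) := by
        rw [lintegral_add_left measurable_const, setLIntegral_const,
          lintegral_finsetSum _ fun r _ => hk r]
    _ ≤ ENNReal.ofReal (80000 * Q ^ 2) * ENNReal.ofReal 4 +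
          ∑ r ∈ S, ENNReal.ofReal (10 * Q * (8 * π)) := by
        gcongr with r hr
        · rw [Complex.volume_ball]
          rw [← ENNReal.ofReal_pow (by norm_num), ← ENNReal.ofReal_coe_nnreal,
            ← ENNReal.ofReal_mul (by norm_num)]
          refine ENNReal.ofReal_le_ofReal ?_
          rw [NNReal.coe_real_pi]
          nlinarith [pi_lt_d2]
        · refine (setLIntegral_le_lintegral _ _).trans ?_
          simp_rw [ENNReal.ofReal_mul (show 0 ≤ 10 * Q by positivity)]
          rw [lintegral_const_mul' _ _ ENNReal.ofReal_ne_top,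
            lintegral_sub_left_eq_self (fun w => ENNReal.ofReal (logKernel w ^ 2)) r.loc]
          gcongr
          exact lintegral_logKernel_sq_le
    _ ≤ ENNReal.ofReal (10 ^ 6 * Q ^ 2) := by
        rw [Finset.sum_const, nsmul_eq_mul, ← ENNReal.ofReal_natCast,
          ← ENNReal.ofReal_mul (by positivity), ← ENNReal.ofReal_mul (by positivity),
          ← ENNReal.ofReal_add (by positivity) (by positivity)]
        refine ENNReal.ofReal_le_ofReal ?_
        have h5 : (S.card : ℝ) * (10 * Q * (8 * π)) ≤ 5 * Q * (10 * Q * (8 * π)) := by gcongr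
        nlinarith [pi_lt_d2, mul_pos hQ hQ]

end LogBounds

/-! ### Small ball probabilities for sums of independent random variables -/

section SmallBall

open Real

/-- A law on `ℝ` with variance `1` and `(2 + ε)`-th centred absolute moment at most `τ`. -/
structure NormalizedLaw (τ ε : ℝ) (ν : Measure ℝ) : Prop where
  isProb : IsProbabilityMeasure ν
  memLp : MemLp id (ENNReal.ofReal (2 + ε)) ν
  variance : ∫ x, (x - ∫ y, y ∂ν) ^ 2 ∂ν = 1
  moment : ∫ x, |x - ∫ y, y ∂ν| ^ (2 + ε) ∂ν ≤ τ

/-- Independent random variables with normalized laws. -/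
structure IndepNormalized {J Ω : Type*} [MeasurableSpace Ω] (τ ε : ℝ) (μ : Measure Ω)
    (ξ : J → Ω → ℝ) : Prop where
  measurable : ∀ j, Measurable (ξ j)
  indep : iIndepFun ξ μ
  law : ∀ j, NormalizedLaw τ ε (μ.map (ξ j))

variable {τ ε : ℝ} {ν : Measure ℝ}

namespace NormalizedLaw

lemma memLp_sub (h : NormalizedLaw τ ε ν) :
    MemLp (fun x => x - ∫ y, y ∂ν) (ENNReal.ofReal (2 + ε)) ν := by
  have := h.isProb
  exact h.memLp.sub (memLp_const _)

lemma memLp_two (h : NormalizedLaw τ ε ν) (hε : 0 < ε) :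
    MemLp (fun x => x - ∫ y, y ∂ν) 2 ν := by
  have := h.isProb
  refine h.memLp_sub.mono_exponent ?_
  rw [show (2 : ℝ≥0∞) = ENNReal.ofReal 2 by simp]
  exact ENNReal.ofReal_le_ofReal (by linarith)

lemma integrable_sub (h : NormalizedLaw τ ε ν) (hε : 0 < ε) :
    Integrable (fun x => x - ∫ y, y ∂ν) ν := by
  have := h.isProb
  exact (h.memLp_two hε).integrable (by norm_num)

lemma integrable_id (h : NormalizedLaw τ ε ν) (hε : 0 < ε) :
    Integrable (fun x => x) ν := by
  have := h.isProb
  refine ((h.integrable_sub hε).add (integrable_const (∫ y, y ∂ν))).congr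
    (ae_of_all _ fun x => ?_)
  simp

lemma integrable_sq (h : NormalizedLaw τ ε ν) (hε : 0 < ε) :
    Integrable (fun x => (x - ∫ y, y ∂ν) ^ 2) ν :=
  (h.memLp_two hε).integrable_sq

lemma integrable_rpow (h : NormalizedLaw τ ε ν) (hε : 0 < ε) :
    Integrable (fun x => |x - ∫ y, y ∂ν| ^ (2 + ε)) ν := by
  have := h.memLp_sub.integrable_norm_rpow (by simpa using by linarith) (by simp)
  simpa [ENNReal.toReal_ofReal (show (0:ℝ) ≤ 2 + ε by linarith)] using this

lemma integral_sub_mean (h : NormalizedLaw τ ε ν) (hε : 0 < ε) :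
    ∫ x, (x - ∫ y, y ∂ν) ∂ν = 0 := by
  have := h.isProb
  rw [MeasureTheory.integral_sub (h.integrable_id hε) (integrable_const _)]
  simp

end NormalizedLaw

lemma norm_exp_sub_le (hε₀ : 0 < ε) (hε₁ : ε < 1) (x : ℝ) :
    ‖Complex.exp (x * Complex.I) - (1 + x * Complex.I - (x : ℂ) ^ 2 / 2)‖ ≤ 4 * |x| ^ (2 + ε) := by
  rcases le_total |x| 1 with hx | hx
  · have hn : ‖(x * Complex.I : ℂ)‖ ≤ 1 := by simpa using hx
    have h := Complex.exp_bound hn (n := 3) (by norm_num)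
    have hs : ∑ m ∈ Finset.range 3, ((x * Complex.I : ℂ)) ^ m / (m.factorial : ℂ)
        = 1 + x * Complex.I - (x : ℂ) ^ 2 / 2 := by
      simp [Finset.sum_range_succ, mul_pow, Nat.factorial]
      ring
    rw [hs] at h
    have h2 : ‖(x * Complex.I : ℂ)‖ = |x| := by simp
    rw [h2] at h
    refine h.trans ?_
    have h3 : |x| ^ (3 : ℕ) ≤ |x| ^ (2 + ε) := by
      rcases (abs_nonneg x).eq_or_lt with h0 | h0
      · rw [← h0, zero_rpow (by linarith)]; norm_num
      · rw [← rpow_natCast]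
        exact rpow_le_rpow_of_exponent_ge h0 hx (by norm_num; linarith)
    have h4 : (0:ℝ) ≤ |x| ^ (3 : ℕ) := by positivity
    norm_num [Nat.factorial]
    nlinarith
  · have h1 : ‖Complex.exp (x * Complex.I)‖ = 1 := Complex.norm_exp_ofReal_mul_I x
    have h3 : |x| ^ (2 : ℕ) ≤ |x| ^ (2 + ε) := by
      rw [← rpow_natCast]
      exact rpow_le_rpow_of_exponent_le hx (by norm_num; linarith)
    calc _ ≤ ‖Complex.exp (x * Complex.I)‖ + ‖(1 + x * Complex.I - (x : ℂ) ^ 2 / 2)‖ := norm_sub_le _ _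
      _ ≤ 1 + (1 + |x| + |x| ^ 2 / 2) := by
        rw [h1]
        gcongr
        refine (norm_sub_le _ _).trans ?_
        gcongr
        · refine (norm_add_le _ _).trans ?_
          simp
        · simp
      _ ≤ 4 * |x| ^ (2 : ℕ) := by nlinarith
      _ ≤ _ := by gcongr

/-- The radius up to which the characteristic function of a normalized law decays at a Gaussian
rate. -/
noncomputable def charFunRadius (τ ε : ℝ) : ℝ := min 1 ((16 * τ)⁻¹ ^ (1 / ε))

lemma charFunRadius_pos (hτ : 0 < τ) : 0 < charFunRadius τ ε := by
  unfold charFunRadius; positivity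

lemma NormalizedLaw.norm_charFun_le (h : NormalizedLaw τ ε ν) (hτ : 0 < τ) (hε₀ : 0 < ε)
    (hε₁ : ε < 1) {s : ℝ} (hs : |s| ≤ charFunRadius τ ε) :
    ‖charFun ν s‖ ≤ exp (-(s ^ 2 / 4)) := by
  have := h.isProb
  set m := ∫ y, y ∂ν with hm
  have hint : ∀ F : ℝ → ℂ, Measurable F → (∀ x, ‖F x‖ ≤ 1) → Integrable F ν := fun F hF h1 =>
    Integrable.of_bound hF.aestronglyMeasurable 1 (ae_of_all _ h1)
  have hI : Integrable (fun x : ℝ => Complex.exp ((s * (x - m) : ℝ) * Complex.I)) ν :=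
    hint _ (by fun_prop) fun x => (Complex.norm_exp_ofReal_mul_I _).le
  have h1 : charFun ν s = Complex.exp ((s * m : ℝ) * Complex.I)
      * ∫ x, Complex.exp ((s * (x - m) : ℝ) * Complex.I) ∂ν := by
    rw [charFun_apply_real, ← integral_const_mul]
    congr 1
    ext x
    rw [← Complex.exp_add]
    congr 1
    push_cast
    ring
  have hA : Integrable (fun x : ℝ => (((s * (x - m) : ℝ) : ℂ) * Complex.I)) ν :=
    (((h.integrable_sub hε₀).const_mul s).ofReal).mul_const _
  have e2 : ∀ x : ℝ, (s * (x - m)) ^ 2 / 2 = s ^ 2 / 2 * (x - m) ^ 2 := fun x => by ring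
  have hB : Integrable (fun x : ℝ => (((s * (x - m)) ^ 2 / 2 : ℝ) : ℂ)) ν := by
    simp_rw [e2]
    exact ((h.integrable_sq hε₀).const_mul (s ^ 2 / 2)).ofReal (𝕜 := ℂ)
  have e : ∀ x : ℝ, (1 + (s * (x - m) : ℝ) * Complex.I - ((s * (x - m) : ℝ) : ℂ) ^ 2 / 2 : ℂ)
      = (1 + (s * (x - m) : ℝ) * Complex.I) - (((s * (x - m)) ^ 2 / 2 : ℝ) : ℂ) := by
    intro x; push_cast; ring
  have hA' : Integrable (fun x : ℝ => (1 + ((s * (x - m) : ℝ) : ℂ) * Complex.I)) ν :=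
    (integrable_const (1 : ℂ)).add hA
  have hq : Integrable (fun x : ℝ => (1 + (s * (x - m) : ℝ) * Complex.I
      - ((s * (x - m) : ℝ) : ℂ) ^ 2 / 2 : ℂ)) ν := by
    simp_rw [e]
    exact hA'.sub hB
  have h2 : ∫ x, (1 + (s * (x - m) : ℝ) * Complex.I - ((s * (x - m) : ℝ) : ℂ) ^ 2 / 2 : ℂ) ∂ν
      = ((1 - s ^ 2 / 2 : ℝ) : ℂ) := by
    simp_rw [e]
    rw [integral_sub hA' hB, integral_add (integrable_const _) hA,
      integral_mul_const, integral_complex_ofReal, integral_complex_ofReal, integral_const_mul,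
      h.integral_sub_mean hε₀]
    simp_rw [e2]
    rw [integral_const_mul, h.variance]
    simp
  have h3 : ‖(∫ x, Complex.exp ((s * (x - m) : ℝ) * Complex.I) ∂ν) - ((1 - s ^ 2 / 2 : ℝ) : ℂ)‖
      ≤ 4 * τ * |s| ^ (2 + ε) := by
    rw [← h2, ← integral_sub hI hq]
    calc _ ≤ ∫ x, 4 * |s| ^ (2 + ε) * |x - m| ^ (2 + ε) ∂ν := by
          refine norm_integral_le_of_norm_le ((h.integrable_rpow hε₀).const_mul _)
            (ae_of_all _ fun x => ?_)
          refine (norm_exp_sub_le hε₀ hε₁ _).trans (le_of_eq ?_)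
          rw [abs_mul, mul_rpow (abs_nonneg _) (abs_nonneg _)]
          ring
      _ = 4 * |s| ^ (2 + ε) * ∫ x, |x - m| ^ (2 + ε) ∂ν := integral_const_mul _ _
      _ ≤ 4 * |s| ^ (2 + ε) * τ := by gcongr; exact h.moment
      _ = _ := by ring
  have hs1 : |s| ≤ 1 := hs.trans (min_le_left _ _)
  have hs2 : 4 * τ * |s| ^ (2 + ε) ≤ s ^ 2 / 4 := by
    have h4 : |s| ^ ε ≤ (16 * τ)⁻¹ := by
      calc |s| ^ ε ≤ ((16 * τ)⁻¹ ^ (1 / ε)) ^ ε :=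
            rpow_le_rpow (abs_nonneg _) (hs.trans (min_le_right _ _)) hε₀.le
        _ = (16 * τ)⁻¹ := by
            rw [← rpow_mul (by positivity), one_div, inv_mul_cancel₀ hε₀.ne', rpow_one]
    have h5 : |s| ^ (2 + ε) = s ^ 2 * |s| ^ ε := by
      rw [rpow_add_of_nonneg (abs_nonneg _) (by norm_num) hε₀.le]
      norm_num
    rw [h5]
    calc 4 * τ * (s ^ 2 * |s| ^ ε) ≤ 4 * τ * (s ^ 2 * (16 * τ)⁻¹) := by gcongr
      _ = s ^ 2 / 4 := by field_simp; ring
  have hs3 : s ^ 2 ≤ 1 := by rw [← sq_abs]; exact pow_le_one₀ (abs_nonneg _) hs1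
  have h6 : ‖charFun ν s‖ = ‖∫ x, Complex.exp ((s * (x - m) : ℝ) * Complex.I) ∂ν‖ := by
    rw [h1, norm_mul, Complex.norm_exp_ofReal_mul_I, one_mul]
  rw [h6]
  calc _ ≤ ‖((1 - s ^ 2 / 2 : ℝ) : ℂ)‖ + 4 * τ * |s| ^ (2 + ε) := by
        exact (norm_le_norm_add_norm_sub' _ _).trans (add_le_add le_rfl h3)
    _ ≤ (1 - s ^ 2 / 2) + s ^ 2 / 4 := by
        gcongr
        rw [Complex.norm_real, norm_of_nonneg (by linarith)]
    _ ≤ exp (-(s ^ 2 / 4)) := by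
        have := add_one_le_exp (-(s ^ 2 / 4))
        linarith

/-- A form of Esseen's inequality, with a Gaussian mollifier. -/
lemma measureReal_abs_sub_le_integral_charFun (ν : Measure ℝ) [IsProbabilityMeasure ν] (x : ℝ)
    {r : ℝ} (hr : 0 < r) :
    ν.real {y | |y - x| ≤ r} ≤ 2 * ∫ g, ‖charFun ν (g / r)‖ ∂gaussianReal 0 1 := by
  set γ := gaussianReal 0 1
  have hG : ∀ y : ℝ, ((exp (-((y - x) / r) ^ 2 / 2) : ℝ) : ℂ)
      = ∫ g, Complex.exp (((y - x) / r : ℝ) * g * Complex.I) ∂γ := by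
    intro y
    rw [← charFun_apply_real, charFun_gaussianReal]
    push_cast
    congr 1
    simp
    ring
  have hI : Integrable (Function.uncurry fun (y g : ℝ) =>
      Complex.exp (((y - x) / r : ℝ) * g * Complex.I)) (ν.prod γ) := by
    refine Integrable.of_bound (by fun_prop) 1 (ae_of_all _ fun p => ?_)
    simp only [Function.uncurry]
    rw [← Complex.ofReal_mul, Complex.norm_exp_ofReal_mul_I]
  have h1 : (∫ y, ((exp (-((y - x) / r) ^ 2 / 2) : ℝ) : ℂ) ∂ν)
      = ∫ g, Complex.exp ((-(x * g / r) : ℝ) * Complex.I) * charFun ν (g / r) ∂γ := by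
    simp_rw [hG]
    rw [integral_integral_swap hI]
    congr 1
    ext g
    rw [charFun_apply_real, ← integral_const_mul]
    congr 1
    ext y
    rw [← Complex.exp_add]
    congr 1
    push_cast
    ring
  have h2 : ∫ y, exp (-((y - x) / r) ^ 2 / 2) ∂ν ≤ ∫ g, ‖charFun ν (g / r)‖ ∂γ := by
    have h3 : ‖∫ y, ((exp (-((y - x) / r) ^ 2 / 2) : ℝ) : ℂ) ∂ν‖ = ∫ y, exp (-((y - x) / r) ^ 2 / 2) ∂ν := by
      rw [integral_complex_ofReal]
      rw [Complex.norm_of_nonneg (integral_nonneg fun y => (exp_pos _).le)]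
    rw [← h3, h1]
    refine (norm_integral_le_integral_norm _).trans (le_of_eq ?_)
    simp only [norm_mul, Complex.norm_exp_ofReal_mul_I, one_mul]
  have hms : MeasurableSet {y : ℝ | |y - x| ≤ r} :=
    measurableSet_le (by fun_prop) measurable_const
  have h4 : ν.real {y | |y - x| ≤ r} ≤ ∫ y, 2 * exp (-((y - x) / r) ^ 2 / 2) ∂ν := by
    rw [← integral_indicator_one hms]
    refine integral_mono_of_nonneg (ae_of_all _ fun y => Set.indicator_nonneg (fun _ _ => zero_le_one) _)
      (Integrable.of_bound (by fun_prop) 2 (ae_of_all _ fun y => ?_)) (ae_of_all _ fun y => ?_)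
    · rw [norm_of_nonneg (by positivity)]
      have : exp (-((y - x) / r) ^ 2 / 2) ≤ 1 := exp_le_one_iff.2 (by nlinarith [sq_nonneg ((y - x) / r)])
      linarith
    · refine Set.indicator_apply_le' (fun hy => ?_) (fun _ => by positivity)
      have h5 : ((y - x) / r) ^ 2 ≤ 1 := by
        rw [div_pow, div_le_one (by positivity), ← sq_abs]
        exact pow_le_pow_left₀ (abs_nonneg _) hy 2
      have h6 := add_one_le_exp (-((y - x) / r) ^ 2 / 2)
      simp only [Pi.one_apply]
      linarith
  rw [integral_const_mul] at h4
  linarith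

lemma measureReal_abs_sub_le_of_charFun (ν : Measure ℝ) [IsProbabilityMeasure ν] (x : ℝ)
    {r σ B : ℝ} (hr : 0 < r) (hσ : 0 < σ) (hB : 0 < B)
    (h : ∀ s, |s| ≤ B → ‖charFun ν s‖ ≤ exp (-(σ ^ 2 * s ^ 2 / 4))) :
    ν.real {y | |y - x| ≤ r} ≤ 3 * (r / σ) + 2 * (1 / (B * r)) ^ 2 := by
  refine (measureReal_abs_sub_le_integral_charFun ν x hr).trans ?_
  set γ := gaussianReal 0 1
  set b : ℝ := (σ / (2 * r)) ^ 2 with hb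
  have hb0 : 0 < b := by positivity
  have hmem : MemLp (id : ℝ → ℝ) 2 γ := memLp_id_gaussianReal 2
  have hsq : ∫ g, g ^ 2 ∂γ = 1 := by
    have h1 := variance_fun_id_gaussianReal (μ := 0) (v := 1)
    rw [variance_eq_integral (by fun_prop)] at h1
    simpa using h1
  have hsqi : Integrable (fun g : ℝ => g ^ 2) γ := hmem.integrable_sq
  have hei : Integrable (fun g : ℝ => exp (-b * g ^ 2)) γ :=
    Integrable.of_bound (by fun_prop) 1 (ae_of_all _ fun g => by
      rw [norm_of_nonneg (exp_pos _).le]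
      exact exp_le_one_iff.2 (by nlinarith [sq_nonneg g]))
  have hptw : ∀ g, ‖charFun ν (g / r)‖ ≤ exp (-b * g ^ 2) + (1 / (B * r)) ^ 2 * g ^ 2 := by
    intro g
    by_cases hg : |g / r| ≤ B
    · refine (h _ hg).trans ?_
      have : exp (-(σ ^ 2 * (g / r) ^ 2 / 4)) = exp (-b * g ^ 2) := by
        congr 1; rw [hb]; field_simp; ring
      rw [this]
      have : 0 ≤ (1 / (B * r)) ^ 2 * g ^ 2 := by positivity
      linarith
    · rw [not_le] at hg
      refine (norm_charFun_le_one _).trans ?_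
      have h1 : 1 ≤ (1 / (B * r)) ^ 2 * g ^ 2 := by
        rw [← mul_pow, one_le_sq_iff_one_le_abs, abs_mul, abs_of_pos (show 0 < 1 / (B * r) by positivity)]
        rw [abs_div, abs_of_pos hr, lt_div_iff₀ hr] at hg
        rw [div_mul_eq_mul_div, one_mul, one_le_div (by positivity)]
        exact hg.le
      have := exp_pos (-b * g ^ 2)
      linarith
  have h1 : ∫ g, ‖charFun ν (g / r)‖ ∂γ ≤ (∫ g, exp (-b * g ^ 2) ∂γ) + (1 / (B * r)) ^ 2 := by
    calc _ ≤ ∫ g, (exp (-b * g ^ 2) + (1 / (B * r)) ^ 2 * g ^ 2) ∂γ :=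
          integral_mono_of_nonneg (ae_of_all _ fun _ => norm_nonneg _)
            (hei.add (hsqi.const_mul _)) (ae_of_all _ hptw)
      _ = _ := by rw [integral_add hei (hsqi.const_mul _), integral_const_mul, hsq, mul_one]
  have h2 : ∫ g, exp (-b * g ^ 2) ∂γ ≤ 3 / 2 * (r / σ) := by
    rw [integral_gaussianReal_eq_integral_smul (by norm_num)]
    have hlim : ∫ g, exp (-b * g ^ 2) = √(π / b) := integral_gaussian b
    have hint : Integrable (fun g : ℝ => exp (-b * g ^ 2)) := integrable_exp_neg_mul_sq hb0
    have hpdf : ∀ g, gaussianPDFReal 0 1 g ≤ (√(2 * π))⁻¹ := by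
      intro g
      rw [gaussianPDFReal_def]
      simp only [NNReal.coe_one, mul_one, sub_zero]
      have : exp (-g ^ 2 / 2) ≤ 1 := exp_le_one_iff.2 (by nlinarith [sq_nonneg g])
      exact mul_le_of_le_one_right (by positivity) this
    calc ∫ g, gaussianPDFReal 0 1 g • exp (-b * g ^ 2)
        ≤ ∫ g, (√(2 * π))⁻¹ * exp (-b * g ^ 2) := by
          refine integral_mono_of_nonneg (ae_of_all _ fun g => ?_) (hint.const_mul _)
            (ae_of_all _ fun g => ?_)
          · exact smul_nonneg (gaussianPDFReal_nonneg _ _ _) (exp_pos _).le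
          · exact mul_le_mul_of_nonneg_right (hpdf g) (exp_pos _).le
      _ = (√(2 * π))⁻¹ * √(π / b) := by rw [integral_const_mul, hlim]
      _ = √2 * (r / σ) := by
          rw [← sqrt_inv, ← sqrt_mul (by positivity)]
          have : (2 * π)⁻¹ * (π / b) = 2 * (r / σ) ^ 2 := by
            rw [hb]; field_simp
          rw [this, sqrt_mul (by norm_num), sqrt_sq (by positivity)]
      _ ≤ 3 / 2 * (r / σ) := by
          gcongr
          rw [sqrt_le_left (by norm_num)]
          norm_num
  linarith

variable {J Ω : Type*} [MeasurableSpace Ω] {μ : Measure Ω} {ξ : J → Ω → ℝ}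

lemma IndepNormalized.measureReal_abs_sum_sub_le (h : IndepNormalized τ ε μ ξ) (hτ : 0 < τ)
    (hε₀ : 0 < ε) (hε₁ : ε < 1) (t : Finset J) (a : J → ℝ) {η σ r : ℝ} (hη : 0 < η) (hσ : 0 < σ)
    (hr : 0 < r) (hσa : σ ^ 2 ≤ ∑ j ∈ t, a j ^ 2) (hηa : ∀ j ∈ t, |a j| ≤ η) (x : ℝ) :
    μ.real {ω | |∑ j ∈ t, ξ j ω * a j - x| ≤ r}
      ≤ 3 * (r / σ) + 2 * (η / (charFunRadius τ ε * r)) ^ 2 := by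
  have hμ : IsProbabilityMeasure μ := h.indep.isProbabilityMeasure
  have hs0 := charFunRadius_pos (ε := ε) hτ
  set X : J → Ω → ℝ := fun j ω => a j * ξ j ω with hX
  have hXm : ∀ j, Measurable (X j) := fun j => (h.measurable j).const_mul _
  have hXi : iIndepFun X μ := h.indep.comp (fun j x => a j * x) fun j => measurable_const_mul _
  have hSm : Measurable fun ω => ∑ j ∈ t, X j ω := Finset.measurable_sum _ fun j _ => hXm j
  have hmap : μ.real {ω | |∑ j ∈ t, ξ j ω * a j - x| ≤ r}
      = (μ.map fun ω => ∑ j ∈ t, X j ω).real {y | |y - x| ≤ r} := by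
    rw [map_measureReal_apply hSm (measurableSet_le (by fun_prop) measurable_const)]
    simp [hX, mul_comm, Set.preimage]
  rw [hmap]
  have hprob : IsProbabilityMeasure (μ.map fun ω => ∑ j ∈ t, X j ω) :=
    Measure.isProbabilityMeasure_map hSm.aemeasurable
  have hcf : ∀ s, |s| ≤ charFunRadius τ ε / η →
      ‖charFun (μ.map fun ω => ∑ j ∈ t, X j ω) s‖ ≤ exp (-(σ ^ 2 * s ^ 2 / 4)) := by
    intro s hs
    rw [iIndepFun.charFun_map_fun_finsetSum_eq_prod (fun j _ => (hXm j).aemeasurable)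
      (hXi.restrict t), Finset.prod_apply, norm_prod]
    calc ∏ j ∈ t, ‖charFun (μ.map (X j)) s‖ ≤ ∏ j ∈ t, exp (-((a j * s) ^ 2 / 4)) := by
          refine Finset.prod_le_prod (fun _ _ => norm_nonneg _) fun j hj => ?_
          have h1 : charFun (μ.map (X j)) s = charFun (μ.map (ξ j)) (a j * s) := by
            rw [charFun_apply_real, charFun_apply_real, integral_map (hXm j).aemeasurable
              (by fun_prop), integral_map (h.measurable j).aemeasurable (by fun_prop)]
            congr 1
            ext ω
            congr 1
            simp only [hX]
            push_cast
            ring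
          rw [h1]
          refine (h.law j).norm_charFun_le hτ hε₀ hε₁ ?_
          rw [abs_mul]
          calc |a j| * |s| ≤ η * (charFunRadius τ ε / η) := by gcongr; exact hηa j hj
            _ = _ := by field_simp
      _ = exp (-((∑ j ∈ t, a j ^ 2) * s ^ 2 / 4)) := by
          rw [← exp_sum]
          congr 1
          rw [Finset.sum_neg_distrib, Finset.sum_mul, Finset.sum_div]
          simp [mul_pow]
      _ ≤ _ := by
          gcongr
  have := measureReal_abs_sub_le_of_charFun _ x hr hσ (by positivity : 0 < charFunRadius τ ε / η) hcf
  have e : 1 / (charFunRadius τ ε / η * r) = η / (charFunRadius τ ε * r) := by field_simp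
  rwa [e] at this

lemma measureReal_le_of_eventually_mem [IsFiniteMeasure μ] {A : Set Ω} {B : ℕ → Set Ω} {c : ℝ}
    (hc : 0 ≤ c)
    (hAB : ∀ ω ∈ A, ∀ᶠ M in atTop, ω ∈ B M) (hB : ∀ᶠ M in atTop, μ.real (B M) ≤ c) :
    μ.real A ≤ c := by
  have hmono : Monotone fun N : ℕ => ⋂ M ≥ N, B M := by
    intro N N' hN
    exact Set.biInter_mono (fun M hM => le_trans hN hM) fun _ _ => le_rfl
  have hsub : A ⊆ ⋃ N : ℕ, ⋂ M ≥ N, B M := by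
    intro ω hω
    obtain ⟨N, hN⟩ := eventually_atTop.1 (hAB ω hω)
    exact Set.mem_iUnion.2 ⟨N, Set.mem_iInter₂.2 fun M hM => hN M hM⟩
  refine ENNReal.toReal_le_of_le_ofReal hc ((measure_mono hsub).trans ?_)
  rw [hmono.measure_iUnion]
  refine iSup_le fun N => ?_
  obtain ⟨M, hM1, hM2⟩ := (hB.and (eventually_ge_atTop N)).exists
  calc μ (⋂ M ≥ N, B M) ≤ μ (B M) := measure_mono (Set.biInter_subset_of_mem hM2)
    _ = ENNReal.ofReal (μ.real (B M)) := by simp [Measure.real]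
    _ ≤ _ := ENNReal.ofReal_le_ofReal hM1

/-- The small ball estimate for a random series `∑ ξ_j a_j` with complex coefficients.  The
direction (real or imaginary part) that carries at least half of `∑ |a_j|²` is used. -/
lemma IndepNormalized.measureReal_norm_le (h : IndepNormalized τ ε μ ξ) (hτ : 0 < τ)
    (hε₀ : 0 < ε) (hε₁ : ε < 1) {s : ℕ → Finset J} (hs : Tendsto s atTop atTop) (a : J → ℂ)
    {X : Ω → ℂ} (hX : ∀ ω, Tendsto (fun M => ∑ j ∈ s M, (ξ j ω : ℂ) * a j) atTop (𝓝 (X ω)))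
    (ha : Summable fun j => ‖a j‖ ^ 2) {V : ℝ} (hV : V = ∑' j, ‖a j‖ ^ 2) (hV0 : 0 < V)
    {η r : ℝ} (hη : 0 < η) (hr : 0 < r) (hηa : ∀ j, ‖a j‖ ≤ η * √V) :
    μ.real {ω | ‖X ω‖ ≤ r * √V} ≤ 12 * r + (η / (charFunRadius τ ε * r)) ^ 2 := by
  have hμ : IsProbabilityMeasure μ := h.indep.isProbabilityMeasure
  have hs0 := charFunRadius_pos (ε := ε) hτ
  have hVs : 0 < √V := sqrt_pos.2 hV0
  have main : ∀ p : ℂ →L[ℝ] ℝ, (∀ w, |p w| ≤ ‖w‖) → V / 2 ≤ ∑' j, (p (a j)) ^ 2 →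
      μ.real {ω | ‖X ω‖ ≤ r * √V} ≤ 12 * r + (η / (charFunRadius τ ε * r)) ^ 2 := by
    intro p hp hpV
    have hps : Summable fun j => (p (a j)) ^ 2 :=
      Summable.of_nonneg_of_le (fun _ => sq_nonneg _) (fun j => by
        rw [← sq_abs]; exact pow_le_pow_left₀ (abs_nonneg _) (hp _) 2) ha
    have hev : ∀ᶠ M in atTop, V / 4 ≤ ∑ j ∈ s M, (p (a j)) ^ 2 :=
      (hps.hasSum.comp hs).eventually_const_le (by linarith)
    refine measureReal_le_of_eventually_mem (B := fun M => {ω | |∑ j ∈ s M, ξ j ω * p (a j) - 0| ≤ 2 * r * √V})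
      (by positivity) ?_ ?_
    · intro ω hω
      have ht : Tendsto (fun M => ∑ j ∈ s M, ξ j ω * p (a j)) atTop (𝓝 (p (X ω))) := by
        have := (p.continuous.tendsto (X ω)).comp (hX ω)
        refine this.congr fun M => ?_
        simp only [Function.comp, map_sum]
        refine Finset.sum_congr rfl fun j _ => ?_
        rw [← smul_eq_mul (ξ j ω), ← p.map_smul]
        simp
      have hlt : |p (X ω)| < 2 * r * √V := by
        have h1 := (hp (X ω)).trans hω
        nlinarith [mul_pos hr hVs]
      filter_upwards [ht.abs.eventually_lt_const hlt] with M hM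
      simpa using hM.le
    · filter_upwards [hev] with M hM
      have := h.measureReal_abs_sum_sub_le hτ hε₀ hε₁ (s M) (fun j => p (a j)) (η := η * √V)
        (σ := √V / 2) (r := 2 * r * √V) (by positivity) (by positivity) (by positivity)
        (by rw [div_pow, sq_sqrt hV0.le]; linarith) (fun j _ => (hp _).trans (hηa j)) 0
      refine this.trans ?_
      have e1 : 3 * (2 * r * √V / (√V / 2)) = 12 * r := by field_simp; norm_num
      have e2 : η * √V / (charFunRadius τ ε * (2 * r * √V))
          = η / (charFunRadius τ ε * r) / 2 := by field_simp
      rw [e1, e2]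
      have := sq_nonneg (η / (charFunRadius τ ε * r))
      nlinarith
  have hre : Summable fun j => (a j).re ^ 2 :=
    Summable.of_nonneg_of_le (fun _ => sq_nonneg _) (fun j => by
      rw [← sq_abs]; exact pow_le_pow_left₀ (abs_nonneg _) (Complex.abs_re_le_norm _) 2) ha
  have him : Summable fun j => (a j).im ^ 2 :=
    Summable.of_nonneg_of_le (fun _ => sq_nonneg _) (fun j => by
      rw [← sq_abs]; exact pow_le_pow_left₀ (abs_nonneg _) (Complex.abs_im_le_norm _) 2) ha
  have hsum : V = ∑' j, (a j).re ^ 2 + ∑' j, (a j).im ^ 2 := by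
    rw [hV, ← hre.tsum_add him]
    congr 1
    ext j
    rw [← Complex.normSq_eq_norm_sq, Complex.normSq_apply]
    ring
  rcases le_total (∑' j, (a j).im ^ 2) (∑' j, (a j).re ^ 2) with hle | hle
  · exact main Complex.reCLM Complex.abs_re_le_norm (by simp only [Complex.reCLM_apply]; linarith)
  · exact main Complex.imCLM Complex.abs_im_le_norm (by simp only [Complex.imCLM_apply]; linarith)

end SmallBall

/-! ### Functions with bounded derivatives and the exchange of one law -/

section Exchange

open Real

/-- `g` is three times differentiable with `|g^(r)| ≤ A κ ^ r` for `r ≤ 3`. -/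
def DerivBound (g : ℝ → ℝ) (A κ : ℝ) : Prop :=
  ∃ g₁ g₂ g₃ : ℝ → ℝ, (∀ t, HasDerivAt g (g₁ t) t) ∧ (∀ t, HasDerivAt g₁ (g₂ t) t) ∧
    (∀ t, HasDerivAt g₂ (g₃ t) t) ∧ (∀ t, |g t| ≤ A) ∧ (∀ t, |g₁ t| ≤ A * κ) ∧
    (∀ t, |g₂ t| ≤ A * κ ^ 2) ∧ ∀ t, |g₃ t| ≤ A * κ ^ 3

namespace DerivBound

variable {f g : ℝ → ℝ} {A B κ : ℝ}

lemma nonneg (hf : DerivBound f A κ) : 0 ≤ A := by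
  obtain ⟨_, _, _, _, _, _, h, _⟩ := hf
  exact (abs_nonneg _).trans (h 0)

lemma continuous (hf : DerivBound f A κ) : Continuous f := by
  obtain ⟨_, _, _, h, _⟩ := hf
  exact continuous_iff_continuousAt.2 fun t => (h t).continuousAt

lemma abs_le (hf : DerivBound f A κ) (t : ℝ) : |f t| ≤ A := by
  obtain ⟨_, _, _, _, _, _, h, _⟩ := hf
  exact h t

lemma one (hκ : 0 ≤ κ) : DerivBound (fun _ => 1) 1 κ :=
  ⟨fun _ => 0, fun _ => 0, fun _ => 0, fun t => hasDerivAt_const t 1, fun t => hasDerivAt_const t 0,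
    fun t => hasDerivAt_const t 0, fun _ => by simp, fun _ => by simpa, fun _ => by simp; positivity,
    fun _ => by simp; positivity⟩

lemma sub (hf : DerivBound f A κ) (hg : DerivBound g B κ) :
    DerivBound (fun t => f t - g t) (A + B) κ := by
  obtain ⟨f₁, f₂, f₃, hf₁, hf₂, hf₃, b₀, b₁, b₂, b₃⟩ := hf
  obtain ⟨g₁, g₂, g₃, hg₁, hg₂, hg₃, c₀, c₁, c₂, c₃⟩ := hg
  refine ⟨fun t => f₁ t - g₁ t, fun t => f₂ t - g₂ t, fun t => f₃ t - g₃ t,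
    fun t => (hf₁ t).sub (hg₁ t), fun t => (hf₂ t).sub (hg₂ t), fun t => (hf₃ t).sub (hg₃ t),
    fun t => ?_, fun t => ?_, fun t => ?_, fun t => ?_⟩
  · exact (abs_sub _ _).trans (add_le_add (b₀ t) (c₀ t))
  · rw [add_mul]; exact (abs_sub _ _).trans (add_le_add (b₁ t) (c₁ t))
  · rw [add_mul]; exact (abs_sub _ _).trans (add_le_add (b₂ t) (c₂ t))
  · rw [add_mul]; exact (abs_sub _ _).trans (add_le_add (b₃ t) (c₃ t))

lemma abs_mul_le {x y X Y : ℝ} (hx : |x| ≤ X) (hy : |y| ≤ Y) : |x * y| ≤ X * Y := by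
  rw [abs_mul]
  exact mul_le_mul hx hy (abs_nonneg _) ((abs_nonneg _).trans hx)

lemma mul (hκ : 0 ≤ κ) (hf : DerivBound f A κ) (hg : DerivBound g B κ) :
    DerivBound (fun t => f t * g t) (8 * A * B) κ := by
  have hA := hf.nonneg
  have hB := hg.nonneg
  obtain ⟨f₁, f₂, f₃, hf₁, hf₂, hf₃, b₀, b₁, b₂, b₃⟩ := hf
  obtain ⟨g₁, g₂, g₃, hg₁, hg₂, hg₃, c₀, c₁, c₂, c₃⟩ := hg
  have hAB : 0 ≤ A * B := mul_nonneg hA hB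
  refine ⟨fun t => f₁ t * g t + f t * g₁ t, fun t => f₂ t * g t + 2 * (f₁ t * g₁ t) + f t * g₂ t,
    fun t => f₃ t * g t + 3 * (f₂ t * g₁ t) + 3 * (f₁ t * g₂ t) + f t * g₃ t,
    fun t => (hf₁ t).mul (hg₁ t), fun t => ?_, fun t => ?_, fun t => ?_, fun t => ?_, fun t => ?_,
    fun t => ?_⟩
  · exact (((hf₂ t).mul (hg₁ t)).add ((hf₁ t).mul (hg₂ t))).congr_deriv (by ring)
  · exact ((((hf₃ t).mul (hg₁ t)).add (((hf₂ t).mul (hg₂ t)).const_mul 2)).add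
      ((hf₁ t).mul (hg₃ t))).congr_deriv (by ring)
  · have := abs_mul_le (b₀ t) (c₀ t)
    nlinarith
  · have h1 := abs_mul_le (b₁ t) (c₀ t)
    have h2 := abs_mul_le (b₀ t) (c₁ t)
    have h3 : 0 ≤ A * B * κ := by positivity
    refine (abs_add_le _ _).trans ?_
    nlinarith
  · have h1 := abs_mul_le (b₂ t) (c₀ t)
    have h2 := abs_mul_le (b₁ t) (c₁ t)
    have h4 := abs_mul_le (b₀ t) (c₂ t)
    have h3 : 0 ≤ A * B * κ ^ 2 := by positivity
    have h5 : |2 * (f₁ t * g₁ t)| = 2 * |f₁ t * g₁ t| := by rw [abs_mul]; norm_num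
    refine (abs_add_le _ _).trans ((add_le_add_left (abs_add_le _ _) _).trans ?_)
    rw [h5]
    nlinarith
  · have h1 := abs_mul_le (b₃ t) (c₀ t)
    have h2 := abs_mul_le (b₂ t) (c₁ t)
    have h4 := abs_mul_le (b₁ t) (c₂ t)
    have h6 := abs_mul_le (b₀ t) (c₃ t)
    have h3 : 0 ≤ A * B * κ ^ 3 := by positivity
    have h5 : |3 * (f₂ t * g₁ t)| = 3 * |f₂ t * g₁ t| := by rw [abs_mul]; norm_num
    have h7 : |3 * (f₁ t * g₂ t)| = 3 * |f₁ t * g₂ t| := by rw [abs_mul]; norm_num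
    refine (abs_add_le _ _).trans ((add_le_add_left ((abs_add_le _ _).trans
      (add_le_add_left (abs_add_le _ _) _)) _).trans ?_)
    rw [h5, h7]
    nlinarith

lemma prod {ι : Type*} (hκ : 0 ≤ κ) (s : Finset ι) {F : ι → ℝ → ℝ}
    (h : ∀ i ∈ s, DerivBound (F i) A κ) :
    DerivBound (fun t => ∏ i ∈ s, F i t) ((8 * A) ^ s.card) κ := by
  classical
  induction s using Finset.induction_on with
  | empty => simpa using one hκ
  | insert i s hi ih =>
    have h1 := mul hκ (h i (Finset.mem_insert_self i s))
      (ih fun j hj => h j (Finset.mem_insert_of_mem hj))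
    simp only [Finset.prod_insert hi, Finset.card_insert_of_notMem hi]
    convert h1 using 1
    ring

lemma mono {A' : ℝ} (hκ : 0 ≤ κ) (hf : DerivBound f A κ) (h : A ≤ A') : DerivBound f A' κ := by
  obtain ⟨f₁, f₂, f₃, hf₁, hf₂, hf₃, b₀, b₁, b₂, b₃⟩ := hf
  refine ⟨f₁, f₂, f₃, hf₁, hf₂, hf₃, fun t => (b₀ t).trans h, fun t => (b₁ t).trans ?_,
    fun t => (b₂ t).trans ?_, fun t => (b₃ t).trans ?_⟩ <;> gcongr

end DerivBound

lemma abs_le_of_hasDerivAt {R R₁ : ℝ → ℝ} (h : ∀ t, HasDerivAt R (R₁ t) t) (h0 : R 0 = 0) {c : ℝ}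
    (n : ℕ) (hc : 0 ≤ c) (hb : ∀ t, |R₁ t| ≤ c * |t| ^ n) (x : ℝ) : |R x| ≤ c * |x| ^ (n + 1) := by
  have h1 := (convex_uIcc (0 : ℝ) x).norm_image_sub_le_of_norm_hasDerivWithin_le (f := R)
    (f' := R₁) (C := c * |x| ^ n) (fun t _ => (h t).hasDerivWithinAt) (fun t ht => ?_)
    Set.left_mem_uIcc Set.right_mem_uIcc
  · rw [h0, sub_zero, sub_zero, norm_eq_abs, norm_eq_abs] at h1
    rw [pow_succ, ← mul_assoc]
    exact h1
  · have : |t| ≤ |x| := by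
      have := Set.abs_sub_left_of_mem_uIcc ht
      simpa using this
    refine (hb t).trans ?_
    gcongr

/-- Taylor's formula of order two, with a remainder of order `2 + ε`. -/
lemma DerivBound.taylor {g : ℝ → ℝ} {A κ ε : ℝ} (hg : DerivBound g A κ) (hκ : 0 ≤ κ) (hε₀ : 0 < ε)
    (hε₁ : ε < 1) : ∃ g₁ g₂ : ℝ → ℝ, (∀ t, |g₁ t| ≤ A * κ) ∧ ∀ m x : ℝ,
      |g (m + x) - (g m + g₁ m * x + g₂ m / 2 * x ^ 2)| ≤ 2 * A * κ ^ (2 + ε) * |x| ^ (2 + ε) := by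
  have hA := hg.nonneg
  obtain ⟨g₁, g₂, g₃, h₁, h₂, h₃, b₀, b₁, b₂, b₃⟩ := hg
  refine ⟨g₁, g₂, b₁, fun m x => ?_⟩
  have hd : ∀ {F F' : ℝ → ℝ}, (∀ t, HasDerivAt F (F' t) t) →
      ∀ t, HasDerivAt (fun t => F (m + t)) (F' (m + t)) t := fun h t =>
    HasDerivAt.comp_const_add m t (h (m + t))
  have d0 : ∀ t, HasDerivAt (fun t => g (m + t) - (g m + g₁ m * t + g₂ m / 2 * t ^ 2))
      (g₁ (m + t) - (g₁ m + g₂ m * t)) t := by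
    intro t
    have := (hd h₁ t).sub (((((hasDerivAt_id t).const_mul (g₁ m)).const_add (g m))).add
      ((hasDerivAt_pow 2 t).const_mul (g₂ m / 2)))
    refine this.congr_deriv ?_
    simp
    ring
  have d1 : ∀ t, HasDerivAt (fun t => g₁ (m + t) - (g₁ m + g₂ m * t)) (g₂ (m + t) - g₂ m) t := by
    intro t
    have := (hd h₂ t).sub (((hasDerivAt_id t).const_mul (g₂ m)).const_add (g₁ m))
    exact this.congr_deriv (by simp)
  have d2 : ∀ t, HasDerivAt (fun t => g₂ (m + t) - g₂ m) (g₃ (m + t)) t := fun t =>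
    (hd h₃ t).sub_const _
  have e2 := abs_le_of_hasDerivAt d2 (by simp) (c := A * κ ^ 3) 0 (by positivity)
    (fun t => by simpa using b₃ (m + t))
  have e1 := abs_le_of_hasDerivAt d1 (by simp) (c := A * κ ^ 3) 1 (by positivity)
    (fun t => by simpa using e2 t)
  have e0 := abs_le_of_hasDerivAt d0 (by simp) (c := A * κ ^ 3) 2 (by positivity)
    (fun t => by simpa using e1 t) x
  have f1 := abs_le_of_hasDerivAt d1 (by simp) (c := 2 * (A * κ ^ 2)) 0 (by positivity)
    (fun t => by
      have := (abs_sub (g₂ (m + t)) (g₂ m)).trans (add_le_add (b₂ (m + t)) (b₂ m))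
      simp only [pow_zero, mul_one]
      linarith)
  have f0 := abs_le_of_hasDerivAt d0 (by simp) (c := 2 * (A * κ ^ 2)) 1 (by positivity)
    (fun t => by simpa using f1 t) x
  have hp : κ ^ (2 + ε) * |x| ^ (2 + ε) = (κ * |x|) ^ (2 + ε) :=
    (mul_rpow hκ (abs_nonneg x)).symm
  rw [mul_assoc, hp]
  have hy : 0 ≤ κ * |x| := by positivity
  rcases le_total (κ * |x|) 1 with hle | hle
  · refine e0.trans ?_
    have : (κ * |x|) ^ (3 : ℕ) ≤ (κ * |x|) ^ (2 + ε) := by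
      rcases hy.eq_or_lt with h0 | h0
      · rw [← h0, zero_rpow (by linarith)]; norm_num
      · rw [← rpow_natCast]
        exact rpow_le_rpow_of_exponent_ge h0 hle (by norm_num; linarith)
    have h3 : 0 ≤ (κ * |x|) ^ (3 : ℕ) := by positivity
    calc A * κ ^ 3 * |x| ^ (2 + 1) = A * (κ * |x|) ^ (3 : ℕ) := by ring
      _ ≤ A * (κ * |x|) ^ (2 + ε) := by gcongr
      _ ≤ 2 * A * (κ * |x|) ^ (2 + ε) := by
          have : 0 ≤ A * (κ * |x|) ^ (2 + ε) := by positivity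
          linarith
  · refine f0.trans ?_
    have : (κ * |x|) ^ (2 : ℕ) ≤ (κ * |x|) ^ (2 + ε) := by
      rw [← rpow_natCast]
      exact rpow_le_rpow_of_exponent_le hle (by norm_num; linarith)
    calc 2 * (A * κ ^ 2) * |x| ^ (1 + 1) = 2 * A * (κ * |x|) ^ (2 : ℕ) := by ring
      _ ≤ _ := by gcongr

variable {τ ε : ℝ} {ν ν' : Measure ℝ}

lemma NormalizedLaw.abs_integral_sub_le_rpow (h : NormalizedLaw τ ε ν) (h' : NormalizedLaw τ ε ν')
    (hε₀ : 0 < ε) (hε₁ : ε < 1) (hm : ∫ x, x ∂ν = ∫ x, x ∂ν') {g : ℝ → ℝ} {A κ : ℝ}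
    (hg : DerivBound g A κ) (hκ : 0 ≤ κ) :
    |∫ x, g x ∂ν - ∫ x, g x ∂ν'| ≤ 4 * A * τ * κ ^ (2 + ε) := by
  have hA := hg.nonneg
  obtain ⟨g₁, g₂, -, ht⟩ := hg.taylor hκ hε₀ hε₁
  have key : ∀ {ν : Measure ℝ}, NormalizedLaw τ ε ν →
      |∫ x, g x ∂ν - (g (∫ x, x ∂ν) + g₂ (∫ x, x ∂ν) / 2)| ≤ 2 * A * τ * κ ^ (2 + ε) := by
    intro ν h
    have := h.isProb
    set m := ∫ x, x ∂ν with hm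
    have hgi : Integrable g ν := Integrable.of_bound hg.continuous.aestronglyMeasurable A
      (ae_of_all _ fun x => hg.abs_le x)
    have i1 : Integrable (fun x => g₁ m * (x - m)) ν := (h.integrable_sub hε₀).const_mul _
    have i2 : Integrable (fun x => g₂ m / 2 * (x - m) ^ 2) ν := (h.integrable_sq hε₀).const_mul _
    have i0 : Integrable (fun x => g m + g₁ m * (x - m)) ν := (integrable_const _).add i1
    have e : g m + g₂ m / 2 = ∫ x, (g m + g₁ m * (x - m) + g₂ m / 2 * (x - m) ^ 2) ∂ν := by
      rw [integral_add i0 i2, integral_add (integrable_const _) i1, integral_const_mul,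
        integral_const_mul, h.integral_sub_mean hε₀, h.variance]
      simp
    have i3 : Integrable (fun x => g m + g₁ m * (x - m) + g₂ m / 2 * (x - m) ^ 2) ν := i0.add i2
    rw [e, ← integral_sub hgi i3, ← norm_eq_abs]
    calc _ ≤ ∫ x, 2 * A * κ ^ (2 + ε) * |x - m| ^ (2 + ε) ∂ν := by
          refine norm_integral_le_of_norm_le ((h.integrable_rpow hε₀).const_mul _)
            (ae_of_all _ fun x => ?_)
          have := ht m (x - m)
          rwa [add_sub_cancel] at this
      _ = 2 * A * κ ^ (2 + ε) * ∫ x, |x - m| ^ (2 + ε) ∂ν := integral_const_mul _ _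
      _ ≤ 2 * A * κ ^ (2 + ε) * τ := by gcongr; exact h.moment
      _ = _ := by ring
  have k1 := abs_le.1 (key h)
  have k2 := abs_le.1 (key h')
  rw [← hm] at k2
  rw [abs_le]
  constructor <;> linarith [k1.1, k1.2, k2.1, k2.2]

lemma NormalizedLaw.integral_abs_sub_le (h : NormalizedLaw τ ε ν) (hε₀ : 0 < ε) :
    ∫ x, |x - ∫ y, y ∂ν| ∂ν ≤ 1 := by
  have := h.isProb
  have h1 : ∫ x, |x - ∫ y, y ∂ν| ∂ν ≤ ∫ x, (1 / 2 + 1 / 2 * (x - ∫ y, y ∂ν) ^ 2) ∂ν := by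
    refine integral_mono (h.integrable_sub hε₀).abs
      ((integrable_const _).add ((h.integrable_sq hε₀).const_mul _)) fun x => ?_
    simp only
    rw [← sq_abs (x - _)]
    nlinarith [sq_nonneg (|x - ∫ y, y ∂ν| - 1)]
  rw [integral_add (integrable_const _) ((h.integrable_sq hε₀).const_mul _), integral_const_mul,
    h.variance] at h1
  norm_num at h1
  exact h1

lemma NormalizedLaw.abs_integral_sub_le (h : NormalizedLaw τ ε ν) (h' : NormalizedLaw τ ε ν')
    (hε₀ : 0 < ε) (hm : |∫ x, x ∂ν - ∫ x, x ∂ν'| ≤ τ) {g : ℝ → ℝ} {A κ : ℝ}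
    (hg : DerivBound g A κ) (hκ : 0 ≤ κ) :
    |∫ x, g x ∂ν - ∫ x, g x ∂ν'| ≤ A * κ * (2 + τ) := by
  have hA := hg.nonneg
  have hlip : ∀ x y, |g x - g y| ≤ A * κ * |x - y| := by
    obtain ⟨g₁, g₂, g₃, h₁, -, -, -, b₁, -⟩ := hg
    intro x y
    exact convex_univ.norm_image_sub_le_of_norm_hasDerivWithin_le (f := g)
      (f' := g₁) (C := A * κ) (fun t _ => (h₁ t).hasDerivWithinAt) (fun t _ => b₁ t)
      (Set.mem_univ y) (Set.mem_univ x)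
  have key : ∀ {ν : Measure ℝ}, NormalizedLaw τ ε ν → |∫ x, g x ∂ν - g (∫ x, x ∂ν)| ≤ A * κ := by
    intro ν h
    have := h.isProb
    have hgi : Integrable g ν := Integrable.of_bound hg.continuous.aestronglyMeasurable A
      (ae_of_all _ fun x => hg.abs_le x)
    have e : g (∫ x, x ∂ν) = ∫ _, g (∫ x, x ∂ν) ∂ν := by simp
    rw [e, ← integral_sub hgi (integrable_const _), ← norm_eq_abs]
    calc _ ≤ ∫ x, A * κ * |x - ∫ y, y ∂ν| ∂ν :=
          norm_integral_le_of_norm_le ((h.integrable_sub hε₀).abs.const_mul _)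
            (ae_of_all _ fun x => hlip _ _)
      _ = A * κ * ∫ x, |x - ∫ y, y ∂ν| ∂ν := integral_const_mul _ _
      _ ≤ A * κ * 1 := by gcongr; exact h.integral_abs_sub_le hε₀
      _ = A * κ := mul_one _
  have k1 := abs_le.1 (key h)
  have k2 := abs_le.1 (key h')
  have k3 := abs_le.1 ((hlip (∫ x, x ∂ν) (∫ x, x ∂ν')).trans
    (mul_le_mul_of_nonneg_left hm (by positivity)))
  rw [abs_le]
  constructor <;> nlinarith [k1.1, k1.2, k2.1, k2.2, k3.1, k3.2]

end Exchange

/-! ### A smooth truncated logarithm -/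

section TruncatedLog

open Real

/-- The bounded smooth function `u ↦ T sin (log √(|u|² + b) / T)`, which is close to `log |u|` when
`b ≪ |u|²` and `|log |u|| ≪ √T`. -/
noncomputable def truncLog (T b : ℝ) (u : ℂ) : ℝ := T * sin (1 / 2 * log (‖u‖ ^ 2 + b) / T)

variable {T b : ℝ}

lemma continuous_truncLog (hb : 0 < b) : Continuous (truncLog T b) := by
  unfold truncLog
  have : Continuous fun u : ℂ => log (‖u‖ ^ 2 + b) :=
    (by fun_prop : Continuous fun u : ℂ => ‖u‖ ^ 2 + b).log fun u => by positivity
  fun_prop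

lemma abs_truncLog_le (hT : 0 ≤ T) (u : ℂ) : |truncLog T b u| ≤ T := by
  rw [truncLog, abs_mul, abs_of_nonneg hT]
  exact mul_le_of_le_one_right hT (abs_sin_le_one _)

/-- Bounds for `T sin p` when `p' = x / T`, `x' = y - 2 x²` and `y' = - 2 x y`: this is the shape of
the derivatives of `p = log (q) / (2 T)` for a quadratic polynomial `q`. -/
lemma derivBound_sin (hT : 1 ≤ T) {κ : ℝ} (hκ : 0 ≤ κ) {p x y : ℝ → ℝ}
    (dp : ∀ t, HasDerivAt p (x t / T) t) (dx : ∀ t, HasDerivAt x (y t - 2 * x t ^ 2) t)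
    (dy : ∀ t, HasDerivAt y (-(2 * y t * x t)) t) (hx : ∀ t, |x t| ≤ κ) (hy0 : ∀ t, 0 ≤ y t)
    (hy : ∀ t, y t ≤ κ ^ 2) : DerivBound (fun t => T * sin (p t)) (24 * T) κ := by
  have hT0 : 0 < T := by linarith
  set x' : ℝ → ℝ := fun t => y t - 2 * x t ^ 2 with hx'
  set x'' : ℝ → ℝ := fun t => -(2 * y t * x t) - 4 * x t * x' t with hx''
  have dx' : ∀ t, HasDerivAt x' (x'' t) t := by
    intro t
    exact ((dy t).sub (((dx t).pow 2).const_mul 2)).congr_deriv (by simp [hx'', hx']; ring)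
  have bx' : ∀ t, |x' t| ≤ 3 * κ ^ 2 := by
    intro t
    have h1 : x t ^ 2 ≤ κ ^ 2 := by rw [← sq_abs]; exact pow_le_pow_left₀ (abs_nonneg _) (hx t) 2
    rw [abs_le]
    constructor <;> simp only [hx'] <;> nlinarith [hy t, hy0 t, sq_nonneg (x t)]
  have bx'' : ∀ t, |x'' t| ≤ 14 * κ ^ 3 := by
    intro t
    have h1 := DerivBound.abs_mul_le (show |y t| ≤ κ ^ 2 by rw [abs_of_nonneg (hy0 t)]; exact hy t) (hx t)
    have h2 := DerivBound.abs_mul_le (hx t) (bx' t)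
    have e : x'' t = -2 * (y t * x t) - 4 * (x t * x' t) := by simp only [hx'']; ring
    rw [e]
    refine (abs_sub _ _).trans ?_
    rw [abs_mul (-2), abs_mul 4, abs_neg, abs_two, abs_of_pos (show (0 : ℝ) < 4 by norm_num)]
    linarith
  have dS : ∀ t, HasDerivAt (fun t => sin (p t)) (cos (p t) * (x t / T)) t := fun t => (dp t).sin
  have dC : ∀ t, HasDerivAt (fun t => cos (p t)) (-sin (p t) * (x t / T)) t := fun t => (dp t).cos
  have d₂ : ∀ t, HasDerivAt (fun t => cos (p t) * x t)
      (-(T⁻¹ * (sin (p t) * (x t * x t))) + cos (p t) * x' t) t := by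
    intro t
    have h2 : HasDerivAt (fun t => cos (p t) * x t)
        (-sin (p t) * (x t / T) * x t + cos (p t) * x' t) t := (dC t).mul (dx t)
    refine h2.congr_deriv ?_
    rw [div_eq_mul_inv]
    generalize x' t = X
    ring
  have d₃ : ∀ t, HasDerivAt (fun t => -(T⁻¹ * (sin (p t) * (x t * x t))) + cos (p t) * x' t)
      (-(T⁻¹ * (T⁻¹ * (cos (p t) * (x t * (x t * x t))))) - 3 * (T⁻¹ * (sin (p t) * (x t * x' t)))
        + cos (p t) * x'' t) t := by
    intro t
    have h0 : HasDerivAt (fun t => x t * x t) (x' t * x t + x t * x' t) t := (dx t).mul (dx t)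
    have h1 : HasDerivAt (fun t => sin (p t) * (x t * x t))
        (cos (p t) * (x t / T) * (x t * x t) + sin (p t) * (x' t * x t + x t * x' t)) t :=
      (dS t).mul h0
    have h2 : HasDerivAt (fun t => cos (p t) * x' t)
        (-sin (p t) * (x t / T) * x' t + cos (p t) * x'' t) t := (dC t).mul (dx' t)
    have h3 : HasDerivAt (fun t => -(T⁻¹ * (sin (p t) * (x t * x t))) + cos (p t) * x' t) _ t :=
      (h1.const_mul T⁻¹).neg.add h2
    refine h3.congr_deriv ?_
    rw [div_eq_mul_inv]
    generalize x' t = X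
    generalize x'' t = Y
    ring
  have hTi : T⁻¹ ≤ 1 := inv_le_one_of_one_le₀ hT
  have hTi0 : 0 ≤ T⁻¹ := by positivity
  have hκ2 : 0 ≤ κ ^ 2 := by positivity
  have hκ3 : 0 ≤ κ ^ 3 := by positivity
  refine ⟨fun t => cos (p t) * x t, fun t => -(T⁻¹ * (sin (p t) * (x t * x t))) + cos (p t) * x' t,
    fun t => -(T⁻¹ * (T⁻¹ * (cos (p t) * (x t * (x t * x t))))) - 3 * (T⁻¹ * (sin (p t) * (x t * x' t)))
      + cos (p t) * x'' t, fun t => ?_, fun t => ?_, fun t => ?_, fun t => ?_, fun t => ?_, fun t => ?_,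
      fun t => ?_⟩
  · exact ((dS t).const_mul T).congr_deriv (by field_simp)
  · exact d₂ t
  · exact d₃ t
  · have := DerivBound.abs_mul_le (abs_of_pos hT0).le (abs_sin_le_one (p t))
    linarith
  · have := DerivBound.abs_mul_le (abs_cos_le_one (p t)) (hx t)
    nlinarith
  · have h1 := DerivBound.abs_mul_le (abs_sin_le_one (p t)) (DerivBound.abs_mul_le (hx t) (hx t))
    have h2 := DerivBound.abs_mul_le (abs_cos_le_one (p t)) (bx' t)
    have h3 := DerivBound.abs_mul_le (show |T⁻¹| ≤ 1 by rwa [abs_of_nonneg hTi0]) h1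
    refine (abs_add_le _ _).trans ?_
    rw [abs_neg]
    nlinarith
  · have hT1 : |T⁻¹| ≤ 1 := by rwa [abs_of_nonneg hTi0]
    have h1 := DerivBound.abs_mul_le hT1 (DerivBound.abs_mul_le hT1 (DerivBound.abs_mul_le
      (abs_cos_le_one (p t)) (DerivBound.abs_mul_le (hx t) (DerivBound.abs_mul_le (hx t) (hx t)))))
    have h2 := DerivBound.abs_mul_le hT1 (DerivBound.abs_mul_le (abs_sin_le_one (p t))
      (DerivBound.abs_mul_le (hx t) (bx' t)))
    have h3 := DerivBound.abs_mul_le (abs_cos_le_one (p t)) (bx'' t)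
    refine (abs_add_le _ _).trans ((add_le_add_left (abs_sub _ _) _).trans ?_)
    rw [abs_neg, abs_mul 3, abs_of_pos (show (0 : ℝ) < 3 by norm_num)]
    nlinarith

lemma derivBound_truncLog (hT : 1 ≤ T) (hb : 0 < b) (u a : ℂ) {κ : ℝ} (hκ : 0 ≤ κ)
    (ha : ‖a‖ ^ 2 ≤ κ ^ 2 * b) : DerivBound (fun t : ℝ => truncLog T b (u + t * a)) (24 * T) κ := by
  have hT0 : 0 < T := by linarith
  set q : ℝ → ℝ := fun t => ‖u + t * a‖ ^ 2 + b with hq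
  set q₁ : ℝ → ℝ := fun t => 2 * (u.re * a.re + u.im * a.im) + 2 * t * ‖a‖ ^ 2 with hq₁
  have hqe : ∀ t, q t = ‖u‖ ^ 2 + 2 * (u.re * a.re + u.im * a.im) * t + ‖a‖ ^ 2 * t ^ 2 + b := by
    intro t
    simp only [hq, ← Complex.normSq_eq_norm_sq, Complex.normSq_apply]
    simp
    ring
  have hqpos : ∀ t, 0 < q t := fun t => by positivity
  have hqb : ∀ t, b ≤ q t := fun t => by simp only [hq]; nlinarith [sq_nonneg ‖u + t * a‖]
  have dq : ∀ t, HasDerivAt q (q₁ t) t := by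
    intro t
    have : q = fun t => ‖u‖ ^ 2 + 2 * (u.re * a.re + u.im * a.im) * t + ‖a‖ ^ 2 * t ^ 2 + b :=
      funext hqe
    rw [this]
    have h := ((((hasDerivAt_id t).const_mul (2 * (u.re * a.re + u.im * a.im))).const_add
      (‖u‖ ^ 2)).add ((hasDerivAt_pow 2 t).const_mul (‖a‖ ^ 2))).add_const b
    refine h.congr_deriv ?_
    simp [hq₁]
    ring
  have dq₁ : ∀ t, HasDerivAt q₁ (2 * ‖a‖ ^ 2) t := by
    intro t
    have h := ((((hasDerivAt_id t).const_mul 2).mul_const (‖a‖ ^ 2)).const_add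
      (2 * (u.re * a.re + u.im * a.im)))
    exact h.congr_deriv (by simp)
  -- the Cauchy–Schwarz bound `q₁² ≤ 4 |a|² q`
  have hq₁sq : ∀ t, q₁ t ^ 2 ≤ 4 * ‖a‖ ^ 2 * q t := by
    intro t
    rw [hqe t]
    simp only [hq₁]
    have e1 : ‖a‖ ^ 2 = a.re ^ 2 + a.im ^ 2 := by
      rw [← Complex.normSq_eq_norm_sq, Complex.normSq_apply]; ring
    have e2 : ‖u‖ ^ 2 = u.re ^ 2 + u.im ^ 2 := by
      rw [← Complex.normSq_eq_norm_sq, Complex.normSq_apply]; ring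
    rw [e1, e2]
    nlinarith [sq_nonneg (u.re * a.im - u.im * a.re),
      mul_nonneg (add_nonneg (sq_nonneg a.re) (sq_nonneg a.im)) hb.le]
  -- the logarithmic derivative `x = q₁ / (2 q)` and `y = |a|² / q` satisfy `|x| ≤ κ`, `y ≤ κ²`
  have hy : ∀ t, ‖a‖ ^ 2 / q t ≤ κ ^ 2 := by
    intro t
    rw [div_le_iff₀ (hqpos t)]
    exact ha.trans (by gcongr; exact hqb t)
  have hy0 : ∀ t, 0 ≤ ‖a‖ ^ 2 / q t := fun t => div_nonneg (sq_nonneg _) (hqpos t).le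
  have hx : ∀ t, |q₁ t / (2 * q t)| ≤ κ := by
    intro t
    refine abs_le_of_sq_le_sq ?_ hκ
    refine le_trans ?_ (hy t)
    rw [div_pow, div_le_div_iff₀ (by have := hqpos t; positivity) (hqpos t)]
    nlinarith [hq₁sq t, hqpos t]
  set p : ℝ → ℝ := fun t => 1 / 2 * log (q t) / T with hp
  have dp : ∀ t, HasDerivAt p (q₁ t / (2 * q t) / T) t := by
    intro t
    have := (((dq t).log (hqpos t).ne').const_mul (1 / 2)).div_const T
    refine this.congr_deriv ?_
    have := (hqpos t).ne'
    field_simp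
  have dx : ∀ t, HasDerivAt (fun t => q₁ t / (2 * q t))
      (‖a‖ ^ 2 / q t - 2 * (q₁ t / (2 * q t)) ^ 2) t := by
    intro t
    have h1 := (hqpos t).ne'
    have := (dq₁ t).div ((dq t).const_mul 2) (by positivity)
    refine this.congr_deriv ?_
    field_simp
  have dy : ∀ t, HasDerivAt (fun t => ‖a‖ ^ 2 / q t)
      (-(2 * (‖a‖ ^ 2 / q t) * (q₁ t / (2 * q t)))) t := by
    intro t
    have h1 := (hqpos t).ne'
    have := (hasDerivAt_const t (‖a‖ ^ 2)).div (dq t) h1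
    refine this.congr_deriv ?_
    field_simp
    ring
  exact derivBound_sin hT hκ dp dx dy hx hy0 hy

end TruncatedLog

/-! ### Lindeberg's replacement argument -/

section Lindeberg

variable {J Ω Ω' : Type*} [MeasurableSpace Ω] [MeasurableSpace Ω'] {μ : Measure Ω}
  {μ' : Measure Ω'} {ξ : J → Ω → ℝ} {ξ' : J → Ω' → ℝ}
  {E : Type*} [NormedAddCommGroup E] [NormedSpace ℝ E] [MeasurableSpace E] [BorelSpace E]
  [SecondCountableTopology E]

lemma integral_comp_add_of_iIndepFun [IsProbabilityMeasure μ] (hm : ∀ j, Measurable (ξ j))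
    (hi : iIndepFun ξ μ) (a : J → E) {t : Finset J} {j : J} (hj : j ∉ t) {K : E → ℝ}
    (hK : Measurable K) {B : ℝ} (hB : ∀ v, |K v| ≤ B) :
    ∫ ω, K (∑ i ∈ t, ξ i ω • a i + ξ j ω • a j) ∂μ
      = ∫ ω, ∫ x, K (∑ i ∈ t, ξ i ω • a i + x • a j) ∂(μ.map (ξ j)) ∂μ := by
  classical
  have hXm : ∀ j, Measurable fun ω => ξ j ω • a j := fun j => (hm j).smul_const _
  have hSm : Measurable fun ω => ∑ i ∈ t, ξ i ω • a i := Finset.measurable_sum _ fun i _ => hXm i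
  have hind : IndepFun (fun ω => ∑ i ∈ t, ξ i ω • a i) (ξ j) μ := by
    have hψ : Measurable fun v : ({j} : Finset J) → ℝ => v ⟨j, Finset.mem_singleton_self j⟩ :=
      measurable_pi_apply _
    have h1 := hi.indepFun_finset t {j} (Finset.disjoint_singleton_right.2 hj) hm
    have h2 := h1.comp (φ := fun v : t → ℝ => ∑ i : t, v i • a i)
      (ψ := fun v : ({j} : Finset J) → ℝ => v ⟨j, Finset.mem_singleton_self j⟩)
      (Finset.measurable_sum _ fun i _ => (measurable_pi_apply i).smul_const _) hψ
    have e : (fun ω => ∑ i ∈ t, ξ i ω • a i) =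
        (fun v : t → ℝ => ∑ i : t, v i • a i) ∘ fun ω (i : t) => ξ i ω := by
      ext ω
      simp only [Function.comp]
      exact (Finset.sum_coe_sort t fun i => ξ i ω • a i).symm
    rw [e]
    exact h2
  have hprob : IsProbabilityMeasure (μ.map (ξ j)) :=
    Measure.isProbabilityMeasure_map (hm j).aemeasurable
  have hprob' : IsProbabilityMeasure (μ.map fun ω => ∑ i ∈ t, ξ i ω • a i) :=
    Measure.isProbabilityMeasure_map hSm.aemeasurable
  have hmap := (indepFun_iff_map_prod_eq_prod_map_map hSm.aemeasurable (hm j).aemeasurable).1 hind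
  have hKm : Measurable fun p : E × ℝ => K (p.1 + p.2 • a j) :=
    hK.comp (measurable_fst.add (measurable_snd.smul_const _))
  have h1 : ∫ ω, K (∑ i ∈ t, ξ i ω • a i + ξ j ω • a j) ∂μ
      = ∫ p, K (p.1 + p.2 • a j) ∂(μ.map fun ω => (∑ i ∈ t, ξ i ω • a i, ξ j ω)) := by
    rw [integral_map (hSm.prodMk (hm j)).aemeasurable hKm.aestronglyMeasurable]
  rw [h1, hmap, integral_prod, integral_map hSm.aemeasurable]
  · exact (hKm.stronglyMeasurable.integral_prod_right
      (ν := μ.map (ξ j))).aestronglyMeasurable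
  · exact Integrable.of_bound hKm.aestronglyMeasurable B (ae_of_all _ fun p => hB _)

/-- Lindeberg's replacement principle: if exchanging the law of `ξ_j` for that of `ξ'_j` in a single
summand changes the expectation by at most `e_j`, whatever the other summands, then exchanging all
laws changes it by at most `∑ e_j`. -/
lemma abs_integral_sum_sub_le [IsProbabilityMeasure μ] [IsProbabilityMeasure μ']
    (hm : ∀ j, Measurable (ξ j)) (hi : iIndepFun ξ μ) (hm' : ∀ j, Measurable (ξ' j))
    (hi' : iIndepFun ξ' μ') (a : J → E) (e : J → ℝ) (B : ℝ) (t : Finset J) :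
    ∀ K : E → ℝ, Measurable K → (∀ v, |K v| ≤ B) →
      (∀ j ∈ t, ∀ v, |∫ x, K (v + x • a j) ∂(μ.map (ξ j)) -
        ∫ x, K (v + x • a j) ∂(μ'.map (ξ' j))| ≤ e j) →
      |∫ ω, K (∑ j ∈ t, ξ j ω • a j) ∂μ - ∫ ω, K (∑ j ∈ t, ξ' j ω • a j) ∂μ'| ≤ ∑ j ∈ t, e j := by
  classical
  have hprob : ∀ j, IsProbabilityMeasure (μ.map (ξ j)) := fun j =>
    Measure.isProbabilityMeasure_map (hm j).aemeasurable
  have hprob' : ∀ j, IsProbabilityMeasure (μ'.map (ξ' j)) := fun j =>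
    Measure.isProbabilityMeasure_map (hm' j).aemeasurable
  induction t using Finset.induction_on with
  | empty => intro K _ _ _; simp
  | insert j t hj ih =>
    intro K hK hB he
    have hKu : Measurable fun p : E × ℝ => K (p.1 + p.2 • a j) :=
      hK.comp (measurable_fst.add (measurable_snd.smul_const _))
    set K₁ : E → ℝ := fun v => ∫ x, K (v + x • a j) ∂(μ.map (ξ j)) with hK₁
    set K₂ : E → ℝ := fun v => ∫ x, K (v + x • a j) ∂(μ'.map (ξ' j)) with hK₂
    have hK₁m : Measurable K₁ :=
      (hKu.stronglyMeasurable.integral_prod_right (ν := μ.map (ξ j))).measurable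
    have hK₂m : Measurable K₂ :=
      (hKu.stronglyMeasurable.integral_prod_right (ν := μ'.map (ξ' j))).measurable
    have hbd : ∀ (ν : Measure ℝ) [IsProbabilityMeasure ν] (F : ℝ → ℝ), (∀ x, |F x| ≤ B) →
        |∫ x, F x ∂ν| ≤ B := by
      intro ν _ F hF
      have := norm_integral_le_of_norm_le_const (μ := ν) (f := F) (C := B) (ae_of_all _ hF)
      simpa using this
    have hK₁B : ∀ v, |K₁ v| ≤ B := fun v => hbd _ _ fun x => hB _
    have hK₂B : ∀ v, |K₂ v| ≤ B := fun v => hbd _ _ fun x => hB _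
    have hint : ∀ (ν : Measure ℝ) [IsProbabilityMeasure ν] (ν₂ : Measure ℝ)
        [IsProbabilityMeasure ν₂] (v : E) (i : J), Integrable (Function.uncurry fun y x : ℝ =>
          K (v + y • a i + x • a j)) (ν.prod ν₂) := by
      intro ν _ ν₂ _ v i
      refine Integrable.of_bound (Measurable.aestronglyMeasurable ?_) B (ae_of_all _ fun p => hB _)
      exact hK.comp (((measurable_fst.smul_const _).const_add v).add (measurable_snd.smul_const _))
    have hih := ih K₁ hK₁m hK₁B (by
      intro i hi v
      have h1 : ∀ (ν : Measure ℝ) [IsProbabilityMeasure ν], ∫ y, K₁ (v + y • a i) ∂ν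
          = ∫ x, ∫ y, K ((v + x • a j) + y • a i) ∂ν ∂(μ.map (ξ j)) := by
        intro ν _
        simp only [hK₁]
        rw [integral_integral_swap (hint ν _ v i)]
        simp only [add_right_comm]
      have h2 : ∀ (ν : Measure ℝ) [IsProbabilityMeasure ν], Integrable
          (fun x => ∫ y, K ((v + x • a j) + y • a i) ∂ν) (μ.map (ξ j)) := by
        intro ν _
        have := (hint ν (μ.map (ξ j)) v i).integral_prod_right
        simpa only [Function.uncurry, add_right_comm] using this
      rw [h1, h1, ← integral_sub (h2 _) (h2 _)]
      have := norm_integral_le_of_norm_le_const (μ := μ.map (ξ j)) (C := e i)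
        (f := fun x => (∫ y, K ((v + x • a j) + y • a i) ∂(μ.map (ξ i)))
          - ∫ y, K ((v + x • a j) + y • a i) ∂(μ'.map (ξ' i)))
        (ae_of_all _ fun x => he i (Finset.mem_insert_of_mem hi) _)
      simpa using this)
    have e1 : ∫ ω, K (∑ i ∈ insert j t, ξ i ω • a i) ∂μ = ∫ ω, K₁ (∑ i ∈ t, ξ i ω • a i) ∂μ := by
      simp only [Finset.sum_insert hj, add_comm (ξ j _ • a j)]
      exact integral_comp_add_of_iIndepFun hm hi a hj hK hB
    have e2 : ∫ ω, K (∑ i ∈ insert j t, ξ' i ω • a i) ∂μ'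
        = ∫ ω, K₂ (∑ i ∈ t, ξ' i ω • a i) ∂μ' := by
      simp only [Finset.sum_insert hj, add_comm (ξ' j _ • a j)]
      exact integral_comp_add_of_iIndepFun hm' hi' a hj hK hB
    have hS' : Measurable fun ω => ∑ i ∈ t, ξ' i ω • a i :=
      Finset.measurable_sum _ fun i _ => (hm' i).smul_const _
    have i1 : Integrable (fun ω => K₁ (∑ i ∈ t, ξ' i ω • a i)) μ' :=
      Integrable.of_bound (hK₁m.comp hS').aestronglyMeasurable B (ae_of_all _ fun _ => hK₁B _)
    have i2 : Integrable (fun ω => K₂ (∑ i ∈ t, ξ' i ω • a i)) μ' :=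
      Integrable.of_bound (hK₂m.comp hS').aestronglyMeasurable B (ae_of_all _ fun _ => hK₂B _)
    have h3 : |∫ ω, K₁ (∑ i ∈ t, ξ' i ω • a i) ∂μ' - ∫ ω, K₂ (∑ i ∈ t, ξ' i ω • a i) ∂μ'| ≤ e j := by
      rw [← integral_sub i1 i2]
      have := norm_integral_le_of_norm_le_const (μ := μ') (C := e j)
        (f := fun ω => K₁ (∑ i ∈ t, ξ' i ω • a i) - K₂ (∑ i ∈ t, ξ' i ω • a i))
        (ae_of_all _ fun x => he j (Finset.mem_insert_self j t) _)
      simpa using this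
    rw [e1, e2, Finset.sum_insert hj]
    calc _ ≤ _ := abs_sub_le _ (∫ ω, K₁ (∑ i ∈ t, ξ' i ω • a i) ∂μ') _
      _ ≤ e j + ∑ i ∈ t, e i := by linarith

end Lindeberg

section LindebergSeries

open Real

variable {J Ω Ω' ι : Type*} [MeasurableSpace Ω] [MeasurableSpace Ω'] [Fintype ι] {μ : Measure Ω}
  {μ' : Measure Ω'} {ξ : J → Ω → ℝ} {ξ' : J → Ω' → ℝ} {τ ε : ℝ}

/-- The product of the differences of two truncated logarithms, with the truncation at `u p`
relative to the scale `b p`. -/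
noncomputable def truncLogProd (T : ℝ) (b : ι × Bool → ℝ) (v : ι × Bool → ℂ) : ℝ :=
  ∏ i, (truncLog T (b (i, true)) (v (i, true)) - truncLog T (b (i, false)) (v (i, false)))

variable {T : ℝ} {b : ι × Bool → ℝ}

lemma continuous_truncLogProd (hb : ∀ p, 0 < b p) : Continuous (truncLogProd T b) := by
  unfold truncLogProd
  refine continuous_finsetProd _ fun i _ => ?_
  exact ((continuous_truncLog (hb _)).comp (continuous_apply _)).sub
    ((continuous_truncLog (hb _)).comp (continuous_apply _))

lemma abs_truncLogProd_le (hT : 0 ≤ T) (v : ι × Bool → ℂ) :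
    |truncLogProd T b v| ≤ (2 * T) ^ Fintype.card ι := by
  rw [truncLogProd, Finset.abs_prod, ← Finset.card_univ, ← Finset.prod_const]
  refine Finset.prod_le_prod (fun _ _ => abs_nonneg _) fun i _ => ?_
  have h1 := abs_truncLog_le (b := b (i, true)) hT (v (i, true))
  have h2 := abs_truncLog_le (b := b (i, false)) hT (v (i, false))
  exact (abs_sub _ _).trans (by linarith)

lemma derivBound_truncLogProd (hT : 1 ≤ T) (hb : ∀ p, 0 < b p) (v a : ι × Bool → ℂ) {κ : ℝ}
    (hκ : 0 ≤ κ) (ha : ∀ p, ‖a p‖ ^ 2 ≤ κ ^ 2 * b p) :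
    DerivBound (fun x : ℝ => truncLogProd T b (v + x • a)) ((400 * T) ^ Fintype.card ι) κ := by
  have h := DerivBound.prod hκ (Finset.univ : Finset ι) (fun i _ =>
    (derivBound_truncLog hT (hb (i, true)) (v (i, true)) (a (i, true)) hκ (ha _)).sub
      (derivBound_truncLog hT (hb (i, false)) (v (i, false)) (a (i, false)) hκ (ha _)))
  have h2 : DerivBound (fun x : ℝ => truncLogProd T b (v + x • a)) _ κ := h
  refine h2.mono hκ ?_
  rw [Finset.card_univ]
  refine pow_le_pow_left₀ (by positivity) (by linarith) _

/-- The total error of Lindeberg's replacement argument for `truncLogProd` over finitely many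
summands, all of which are small compared with the quadratic mean of the sum. -/
lemma sum_exchange_error_le {β η : ℝ} (hτ : 0 < τ) (hε₀ : 0 < ε) (hβ : 0 < β) (hη : 0 ≤ η)
    {a : J → ι × Bool → ℂ} {V : ι × Bool → ℝ} (hV : ∀ p, 0 < V p)
    (haV : ∀ p, ∀ t : Finset J, ∑ j ∈ t, ‖a j p‖ ^ 2 ≤ V p)
    (hηa : ∀ j p, ‖a j p‖ ≤ η * √(V p)) {κ : J → ℝ}
    (hκ : ∀ j, κ j = √(∑ p, ‖a j p‖ ^ 2 / (β ^ 2 * V p))) (X : Finset J) (t : Finset J) {A : ℝ}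
    (hA : 0 ≤ A) [DecidableEq J] :
    ∑ j ∈ t, (if j ∈ X then A * κ j * (2 + τ) else 4 * A * τ * κ j ^ (2 + ε)) ≤
      A * (4 * τ * (√(2 * Fintype.card ι) * η / β) ^ ε * (2 * Fintype.card ι / β ^ 2) +
        X.card * (2 + τ) * (√(2 * Fintype.card ι) * η / β)) := by
  set m : ℝ := (Fintype.card ι : ℝ) with hm
  set K := √(2 * m) * η / β with hK
  have hK0 : 0 ≤ K := by positivity
  have hcard : (Fintype.card (ι × Bool) : ℝ) = 2 * m := by
    rw [Fintype.card_prod, Fintype.card_bool]; push_cast; ring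
  have hterm : ∀ j p, ‖a j p‖ ^ 2 / (β ^ 2 * V p) ≤ η ^ 2 / β ^ 2 := by
    intro j p
    rw [div_le_div_iff₀ (mul_pos (by positivity) (hV p)) (by positivity)]
    have := pow_le_pow_left₀ (norm_nonneg _) (hηa j p) 2
    rw [mul_pow, sq_sqrt (hV p).le] at this
    nlinarith [sq_nonneg β]
  have hterm0 : ∀ j p, 0 ≤ ‖a j p‖ ^ 2 / (β ^ 2 * V p) := fun j p => by
    have := hV p; positivity
  have hκ0 : ∀ j, 0 ≤ κ j := fun j => by rw [hκ]; positivity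
  have hκsq : ∀ j, κ j ^ 2 = ∑ p, ‖a j p‖ ^ 2 / (β ^ 2 * V p) := fun j => by
    rw [hκ, sq_sqrt (Finset.sum_nonneg fun p _ => hterm0 j p)]
  have hκK : ∀ j, κ j ≤ K := by
    intro j
    refine abs_le_of_sq_le_sq' ?_ hK0 |>.2
    rw [hκsq, hK, div_pow, mul_pow, sq_sqrt (by positivity)]
    calc _ ≤ ∑ _p : ι × Bool, η ^ 2 / β ^ 2 := Finset.sum_le_sum fun p _ => hterm j p
      _ = _ := by rw [Finset.sum_const, Finset.card_univ, nsmul_eq_mul, hcard]; ring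
  have hsum : ∑ j ∈ t, κ j ^ 2 ≤ 2 * m / β ^ 2 := by
    simp only [hκsq]
    rw [Finset.sum_comm]
    calc _ ≤ ∑ _p : ι × Bool, 1 / β ^ 2 := by
          refine Finset.sum_le_sum fun p _ => ?_
          rw [← Finset.sum_div, div_le_div_iff₀ (mul_pos (by positivity) (hV p)) (by positivity)]
          nlinarith [haV p t, sq_nonneg β]
      _ = _ := by rw [Finset.sum_const, Finset.card_univ, nsmul_eq_mul, hcard]; ring
  have hpow : ∀ j, κ j ^ (2 + ε) ≤ K ^ ε * κ j ^ 2 := by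
    intro j
    rw [rpow_add_of_nonneg (hκ0 j) (by norm_num) hε₀.le, mul_comm, rpow_two]
    gcongr
    · exact hκ0 j
    · exact hκK j
  have h1 : ∀ j ∈ t, (if j ∈ X then A * κ j * (2 + τ) else 4 * A * τ * κ j ^ (2 + ε)) ≤
      4 * A * τ * K ^ ε * κ j ^ 2 + if j ∈ X then A * K * (2 + τ) else 0 := by
    intro j _
    split_ifs
    · have : A * κ j * (2 + τ) ≤ A * K * (2 + τ) := by gcongr; exact hκK j
      have : 0 ≤ 4 * A * τ * K ^ ε * κ j ^ 2 := by positivity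
      linarith
    · rw [add_zero, mul_assoc (4 * A * τ)]
      gcongr
      exact hpow j
  refine (Finset.sum_le_sum h1).trans ?_
  rw [Finset.sum_add_distrib, ← Finset.mul_sum, ← Finset.sum_filter, Finset.sum_const,
    nsmul_eq_mul]
  have h2 : ((t.filter (· ∈ X)).card : ℝ) ≤ X.card := by
    exact_mod_cast Finset.card_le_card fun j hj => (Finset.mem_filter.1 hj).2
  calc _ ≤ 4 * A * τ * K ^ ε * (2 * m / β ^ 2) + X.card * (A * K * (2 + τ)) := by gcongr
    _ = _ := by ring

lemma tendsto_integral_truncLogProd [IsProbabilityMeasure μ] (hm : ∀ j, Measurable (ξ j))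
    (hT : 0 ≤ T) (hb : ∀ p, 0 < b p) {s : ℕ → Finset J} {a : J → ι × Bool → ℂ}
    {F : Ω → ι × Bool → ℂ}
    (hF : ∀ ω p, Tendsto (fun M => ∑ j ∈ s M, (ξ j ω : ℂ) * a j p) atTop (𝓝 (F ω p))) :
    Tendsto (fun M => ∫ ω, truncLogProd T b (∑ j ∈ s M, ξ j ω • a j) ∂μ) atTop
      (𝓝 (∫ ω, truncLogProd T b (F ω) ∂μ)) := by
  have hcont := continuous_truncLogProd (T := T) hb
  refine tendsto_integral_of_dominated_convergence (fun _ => (2 * T) ^ Fintype.card ι)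
    (fun M => ?_) (integrable_const _) (fun M => ae_of_all _ fun ω => ?_)
    (ae_of_all _ fun ω => ?_)
  · refine (hcont.measurable.comp ?_).aestronglyMeasurable
    exact Finset.measurable_sum _ fun j _ => (hm j).smul_const _
  · exact abs_truncLogProd_le hT _
  · refine (hcont.tendsto _).comp (tendsto_pi_nhds.2 fun p => ?_)
    refine (hF ω p).congr fun M => ?_
    simp [Finset.sum_apply]

variable [IsProbabilityMeasure μ] [IsProbabilityMeasure μ']

/-- Universality for the expectation of `truncLogProd`: for two random series with the same
coefficients, all small compared with the quadratic mean of the series. -/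
lemma abs_integral_truncLogProd_sub_le {β η : ℝ} (h : IndepNormalized τ ε μ ξ)
    (h' : IndepNormalized τ ε μ' ξ') (hτ : 0 < τ) (hε₀ : 0 < ε) (hε₁ : ε < 1) (hT : 1 ≤ T)
    (hβ : 0 < β) (hη : 0 ≤ η) {a : J → ι × Bool → ℂ} {V : ι × Bool → ℝ} (hV : ∀ p, 0 < V p)
    (haV : ∀ p, ∀ t : Finset J, ∑ j ∈ t, ‖a j p‖ ^ 2 ≤ V p)
    (hηa : ∀ j p, ‖a j p‖ ≤ η * √(V p)) (X : Finset J)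
    (hX : ∀ j ∉ X, ∫ x, x ∂(μ.map (ξ j)) = ∫ x, x ∂(μ'.map (ξ' j)))
    (hX' : ∀ j ∈ X, |∫ x, x ∂(μ.map (ξ j)) - ∫ x, x ∂(μ'.map (ξ' j))| ≤ τ)
    {s : ℕ → Finset J} {F : Ω → ι × Bool → ℂ} {F' : Ω' → ι × Bool → ℂ}
    (hF : ∀ ω p, Tendsto (fun M => ∑ j ∈ s M, (ξ j ω : ℂ) * a j p) atTop (𝓝 (F ω p)))
    (hF' : ∀ ω p, Tendsto (fun M => ∑ j ∈ s M, (ξ' j ω : ℂ) * a j p) atTop (𝓝 (F' ω p))) :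
    |∫ ω, truncLogProd T (fun p => β ^ 2 * V p) (F ω) ∂μ -
        ∫ ω, truncLogProd T (fun p => β ^ 2 * V p) (F' ω) ∂μ'| ≤
      (400 * T) ^ Fintype.card ι *
        (4 * τ * (√(2 * Fintype.card ι) * η / β) ^ ε * (2 * Fintype.card ι / β ^ 2) +
          X.card * (2 + τ) * (√(2 * Fintype.card ι) * η / β)) := by
  classical
  have hT0 : 0 ≤ T := by linarith
  have hb : ∀ p, 0 < β ^ 2 * V p := fun p => mul_pos (by positivity) (hV p)
  set b : ι × Bool → ℝ := fun p => β ^ 2 * V p with hbdef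
  set κ : J → ℝ := fun j => √(∑ p, ‖a j p‖ ^ 2 / b p) with hκ
  have hκ0 : ∀ j, 0 ≤ κ j := fun j => sqrt_nonneg _
  have hterm0 : ∀ j p, 0 ≤ ‖a j p‖ ^ 2 / b p := fun j p => div_nonneg (sq_nonneg _) (hb p).le
  have hκa : ∀ j p, ‖a j p‖ ^ 2 ≤ κ j ^ 2 * b p := by
    intro j p
    rw [hκ, sq_sqrt (Finset.sum_nonneg fun p _ => hterm0 j p), ← div_le_iff₀ (hb p)]
    exact Finset.single_le_sum (f := fun p => ‖a j p‖ ^ 2 / b p) (fun p _ => hterm0 j p)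
      (Finset.mem_univ p)
  have hcont := continuous_truncLogProd (T := T) hb
  refine le_of_tendsto ((tendsto_integral_truncLogProd h.measurable hT0 hb hF).sub
    (tendsto_integral_truncLogProd h'.measurable hT0 hb hF')).abs
    (Eventually.of_forall fun M => ?_)
  refine (abs_integral_sum_sub_le h.measurable h.indep h'.measurable h'.indep a
    (fun j => if j ∈ X then (400 * T) ^ Fintype.card ι * κ j * (2 + τ) else
      4 * (400 * T) ^ Fintype.card ι * τ * κ j ^ (2 + ε)) _ (s M) (truncLogProd T b)
    hcont.measurable (abs_truncLogProd_le hT0) fun j _ v => ?_).trans ?_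
  · have hd := derivBound_truncLogProd hT hb v (a j) (hκ0 j) (hκa j)
    split_ifs with hj
    · exact (h.law j).abs_integral_sub_le (h'.law j) hε₀ (hX' j hj) hd (hκ0 j)
    · exact (h.law j).abs_integral_sub_le_rpow (h'.law j) hε₀ hε₁ (hX j hj) hd (hκ0 j)
  · exact sum_exchange_error_le hτ hε₀ hβ hη hV haV hηa (fun j => rfl) X (s M) (by positivity)

end LindebergSeries

/-! ### Random analytic series -/

section RandomSeries

variable {J Ω : Type*} [MeasurableSpace Ω] {μ : Measure Ω} {ξ : J → Ω → ℝ} {τ ε : ℝ}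

lemma indepFun_of_measurable_iSup_comap (hm : ∀ j, Measurable (ξ j)) (hi : iIndepFun ξ μ) (j : J)
    {β : Type*} [MeasurableSpace β] {R : Ω → β}
    (hR : Measurable[⨆ i ∈ ({j}ᶜ : Set J), MeasurableSpace.comap (ξ i) inferInstance] R) :
    IndepFun R (ξ j) μ := by
  rw [IndepFun_iff_Indep]
  have h := indep_iSup_of_disjoint (fun i => (hm i).comap_le) hi.iIndep
    (S := ({j}ᶜ : Set J)) (T := {j}) (by simp)
  refine indep_of_indep_of_le_left (indep_of_indep_of_le_right h ?_) hR.comap_le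
  exact le_iSup₂_of_le j rfl le_rfl

/-- A law of variance one is not concentrated in a single point. -/
lemma NormalizedLaw.exists_ne {ν : Measure ℝ} (h : NormalizedLaw τ ε ν) {p : ℝ → Prop}
    (hp : ∀ᵐ x ∂ν, p x) : ∃ x y, p x ∧ p y ∧ x ≠ y := by
  have := h.isProb
  obtain ⟨x₀, hx₀⟩ := hp.exists
  by_contra! hne
  have hx : ∀ᵐ x ∂ν, x = x₀ := hp.mono fun x hx => hne x x₀ hx hx₀
  have h1 : ∫ y, y ∂ν = x₀ := by
    rw [integral_congr_ae (g := fun _ => x₀) hx]; simp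
  have h2 : ∫ x, (x - ∫ y, y ∂ν) ^ 2 ∂ν = 0 := by
    rw [integral_congr_ae (g := fun _ => (0 : ℝ)) (hx.mono fun x hx => by simp [h1, hx])]
    simp
  rw [h.variance] at h2
  norm_num at h2

lemma measurable_of_tendsto_sum {t : ℕ → Finset J} (hξ : ∀ M, ∀ i ∈ t M, Measurable (ξ i))
    (c : ℕ → J → ℂ) (R : Ω → ℕ → ℂ)
    (hR : ∀ n ω, Tendsto (fun M => ∑ i ∈ t M, (ξ i ω : ℂ) * c n i) atTop (𝓝 (R ω n))) :
    Measurable R := by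
  refine measurable_pi_lambda _ fun n => measurable_of_tendsto_metrizable
    (f := fun M ω => ∑ i ∈ t M, (ξ i ω : ℂ) * c n i) (fun M => ?_)
    (tendsto_pi_nhds.2 fun ω => hR n ω)
  exact Finset.measurable_sum _ fun i hi =>
    (Complex.measurable_ofReal.comp (hξ M i hi)).mul_const _

/-- If a sequence of random series converges surely, so does the sequence of the coefficients of any
fixed variable: conditionally on the other variables, this one takes two different values. -/
lemma IndepNormalized.exists_tendsto_coeff (h : IndepNormalized τ ε μ ξ) [IsProbabilityMeasure μ]
    {s : ℕ → Finset J} (hs : Tendsto s atTop atTop) (c : ℕ → J → ℂ) (D : ℕ → Ω → ℂ)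
    (hD : ∀ n ω, Tendsto (fun M => ∑ i ∈ s M, (ξ i ω : ℂ) * c n i) atTop (𝓝 (D n ω)))
    (hlim : ∀ ω, ∃ L, Tendsto (fun n => D n ω) atTop (𝓝 L)) (j : J) :
    ∃ L, Tendsto (fun n => c n j) atTop (𝓝 L) := by
  classical
  set R : Ω → ℕ → ℂ := fun ω n => D n ω - ξ j ω * c n j with hR
  have hRlim : ∀ n ω, Tendsto (fun M => ∑ i ∈ (s M).erase j, (ξ i ω : ℂ) * c n i) atTop
      (𝓝 (R ω n)) := by
    intro n ω
    refine ((hD n ω).sub_const (ξ j ω * c n j)).congr' ?_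
    filter_upwards [hs.eventually_ge_atTop {j}] with M hM
    rw [← Finset.sum_erase_add _ _ (Finset.singleton_subset_iff.1 hM), add_sub_cancel_right]
  have hRm' : Measurable[⨆ i ∈ ({j}ᶜ : Set J), MeasurableSpace.comap (ξ i) inferInstance] R := by
    refine @measurable_of_tendsto_sum J Ω (⨆ i ∈ ({j}ᶜ : Set J),
      MeasurableSpace.comap (ξ i) inferInstance) ξ (fun M => (s M).erase j) (fun M i hi => ?_) c R
      hRlim
    refine Measurable.mono (comap_measurable (ξ i)) ?_ le_rfl
    exact le_iSup₂_of_le (f := fun i (_ : i ∈ ({j}ᶜ : Set J)) =>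
      MeasurableSpace.comap (ξ i) inferInstance) i (Finset.ne_of_mem_erase hi) le_rfl
  have hRm : Measurable R := hRm'.mono (iSup₂_le fun i _ => (h.measurable i).comap_le) le_rfl
  have hind := indepFun_of_measurable_iSup_comap h.measurable h.indep j hRm'
  have hmap := (indepFun_iff_map_prod_eq_prod_map_map hRm.aemeasurable
    (h.measurable j).aemeasurable).1 hind
  have hp1 : IsProbabilityMeasure (μ.map R) := Measure.isProbabilityMeasure_map hRm.aemeasurable
  have hp2 := (h.law j).isProb
  have hG : MeasurableSet {p : (ℕ → ℂ) × ℝ |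
      ∃ L, Tendsto (fun n => p.1 n + p.2 * c n j) atTop (𝓝 L)} :=
    MeasureTheory.measurableSet_exists_tendsto fun n => by fun_prop
  have hae : ∀ᵐ p ∂((μ.map R).prod (μ.map (ξ j))),
      ∃ L, Tendsto (fun n => p.1 n + p.2 * c n j) atTop (𝓝 L) := by
    rw [← hmap, ae_map_iff (hRm.prodMk (h.measurable j)).aemeasurable hG]
    refine ae_of_all _ fun ω => ?_
    obtain ⟨L, hL⟩ := hlim ω
    exact ⟨L, hL.congr fun n => by simp [hR]⟩
  obtain ⟨r, hr⟩ := (Measure.ae_ae_of_ae_prod hae).exists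
  obtain ⟨x, y, ⟨L₁, h₁⟩, ⟨L₂, h₂⟩, hxy⟩ := (h.law j).exists_ne hr
  have hxy' : (x : ℂ) - y ≠ 0 := by
    rw [← Complex.ofReal_sub]
    exact Complex.ofReal_ne_zero.2 (sub_ne_zero.2 hxy)
  refine ⟨((x : ℂ) - y)⁻¹ * (L₁ - L₂), ((h₁.sub h₂).const_mul _).congr fun n => ?_⟩
  simp only
  field_simp
  ring

/-- A map has a limit along a countably generated filter if it converges along every sequence. -/
lemma exists_tendsto_of_seq {α β : Type*} [TopologicalSpace β] [T2Space β] {l : Filter α}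
    [l.IsCountablyGenerated] [l.NeBot] {f : α → β}
    (h : ∀ u : ℕ → α, Tendsto u atTop l → ∃ L, Tendsto (f ∘ u) atTop (𝓝 L)) :
    ∃ L, Tendsto f l (𝓝 L) := by
  obtain ⟨u, hu⟩ := exists_seq_tendsto l
  obtain ⟨L, hL⟩ := h u hu
  refine ⟨L, tendsto_of_seq_tendsto fun v hv => ?_⟩
  have hd : Tendsto (fun n : ℕ => n / 2) atTop atTop := Nat.tendsto_div_const_atTop (by norm_num)
  obtain ⟨L', hL'⟩ := h (fun n => if Even n then u (n / 2) else v (n / 2)) (by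
    refine Tendsto.if' (hu.comp hd) (hv.comp hd))
  have h1 := hL'.comp (tendsto_id.const_mul_atTop' (show 0 < 2 by norm_num))
  have h2 := hL'.comp (tendsto_atTop_mono (fun n => show n ≤ 2 * n + 1 by omega) tendsto_id)
  have e1 : L' = L := tendsto_nhds_unique h1 (hL.congr fun n => by simp)
  rw [← e1]
  refine h2.congr fun n => ?_
  have : ¬ Even (2 * n + 1) := by simp
  simp only [Function.comp, this, if_false]
  congr 2
  omega

/-- The series `F = ∑ ξ_j φ_j`, summed along the finite sets `s M`, converges surely on the open set
`U` to an analytic function. -/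
structure IsAnalyticSeries (τ ε : ℝ) (μ : Measure Ω) (ξ : J → Ω → ℝ) (φ : J → ℂ → ℂ)
    (s : ℕ → Finset J) (U : Set ℂ) (F : Ω → ℂ → ℂ) : Prop where
  normalized : IndepNormalized τ ε μ ξ
  tendsto_s : Tendsto s atTop atTop
  isOpen : IsOpen U
  tendsto : ∀ ω, ∀ w ∈ U,
    Tendsto (fun M => ∑ j ∈ s M, (ξ j ω : ℂ) * φ j w) atTop (𝓝 (F ω w))
  analytic : ∀ ω, AnalyticOnNhd ℂ (F ω) U

namespace IsAnalyticSeries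

variable {φ : J → ℂ → ℂ} {s : ℕ → Finset J} {U : Set ℂ} {F : Ω → ℂ → ℂ}
  (h : IsAnalyticSeries τ ε μ ξ φ s U F)

include h in
/-- The terms of a random analytic series are analytic: their difference quotients converge, since
those of the sum do. -/
lemma analytic_coeff [IsProbabilityMeasure μ] (j : J) : AnalyticOnNhd ℂ (φ j) U := by
  refine DifferentiableOn.analyticOnNhd (fun p hp => ?_) h.isOpen
  refine DifferentiableAt.differentiableWithinAt ?_
  suffices H : ∃ L, Tendsto (fun w => slope (φ j) p w) (𝓝[U \ {p}] p) (𝓝 L) by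
    obtain ⟨L, hL⟩ := H
    have e : 𝓝[U \ {p}] p = 𝓝[≠] p := by
      rw [Set.sdiff_eq, Set.inter_comm, nhdsWithin_inter_of_mem']
      exact mem_nhdsWithin_of_mem_nhds (h.isOpen.mem_nhds hp)
    rw [e] at hL
    exact (hasDerivAt_iff_tendsto_slope.2 hL).differentiableAt
  have hne : (𝓝[U \ {p}] p).NeBot := by
    have e : 𝓝[U \ {p}] p = 𝓝[≠] p := by
      rw [Set.sdiff_eq, Set.inter_comm, nhdsWithin_inter_of_mem']
      exact mem_nhdsWithin_of_mem_nhds (h.isOpen.mem_nhds hp)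
    rw [e]
    infer_instance
  refine exists_tendsto_of_seq fun u hu => ?_
  obtain ⟨N, hN⟩ := eventually_atTop.1 (hu.eventually self_mem_nhdsWithin)
  obtain ⟨L, hL⟩ := h.normalized.exists_tendsto_coeff h.tendsto_s
    (fun n i => slope (φ i) p (u (n + N))) (fun n ω => slope (F ω) p (u (n + N)))
    (fun n ω => by
      have h1 := (h.tendsto ω _ (hN (n + N) (by omega)).1).sub (h.tendsto ω p hp)
      refine (h1.const_mul ((u (n + N) - p)⁻¹)).congr fun M => ?_
      rw [← Finset.sum_sub_distrib, Finset.mul_sum]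
      refine Finset.sum_congr rfl fun i _ => ?_
      simp only [slope_def_field]
      ring)
    (fun ω => by
      have h1 := hasDerivAt_iff_tendsto_slope.1
        (h.analytic ω p hp).differentiableAt.hasDerivAt
      refine ⟨_, h1.comp ?_⟩
      have h2 := hu.comp (tendsto_add_atTop_nat N)
      exact tendsto_nhdsWithin_mono_right (fun w hw => hw.2) h2) j
  exact ⟨L, (tendsto_add_atTop_iff_nat N).1 hL⟩

include h in
lemma measurable_indicator [IsProbabilityMeasure μ] :
    Measurable fun p : Ω × ℂ => U.indicator (F p.1) p.2 := by
  refine measurable_of_tendsto_metrizable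
    (f := fun M (p : Ω × ℂ) => ∑ j ∈ s M, (ξ j p.1 : ℂ) * U.indicator (φ j) p.2) (fun M => ?_)
    (tendsto_pi_nhds.2 fun p => ?_)
  · refine Finset.measurable_sum _ fun j _ => Measurable.mul ?_ ?_
    · exact Complex.measurable_ofReal.comp ((h.normalized.measurable j).comp measurable_fst)
    · have hc : ContinuousOn (φ j) U := (h.analytic_coeff j).continuousOn
      have h1 : Measurable (U.indicator (φ j)) := by
        classical
        rw [← Set.piecewise_eq_indicator]
        exact hc.measurable_piecewise continuousOn_const h.isOpen.measurableSet
      exact h1.comp measurable_snd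
  · by_cases hp : p.2 ∈ U
    · simp only [Set.indicator_of_mem hp]
      exact h.tendsto _ _ hp
    · simp only [Set.indicator_of_notMem hp, mul_zero, Finset.sum_const_zero]
      exact tendsto_const_nhds

include h in
lemma measurable_apply [IsProbabilityMeasure μ] {w : ℂ} (hw : w ∈ U) :
    Measurable fun ω => F ω w := by
  have := h.measurable_indicator.comp (measurable_prodMk_right (y := w))
  simpa [Function.comp_def, hw] using this

end IsAnalyticSeries

end RandomSeries

/-! ### Repulsion of the non-real roots from the real axis -/

section SecondDifference

open Metric Real

lemma norm_sub_sub_deriv_le {p : ℂ → ℂ} {s : Set ℂ} (hs : Convex ℝ s) (ho : IsOpen s)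
    (hp : DifferentiableOn ℂ p s) {B : ℝ} (hB : ∀ w ∈ s, ‖deriv (deriv p) w‖ ≤ B) {a w : ℂ}
    (ha : a ∈ s) (hw : w ∈ s) : ‖p w - p a - deriv p a * (w - a)‖ ≤ B * ‖w - a‖ ^ 2 := by
  have hp' : DifferentiableOn ℂ (deriv p) s := hp.deriv ho
  have hB0 : 0 ≤ B := (norm_nonneg _).trans (hB a ha)
  have h1 : ∀ u ∈ s, ‖deriv p u - deriv p a‖ ≤ B * ‖u - a‖ := fun u hu =>
    hs.norm_image_sub_le_of_norm_deriv_le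
      (fun v hv => (hp' v hv).differentiableAt (ho.mem_nhds hv)) hB ha hu
  -- the mean value inequality on the part of `s` that is no farther from `a` than `w`
  have hsub : Convex ℝ (s ∩ closedBall a ‖w - a‖) := hs.inter (convex_closedBall _ _)
  have h2 := hsub.norm_image_sub_le_of_norm_hasDerivWithin_le (f := fun u => p u - deriv p a * u)
    (f' := fun u => deriv p u - deriv p a) (C := B * ‖w - a‖) (x := a) (y := w)
    (fun u hu => by
      have h3 := ((hp u hu.1).differentiableAt (ho.mem_nhds hu.1)).hasDerivAt
      have h4 := (h3.sub ((hasDerivAt_id u).const_mul (deriv p a))).hasDerivWithinAt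
        (s := s ∩ closedBall a ‖w - a‖)
      rw [mul_one] at h4
      exact h4)
    (fun u hu => (h1 u hu.1).trans (by
      have := hu.2
      rw [mem_closedBall, dist_eq_norm] at this
      gcongr))
    ⟨ha, mem_closedBall_self (norm_nonneg _)⟩ ⟨hw, by rw [mem_closedBall, dist_eq_norm]⟩
  calc _ = ‖p w - deriv p a * w - (p a - deriv p a * a)‖ := by congr 1; ring
    _ ≤ _ := h2
    _ = _ := by ring

/-- The value of `p` at a point `x` of the line through the midpoint `a` of two conjugate points is
determined, up to a quadratic error, by the values at these two points. -/
lemma norm_apply_sub_conj_le {p : ℂ → ℂ} {s : Set ℂ} (hs : Convex ℝ s) (ho : IsOpen s)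
    (hp : DifferentiableOn ℂ p s) {B : ℝ} (hB : ∀ w ∈ s, ‖deriv (deriv p) w‖ ≤ B) {a x h : ℂ}
    (ha : a ∈ s) (hx : x ∈ s) (h1 : a + h ∈ s) (h2 : a - h ∈ s) (h0 : h ≠ 0) {γ : ℝ}
    (hγ : ‖h‖ ≤ γ) (hxa : ‖x - a‖ ≤ γ) :
    ‖p x - ((p (a + h) + p (a - h)) / 2 + (x - a) * ((p (a + h) - p (a - h)) / (2 * h)))‖ ≤
      3 * B * γ ^ 2 := by
  have hB0 : 0 ≤ B := (norm_nonneg _).trans (hB a ha)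
  have hh : 0 < ‖h‖ := norm_pos_iff.2 h0
  have k1 := norm_sub_sub_deriv_le hs ho hp hB ha h1
  have k2 := norm_sub_sub_deriv_le hs ho hp hB ha h2
  have k3 := norm_sub_sub_deriv_le hs ho hp hB ha hx
  set d := deriv p a
  rw [add_sub_cancel_left] at k1
  rw [show a - h - a = -h by ring, norm_neg] at k2
  set r₁ := p (a + h) - p a - d * h
  set r₂ := p (a - h) - p a - d * -h
  set r₃ := p x - p a - d * (x - a)
  have e : p x - ((p (a + h) + p (a - h)) / 2 + (x - a) * ((p (a + h) - p (a - h)) / (2 * h))) =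
      r₃ - (r₁ + r₂) / 2 - (x - a) / h * ((r₁ - r₂) / 2) := by
    simp only [r₁, r₂, r₃]
    field_simp
    ring
  rw [e]
  have n1 : ‖(r₁ + r₂) / 2‖ ≤ B * ‖h‖ ^ 2 := by
    rw [norm_div, Complex.norm_two]
    linarith [norm_add_le r₁ r₂]
  have n2 : ‖(r₁ - r₂) / 2‖ ≤ B * ‖h‖ ^ 2 := by
    rw [norm_div, Complex.norm_two]
    linarith [norm_sub_le r₁ r₂]
  have n3 : ‖(x - a) / h * ((r₁ - r₂) / 2)‖ ≤ B * (γ * γ) := by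
    rw [norm_mul, norm_div]
    calc ‖x - a‖ / ‖h‖ * ‖(r₁ - r₂) / 2‖ ≤ ‖x - a‖ / ‖h‖ * (B * ‖h‖ ^ 2) := by gcongr
      _ = B * (‖x - a‖ * ‖h‖) := by field_simp
      _ ≤ _ := by gcongr; exact (norm_nonneg _).trans hγ
  have n4 : B * ‖h‖ ^ 2 ≤ B * γ ^ 2 := by gcongr
  have n5 : B * ‖x - a‖ ^ 2 ≤ B * γ ^ 2 := by gcongr
  refine (norm_sub_le _ _).trans ((add_le_add_left (norm_sub_le _ _) _).trans ?_)
  nlinarith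

/-- The square of an analytic function is controlled by its mean square on a circle. -/
lemma sq_enorm_le_lintegral_circleMap {g : ℂ → ℂ} {x w : ℂ} (hg : DifferentiableOn ℂ g (ball x 1))
    (hw : w ∈ ball x (1 / 4)) :
    ‖g w‖ₑ ^ 2 ≤ ENNReal.ofReal π⁻¹ *
      ∫⁻ θ in Set.Ioc 0 (2 * π), ‖g (circleMap x (1 / 2) θ)‖ₑ ^ 2 := by
  have hd : DiffContOnCl ℂ (fun u => g u ^ 2) (ball x (1 / 2)) := by
    refine DifferentiableOn.diffContOnCl_ball (U := ball x 1) (hg.pow 2) ?_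
    exact closedBall_subset_ball (by norm_num)
  have hc := hd.two_pi_i_inv_smul_circleIntegral_sub_inv_smul
    (ball_subset_ball (by norm_num) hw)
  rw [← enorm_pow, ← hc, circleIntegral, intervalIntegral.integral_of_le (by positivity),
    enorm_smul]
  have e1 : ‖(2 * π * Complex.I : ℂ)⁻¹‖ₑ = ENNReal.ofReal (2 * π)⁻¹ := by
    rw [← ofReal_norm]
    congr 1
    rw [norm_inv, norm_mul, norm_mul, Complex.norm_I, Complex.norm_two, Complex.norm_real,
      norm_of_nonneg pi_pos.le, mul_one]
  have e2 : ENNReal.ofReal π⁻¹ = ENNReal.ofReal (2 * π)⁻¹ * 2 := by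
    rw [← ENNReal.ofReal_ofNat, ← ENNReal.ofReal_mul (by positivity)]
    congr 1
    field_simp
  rw [e1, e2, mul_assoc]
  gcongr
  refine (enorm_integral_le_lintegral_enorm _).trans ?_
  rw [← lintegral_const_mul' _ _ (by norm_num)]
  refine lintegral_mono fun θ => ?_
  simp only
  rw [enorm_smul, enorm_smul, ← mul_assoc, enorm_pow]
  gcongr
  rw [← enorm_mul, ← ofReal_norm, ← ENNReal.ofReal_ofNat]
  refine ENNReal.ofReal_le_ofReal ?_
  have h1 : ‖circleMap x (1 / 2) θ - x‖ = 1 / 2 := by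
    rw [circleMap_sub_center, norm_circleMap_zero]; norm_num
  rw [mem_ball, dist_eq_norm] at hw
  have h2 : 1 / 4 ≤ ‖circleMap x (1 / 2) θ - w‖ := by
    have := norm_sub_norm_le (circleMap x (1 / 2) θ - x) (w - x)
    rw [sub_sub_sub_cancel_right] at this
    linarith
  rw [norm_mul, norm_inv, deriv_circleMap, norm_mul, norm_circleMap_zero, Complex.norm_I, mul_one,
    ← div_eq_mul_inv, div_le_iff₀ (by linarith), abs_of_pos (by norm_num)]
  linarith

/-- An analytic function which is real on the real axis vanishes at `conj w` if it vanishes at `w`.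
-/
lemma apply_conj_eq_zero {f : ℂ → ℂ} {x r : ℝ} (hr : 0 < r)
    (hf : AnalyticOnNhd ℂ f (ball (x : ℂ) r))
    (hreal : ∀ t : ℝ, (t : ℂ) ∈ ball (x : ℂ) r → (f t).im = 0) {w : ℂ} (hw : w ∈ ball (x : ℂ) r)
    (h0 : f w = 0) : f (starRingEnd ℂ w) = 0 := by
  have hconj : ∀ u ∈ ball (x : ℂ) r, starRingEnd ℂ u ∈ ball (x : ℂ) r := by
    intro u hu
    rw [mem_ball] at hu ⊢
    rwa [← Complex.conj_ofReal x, Complex.dist_conj_conj]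
  have hg : AnalyticOnNhd ℂ (starRingEnd ℂ ∘ f ∘ starRingEnd ℂ) (ball (x : ℂ) r) := by
    refine DifferentiableOn.analyticOnNhd (fun u hu => ?_) isOpen_ball
    exact (differentiableAt_conj_conj_iff.2
      (hf _ (hconj u hu)).differentiableAt).differentiableWithinAt
  have hx : (x : ℂ) ∈ ball (x : ℂ) r := mem_ball_self hr
  have hfr : ∃ᶠ z in 𝓝[≠] (x : ℂ), f z = (starRingEnd ℂ ∘ f ∘ starRingEnd ℂ) z := by
    have ht : Tendsto (fun t : ℝ => (t : ℂ)) (𝓝[≠] x) (𝓝[≠] (x : ℂ)) :=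
      tendsto_nhdsWithin_of_tendsto_nhds_of_eventually_within _
        ((Complex.continuous_ofReal.tendsto x).mono_left nhdsWithin_le_nhds)
        (eventually_mem_nhdsWithin.mono fun t ht => by simpa using ht)
    refine ht.frequently (Eventually.frequently ?_)
    have hb : ∀ᶠ t : ℝ in 𝓝[≠] x, (t : ℂ) ∈ ball (x : ℂ) r :=
      nhdsWithin_le_nhds (Complex.continuous_ofReal.continuousAt.eventually
        (isOpen_ball.mem_nhds hx))
    filter_upwards [hb] with t ht
    simp only [Function.comp, Complex.conj_ofReal]
    exact (Complex.conj_eq_iff_im.2 (hreal t ht)).symm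
  have heq := hf.eqOn_of_preconnected_of_frequently_eq hg
    (convex_ball _ _).isPreconnected hx hfr
  rw [heq (hconj w hw)]
  simp [h0]

end SecondDifference

section SecondMoment

open Real

variable {J Ω : Type*} [MeasurableSpace Ω] {μ : Measure Ω} {ξ : J → Ω → ℝ} {τ ε : ℝ}

lemma IndepNormalized.memLp (h : IndepNormalized τ ε μ ξ) (hε : 0 < ε) (j : J) :
    MemLp (ξ j) 2 μ :=
  (memLp_map_measure_iff (g := id) measurable_id.aestronglyMeasurable
    (h.measurable j).aemeasurable).1 (by
      have := (h.law j).isProb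
      refine (h.law j).memLp.mono_exponent ?_
      rw [← ENNReal.ofReal_ofNat]
      exact ENNReal.ofReal_le_ofReal (by linarith))

lemma IndepNormalized.integral_eq (h : IndepNormalized τ ε μ ξ) (j : J) :
    ∫ x, x ∂(μ.map (ξ j)) = ∫ ω, ξ j ω ∂μ :=
  integral_map (h.measurable j).aemeasurable measurable_id.aestronglyMeasurable

lemma IndepNormalized.variance_eq (h : IndepNormalized τ ε μ ξ) (j : J) :
    Var[ξ j; μ] = 1 := by
  rw [variance_eq_integral (h.measurable j).aemeasurable, ← h.integral_eq, ← (h.law j).variance]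
  exact (integral_map (f := fun x => (x - ∫ y, y ∂(μ.map (ξ j))) ^ 2)
    (h.measurable j).aemeasurable (by fun_prop)).symm

variable [IsProbabilityMeasure μ]

lemma IndepNormalized.integral_sq_sum (h : IndepNormalized τ ε μ ξ) (hε : 0 < ε) (t : Finset J)
    (b : J → ℝ) : ∫ ω, (∑ j ∈ t, ξ j ω * b j) ^ 2 ∂μ =
      (∑ j ∈ t, (∫ ω, ξ j ω ∂μ) * b j) ^ 2 + ∑ j ∈ t, b j ^ 2 := by
  have hL : ∀ j, MemLp (fun ω => ξ j ω * b j) 2 μ := fun j => (h.memLp hε j).mul_const _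
  have hS : MemLp (∑ j ∈ t, fun ω => ξ j ω * b j) 2 μ := memLp_finsetSum' _ fun j _ => hL j
  have hv : Var[∑ j ∈ t, fun ω => ξ j ω * b j; μ] = ∑ j ∈ t, b j ^ 2 := by
    rw [IndepFun.variance_sum (fun j _ => hL j)]
    · refine Finset.sum_congr rfl fun j _ => ?_
      have : (fun ω => ξ j ω * b j) = fun ω => b j * ξ j ω := by ext; ring
      rw [this, variance_const_mul, h.variance_eq, mul_one]
    · intro i _ j _ hij
      exact (h.indep.indepFun hij).comp (φ := fun x => x * b i) (ψ := fun x => x * b j)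
        (by fun_prop) (by fun_prop)
  rw [variance_eq_sub hS] at hv
  have hE : ∫ ω, (∑ j ∈ t, fun ω => ξ j ω * b j) ω ∂μ = ∑ j ∈ t, (∫ ω, ξ j ω ∂μ) * b j := by
    simp only [Finset.sum_apply]
    rw [integral_finsetSum _ fun j _ => (hL j).integrable (by norm_num)]
    simp [integral_mul_const]
  rw [hE] at hv
  have : ∫ ω, (∑ j ∈ t, ξ j ω * b j) ^ 2 ∂μ = ∫ ω, ((∑ j ∈ t, fun ω => ξ j ω * b j) ^ 2) ω ∂μ := by
    simp
  rw [this]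
  linarith

lemma IndepNormalized.lintegral_sq_enorm_sum_le (h : IndepNormalized τ ε μ ξ) (hε : 0 < ε)
    (t : Finset J) (b : J → ℂ) {B : J → ℝ} (hb : ∀ j ∈ t, ‖b j‖ ≤ B j) :
    ∫⁻ ω, ‖∑ j ∈ t, (ξ j ω : ℂ) * b j‖ₑ ^ 2 ∂μ ≤
      ENNReal.ofReal ((∑ j ∈ t, |∫ ω, ξ j ω ∂μ| * B j) ^ 2 + ∑ j ∈ t, B j ^ 2) := by
  have hre : ∀ ω, (∑ j ∈ t, (ξ j ω : ℂ) * b j).re = ∑ j ∈ t, ξ j ω * (b j).re := fun ω => by simp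
  have him : ∀ ω, (∑ j ∈ t, (ξ j ω : ℂ) * b j).im = ∑ j ∈ t, ξ j ω * (b j).im := fun ω => by simp
  have hsq : ∀ ω, ‖∑ j ∈ t, (ξ j ω : ℂ) * b j‖ ^ 2 =
      (∑ j ∈ t, ξ j ω * (b j).re) ^ 2 + (∑ j ∈ t, ξ j ω * (b j).im) ^ 2 := fun ω => by
    rw [← Complex.normSq_eq_norm_sq, Complex.normSq_apply, hre, him]; ring
  have hi : ∀ c : J → ℝ, Integrable (fun ω => (∑ j ∈ t, ξ j ω * c j) ^ 2) μ := fun c =>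
    (memLp_finsetSum _ fun j _ => (h.memLp hε j).mul_const _).integrable_sq
  have e : ∀ ω, ‖∑ j ∈ t, (ξ j ω : ℂ) * b j‖ₑ ^ 2 = ENNReal.ofReal
      ((∑ j ∈ t, ξ j ω * (b j).re) ^ 2 + (∑ j ∈ t, ξ j ω * (b j).im) ^ 2) := fun ω => by
    rw [← hsq, ENNReal.ofReal_pow (norm_nonneg _), ofReal_norm]
  simp only [e]
  have hii : Integrable (fun ω => (∑ j ∈ t, ξ j ω * (b j).re) ^ 2 +
    (∑ j ∈ t, ξ j ω * (b j).im) ^ 2) μ := (hi _).add (hi _)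
  rw [← ofReal_integral_eq_lintegral_ofReal hii (ae_of_all _ fun ω => by positivity),
    integral_add (hi _) (hi _), h.integral_sq_sum hε, h.integral_sq_sum hε]
  refine ENNReal.ofReal_le_ofReal ?_
  have h1 : (∑ j ∈ t, (∫ ω, ξ j ω ∂μ) * (b j).re) ^ 2 + (∑ j ∈ t, (∫ ω, ξ j ω ∂μ) * (b j).im) ^ 2 =
      ‖∑ j ∈ t, ((∫ ω, ξ j ω ∂μ : ℝ) : ℂ) * b j‖ ^ 2 := by
    rw [← Complex.normSq_eq_norm_sq, Complex.normSq_apply]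
    simp
    ring
  have h2 : ‖∑ j ∈ t, ((∫ ω, ξ j ω ∂μ : ℝ) : ℂ) * b j‖ ≤ ∑ j ∈ t, |∫ ω, ξ j ω ∂μ| * B j := by
    refine norm_sum_le_of_le _ fun j hj => ?_
    rw [norm_mul, Complex.norm_real, norm_eq_abs]
    exact mul_le_mul_of_nonneg_left (hb j hj) (abs_nonneg _)
  have h3 : ∑ j ∈ t, ((b j).re ^ 2 + (b j).im ^ 2) ≤ ∑ j ∈ t, B j ^ 2 := by
    refine Finset.sum_le_sum fun j hj => ?_
    have := pow_le_pow_left₀ (norm_nonneg _) (hb j hj) 2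
    rw [← Complex.normSq_eq_norm_sq, Complex.normSq_apply] at this
    linarith
  rw [Finset.sum_add_distrib] at h3
  have h4 := pow_le_pow_left₀ (norm_nonneg _) h2 2
  linarith

end SecondMoment

section Repulsion

open Metric Real

variable {J Ω : Type*} [MeasurableSpace Ω]

/-- The quantitative conditions, with constants `K` and `η`, on the coefficient functions near a
point `x` of the real axis: no term dominates the quadratic mean of the series at `x`, and the
derivatives of the terms are controlled by this quadratic mean. -/
structure GrowthAt (μ : Measure Ω) (ξ : J → Ω → ℝ) (φ : J → ℂ → ℂ) (K η x : ℝ) : Prop where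
  summable : Summable fun j => ‖φ j x‖ ^ 2
  norm_le : ∀ j, ‖φ j x‖ ≤ η * √(∑' i, ‖φ i x‖ ^ 2)
  deriv_le : ∀ j, ‖deriv (φ j) x‖ ^ 2 ≤ K * ∑' i, ‖φ i x‖ ^ 2
  exists_bound : ∃ B : J → ℝ, (∀ j, ∀ w ∈ ball (x : ℂ) 1, ‖deriv (deriv (φ j)) w‖ ≤ B j) ∧
    ∀ t : Finset J, ∑ j ∈ t, B j ^ 2 ≤ K * ∑' i, ‖φ i x‖ ^ 2 ∧
      ∑ j ∈ t, |∫ ω, ξ j ω ∂μ| * B j ≤ K * √(∑' i, ‖φ i x‖ ^ 2)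

variable {μ : Measure Ω} {ξ : J → Ω → ℝ} {τ ε : ℝ} {φ : J → ℂ → ℂ} {s : ℕ → Finset J}
  {U : Set ℂ} {F : Ω → ℂ → ℂ} {K η x : ℝ}

lemma deriv_deriv_sum {t : Finset J} {c : J → ℂ} {D : Set ℂ} (hD : IsOpen D)
    (hφ : ∀ j, AnalyticOnNhd ℂ (φ j) D) {w : ℂ} (hw : w ∈ D) :
    deriv (deriv fun w => ∑ j ∈ t, c j * φ j w) w = ∑ j ∈ t, c j * deriv (deriv (φ j)) w := by
  have h1 : ∀ u ∈ D, deriv (fun w => ∑ j ∈ t, c j * φ j w) u = ∑ j ∈ t, c j * deriv (φ j) u := by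
    intro u hu
    exact (HasDerivAt.fun_sum fun j _ =>
      ((hφ j u hu).differentiableAt.hasDerivAt).const_mul (c j)).deriv
  have h2 : deriv (fun w => ∑ j ∈ t, c j * φ j w) =ᶠ[𝓝 w] fun u => ∑ j ∈ t, c j * deriv (φ j) u :=
    eventually_of_mem (hD.mem_nhds hw) h1
  rw [h2.deriv_eq]
  exact (HasDerivAt.fun_sum fun j _ =>
    (((hφ j).deriv w hw).differentiableAt.hasDerivAt).const_mul (c j)).deriv

/-- If the quadratic mean of the series vanishes at `x`, then so does the series near `x`, and it
has no roots there. -/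
lemma GrowthAt.isEmpty_root (hg : GrowthAt μ ξ φ K η x) (h : IsAnalyticSeries τ ε μ ξ φ s U F)
    [IsProbabilityMeasure μ] (hx : ball (x : ℂ) 1 ⊆ U) (hV : ∑' i, ‖φ i x‖ ^ 2 = 0) (ω : Ω)
    (r : Root (F ω)) : r.loc ∉ ball (x : ℂ) 1 := by
  intro hr
  obtain ⟨B, hB, hsum⟩ := hg.exists_bound
  have hφ : ∀ j, ∀ w ∈ ball (x : ℂ) 1, φ j w = 0 := by
    intro j w hw
    have h0 : φ j x = 0 := by
      have := hg.norm_le j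
      rw [hV, sqrt_zero, mul_zero] at this
      exact norm_le_zero_iff.1 this
    have h1 : deriv (φ j) x = 0 := by
      have := hg.deriv_le j
      rw [hV, mul_zero] at this
      exact norm_eq_zero.1 (pow_eq_zero_iff (by norm_num) |>.1
        (le_antisymm this (by positivity)))
    have h2 : B j = 0 := by
      have := (hsum {j}).1
      rw [hV, mul_zero, Finset.sum_singleton] at this
      exact pow_eq_zero_iff (by norm_num) |>.1 (le_antisymm this (by positivity))
    have := norm_sub_sub_deriv_le (convex_ball (x : ℂ) 1) isOpen_ball
      ((h.analytic_coeff j).mono hx).differentiableOn (hB j)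
      (mem_ball_self one_pos) hw
    rw [h0, h1, h2] at this
    simpa using this
  have hF : ∀ w ∈ ball (x : ℂ) 1, F ω w = 0 := by
    intro w hw
    refine tendsto_nhds_unique (h.tendsto ω w (hx hw)) ?_
    simp [hφ _ w hw]
  have : analyticOrderNatAt (F ω) r.loc = 0 := by
    rw [analyticOrderNatAt, analyticOrderAt_eq_top.2]
    · rfl
    · exact eventually_of_mem (isOpen_ball.mem_nhds hr) hF
  have h2 := r.2.2
  have h3 : analyticOrderNatAt (F ω) r.fst = 0 := this
  omega

variable [IsProbabilityMeasure μ]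

/-- The probability that there is a non-real root within about `γ` of the real point `x`. Such a
root and its conjugate force the series to be of order `γ²` at `x`, apart from the unlikely event
that the second derivative is large. -/
lemma GrowthAt.measure_root_near_le (hg : GrowthAt μ ξ φ K η x)
    (h : IsAnalyticSeries τ ε μ ξ φ s U F) (hτ : 0 < τ) (hε₀ : 0 < ε) (hε₁ : ε < 1)
    (hreal : ∀ j, ∀ t : ℝ, (φ j t).im = 0) (hx : ball (x : ℂ) 1 ⊆ U) (hK : 1 ≤ K) (hη : 0 < η)
    {γ L : ℝ} (hγ : 0 < γ) (hγ' : γ ≤ 1 / 16) (hL : 0 < L) :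
    μ {ω | ∃ r : Root (F ω), r.loc.im ≠ 0 ∧ |r.loc.im| ≤ γ ∧ |r.loc.re - x| ≤ γ} ≤
      ENNReal.ofReal (4 * K ^ 2 / L ^ 2 +
        (36 * γ ^ 2 * L + (η / (charFunRadius τ ε * (3 * γ ^ 2 * L))) ^ 2)) := by
  set V := ∑' i, ‖φ i x‖ ^ 2 with hVdef
  have hV0 : 0 ≤ V := tsum_nonneg fun i => by positivity
  have hmem : ∀ ζ : ℂ, |ζ.im| ≤ γ → |ζ.re - x| ≤ γ → ζ ∈ ball (x : ℂ) (1 / 4) := by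
    intro ζ h1 h2
    rw [mem_ball, dist_eq_norm]
    refine (Complex.norm_le_abs_re_add_abs_im _).trans_lt ?_
    simp only [Complex.sub_re, Complex.sub_im, Complex.ofReal_re, Complex.ofReal_im, sub_zero]
    linarith
  have hsub14 : ball (x : ℂ) (1 / 4) ⊆ ball (x : ℂ) 1 := ball_subset_ball (by norm_num)
  rcases hV0.eq_or_lt with hV | hV
  · have : {ω | ∃ r : Root (F ω), r.loc.im ≠ 0 ∧ |r.loc.im| ≤ γ ∧ |r.loc.re - x| ≤ γ} = ∅ := by
      refine Set.eq_empty_of_forall_notMem fun ω ⟨r, _, h1, h2⟩ => ?_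
      exact hg.isEmpty_root h hx hV.symm ω r (hsub14 (hmem _ h1 h2))
    rw [this]
    simp
  obtain ⟨B, hB, hsum⟩ := hg.exists_bound
  have hφan : ∀ j, AnalyticOnNhd ℂ (φ j) (ball (x : ℂ) 1) := fun j => (h.analytic_coeff j).mono hx
  have hcirc : ∀ θ, circleMap (x : ℂ) (1 / 2) θ ∈ ball (x : ℂ) 1 := fun θ => by
    rw [mem_ball, dist_eq_norm, circleMap_sub_center, norm_circleMap_zero]; norm_num
  -- the mean square of the second derivative of the partial sums on a circle around `x`
  set Y : ℕ → Ω → ℝ≥0∞ := fun M ω => ∫⁻ θ in Set.Ioc 0 (2 * π),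
    ‖∑ j ∈ s M, (ξ j ω : ℂ) * deriv (deriv (φ j)) (circleMap x (1 / 2) θ)‖ₑ ^ 2 with hY
  have hjm : ∀ M, Measurable fun p : Ω × ℝ =>
      ‖∑ j ∈ s M, (ξ j p.1 : ℂ) * deriv (deriv (φ j)) (circleMap x (1 / 2) p.2)‖ₑ ^ 2 := by
    intro M
    refine Measurable.pow_const (Measurable.enorm (Finset.measurable_sum _ fun j _ =>
      Measurable.mul ?_ ?_)) _
    · exact Complex.measurable_ofReal.comp ((h.normalized.measurable j).comp measurable_fst)
    · have h1 : Continuous fun θ => deriv (deriv (φ j)) (circleMap x (1 / 2) θ) :=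
        (hφan j).deriv.deriv.continuousOn.comp_continuous (continuous_circleMap _ _) hcirc
      exact h1.measurable.comp measurable_snd
  have hYm : ∀ M, Measurable (Y M) := fun M => (hjm M).lintegral_prod_right'
  have hYint : ∀ M, ∫⁻ ω, Y M ω ∂μ ≤ ENNReal.ofReal (4 * π * K ^ 2 * V) := by
    intro M
    rw [lintegral_lintegral_swap (hjm M).aemeasurable]
    calc _ ≤ ∫⁻ _θ in Set.Ioc 0 (2 * π), ENNReal.ofReal (2 * K ^ 2 * V) := by
          refine lintegral_mono fun θ => ?_
          refine (h.normalized.lintegral_sq_enorm_sum_le hε₀ (s M) _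
            fun j _ => hB j _ (hcirc θ)).trans (ENNReal.ofReal_le_ofReal ?_)
          have hB0 : ∀ j, 0 ≤ B j := fun j =>
            (norm_nonneg _).trans (hB j x (mem_ball_self one_pos))
          have k1 : 0 ≤ ∑ j ∈ s M, |∫ ω, ξ j ω ∂μ| * B j :=
            Finset.sum_nonneg fun j _ => mul_nonneg (abs_nonneg _) (hB0 j)
          have k2 := pow_le_pow_left₀ k1 (hsum (s M)).2 2
          rw [mul_pow, sq_sqrt hV0] at k2
          have k3 : K * V ≤ K ^ 2 * V := by
            gcongr
            nlinarith
          linarith [(hsum (s M)).1]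
      _ = ENNReal.ofReal (4 * π * K ^ 2 * V) := by
          rw [lintegral_const, Measure.restrict_apply MeasurableSet.univ, Set.univ_inter,
            Real.volume_Ioc, sub_zero, ← ENNReal.ofReal_mul (by positivity)]
          congr 1
          ring
  have hliminf : ∫⁻ ω, liminf (fun M => Y M ω) atTop ∂μ ≤ ENNReal.ofReal (4 * π * K ^ 2 * V) := by
    refine (lintegral_liminf_le hYm).trans ?_
    exact (liminf_le_liminf (Eventually.of_forall hYint)).trans (by simp)
  set E₁ : Set Ω := {ω | ENNReal.ofReal (π * L ^ 2 * V) ≤ liminf (fun M => Y M ω) atTop} with hE₁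
  set E₂ : Set Ω := {ω | ‖F ω x‖ ≤ 3 * γ ^ 2 * L * √V} with hE₂
  have hE₁m : μ E₁ ≤ ENNReal.ofReal (4 * K ^ 2 / L ^ 2) := by
    have hpos : 0 < π * L ^ 2 * V := by positivity
    refine (meas_ge_le_lintegral_div (Measurable.liminf hYm).aemeasurable
      (ENNReal.ofReal_pos.2 hpos).ne' ENNReal.ofReal_ne_top).trans ?_
    rw [ENNReal.div_le_iff (ENNReal.ofReal_pos.2 hpos).ne' ENNReal.ofReal_ne_top,
      ← ENNReal.ofReal_mul (by positivity)]
    refine hliminf.trans (ENNReal.ofReal_le_ofReal (le_of_eq ?_))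
    field_simp
  have hE₂m : μ E₂ ≤ ENNReal.ofReal (36 * γ ^ 2 * L +
      (η / (charFunRadius τ ε * (3 * γ ^ 2 * L))) ^ 2) := by
    rw [← ofReal_measureReal]
    refine ENNReal.ofReal_le_ofReal ?_
    have := h.normalized.measureReal_norm_le hτ hε₀ hε₁ h.tendsto_s (fun j => φ j x)
      (X := fun ω => F ω x) (fun ω => h.tendsto ω x (hx (mem_ball_self one_pos))) hg.summable
      hVdef hV hη (show 0 < 3 * γ ^ 2 * L by positivity) hg.norm_le
    linarith
  rw [ENNReal.ofReal_add (by positivity) (by positivity)]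
  refine (measure_mono ?_).trans ((measure_union_le E₁ E₂).trans (add_le_add hE₁m hE₂m))
  rintro ω ⟨r, him, hr1, hr2⟩
  by_cases hω : ω ∈ E₁
  · exact Or.inl hω
  right
  have hfr : ∃ᶠ M in atTop, Y M ω < ENNReal.ofReal (π * L ^ 2 * V) :=
    frequently_lt_of_liminf_lt (by isBoundedDefault) (not_le.1 hω)
  set ζ := r.loc with hζ
  have hζ14 := hmem ζ hr1 hr2
  have hFζ : F ω ζ = 0 := r.apply_loc_eq_zero
  have hFreal : ∀ t : ℝ, (t : ℂ) ∈ ball (x : ℂ) 1 → (F ω t).im = 0 := by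
    intro t ht
    refine tendsto_nhds_unique ((Complex.continuous_im.tendsto _).comp (h.tendsto ω t (hx ht))) ?_
    have : (Complex.im ∘ fun M => ∑ j ∈ s M, (ξ j ω : ℂ) * φ j t) = fun _ => 0 := by
      ext M
      simp [hreal]
    rw [this]
    exact tendsto_const_nhds
  have hFζ' : F ω (starRingEnd ℂ ζ) = 0 :=
    apply_conj_eq_zero one_pos ((h.analytic ω).mono hx) hFreal (hsub14 hζ14) hFζ
  have hζ14' := hmem (starRingEnd ℂ ζ) (by simpa using hr1) (by simpa using hr2)
  have hre14 : (ζ.re : ℂ) ∈ ball (x : ℂ) (1 / 4) :=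
    hmem _ (by simpa using hγ.le) (by simpa using hr2)
  have hx14 : (x : ℂ) ∈ ball (x : ℂ) (1 / 4) := mem_ball_self (by norm_num)
  set p : ℕ → ℂ → ℂ := fun M w => ∑ j ∈ s M, (ξ j ω : ℂ) * φ j w with hp
  have hpan : ∀ M, AnalyticOnNhd ℂ (p M) (ball (x : ℂ) 1) := fun M w hw =>
    Finset.analyticAt_fun_sum _ fun j _ => analyticAt_const.mul (hφan j w hw)
  set i₀ : ℂ := ζ.im * Complex.I with hi₀
  have e1 : (ζ.re : ℂ) + i₀ = ζ := Complex.re_add_im ζ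
  have e2 : (ζ.re : ℂ) - i₀ = starRingEnd ℂ ζ := by
    apply Complex.ext <;> simp [hi₀]
  have hlim : Tendsto (fun M => ‖p M x - ((p M ζ + p M (starRingEnd ℂ ζ)) / 2 + ((x : ℂ) - ζ.re) *
      ((p M ζ - p M (starRingEnd ℂ ζ)) / (2 * i₀)))‖) atTop (𝓝 ‖F ω x‖) := by
    have t1 := h.tendsto ω x (hx (hsub14 hx14))
    have t2 := h.tendsto ω ζ (hx (hsub14 hζ14))
    have t3 := h.tendsto ω _ (hx (hsub14 hζ14'))
    rw [hFζ] at t2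
    rw [hFζ'] at t3
    have t4 := (t1.sub (((t2.add t3).div_const 2).add (((t2.sub t3).div_const
      (2 * i₀)).const_mul ((x : ℂ) - ζ.re)))).norm
    simpa using t4
  refine le_of_tendsto_of_frequently hlim (hfr.mono fun M hM => ?_)
  have hbound : ∀ w ∈ ball (x : ℂ) (1 / 4), ‖deriv (deriv (p M)) w‖ ≤ L * √V := by
    intro w hw
    have k1 := sq_enorm_le_lintegral_circleMap
      (fun u hu => ((hpan M).deriv.deriv u hu).differentiableAt.differentiableWithinAt) hw
    have k2 : ∀ θ, deriv (deriv (p M)) (circleMap x (1 / 2) θ) =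
        ∑ j ∈ s M, (ξ j ω : ℂ) * deriv (deriv (φ j)) (circleMap x (1 / 2) θ) := fun θ =>
      deriv_deriv_sum isOpen_ball hφan (hcirc θ)
    simp only [k2] at k1
    have k3 : ‖deriv (deriv (p M)) w‖ₑ ^ 2 ≤ ENNReal.ofReal ((L * √V) ^ 2) := by
      refine k1.trans ((mul_le_mul_right hM.le _).trans ?_)
      rw [← ENNReal.ofReal_mul (by positivity), mul_pow, sq_sqrt hV0]
      refine ENNReal.ofReal_le_ofReal (le_of_eq ?_)
      field_simp
    rw [← ofReal_norm, ← ENNReal.ofReal_pow (norm_nonneg _),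
      ENNReal.ofReal_le_ofReal_iff (by positivity)] at k3
    exact (abs_le_of_sq_le_sq' k3 (by positivity)).2
  have key := norm_apply_sub_conj_le (convex_ball (x : ℂ) (1 / 4)) isOpen_ball
    (((hpan M).mono hsub14).differentiableOn) hbound (a := ζ.re) (x := x) (h := i₀) hre14 hx14
    (by rwa [e1]) (by rwa [e2]) (by simpa [hi₀] using him)
    (γ := γ) (by simpa [hi₀] using hr1) (by
      rw [← Complex.ofReal_sub, Complex.norm_real, norm_eq_abs, abs_sub_comm]; exact hr2)
  rw [e1, e2] at key
  refine key.trans (le_of_eq (by ring))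

/-- The probability that there is a non-real root near `z` at distance at most `γ` from the real
axis, by a union bound over a grid of spacing `γ`. -/
lemma measure_root_near_real_le {z : ℂ} (h : IsAnalyticSeries τ ε μ ξ φ s U F) (hz : ball z 2 ⊆ U)
    (hg : ∀ x : ℝ, (x : ℂ) ∈ ball z 1 → GrowthAt μ ξ φ K η x) (hτ : 0 < τ) (hε₀ : 0 < ε)
    (hε₁ : ε < 1) (hreal : ∀ j, ∀ t : ℝ, (φ j t).im = 0) (hK : 1 ≤ K) (hη : 0 < η)
    {γ L : ℝ} (hγ : 0 < γ) (hγ' : γ ≤ 1 / 16) (hL : 0 < L) :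
    μ {ω | ∃ r : Root (F ω), r.loc ∈ ball z (1 / 50) ∧ r.loc.im ≠ 0 ∧ |r.loc.im| ≤ γ} ≤
      ENNReal.ofReal (1 / γ * (4 * K ^ 2 / L ^ 2 +
        (36 * γ ^ 2 * L + (η / (charFunRadius τ ε * (3 * γ ^ 2 * L))) ^ 2))) := by
  set e := 4 * K ^ 2 / L ^ 2 +
    (36 * γ ^ 2 * L + (η / (charFunRadius τ ε * (3 * γ ^ 2 * L))) ^ 2) with he
  have he0 : 0 ≤ e := by positivity
  set N : ℕ := ⌊1 / (50 * γ) + 1 / 2⌋₊ with hN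
  have hN1 : (N : ℝ) ≤ 1 / (50 * γ) + 1 / 2 := Nat.floor_le (by positivity)
  set E : ℤ → Set Ω := fun i => {ω | z.re + i * γ ∈ {x : ℝ | (x : ℂ) ∈ ball z 1} ∧
    ∃ r : Root (F ω), r.loc.im ≠ 0 ∧ |r.loc.im| ≤ γ ∧ |r.loc.re - (z.re + i * γ)| ≤ γ} with hE
  have hEi : ∀ i, μ (E i) ≤ ENNReal.ofReal e := by
    intro i
    by_cases hi : ((z.re + i * γ : ℝ) : ℂ) ∈ ball z 1
    · refine (measure_mono fun ω hω => hω.2).trans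
        ((hg _ hi).measure_root_near_le h hτ hε₀ hε₁ hreal ?_ hK hη hγ hγ' hL)
      refine Set.Subset.trans (ball_subset_ball' ?_) hz
      rw [mem_ball] at hi
      linarith
    · have : E i = ∅ := Set.eq_empty_of_forall_notMem fun ω hω => hi hω.1
      rw [this, measure_empty]
      exact zero_le
  have hsub : {ω | ∃ r : Root (F ω), r.loc ∈ ball z (1 / 50) ∧ r.loc.im ≠ 0 ∧ |r.loc.im| ≤ γ} ⊆
      ⋃ i ∈ Finset.Icc (-N : ℤ) N, E i := by
    rintro ω ⟨r, hr, hr0, hr1⟩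
    rw [mem_ball, dist_eq_norm] at hr
    have hre : |r.loc.re - z.re| < 1 / 50 := (Complex.abs_re_le_norm (r.loc - z)).trans_lt hr
    set i : ℤ := round ((r.loc.re - z.re) / γ) with hi
    have h1 : |(r.loc.re - z.re) / γ - i| ≤ 1 / 2 := abs_sub_round _
    have h2 : |r.loc.re - (z.re + i * γ)| ≤ γ / 2 := by
      have : r.loc.re - (z.re + i * γ) = ((r.loc.re - z.re) / γ - i) * γ := by field_simp; ring
      rw [this, abs_mul, abs_of_pos hγ]
      nlinarith
    have h3 : |(i : ℝ)| ≤ 1 / (50 * γ) + 1 / 2 := by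
      have k1 : |(r.loc.re - z.re) / γ| ≤ 1 / (50 * γ) := by
        rw [abs_div, abs_of_pos hγ, div_le_div_iff₀ hγ (by positivity)]
        nlinarith
      rw [abs_le] at h1 k1 ⊢
      constructor <;> linarith [h1.1, h1.2, k1.1, k1.2]
    have h4 : |i| ≤ N := by
      have k2 : (i.natAbs : ℝ) ≤ 1 / (50 * γ) + 1 / 2 := by
        rw [Nat.cast_natAbs, Int.cast_abs]; exact h3
      rw [Int.abs_eq_natAbs]
      exact_mod_cast Nat.le_floor k2
    simp only [Set.mem_iUnion]
    refine ⟨i, Finset.mem_Icc.2 (abs_le.1 h4), ?_, r, hr0, hr1, h2.trans (by linarith)⟩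
    change ((z.re + i * γ : ℝ) : ℂ) ∈ ball z 1
    rw [mem_ball, dist_eq_norm]
    have k3 : ‖((z.re + i * γ : ℝ) : ℂ) - r.loc‖ ≤ γ / 2 + γ := by
      refine (Complex.norm_le_abs_re_add_abs_im _).trans ?_
      simp only [Complex.sub_re, Complex.sub_im, Complex.ofReal_re, Complex.ofReal_im, zero_sub,
        abs_neg]
      rw [abs_sub_comm] at h2
      linarith
    have k4 := norm_sub_le_norm_sub_add_norm_sub ((z.re + i * γ : ℝ) : ℂ) r.loc z
    linarith
  calc _ ≤ _ := measure_mono hsub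
    _ ≤ ∑ i ∈ Finset.Icc (-N : ℤ) N, μ (E i) := measure_biUnion_finset_le _ _
    _ ≤ ∑ _i ∈ Finset.Icc (-N : ℤ) N, ENNReal.ofReal e := Finset.sum_le_sum fun i _ => hEi i
    _ = ENNReal.ofReal ((2 * N + 1) * e) := by
        rw [Finset.sum_const, Int.card_Icc, nsmul_eq_mul, ENNReal.ofReal_mul (by positivity)]
        congr 1
        rw [show (N + 1 - -(N : ℤ)).toNat = 2 * N + 1 by omega,
          show (2 * N + 1 : ℝ) = ((2 * N + 1 : ℕ) : ℝ) by push_cast; ring, ENNReal.ofReal_natCast]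
    _ ≤ _ := by
        refine ENNReal.ofReal_le_ofReal ?_
        gcongr
        have : 1 / (50 * γ) = 1 / 50 * (1 / γ) := by field_simp
        have h5 : 16 ≤ 1 / γ := by rw [le_div_iff₀ hγ]; linarith
        linarith

end Repulsion

/-! ### Sums over tuples of roots and their smoothing -/

section Kernel

open Metric Real

/-- The mass of `logKernel`. -/
noncomputable def logMass : ℝ := ∫ w, logKernel w

lemma logMass_pos : 0 < logMass := integral_logKernel_pos

/-- The probability density `log⁺ (R / |w|)`, normalized. -/
noncomputable def rootKernel (R : ℝ) (w : ℂ) : ℝ := logKernel (R⁻¹ • w) / (logMass * R ^ 2)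

variable {R : ℝ}

lemma rootKernel_nonneg (w : ℂ) : 0 ≤ rootKernel R w := by
  have := logMass_pos
  exact div_nonneg (logKernel_nonneg _) (by positivity)

lemma rootKernel_eq_zero (hR : 0 < R) {w : ℂ} (hw : R ≤ ‖w‖) : rootKernel R w = 0 := by
  rw [rootKernel, logKernel_eq_zero, zero_div]
  rw [norm_smul, norm_inv, norm_of_nonneg hR.le, ← div_eq_inv_mul, le_div_iff₀ hR, one_mul]
  exact hw

lemma integral_rootKernel (hR : 0 < R) : ∫ w, rootKernel R w = 1 := by
  have := logMass_pos
  simp only [rootKernel]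
  rw [integral_div, Measure.integral_comp_inv_smul_of_nonneg volume logKernel hR.le,
    Complex.finrank_real_complex, smul_eq_mul, ← logMass, mul_comm, div_self (by positivity)]

lemma integrable_rootKernel (hR : 0 < R) : Integrable (rootKernel R) :=
  (integrable_logKernel.comp_smul (inv_ne_zero hR.ne')).div_const _

lemma integral_rootKernel_sub (hR : 0 < R) (a : ℂ) : ∫ w, rootKernel R (a - w) = 1 := by
  rw [integral_sub_left_eq_self, integral_rootKernel hR]

/-- The difference between the mean of `u` over the circle of radius `R` around `c` and its value at
`c`, normalized in such a way that `log |f|` yields the sum of `rootKernel R` over the roots. -/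
noncomputable def circleIncr (R : ℝ) (u : ℂ → ℝ) (c : ℂ) : ℝ :=
  (circleAverage u c R - u c) / (logMass * R ^ 2)

/-- Jensen's formula. -/
lemma circleIncr_log_eq {f : ℂ → ℂ} {z c : ℂ} (hf : AnalyticOnNhd ℂ f (ball z 2))
    (hR : 0 < R) (hR' : R ≤ 1 / 10) (hc : c ∈ ball z (1 / 25)) (h0 : f c ≠ 0) :
    circleIncr R (fun w => log ‖f w‖) c =
      ∑ r ∈ rootsIn f (closedBall z (4 / 5)), rootKernel R (r.loc - c) := by
  rw [mem_ball] at hc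
  have hf' : AnalyticOnNhd ℂ f (closedBall z (4 / 5)) :=
    hf.mono (closedBall_subset_ball (by norm_num))
  rw [circleIncr, circleAverage_log_norm_eq hR (hf.mono ?_) h0
    (rootsIn f (closedBall z (4 / 5))) (fun r hr => ?_), add_sub_cancel_left, Finset.sum_div]
  · refine Finset.sum_congr rfl fun r _ => ?_
    rw [rootKernel, logKernel, norm_smul, norm_inv, norm_of_nonneg hR.le, mul_inv, inv_inv]
  · exact closedBall_subset_ball' (by linarith)
  · rw [mem_rootsIn hf']
    exact closedBall_subset_closedBall' (by linarith) hr

lemma rootsIn_eq_empty {f : ℂ → ℂ} {z : ℂ} {ρ : ℝ} (hf : AnalyticOnNhd ℂ f (closedBall z ρ))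
    (h0 : ∀ w ∈ closedBall z ρ, ∀ᶠ u in 𝓝 w, f u = 0) : rootsIn f (closedBall z ρ) = ∅ := by
  refine Finset.eq_empty_of_forall_notMem fun r hr => ?_
  have h1 := h0 _ ((mem_rootsIn hf).1 hr)
  have h2 : analyticOrderNatAt f r.fst = 0 := by
    have h3 : analyticOrderAt f r.fst = ⊤ := analyticOrderAt_eq_top.2 h1
    rw [analyticOrderNatAt, h3]
    rfl
  have := r.2.2
  omega

lemma ae_circleIncr_log_eq {f : ℂ → ℂ} {z : ℂ} (hf : AnalyticOnNhd ℂ f (ball z 2))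
    (hR : 0 < R) (hR' : R ≤ 1 / 10) : ∀ᵐ c, c ∈ ball z (1 / 25) →
      circleIncr R (fun w => log ‖f w‖) c =
        ∑ r ∈ rootsIn f (closedBall z (4 / 5)), rootKernel R (r.loc - c) := by
  by_cases h : ∃ w ∈ ball z 2, f w ≠ 0
  · obtain ⟨w, hw, h0⟩ := h
    have h1 := ae_ne_zero_of_analyticOnNhd isOpen_ball (convex_ball z 2).isPreconnected hf hw h0
    rw [ae_restrict_iff' measurableSet_ball] at h1
    filter_upwards [h1] with c hc hcb
    exact circleIncr_log_eq hf hR hR' hcb (hc (ball_subset_ball (by norm_num) hcb))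
  · push Not at h
    refine ae_of_all _ fun c hc => ?_
    rw [rootsIn_eq_empty (hf.mono (closedBall_subset_ball (by norm_num)))
      (fun w hw => eventually_of_mem
        (isOpen_ball.mem_nhds (closedBall_subset_ball (by norm_num) hw)) h), Finset.sum_empty,
      circleIncr]
    have hc' := mem_ball.1 hc
    have h2 : circleAverage (fun w => log ‖f w‖) c R = 0 := by
      rw [circleAverage_congr_sphere (f₂ := fun _ => 0) (fun w hw => ?_), circleAverage_const]
      rw [h w]
      · simp
      · rw [abs_of_pos hR] at hw
        exact closedBall_subset_ball' (by linarith) (sphere_subset_closedBall hw)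
    rw [h2, h c (ball_subset_ball (by norm_num) hc)]
    simp

end Kernel

section RootSum

open Metric Real

variable {ι : Type*} [Fintype ι]

/-- The sum of `Γ` over all tuples of roots of `f`. -/
noncomputable def rootSum (Γ : (ι → ℂ) → ℂ) (f : ℂ → ℂ) : ℂ :=
  ∑' r : ι → Root f, Γ fun i => (r i).loc

/-- Bounded Lipschitz functions supported near `z`. -/
structure IsTestFunction (z : ι → ℂ) (Λ : ℝ) (Γ : (ι → ℂ) → ℂ) : Prop where
  mem_ball : ∀ c, Γ c ≠ 0 → ∀ i, c i ∈ ball (z i) (1 / 25)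
  norm_le : ∀ c, ‖Γ c‖ ≤ 2
  lipschitz : ∀ c c', ‖Γ c - Γ c'‖ ≤ Λ * dist c c'

/-- The smoothed sum over roots, if `u = log |f|`. -/
noncomputable def smoothSum (Γ : (ι → ℂ) → ℂ) (R : ℝ) (u : ℂ → ℝ) : ℂ :=
  ∫ c : ι → ℂ, Γ c * ∏ i, (circleIncr R u (c i) : ℂ)

variable {z : ι → ℂ} {Λ R : ℝ} {Γ : (ι → ℂ) → ℂ} {f : ℂ → ℂ}

lemma IsTestFunction.continuous (h : IsTestFunction z Λ Γ) : Continuous Γ := by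
  have h1 : LipschitzWith (Real.toNNReal Λ) Γ := LipschitzWith.of_dist_le_mul fun c c' => by
    rw [dist_eq_norm]
    exact (h.lipschitz c c').trans
      (mul_le_mul_of_nonneg_right (Real.le_coe_toNNReal Λ) dist_nonneg)
  exact h1.continuous

lemma rootSum_eq_sum [DecidableEq ι] (hΓ : ∀ c, Γ c ≠ 0 → ∀ i, c i ∈ ball (z i) (1 / 25))
    (hf : ∀ i, AnalyticOnNhd ℂ f (ball (z i) 2)) :
    rootSum Γ f = ∑ r ∈ Fintype.piFinset fun i => rootsIn f (closedBall (z i) (4 / 5)),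
      Γ fun i => (r i).loc := by
  refine tsum_eq_sum fun r hr => ?_
  by_contra h0
  refine hr (Fintype.mem_piFinset.2 fun i => ?_)
  rw [mem_rootsIn ((hf i).mono (closedBall_subset_ball (by norm_num)))]
  exact ball_subset_closedBall (ball_subset_ball (by norm_num) (hΓ _ h0 i))

/-- The number of roots in the disk of radius `4 / 5`. -/
noncomputable def nearCount (f : ℂ → ℂ) (z : ℂ) : ℕ := (rootsIn f (closedBall z (4 / 5))).card

lemma integrable_prod_rootKernel (hR : 0 < R) (a : ι → ℂ) :
    Integrable fun c : ι → ℂ => ∏ i, rootKernel R (a i - c i) :=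
  Integrable.fintype_prod (f := fun i w => rootKernel R (a i - w)) fun i =>
    (integrable_rootKernel hR).comp_sub_left (a i)

lemma norm_apply_sub_integral_le (hΓ : IsTestFunction z Λ Γ) (hΛ : 0 ≤ Λ) (hR : 0 < R)
    (a : ι → ℂ) :
    ‖Γ a - ∫ c : ι → ℂ, Γ c * ((∏ i, rootKernel R (a i - c i) : ℝ) : ℂ)‖ ≤ Λ * R := by
  have hint := integrable_prod_rootKernel hR a
  have hintC : Integrable fun c : ι → ℂ => ((∏ i, rootKernel R (a i - c i) : ℝ) : ℂ) := hint.ofReal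
  have h1 : ∫ c : ι → ℂ, (∏ i, rootKernel R (a i - c i)) = 1 := by
    rw [integral_fintype_prod_volume_eq_prod (fun i w => rootKernel R (a i - w))]
    simp [integral_rootKernel_sub hR]
  have h2 : Γ a = ∫ c : ι → ℂ, Γ a * ((∏ i, rootKernel R (a i - c i) : ℝ) : ℂ) := by
    rw [integral_const_mul, integral_complex_ofReal, h1]
    simp
  have h3 : Integrable fun c : ι → ℂ => Γ c * ((∏ i, rootKernel R (a i - c i) : ℝ) : ℂ) :=
    hintC.bdd_mul hΓ.continuous.aestronglyMeasurable (ae_of_all _ hΓ.norm_le)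
  rw [h2, ← integral_sub (hintC.const_mul _) h3]
  calc _ ≤ ∫ c : ι → ℂ, Λ * R * ∏ i, rootKernel R (a i - c i) := by
        refine norm_integral_le_of_norm_le (hint.const_mul _) (ae_of_all _ fun c => ?_)
        have h0 : 0 ≤ ∏ i, rootKernel R (a i - c i) :=
          Finset.prod_nonneg fun i _ => rootKernel_nonneg _
        rw [← sub_mul, norm_mul, Complex.norm_real, norm_of_nonneg h0]
        by_cases hc : ∀ i, ‖a i - c i‖ ≤ R
        · gcongr
          refine (hΓ.lipschitz a c).trans (mul_le_mul_of_nonneg_left ?_ hΛ)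
          refine (dist_pi_le_iff hR.le).2 fun i => ?_
          rw [dist_eq_norm]
          exact hc i
        · push Not at hc
          obtain ⟨i, hi⟩ := hc
          rw [Finset.prod_eq_zero (Finset.mem_univ i) (rootKernel_eq_zero hR hi.le)]
          simp
    _ = Λ * R := by rw [integral_const_mul, h1, mul_one]

/-- Smoothing at scale `R` changes the sum over the tuples of roots by at most `Λ R` per tuple. -/
lemma norm_rootSum_sub_smoothSum_le (hΓ : IsTestFunction z Λ Γ) (hΛ : 0 ≤ Λ)
    (hf : ∀ i, AnalyticOnNhd ℂ f (ball (z i) 2)) (hR : 0 < R) (hR' : R ≤ 1 / 10) :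
    ‖rootSum Γ f - smoothSum Γ R fun w => log ‖f w‖‖ ≤
      Λ * R * ∏ i, (nearCount f (z i) : ℝ) := by
  classical
  have hae : ∀ᵐ c : ι → ℂ, ∀ i, c i ∈ ball (z i) (1 / 25) →
      circleIncr R (fun w => log ‖f w‖) (c i) =
        ∑ r ∈ rootsIn f (closedBall (z i) (4 / 5)), rootKernel R (r.loc - c i) := by
    rw [ae_all_iff]
    intro i
    exact (Measure.quasiMeasurePreserving_eval (μ := fun _ : ι => (volume : Measure ℂ)) i).ae
      (ae_circleIncr_log_eq (hf i) hR hR')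
  have h1 : smoothSum Γ R (fun w => log ‖f w‖) =
      ∑ r ∈ Fintype.piFinset fun i => rootsIn f (closedBall (z i) (4 / 5)),
        ∫ c : ι → ℂ, Γ c * ((∏ i, rootKernel R ((r i).loc - c i) : ℝ) : ℂ) := by
    rw [smoothSum, ← integral_finsetSum _ fun r _ => ?_]
    · refine integral_congr_ae (hae.mono fun c hc => ?_)
      simp only
      rw [← Finset.mul_sum]
      by_cases h0 : Γ c = 0
      · simp [h0]
      · congr 1
        have e := Finset.prod_univ_sum (fun i => rootsIn f (closedBall (z i) (4 / 5)))
          fun i (r : Root f) => rootKernel R (r.loc - c i)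
        rw [← Complex.ofReal_sum, ← e, ← Complex.ofReal_prod]
        congr 1
        exact Finset.prod_congr rfl fun i _ => hc i (hΓ.mem_ball c h0 i)
    · exact (integrable_prod_rootKernel hR _).ofReal.bdd_mul
        hΓ.continuous.aestronglyMeasurable (ae_of_all _ hΓ.norm_le)
  rw [h1, rootSum_eq_sum hΓ.mem_ball hf, ← Finset.sum_sub_distrib]
  refine (norm_sum_le_of_le _ fun r _ => norm_apply_sub_integral_le hΓ hΛ hR _).trans
    (le_of_eq ?_)
  rw [Finset.sum_const, Fintype.card_piFinset, nsmul_eq_mul]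
  push_cast [nearCount]
  ring

lemma tendsto_smoothSum (hΓ : IsTestFunction z Λ Γ) (hΛ : 0 ≤ Λ)
    (hf : ∀ i, AnalyticOnNhd ℂ f (ball (z i) 2)) :
    Tendsto (fun N : ℕ => smoothSum Γ (1 / (N + 10 : ℝ)) fun w => log ‖f w‖) atTop
      (𝓝 (rootSum Γ f)) := by
  rw [tendsto_iff_norm_sub_tendsto_zero]
  have h0 : Tendsto (fun N : ℕ => 1 / (N + 10 : ℝ)) atTop (𝓝 0) := by
    have : Tendsto (fun N : ℕ => (N + 10 : ℝ)) atTop atTop :=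
      tendsto_atTop_add_const_right _ _ tendsto_natCast_atTop_atTop
    simp only [one_div]
    exact this.inv_tendsto_atTop
  have h1 := (h0.const_mul Λ).mul_const (∏ i, (nearCount f (z i) : ℝ))
  rw [mul_zero, zero_mul] at h1
  refine squeeze_zero (fun _ => norm_nonneg _) (fun N => ?_) h1
  rw [norm_sub_rev]
  refine norm_rootSum_sub_smoothSum_le hΓ hΛ hf (by positivity) ?_
  rw [div_le_div_iff₀ (by positivity) (by norm_num)]
  have : (0 : ℝ) ≤ N := Nat.cast_nonneg N
  linarith

end RootSum

/-! ### Measurability and stability of smoothed sums -/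

section Measurability

open Metric Real

lemma measurable_circleMap_uncurry (R : ℝ) : Measurable fun p : ℂ × ℝ => circleMap p.1 R p.2 := by
  unfold circleMap
  fun_prop

variable {Ω : Type*} [MeasurableSpace Ω] {R : ℝ}

lemma measurable_circleIncr {u : Ω → ℂ → ℝ} (hu : Measurable fun p : Ω × ℂ => u p.1 p.2) :
    Measurable fun p : Ω × ℂ => circleIncr R (u p.1) p.2 := by
  unfold circleIncr
  refine Measurable.div_const (Measurable.sub ?_ hu) _
  simp only [circleAverage_def, intervalIntegral.integral_of_le two_pi_pos.le]
  simp only [smul_eq_mul]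
  refine Measurable.const_mul ?_ _
  have h1 : Measurable fun q : (Ω × ℂ) × ℝ => u q.1.1 (circleMap q.1.2 R q.2) :=
    hu.comp (measurable_fst.fst.prodMk ((measurable_circleMap_uncurry R).comp
      (measurable_fst.snd.prodMk measurable_snd)))
  exact (h1.stronglyMeasurable.integral_prod_right
    (ν := volume.restrict (Set.Ioc 0 (2 * π)))).measurable

lemma measurable_circleIncr_apply {u : ℂ → ℝ} (hu : Measurable u) : Measurable (circleIncr R u) := by
  have h := measurable_circleIncr (Ω := Unit) (R := R) (u := fun _ => u) (hu.comp measurable_snd)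
  exact h.comp (measurable_prodMk_left (x := ()))

variable {ι : Type*} [Fintype ι] {z : ι → ℂ} {Λ : ℝ} {Γ : (ι → ℂ) → ℂ}

lemma measurable_smoothSum (hΓ : IsTestFunction z Λ Γ) {u : Ω → ℂ → ℝ}
    (hu : Measurable fun p : Ω × ℂ => u p.1 p.2) :
    Measurable fun ω => smoothSum Γ R (u ω) := by
  have h1 : Measurable fun q : Ω × (ι → ℂ) =>
      Γ q.2 * ∏ i, (circleIncr R (u q.1) (q.2 i) : ℂ) := by
    refine Measurable.mul (hΓ.continuous.measurable.comp measurable_snd)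
      (Finset.measurable_prod _ fun i _ => Complex.measurable_ofReal.comp ?_)
    exact (measurable_circleIncr hu).comp
      (measurable_fst.prodMk ((measurable_pi_apply i).comp measurable_snd))
  exact (h1.stronglyMeasurable.integral_prod_right (ν := volume)).measurable

lemma circleIncr_congr {u v : ℂ → ℝ} {z c : ℂ} (huv : ∀ w ∈ ball z (1 / 5), u w = v w)
    (hR : 0 < R) (hR' : R ≤ 1 / 10) (hc : c ∈ ball z (1 / 25)) :
    circleIncr R u c = circleIncr R v c := by
  rw [circleIncr, circleIncr, huv c (ball_subset_ball (by norm_num) hc),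
    circleAverage_congr_sphere fun w hw => huv w ?_]
  rw [abs_of_pos hR] at hw
  rw [mem_ball] at hc
  have := sphere_subset_closedBall.trans
    (closedBall_subset_ball' (ε₂ := 1 / 5) (y := z) (by linarith : R + dist c z < 1 / 5))
  exact this hw

lemma smoothSum_congr (hΓ : IsTestFunction z Λ Γ) {u v : ℂ → ℝ}
    (huv : ∀ i, ∀ w ∈ ball (z i) (1 / 5), u w = v w) (hR : 0 < R) (hR' : R ≤ 1 / 10) :
    smoothSum Γ R u = smoothSum Γ R v := by
  refine integral_congr_ae (ae_of_all _ fun c => ?_)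
  simp only
  by_cases h0 : Γ c = 0
  · simp [h0]
  · congr 1
    exact Finset.prod_congr rfl fun i _ => by
      rw [circleIncr_congr (huv i) hR hR' (hΓ.mem_ball c h0 i)]

lemma IsAnalyticSeries.measurable_rootSum {J : Type*} {τ ε : ℝ} {μ : Measure Ω}
    [IsProbabilityMeasure μ] {ξ : J → Ω → ℝ} {φ : J → ℂ → ℂ} {s : ℕ → Finset J} {U : Set ℂ}
    {F : Ω → ℂ → ℂ} (h : IsAnalyticSeries τ ε μ ξ φ s U F) (hz : ∀ i, ball (z i) 2 ⊆ U)
    (hΓ : IsTestFunction z Λ Γ) (hΛ : 0 ≤ Λ) : Measurable fun ω => rootSum Γ (F ω) := by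
  refine measurable_of_tendsto_metrizable
    (f := fun (N : ℕ) ω => smoothSum Γ (1 / (N + 10 : ℝ)) fun w => log ‖F ω w‖) (fun N => ?_)
    (tendsto_pi_nhds.2 fun ω => tendsto_smoothSum hΓ hΛ fun i => (h.analytic ω).mono (hz i))
  have h1 : ∀ ω, smoothSum Γ (1 / (N + 10 : ℝ)) (fun w => log ‖F ω w‖) =
      smoothSum Γ (1 / (N + 10 : ℝ)) (fun w => log ‖U.indicator (F ω) w‖) := by
    intro ω
    refine smoothSum_congr hΓ (fun i w hw => ?_) (by positivity) ?_
    · rw [Set.indicator_of_mem (hz i (ball_subset_ball (by norm_num) hw))]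
    · rw [div_le_div_iff₀ (by positivity) (by norm_num)]
      have : (0 : ℝ) ≤ N := Nat.cast_nonneg N
      linarith
  simp only [h1]
  exact measurable_smoothSum hΓ (measurable_log.comp h.measurable_indicator.norm)

end Measurability

section Stability

open Metric Real

variable {R : ℝ}

lemma lintegral_circleIncr_le {u : ℂ → ℝ} (hu : Measurable u) {z : ℂ} (hR : 0 < R)
    (hR' : R ≤ 1 / 10) :
    ∫⁻ c in ball z (1 / 25), ‖circleIncr R u c‖ₑ ≤
      ENNReal.ofReal (2 / (logMass * R ^ 2)) * ∫⁻ w in ball z (1 / 5), ‖u w‖ₑ := by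
  have hJ := logMass_pos
  have hm : Measurable fun p : ℂ × ℝ => ‖u (circleMap p.1 R p.2)‖ₑ :=
    (hu.comp (measurable_circleMap_uncurry R)).enorm
  have havg : ∀ c, ‖circleAverage u c R‖ₑ ≤
      ENNReal.ofReal (2 * π)⁻¹ * ∫⁻ θ in Set.Ioc 0 (2 * π), ‖u (circleMap c R θ)‖ₑ := by
    intro c
    rw [circleAverage_def, intervalIntegral.integral_of_le two_pi_pos.le, enorm_smul,
      ← ofReal_norm (2 * π)⁻¹, norm_of_nonneg (by positivity)]
    gcongr
    exact enorm_integral_le_lintegral_enorm _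
  have htrans : ∀ a : ℂ, ‖a‖ ≤ R →
      ∫⁻ c in ball z (1 / 25), ‖u (c + a)‖ₑ ≤ ∫⁻ w in ball z (1 / 5), ‖u w‖ₑ := by
    intro a ha
    rw [← lintegral_indicator measurableSet_ball, ← lintegral_indicator measurableSet_ball,
      ← lintegral_add_right_eq_self (fun w => (ball z (1 / 5)).indicator (fun w => ‖u w‖ₑ) w) a]
    refine lintegral_mono fun c => ?_
    by_cases hc : c ∈ ball z (1 / 25)
    swap
    · rw [Set.indicator_of_notMem hc]
      exact zero_le
    rw [Set.indicator_of_mem hc, Set.indicator_of_mem]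
    rw [mem_ball, dist_eq_norm] at hc ⊢
    calc ‖c + a - z‖ = ‖(c - z) + a‖ := by congr 1; ring
      _ ≤ ‖c - z‖ + ‖a‖ := norm_add_le _ _
      _ < 1 / 5 := by linarith
  have h1 : ∫⁻ c in ball z (1 / 25), ‖circleAverage u c R‖ₑ ≤ ∫⁻ w in ball z (1 / 5), ‖u w‖ₑ := by
    calc _ ≤ ∫⁻ c in ball z (1 / 25), ENNReal.ofReal (2 * π)⁻¹ *
            ∫⁻ θ in Set.Ioc 0 (2 * π), ‖u (circleMap c R θ)‖ₑ := lintegral_mono havg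
      _ = ENNReal.ofReal (2 * π)⁻¹ * ∫⁻ θ in Set.Ioc 0 (2 * π),
            ∫⁻ c in ball z (1 / 25), ‖u (circleMap c R θ)‖ₑ := by
          rw [lintegral_const_mul _ hm.lintegral_prod_right', lintegral_lintegral_swap
            hm.aemeasurable]
      _ ≤ ENNReal.ofReal (2 * π)⁻¹ * ∫⁻ _θ in Set.Ioc 0 (2 * π),
            ∫⁻ w in ball z (1 / 5), ‖u w‖ₑ := by
          refine mul_le_mul_right (lintegral_mono fun θ => ?_) _
          have := htrans (circleMap 0 R θ) (by rw [norm_circleMap_zero, abs_of_pos hR])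
          simpa only [circleMap, zero_add] using this
      _ = _ := by
          rw [lintegral_const, Measure.restrict_apply MeasurableSet.univ, Set.univ_inter,
            Real.volume_Ioc, sub_zero, mul_comm, mul_assoc, ← ENNReal.ofReal_mul (by positivity),
            mul_inv_cancel₀ (by positivity), ENNReal.ofReal_one, mul_one]
  have h2 : ∫⁻ c in ball z (1 / 25), ‖u c‖ₑ ≤ ∫⁻ w in ball z (1 / 5), ‖u w‖ₑ :=
    lintegral_mono_set (ball_subset_ball (by norm_num))
  calc _ ≤ ∫⁻ c in ball z (1 / 25), ENNReal.ofReal (1 / (logMass * R ^ 2)) *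
          (‖circleAverage u c R‖ₑ + ‖u c‖ₑ) := by
        refine lintegral_mono fun c => ?_
        rw [circleIncr, div_eq_inv_mul, enorm_mul, ← ofReal_norm (logMass * R ^ 2)⁻¹,
          norm_of_nonneg (by positivity), one_div]
        gcongr
        exact enorm_sub_le
    _ ≤ ENNReal.ofReal (1 / (logMass * R ^ 2)) * (2 * ∫⁻ w in ball z (1 / 5), ‖u w‖ₑ) := by
        rw [lintegral_const_mul' _ _ ENNReal.ofReal_ne_top, lintegral_add_right _ hu.enorm, two_mul]
        gcongr
    _ = _ := by
        rw [← mul_assoc]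
        congr 1
        rw [← ENNReal.ofReal_ofNat, ← ENNReal.ofReal_mul (by positivity)]
        congr 1
        ring

lemma integrableOn_circleIncr {u : ℂ → ℝ} (hu : Measurable u) {z : ℂ} (hR : 0 < R)
    (hR' : R ≤ 1 / 10) (hi : IntegrableOn u (ball z (1 / 5))) :
    IntegrableOn (circleIncr R u) (ball z (1 / 25)) := by
  refine ⟨(measurable_circleIncr_apply hu).aestronglyMeasurable, ?_⟩
  exact (lintegral_circleIncr_le hu hR hR').trans_lt (ENNReal.mul_lt_top ENNReal.ofReal_lt_top hi.2)

lemma integral_abs_circleIncr_le {u : ℂ → ℝ} (hu : Measurable u) {z : ℂ} (hR : 0 < R)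
    (hR' : R ≤ 1 / 10) (hi : IntegrableOn u (ball z (1 / 5))) :
    ∫ c in ball z (1 / 25), |circleIncr R u c| ≤
      2 / (logMass * R ^ 2) * ∫ w in ball z (1 / 5), |u w| := by
  have hJ := logMass_pos
  have h := lintegral_circleIncr_le hu hR hR' (z := z)
  have e1 := ofReal_integral_norm_eq_lintegral_enorm (integrableOn_circleIncr hu hR hR' hi)
  have e2 := ofReal_integral_norm_eq_lintegral_enorm hi
  rw [← e1, ← e2, ← ENNReal.ofReal_mul (by positivity), ENNReal.ofReal_le_ofReal_iff] at h
  · exact h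
  · have : 0 ≤ ∫ w in ball z (1 / 5), ‖u w‖ := integral_nonneg fun w => norm_nonneg _
    positivity

/-- The difference of two products, factor by factor. -/
lemma abs_prod_sub_prod_le {ι : Type*} [DecidableEq ι] (s : Finset ι) (a b : ι → ℝ) :
    |∏ i ∈ s, a i - ∏ i ∈ s, b i| ≤
      ∑ i ∈ s, |a i - b i| * ∏ j ∈ s.erase i, (|a j| + |b j|) := by
  induction s using Finset.induction_on with
  | empty => simp
  | insert k s hk ih =>
    rw [Finset.prod_insert hk, Finset.prod_insert hk, Finset.sum_insert hk,
      Finset.erase_insert hk]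
    have e : a k * ∏ i ∈ s, a i - b k * ∏ i ∈ s, b i =
        (a k - b k) * ∏ i ∈ s, a i + b k * (∏ i ∈ s, a i - ∏ i ∈ s, b i) := by ring
    rw [e]
    refine (abs_add_le _ _).trans (add_le_add ?_ ?_)
    · rw [abs_mul, Finset.abs_prod]
      gcongr with i
      linarith [abs_nonneg (b i)]
    · rw [abs_mul]
      refine (mul_le_mul_of_nonneg_left ih (abs_nonneg _)).trans ?_
      rw [Finset.mul_sum]
      refine Finset.sum_le_sum fun i hi => ?_
      have hki : k ≠ i := fun hki => hk (hki ▸ hi)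
      rw [Finset.erase_insert_of_ne hki, Finset.prod_insert (fun h => hk (Finset.mem_of_mem_erase h))]
      have h0 : 0 ≤ ∏ j ∈ s.erase i, (|a j| + |b j|) :=
        Finset.prod_nonneg fun j _ => by positivity
      have h1 : 0 ≤ |a k| * (|a i - b i| * ∏ j ∈ s.erase i, (|a j| + |b j|)) := by positivity
      linarith

variable {ι : Type*} [Fintype ι] {z : ι → ℂ} {Λ : ℝ} {Γ : (ι → ℂ) → ℂ}

lemma integrable_test_mul_prod (hΓ : IsTestFunction z Λ Γ) {g : ι → ℂ → ℝ}
    (hg : ∀ i, IntegrableOn (g i) (ball (z i) (1 / 25))) :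
    Integrable fun c : ι → ℂ => Γ c * ∏ i, (g i (c i) : ℂ) := by
  have h1 : Integrable fun c : ι → ℂ => ∏ i, (ball (z i) (1 / 25)).indicator (g i) (c i) :=
    Integrable.fintype_prod fun i => (integrable_indicator_iff measurableSet_ball).2 (hg i)
  have h1' : Integrable fun c : ι → ℂ =>
    ((∏ i, (ball (z i) (1 / 25)).indicator (g i) (c i) : ℝ) : ℂ) := h1.ofReal
  have h2 := h1'.bdd_mul hΓ.continuous.aestronglyMeasurable (ae_of_all _ hΓ.norm_le)
  refine h2.congr (ae_of_all _ fun c => ?_)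
  simp only
  by_cases h0 : Γ c = 0
  · simp [h0]
  · rw [Complex.ofReal_prod]
    congr 1
    exact Finset.prod_congr rfl fun i _ => by rw [Set.indicator_of_mem (hΓ.mem_ball c h0 i)]

/-- Stability of smoothed sums in `L¹`. -/
lemma norm_smoothSum_sub_le (hΓ : IsTestFunction z Λ Γ) {u v : ℂ → ℝ} (hu : Measurable u)
    (hv : Measurable v) (hR : 0 < R) (hR' : R ≤ 1 / 10)
    (hui : ∀ i, IntegrableOn u (ball (z i) (1 / 5)))
    (hvi : ∀ i, IntegrableOn v (ball (z i) (1 / 5)))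
    (huc : ∀ i, ∀ c ∈ ball (z i) (1 / 25), CircleIntegrable u c R)
    (hvc : ∀ i, ∀ c ∈ ball (z i) (1 / 25), CircleIntegrable v c R) {a : ℝ}
    (hua : ∀ i, ∫ w in ball (z i) (1 / 5), |u w| ≤ a)
    (hva : ∀ i, ∫ w in ball (z i) (1 / 5), |v w| ≤ a) :
    ‖smoothSum Γ R u - smoothSum Γ R v‖ ≤ 2 * (2 / (logMass * R ^ 2)) ^ Fintype.card ι *
      (2 * a) ^ (Fintype.card ι - 1) * ∑ i, ∫ w in ball (z i) (1 / 5), |u w - v w| := by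
  classical
  have hJ := logMass_pos
  set q := 2 / (logMass * R ^ 2) with hq
  have hq0 : 0 ≤ q := by positivity
  have huI := fun i => integrableOn_circleIncr hu hR hR' (hui i)
  have hvI := fun i => integrableOn_circleIncr hv hR hR' (hvi i)
  have hdI := fun i => integrableOn_circleIncr (hu.sub hv) hR hR' ((hui i).sub (hvi i))
  have hsub : ∀ i, ∀ c ∈ ball (z i) (1 / 25), circleIncr R u c - circleIncr R v c =
      circleIncr R (u - v) c := by
    intro i c hc
    rw [circleIncr, circleIncr, circleIncr, circleAverage_sub (huc i c hc) (hvc i c hc),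
      Pi.sub_apply]
    ring
  set g : ι → ι → ℂ → ℝ := fun i j => (ball (z j) (1 / 25)).indicator
    (if j = i then fun c => |circleIncr R (u - v) c| else
      fun c => |circleIncr R u c| + |circleIncr R v c|) with hg
  have hgi : ∀ i j, Integrable (g i j) := by
    intro i j
    simp only [hg]
    rw [integrable_indicator_iff measurableSet_ball]
    split_ifs
    · exact (hdI j).abs
    · exact (huI j).abs.add (hvI j).abs
  have hgint : ∀ i j, ∫ c, g i j c ≤
      if j = i then q * ∫ w in ball (z i) (1 / 5), |u w - v w| else q * (2 * a) := by
    intro i j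
    simp only [hg]
    rw [integral_indicator measurableSet_ball]
    split_ifs with hji
    · rw [hji]
      exact integral_abs_circleIncr_le (hu.sub hv) hR hR' ((hui i).sub (hvi i))
    · rw [integral_add (huI j).abs (hvI j).abs]
      have h1 := integral_abs_circleIncr_le hu hR hR' (hui j)
      have h2 := integral_abs_circleIncr_le hv hR hR' (hvi j)
      have h3 := mul_le_mul_of_nonneg_left (hua j) hq0
      have h4 := mul_le_mul_of_nonneg_left (hva j) hq0
      linarith
  have hg0 : ∀ i j c, 0 ≤ g i j c := by
    intro i j c
    simp only [hg]
    refine Set.indicator_nonneg (fun c _ => ?_) c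
    split_ifs <;> positivity
  have hGi : ∀ i, Integrable fun c : ι → ℂ => ∏ j, g i j (c j) := fun i =>
    Integrable.fintype_prod (hgi i)
  rw [smoothSum, smoothSum, ← integral_sub (integrable_test_mul_prod hΓ huI)
    (integrable_test_mul_prod hΓ hvI)]
  calc _ ≤ ∫ c : ι → ℂ, 2 * ∑ i, ∏ j, g i j (c j) := by
        refine norm_integral_le_of_norm_le ((integrable_finsetSum _ fun i _ => hGi i).const_mul _)
          (ae_of_all _ fun c => ?_)
        rw [← mul_sub, norm_mul, ← Complex.ofReal_prod, ← Complex.ofReal_prod,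
          ← Complex.ofReal_sub, Complex.norm_real, norm_eq_abs]
        by_cases h0 : Γ c = 0
        · rw [h0, norm_zero, zero_mul]
          exact mul_nonneg zero_le_two (Finset.sum_nonneg fun i _ =>
            Finset.prod_nonneg fun j _ => hg0 i j _)
        have hmem := hΓ.mem_ball c h0
        refine mul_le_mul (hΓ.norm_le c) ?_ (abs_nonneg _) zero_le_two
        refine (abs_prod_sub_prod_le Finset.univ _ _).trans (Finset.sum_le_sum fun i _ => ?_)
        rw [← Finset.mul_prod_erase Finset.univ _ (Finset.mem_univ i)]
        refine le_of_eq (congr_arg₂ _ ?_ (Finset.prod_congr rfl fun j hj => ?_))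
        · simp only [hg, if_true]
          rw [Set.indicator_of_mem (hmem i), hsub i _ (hmem i)]
        · simp only [hg, if_neg (Finset.ne_of_mem_erase hj)]
          rw [Set.indicator_of_mem (hmem j)]
    _ = 2 * ∑ i, ∏ j, ∫ c, g i j c := by
        rw [integral_const_mul, integral_finsetSum _ fun i _ => hGi i]
        simp only [integral_fintype_prod_volume_eq_prod]
    _ ≤ 2 * ∑ i, (q ^ Fintype.card ι * (2 * a) ^ (Fintype.card ι - 1) *
          ∫ w in ball (z i) (1 / 5), |u w - v w|) := by
        gcongr with i
        refine (Finset.prod_le_prod (fun j _ => integral_nonneg (hg0 i j))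
          fun j _ => hgint i j).trans (le_of_eq ?_)
        rw [← Finset.mul_prod_erase Finset.univ _ (Finset.mem_univ i), if_pos rfl,
          Finset.prod_congr rfl fun j hj => if_neg (Finset.ne_of_mem_erase hj),
          Finset.prod_const, Finset.card_erase_of_mem (Finset.mem_univ i), Finset.card_univ,
          mul_pow]
        have hc : 0 < Fintype.card ι := Fintype.card_pos_iff.2 ⟨i⟩
        rw [show q ^ Fintype.card ι = q * q ^ (Fintype.card ι - 1) by
          rw [← pow_succ']; congr 1; omega]
        ring
    _ = _ := by rw [← Finset.mul_sum]; ring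

lemma abs_circleIncr_le {v : ℂ → ℝ} {T : ℝ} (hT : ∀ w, |v w| ≤ T) (hR : 0 < R) (c : ℂ) :
    |circleIncr R v c| ≤ 2 * T / (logMass * R ^ 2) := by
  have hJ := logMass_pos
  have hT0 : 0 ≤ T := (abs_nonneg _).trans (hT 0)
  rw [circleIncr, abs_div, abs_of_pos (show 0 < logMass * R ^ 2 by positivity)]
  gcongr
  have h1 : |circleAverage v c R| ≤ T := by
    rw [circleAverage_def, smul_eq_mul, abs_mul, abs_of_pos (show 0 < (2 * π)⁻¹ by positivity)]
    have := intervalIntegral.norm_integral_le_of_norm_le_const (a := 0) (b := 2 * π)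
      (f := fun θ => v (circleMap c R θ)) (C := T) fun θ _ => hT _
    rw [sub_zero, abs_of_pos two_pi_pos, norm_eq_abs] at this
    calc _ ≤ (2 * π)⁻¹ * (T * (2 * π)) := by gcongr
      _ = T := by field_simp
  have h2 := abs_sub (circleAverage v c R) (v c)
  linarith [hT c]

lemma volume_real_ball_le (z : ℂ) : (volume : Measure ℂ).real (ball z (1 / 25)) ≤ 1 := by
  rw [Measure.real, Complex.volume_ball, ENNReal.toReal_mul, ENNReal.toReal_pow,
    ENNReal.toReal_ofReal (by norm_num)]
  simp only [ENNReal.coe_toReal, NNReal.coe_real_pi]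
  have := pi_le_four
  linarith

/-- An integral over the domain of a test function is bounded by the supremum norm. -/
lemma norm_integral_test_mul_le (hΓ : IsTestFunction z Λ Γ) {H : (ι → ℂ) → ℂ} {b : ℝ} (hb : 0 ≤ b)
    (hH : ∀ c, (∀ i, c i ∈ ball (z i) (1 / 25)) → ‖H c‖ ≤ b) :
    ‖∫ c : ι → ℂ, Γ c * H c‖ ≤ 2 * b := by
  have hi : ∀ i, Integrable ((ball (z i) (1 / 25)).indicator fun _ => (1 : ℝ)) := fun i =>
    (integrable_indicator_iff measurableSet_ball).2
      (integrableOn_const (measure_ball_lt_top.ne))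
  calc _ ≤ ∫ c : ι → ℂ, 2 * b * ∏ i, (ball (z i) (1 / 25)).indicator (fun _ => (1 : ℝ)) (c i) := by
        refine norm_integral_le_of_norm_le ((Integrable.fintype_prod hi).const_mul _)
          (ae_of_all _ fun c => ?_)
        by_cases h0 : Γ c = 0
        · rw [h0, zero_mul, norm_zero]
          exact mul_nonneg (by positivity) (Finset.prod_nonneg fun i _ =>
            Set.indicator_nonneg (fun _ _ => zero_le_one) _)
        · have hmem := hΓ.mem_ball c h0
          rw [Finset.prod_congr rfl fun i _ => Set.indicator_of_mem (hmem i) _,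
            Finset.prod_const_one, mul_one, norm_mul]
          exact mul_le_mul (hΓ.norm_le c) (hH c hmem) (norm_nonneg _) zero_le_two
    _ ≤ 2 * b * 1 := by
        rw [integral_const_mul]
        refine mul_le_mul_of_nonneg_left ?_ (by positivity)
        rw [integral_fintype_prod_volume_eq_prod
          fun i => (ball (z i) (1 / 25)).indicator fun _ => (1 : ℝ)]
        refine Finset.prod_le_one (fun i _ => integral_nonneg fun c =>
          Set.indicator_nonneg (fun _ _ => zero_le_one) _) fun i _ => ?_
        rw [integral_indicator_const _ measurableSet_ball, smul_eq_mul, mul_one]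
        exact volume_real_ball_le _
    _ = 2 * b := mul_one _

lemma norm_smoothSum_le (hΓ : IsTestFunction z Λ Γ) {v : ℂ → ℝ} {T : ℝ} (hT : ∀ w, |v w| ≤ T)
    (hR : 0 < R) : ‖smoothSum Γ R v‖ ≤ 2 * (2 * T / (logMass * R ^ 2)) ^ Fintype.card ι := by
  have hJ := logMass_pos
  have hT0 : 0 ≤ T := (abs_nonneg _).trans (hT 0)
  refine norm_integral_test_mul_le hΓ (by positivity) fun c _ => ?_
  rw [norm_prod, ← Finset.card_univ, ← Finset.prod_const]
  refine Finset.prod_le_prod (fun _ _ => norm_nonneg _) fun i _ => ?_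
  rw [Complex.norm_real]
  exact abs_circleIncr_le hT hR _

end Stability

/-! ### Comparison of the logarithm with the truncated logarithm -/

section Compare

open Metric Real

lemma abs_sin_sub_self_le (x : ℝ) : |sin x - x| ≤ 2 * x ^ 2 := by
  rw [← sq_abs]
  rcases le_total |x| 1 with h | h
  · rw [abs_sub_comm]
    have := abs_sub_sin_le x
    nlinarith [abs_nonneg x, sq_nonneg |x|]
  · have := (abs_sub (sin x) x).trans (add_le_add_left (abs_sin_le_one x) _)
    nlinarith

variable {T β V : ℝ} {u : ℂ}

lemma abs_log_sub_truncLog_le (hT : 1 ≤ T) (hβ : 0 < β) (hV : 0 < V) (hu : u ≠ 0) :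
    |log ‖u‖ - truncLog T (β ^ 2 * V) u| ≤ β + 4 * (log ‖u‖ ^ 2 + β ^ 2) / T +
      if ‖u‖ ≤ √β * √V then 2 * T else 0 := by
  have hu0 : 0 < ‖u‖ := norm_pos_iff.2 hu
  have hT0 : 0 < T := by linarith
  split_ifs with h
  · have h1 := abs_truncLog_le (b := β ^ 2 * V) hT0.le u
    have h2 : |log ‖u‖| ≤ log ‖u‖ ^ 2 / T + T := by
      rw [← sq_abs, ← sub_le_iff_le_add, le_div_iff₀ hT0]
      nlinarith [sq_nonneg (|log ‖u‖| - T), abs_nonneg (log ‖u‖)]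
    have h3 : log ‖u‖ ^ 2 / T ≤ 4 * (log ‖u‖ ^ 2 + β ^ 2) / T := by
      gcongr
      nlinarith [sq_nonneg (log ‖u‖), sq_nonneg β]
    have := abs_sub (log ‖u‖) (truncLog T (β ^ 2 * V) u)
    linarith
  · push Not at h
    have hsq : β * V ≤ ‖u‖ ^ 2 := by
      have := pow_le_pow_left₀ (by positivity) h.le 2
      rwa [mul_pow, sq_sqrt hβ.le, sq_sqrt hV.le] at this
    set y := 1 / 2 * log (‖u‖ ^ 2 + β ^ 2 * V) with hy
    have hy1 : log ‖u‖ ≤ y := by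
      have : log ‖u‖ = 1 / 2 * log (‖u‖ ^ 2) := by rw [log_pow]; push_cast; ring
      rw [this, hy]
      gcongr
      nlinarith [mul_pos (pow_pos hβ 2) hV]
    have hy2 : y ≤ log ‖u‖ + β / 2 := by
      have h1 : ‖u‖ ^ 2 + β ^ 2 * V ≤ ‖u‖ ^ 2 * (1 + β) := by nlinarith
      have h2 : log (‖u‖ ^ 2 * (1 + β)) = 2 * log ‖u‖ + log (1 + β) := by
        rw [log_mul (by positivity) (by positivity), log_pow]; push_cast; ring
      have h3 : log (1 + β) ≤ β := by linarith [log_le_sub_one_of_pos (show 0 < 1 + β by linarith)]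
      have h4 : log (‖u‖ ^ 2 + β ^ 2 * V) ≤ log (‖u‖ ^ 2 * (1 + β)) := log_le_log (by positivity) h1
      rw [hy]
      linarith
    have h5 : |T * sin (y / T) - y| ≤ 2 * y ^ 2 / T := by
      have : T * sin (y / T) - y = T * (sin (y / T) - y / T) := by field_simp
      rw [this, abs_mul, abs_of_pos hT0]
      refine (mul_le_mul_of_nonneg_left (abs_sin_sub_self_le (y / T)) hT0.le).trans (le_of_eq ?_)
      field_simp
    have h6 : 2 * y ^ 2 / T ≤ 4 * (log ‖u‖ ^ 2 + β ^ 2) / T := by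
      refine div_le_div_of_nonneg_right ?_ hT0.le
      have : y ^ 2 ≤ 2 * log ‖u‖ ^ 2 + 2 * (y - log ‖u‖) ^ 2 := by
        nlinarith [sq_nonneg (y - 2 * log ‖u‖)]
      have : (y - log ‖u‖) ^ 2 ≤ (β / 2) ^ 2 :=
        pow_le_pow_left₀ (by linarith) (by linarith) 2
      nlinarith
    rw [truncLog, add_zero]
    rw [abs_le] at h5 ⊢
    constructor <;> linarith [h5.1, h5.2]

lemma abs_truncLog_le_abs_log (hT : 0 < T) (hβ : 0 < β) (hβ' : β ≤ 1) (hV : 0 < V) (hu : u ≠ 0)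
    {q : ℝ} (hq : 0 ≤ q) (hVq : V ≤ exp (2 * q)) :
    |truncLog T (β ^ 2 * V) u| ≤ |log ‖u‖| + q + 1 := by
  have hu0 : 0 < ‖u‖ := norm_pos_iff.2 hu
  have hbV : 0 < β ^ 2 * V := by positivity
  set y := 1 / 2 * log (‖u‖ ^ 2 + β ^ 2 * V) with hy
  have h1 : |truncLog T (β ^ 2 * V) u| ≤ |y| := by
    rw [truncLog, abs_mul, abs_of_pos hT]
    have h2 : |sin (y / T)| ≤ |y / T| := by
      have := abs_sin_sub_sin_le (y / T) 0
      simpa using this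
    calc T * |sin (y / T)| ≤ T * |y / T| := by gcongr
      _ = |y| := by rw [abs_div, abs_of_pos hT]; field_simp
  refine h1.trans (abs_le.2 ⟨?_, ?_⟩)
  · have : log ‖u‖ ≤ y := by
      have : log ‖u‖ = 1 / 2 * log (‖u‖ ^ 2) := by rw [log_pow]; push_cast; ring
      rw [this, hy]
      have := log_le_log (by positivity) (show ‖u‖ ^ 2 ≤ ‖u‖ ^ 2 + β ^ 2 * V by linarith)
      linarith
    linarith [neg_abs_le (log ‖u‖)]
  · have hle : ‖u‖ ^ 2 + β ^ 2 * V ≤ exp (2 * (|log ‖u‖| + q + 1)) := by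
      have k1 : ‖u‖ ^ 2 ≤ exp (2 * (|log ‖u‖| + q)) := by
        have e : ‖u‖ ^ 2 = exp (2 * log ‖u‖) := by rw [two_mul, exp_add, exp_log hu0]; ring
        rw [e]
        exact exp_le_exp.2 (by linarith [le_abs_self (log ‖u‖)])
      have k2 : β ^ 2 * V ≤ exp (2 * (|log ‖u‖| + q)) := by
        calc β ^ 2 * V ≤ 1 * V := by gcongr; nlinarith
          _ ≤ exp (2 * q) := by rw [one_mul]; exact hVq
          _ ≤ _ := by gcongr; linarith [abs_nonneg (log ‖u‖)]
      have k3 : exp (2 * (|log ‖u‖| + q + 1)) = exp (2 * (|log ‖u‖| + q)) * exp 2 := by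
        rw [← exp_add]; congr 1; ring
      rw [k3]
      have k4 : (2 : ℝ) ≤ exp 2 := by linarith [add_one_le_exp (2 : ℝ)]
      nlinarith [exp_pos (2 * (|log ‖u‖| + q))]
    have := log_le_log (by positivity) hle
    rw [log_exp] at this
    rw [hy]
    linarith

variable {f : ℂ → ℂ} {z : ℂ} {Q : ℝ}

lemma volume_real_ball_fifth_le (z : ℂ) : (volume : Measure ℂ).real (ball z (1 / 5)) ≤ 1 := by
  rw [Measure.real, Complex.volume_ball, ENNReal.toReal_mul, ENNReal.toReal_pow,
    ENNReal.toReal_ofReal (by norm_num)]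
  simp only [ENNReal.coe_toReal, NNReal.coe_real_pi]
  have := pi_le_four
  linarith

lemma integrableOn_const_ball (z : ℂ) (r c : ℝ) : IntegrableOn (fun _ => c) (ball z r) :=
  integrableOn_const measure_ball_lt_top.ne

lemma integral_const_ball_le (z : ℂ) {c : ℝ} (hc : 0 ≤ c) : ∫ _ in ball z (1 / 5), c ≤ c := by
  rw [setIntegral_const, smul_eq_mul]
  exact mul_le_of_le_one_left hc (volume_real_ball_fifth_le z)

namespace LogBounded

lemma aestronglyMeasurable_log (h : LogBounded f z Q) {r : ℝ} (hr : r ≤ 2) :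
    AEStronglyMeasurable (fun w => log ‖f w‖) (volume.restrict (ball z r)) := by
  have h1 : ContinuousOn f (ball z r) := (h.analytic.mono (ball_subset_ball hr)).continuousOn
  exact (measurable_log.comp_aemeasurable
    (h1.aemeasurable measurableSet_ball).norm).aestronglyMeasurable

lemma integrableOn_log_sq (h : LogBounded f z Q) :
    IntegrableOn (fun w => log ‖f w‖ ^ 2) (ball z (1 / 5)) := by
  refine ⟨(h.aestronglyMeasurable_log (by norm_num)).pow 2, ?_⟩
  rw [hasFiniteIntegral_iff_ofReal (ae_of_all _ fun w => sq_nonneg _)]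
  exact h.setLIntegral_log_sq_le.trans_lt ENNReal.ofReal_lt_top

lemma integral_log_sq_le (h : LogBounded f z Q) :
    ∫ w in ball z (1 / 5), log ‖f w‖ ^ 2 ≤ 10 ^ 6 * Q ^ 2 := by
  rw [integral_eq_lintegral_of_nonneg_ae (ae_of_all _ fun w => sq_nonneg _)
    ((h.aestronglyMeasurable_log (by norm_num)).pow 2)]
  exact ENNReal.toReal_le_of_le_ofReal (by positivity) h.setLIntegral_log_sq_le

lemma integrableOn_log (h : LogBounded f z Q) :
    IntegrableOn (fun w => log ‖f w‖) (ball z (1 / 5)) := by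
  refine Integrable.mono' (h.integrableOn_log_sq.add (integrableOn_const_ball z (1 / 5) 1))
    (h.aestronglyMeasurable_log (by norm_num)) (ae_of_all _ fun w => ?_)
  rw [norm_eq_abs, Pi.add_apply, ← sq_abs]
  nlinarith [sq_nonneg (|log ‖f w‖| - 1), abs_nonneg (log ‖f w‖)]

lemma integral_abs_log_le (h : LogBounded f z Q) :
    ∫ w in ball z (1 / 5), |log ‖f w‖| ≤ 10 ^ 6 * Q + Q := by
  have hQ : 0 < Q := zero_lt_one.trans_le h.one_le
  calc _ ≤ ∫ w in ball z (1 / 5), (log ‖f w‖ ^ 2 / Q + Q) := by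
        refine integral_mono h.integrableOn_log.abs ((h.integrableOn_log_sq.div_const _).add
          (integrableOn_const_ball z _ _)) fun w => ?_
        simp only
        rw [← sq_abs, ← sub_le_iff_le_add, le_div_iff₀ hQ]
        nlinarith [sq_nonneg (|log ‖f w‖| - Q), abs_nonneg (log ‖f w‖)]
    _ = (∫ w in ball z (1 / 5), log ‖f w‖ ^ 2) / Q + ∫ _ in ball z (1 / 5), Q := by
        rw [integral_add (h.integrableOn_log_sq.div_const _) (integrableOn_const_ball z _ _),
          integral_div]
    _ ≤ 10 ^ 6 * Q ^ 2 / Q + Q := by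
        gcongr
        · exact h.integral_log_sq_le
        · exact integral_const_ball_le z hQ.le
    _ = _ := by field_simp

variable {W : ℂ → ℝ}

lemma ae_ne_zero_fifth (h : LogBounded f z Q) : ∀ᵐ w ∂volume.restrict (ball z (1 / 5)), f w ≠ 0 :=
  ae_restrict_of_ae_restrict_of_subset (ball_subset_ball (by norm_num)) h.ae_ne_zero

lemma integral_abs_truncLog_le (h : LogBounded f z Q) (hT : 1 ≤ T) (hβ : 0 < β) (hβ' : β ≤ 1)
    (hW : ∀ w, 0 < W w) (hWq : ∀ w ∈ ball z (1 / 5), W w ≤ exp (2 * (Q + 4)))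
    (hi : IntegrableOn (fun w => truncLog T (β ^ 2 * W w) (f w)) (ball z (1 / 5))) :
    ∫ w in ball z (1 / 5), |truncLog T (β ^ 2 * W w) (f w)| ≤ 2 * 10 ^ 6 * Q := by
  have hQ := h.one_le
  calc _ ≤ ∫ w in ball z (1 / 5), (|log ‖f w‖| + (Q + 5)) := by
        refine integral_mono_ae hi.abs (h.integrableOn_log.abs.add
          (integrableOn_const_ball z _ _)) ?_
        filter_upwards [h.ae_ne_zero_fifth, ae_restrict_mem measurableSet_ball] with w hw hwb
        have := abs_truncLog_le_abs_log (T := T) (by linarith) hβ hβ' (hW w) hw (by linarith)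
          (hWq w hwb)
        linarith
    _ = (∫ w in ball z (1 / 5), |log ‖f w‖|) + ∫ _ in ball z (1 / 5), (Q + 5) :=
        integral_add h.integrableOn_log.abs (integrableOn_const_ball z _ _)
    _ ≤ (10 ^ 6 * Q + Q) + (Q + 5) :=
        add_le_add h.integral_abs_log_le (integral_const_ball_le z (by linarith))
    _ ≤ _ := by linarith

lemma integral_abs_log_sub_truncLog_le (h : LogBounded f z Q) (hT : 1 ≤ T) (hβ : 0 < β)
    (hβ' : β ≤ 1) (hW : ∀ w, 0 < W w)
    (hi : IntegrableOn (fun w => truncLog T (β ^ 2 * W w) (f w)) (ball z (1 / 5)))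
    (hm : MeasurableSet {w | w ∈ ball z (1 / 5) ∧ ‖f w‖ ≤ √β * √(W w)}) :
    ∫ w in ball z (1 / 5), |log ‖f w‖ - truncLog T (β ^ 2 * W w) (f w)| ≤
      β + 10 ^ 7 * Q ^ 2 / T +
        2 * T * volume.real {w | w ∈ ball z (1 / 5) ∧ ‖f w‖ ≤ √β * √(W w)} := by
  have hQ := h.one_le
  have hT0 : 0 < T := by linarith
  set E := {w | w ∈ ball z (1 / 5) ∧ ‖f w‖ ≤ √β * √(W w)} with hE
  have hEi : IntegrableOn (E.indicator fun _ => 2 * T) (ball z (1 / 5)) :=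
    (integrableOn_const_ball z (1 / 5) (2 * T)).indicator hm
  have hi2 : IntegrableOn (fun w => log ‖f w‖ ^ 2 + β ^ 2) (ball z (1 / 5)) :=
    h.integrableOn_log_sq.add (integrableOn_const_ball z _ _)
  have hi3 : IntegrableOn (fun w => 4 * (log ‖f w‖ ^ 2 + β ^ 2) / T) (ball z (1 / 5)) :=
    (hi2.const_mul 4).div_const T
  have hi1 : IntegrableOn (fun w => β + 4 * (log ‖f w‖ ^ 2 + β ^ 2) / T) (ball z (1 / 5)) :=
    (integrableOn_const_ball z _ _).add hi3
  have hEint : ∫ w in ball z (1 / 5), E.indicator (fun _ => 2 * T) w = volume.real E * (2 * T) := by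
    rw [integral_indicator hm, setIntegral_const, measureReal_restrict_apply' measurableSet_ball,
      Set.inter_eq_left.2 (fun w hw => hw.1), smul_eq_mul]
  calc _ ≤ ∫ w in ball z (1 / 5), (β + 4 * (log ‖f w‖ ^ 2 + β ^ 2) / T +
          E.indicator (fun _ => 2 * T) w) := by
        refine integral_mono_ae (h.integrableOn_log.sub hi).abs (hi1.add hEi) ?_
        filter_upwards [h.ae_ne_zero_fifth, ae_restrict_mem measurableSet_ball] with w hw hwb
        have := abs_log_sub_truncLog_le hT hβ (hW w) hw
        refine this.trans (le_of_eq ?_)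
        congr 1
        by_cases hc : ‖f w‖ ≤ √β * √(W w)
        · rw [if_pos hc, Set.indicator_of_mem (show w ∈ E from ⟨hwb, hc⟩)]
        · rw [if_neg hc, Set.indicator_of_notMem (fun hE => hc hE.2)]
    _ = ((∫ _ in ball z (1 / 5), β) + 4 * ((∫ w in ball z (1 / 5), log ‖f w‖ ^ 2) +
          ∫ _ in ball z (1 / 5), β ^ 2) / T) + volume.real E * (2 * T) := by
        rw [integral_add hi1 hEi, integral_add (integrableOn_const_ball z _ _) hi3, integral_div, integral_const_mul, integral_add h.integrableOn_log_sq
          (integrableOn_const_ball z _ _), hEint]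
    _ ≤ (β + 4 * (10 ^ 6 * Q ^ 2 + β ^ 2) / T) + volume.real E * (2 * T) := by
        gcongr
        · exact integral_const_ball_le z hβ.le
        · exact h.integral_log_sq_le
        · exact integral_const_ball_le z (by positivity)
    _ ≤ _ := by
        have : 4 * (10 ^ 6 * Q ^ 2 + β ^ 2) / T ≤ 10 ^ 7 * Q ^ 2 / T := by
          refine div_le_div_of_nonneg_right ?_ hT0.le
          nlinarith
        linarith

end LogBounded

end Compare

/-! ### Universality of smoothed sums of truncated logarithms -/

section ExpectedSmoothSum

open Metric Real

variable {R T : ℝ} {ι : Type*} [Fintype ι]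

/-- The measure of integration over tuples of angles. -/
noncomputable def angleMeasure (ι : Type*) [Fintype ι] : Measure (ι → ℝ) :=
  Measure.pi fun _ => volume.restrict (Set.Ioc 0 (2 * π))

instance : IsFiniteMeasure (angleMeasure ι) := by
  unfold angleMeasure
  infer_instance

lemma angleMeasure_real_univ : (angleMeasure ι).real Set.univ = (2 * π) ^ Fintype.card ι := by
  rw [Measure.real, angleMeasure, Measure.pi_univ]
  simp [Real.volume_Ioc, pi_pos.le]

/-- The product of the differences of `v` between the point at angle `θ i` on the circle of radius
`R` around `c i` and its centre. -/
noncomputable def incrProd (R : ℝ) (v : ℂ → ℝ) (c : ι → ℂ) (θ : ι → ℝ) : ℝ :=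
  ∏ i, (v (circleMap (c i) R (θ i)) - v (c i))

lemma prod_circleIncr_eq {v : ℂ → ℝ} (hv : Measurable v) (hT : ∀ w, |v w| ≤ T) (c : ι → ℂ) :
    ∏ i, circleIncr R v (c i) =
      ((logMass * R ^ 2)⁻¹ * (2 * π)⁻¹) ^ Fintype.card ι *
        ∫ θ, incrProd R v c θ ∂(angleMeasure ι) := by
  unfold incrProd
  rw [angleMeasure, integral_fintype_prod_eq_prod (fun i t => v (circleMap (c i) R t) - v (c i)),
    ← Finset.card_univ, ← Finset.prod_const, ← Finset.prod_mul_distrib]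
  refine Finset.prod_congr rfl fun i _ => ?_
  have hi : Integrable (fun t => v (circleMap (c i) R t)) (volume.restrict (Set.Ioc 0 (2 * π))) :=
    Integrable.of_bound (hv.comp (continuous_circleMap _ _).measurable).aestronglyMeasurable T
      (ae_of_all _ fun t => hT _)
  rw [integral_sub hi (integrable_const _), setIntegral_const, circleIncr, circleAverage_def,
    intervalIntegral.integral_of_le two_pi_pos.le, Real.volume_real_Ioc_of_le two_pi_pos.le,
    sub_zero, smul_eq_mul, smul_eq_mul, div_eq_inv_mul, mul_assoc, mul_sub (2 * π)⁻¹, ← mul_assoc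
    (2 * π)⁻¹ (2 * π), inv_mul_cancel₀ two_pi_pos.ne', one_mul]

variable {Ω Ω' : Type*} [MeasurableSpace Ω] [MeasurableSpace Ω']

lemma abs_incrProd_le {v : ℂ → ℝ} (hT : ∀ w, |v w| ≤ T) (c : ι → ℂ) (θ : ι → ℝ) :
    |incrProd R v c θ| ≤ (2 * T) ^ Fintype.card ι := by
  rw [incrProd, Finset.abs_prod, ← Finset.card_univ, ← Finset.prod_const]
  refine Finset.prod_le_prod (fun _ _ => abs_nonneg _) fun i _ => ?_
  exact (abs_sub _ _).trans (by linarith [hT (circleMap (c i) R (θ i)), hT (c i)])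

lemma measurable_incrProd {u : Ω → ℂ → ℝ} (hu : Measurable fun p : Ω × ℂ => u p.1 p.2)
    (c : ι → ℂ) : Measurable fun p : Ω × (ι → ℝ) => incrProd R (u p.1) c p.2 := by
  refine Finset.measurable_prod _ fun i _ => Measurable.sub (hu.comp (measurable_fst.prodMk ?_))
    (hu.comp (measurable_fst.prodMk measurable_const))
  exact (continuous_circleMap _ _).measurable.comp ((measurable_pi_apply i).comp measurable_snd)

variable {μ : Measure Ω} [IsProbabilityMeasure μ] {μ' : Measure Ω'} [IsProbabilityMeasure μ']

lemma integral_prod_circleIncr_eq {u : Ω → ℂ → ℝ} (hu : Measurable fun p : Ω × ℂ => u p.1 p.2)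
    (hT : ∀ ω w, |u ω w| ≤ T) (c : ι → ℂ) :
    ∫ ω, ∏ i, circleIncr R (u ω) (c i) ∂μ =
      ((logMass * R ^ 2)⁻¹ * (2 * π)⁻¹) ^ Fintype.card ι *
        ∫ θ, ∫ ω, incrProd R (u ω) c θ ∂μ ∂(angleMeasure ι) := by
  simp only [fun ω => prod_circleIncr_eq (R := R)
    (show Measurable (u ω) from hu.comp measurable_prodMk_left) (hT ω) c]
  rw [integral_const_mul, integral_integral_swap]
  exact Integrable.of_bound (measurable_incrProd hu c).aestronglyMeasurable _
    (ae_of_all _ fun p => abs_incrProd_le (hT p.1) c p.2)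

variable {z : ι → ℂ} {Λ : ℝ} {Γ : (ι → ℂ) → ℂ}

lemma integral_smoothSum_eq (hΓ : IsTestFunction z Λ Γ) {u : Ω → ℂ → ℝ}
    (hu : Measurable fun p : Ω × ℂ => u p.1 p.2) (hT : ∀ ω w, |u ω w| ≤ T) (hR : 0 < R) :
    ∫ ω, smoothSum Γ R (u ω) ∂μ =
      ∫ c : ι → ℂ, Γ c * ((∫ ω, ∏ i, circleIncr R (u ω) (c i) ∂μ : ℝ) : ℂ) := by
  have hm : Measurable fun q : Ω × (ι → ℂ) => Γ q.2 * ∏ i, (circleIncr R (u q.1) (q.2 i) : ℂ) := by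
    refine Measurable.mul (hΓ.continuous.measurable.comp measurable_snd)
      (Finset.measurable_prod _ fun i _ => Complex.measurable_ofReal.comp ?_)
    exact (measurable_circleIncr hu).comp
      (measurable_fst.prodMk ((measurable_pi_apply i).comp measurable_snd))
  have hΓi : Integrable Γ := by
    have := integrable_test_mul_prod hΓ (g := fun _ _ => 1) fun i =>
      integrableOn_const_ball (z i) (1 / 25) 1
    simpa using this
  simp only [smoothSum]
  rw [integral_integral_swap]
  · refine integral_congr_ae (ae_of_all _ fun c => ?_)
    simp only
    rw [integral_const_mul, ← integral_complex_ofReal]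
    simp only [Complex.ofReal_prod]
  · refine Integrable.mono' ((hΓi.norm.comp_snd μ).const_mul
      ((2 * T / (logMass * R ^ 2)) ^ Fintype.card ι)) hm.aestronglyMeasurable
      (ae_of_all _ fun p => ?_)
    simp only [Function.uncurry]
    rw [norm_mul, mul_comm]
    gcongr
    rw [norm_prod, ← Finset.card_univ, ← Finset.prod_const]
    refine Finset.prod_le_prod (fun _ _ => norm_nonneg _) fun i _ => ?_
    rw [Complex.norm_real]
    exact abs_circleIncr_le (hT p.1) hR _

lemma integrable_test_mul_expectation (hΓ : IsTestFunction z Λ Γ) {u : Ω → ℂ → ℝ}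
    (hu : Measurable fun p : Ω × ℂ => u p.1 p.2) (hT : ∀ ω w, |u ω w| ≤ T) (hR : 0 < R) :
    Integrable fun c : ι → ℂ => Γ c * ((∫ ω, ∏ i, circleIncr R (u ω) (c i) ∂μ : ℝ) : ℂ) := by
  have hΓi : Integrable Γ := by
    have := integrable_test_mul_prod hΓ (g := fun _ _ => 1) fun i =>
      integrableOn_const_ball (z i) (1 / 25) 1
    simpa using this
  refine hΓi.mul_bdd (c := (2 * T / (logMass * R ^ 2)) ^ Fintype.card ι) ?_
    (ae_of_all _ fun c => ?_)
  · refine (Complex.measurable_ofReal.comp ?_).aestronglyMeasurable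
    have h1 : Measurable fun q : (ι → ℂ) × Ω => ∏ i, circleIncr R (u q.2) (q.1 i) :=
      Finset.measurable_prod _ fun i _ => (measurable_circleIncr hu).comp
        (measurable_snd.prodMk ((measurable_pi_apply i).comp measurable_fst))
    exact (h1.stronglyMeasurable.integral_prod_right (ν := μ)).measurable
  · rw [Complex.norm_real]
    refine (norm_integral_le_of_norm_le_const (C := (2 * T / (logMass * R ^ 2)) ^ Fintype.card ι)
      (ae_of_all _ fun ω => ?_)).trans (by simp)
    rw [norm_prod, ← Finset.card_univ, ← Finset.prod_const]
    exact Finset.prod_le_prod (fun _ _ => norm_nonneg _) fun i _ => abs_circleIncr_le (hT ω) hR _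

lemma integrable_expectation_incrProd {u : Ω → ℂ → ℝ}
    (hu : Measurable fun p : Ω × ℂ => u p.1 p.2) (hT : ∀ ω w, |u ω w| ≤ T) (c : ι → ℂ) :
    Integrable (fun θ => ∫ ω, incrProd R (u ω) c θ ∂μ) (angleMeasure ι) := by
  refine Integrable.of_bound (C := (2 * T) ^ Fintype.card ι) ?_ (ae_of_all _ fun θ => ?_)
  · have h1 : Measurable fun q : (ι → ℝ) × Ω => incrProd R (u q.2) c q.1 :=
      (measurable_incrProd hu c).comp measurable_swap
    exact (h1.stronglyMeasurable.integral_prod_right (ν := μ)).aestronglyMeasurable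
  · exact (norm_integral_le_of_norm_le_const (C := (2 * T) ^ Fintype.card ι)
      (ae_of_all _ fun ω => abs_incrProd_le (hT ω) c θ)).trans (by simp)

/-- If the expected products of increments of two random functions are close, then so are the
expected smoothed sums. -/
lemma norm_integral_smoothSum_sub_le (hΓ : IsTestFunction z Λ Γ) {u : Ω → ℂ → ℝ} {u' : Ω' → ℂ → ℝ}
    (hu : Measurable fun p : Ω × ℂ => u p.1 p.2) (hu' : Measurable fun p : Ω' × ℂ => u' p.1 p.2)
    (hT : ∀ ω w, |u ω w| ≤ T) (hT' : ∀ ω w, |u' ω w| ≤ T) (hR : 0 < R) {e : ℝ} (he : 0 ≤ e)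
    (hclose : ∀ c : ι → ℂ, (∀ i, c i ∈ ball (z i) (1 / 25)) → ∀ θ,
      |∫ ω, incrProd R (u ω) c θ ∂μ - ∫ ω, incrProd R (u' ω) c θ ∂μ'| ≤ e) :
    ‖∫ ω, smoothSum Γ R (u ω) ∂μ - ∫ ω, smoothSum Γ R (u' ω) ∂μ'‖ ≤
      2 * ((logMass * R ^ 2)⁻¹ ^ Fintype.card ι * e) := by
  have hJ := logMass_pos
  rw [integral_smoothSum_eq hΓ hu hT hR, integral_smoothSum_eq hΓ hu' hT' hR,
    ← integral_sub (integrable_test_mul_expectation hΓ hu hT hR)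
    (integrable_test_mul_expectation hΓ hu' hT' hR)]
  simp only [← mul_sub]
  refine norm_integral_test_mul_le hΓ (by positivity) fun c hc => ?_
  rw [← Complex.ofReal_sub, Complex.norm_real, norm_eq_abs, integral_prod_circleIncr_eq hu hT,
    integral_prod_circleIncr_eq hu' hT', ← mul_sub, abs_mul, abs_of_pos (by positivity), mul_pow,
    mul_assoc]
  gcongr
  rw [← integral_sub (integrable_expectation_incrProd hu hT c)
    (integrable_expectation_incrProd hu' hT' c)]
  have h1 := norm_integral_le_of_norm_le_const (μ := angleMeasure ι) (C := e)
    (f := fun θ => ∫ ω, incrProd R (u ω) c θ ∂μ - ∫ ω, incrProd R (u' ω) c θ ∂μ') (ae_of_all _ fun θ => hclose c hc θ)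
  rw [angleMeasure_real_univ, norm_eq_abs] at h1
  calc _ ≤ (2 * π)⁻¹ ^ Fintype.card ι * (e * (2 * π) ^ Fintype.card ι) := by gcongr
    _ = e := by
      rw [inv_pow]
      field_simp

end ExpectedSmoothSum

section TruncField

open Metric Real

variable {J Ω Ω' : Type*} [MeasurableSpace Ω] [MeasurableSpace Ω'] {μ : Measure Ω}
  {μ' : Measure Ω'} [IsProbabilityMeasure μ] [IsProbabilityMeasure μ'] {ξ : J → Ω → ℝ}
  {ξ' : J → Ω' → ℝ} {τ ε : ℝ} {φ : J → ℂ → ℂ} {s : ℕ → Finset J} {U : Set ℂ} {F : Ω → ℂ → ℂ}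
  {F' : Ω' → ℂ → ℂ}

/-- The scale `∑ |φ_j|²` of the series on `U`, set to `1` where it vanishes (so that no division by
zero occurs) and off `U`. -/
noncomputable def scale (φ : J → ℂ → ℂ) (U : Set ℂ) (w : ℂ) : ℝ :=
  open Classical in if w ∈ U ∧ 0 < ∑' j, ‖φ j w‖ ^ 2 then ∑' j, ‖φ j w‖ ^ 2 else 1

lemma scale_pos (w : ℂ) : 0 < scale φ U w := by
  unfold scale
  split_ifs with h
  · exact h.2
  · exact one_pos

lemma scale_eq {w : ℂ} (hw : w ∈ U) (h : 0 < ∑' j, ‖φ j w‖ ^ 2) :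
    scale φ U w = ∑' j, ‖φ j w‖ ^ 2 := if_pos ⟨hw, h⟩

lemma le_scale {w : ℂ} (hw : w ∈ U) : ∑' j, ‖φ j w‖ ^ 2 ≤ scale φ U w := by
  by_cases h : 0 < ∑' j, ‖φ j w‖ ^ 2
  · rw [scale_eq hw h]
  · exact (not_lt.1 h).trans (scale_pos w).le

/-- On the disk of radius one around `z`, the series `∑ |φ_j|²` converges and no term dominates it.
-/
structure IsDelocalized (φ : J → ℂ → ℂ) (η : ℝ) (z : ℂ) : Prop where
  summable : ∀ w ∈ ball z 1, Summable fun j => ‖φ j w‖ ^ 2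
  norm_le : ∀ w ∈ ball z 1, ∀ j, ‖φ j w‖ ≤ η * √(∑' i, ‖φ i w‖ ^ 2)

lemma IsAnalyticSeries.measurable_scale [Countable J] (h : IsAnalyticSeries τ ε μ ξ φ s U F) :
    Measurable (scale φ U) := by
  classical
  have h1 : ∀ j, Measurable (U.indicator (φ j)) := fun j => by
    rw [← Set.piecewise_eq_indicator]
    exact (h.analytic_coeff j).continuousOn.measurable_piecewise continuousOn_const
      h.isOpen.measurableSet
  have h2 : Measurable fun w => ∑' j, ‖U.indicator (φ j) w‖ ^ 2 := by
    have e : (fun w => ∑' j, ‖U.indicator (φ j) w‖ ^ 2) =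
        fun w => (∑' j, ‖U.indicator (φ j) w‖ₑ ^ 2).toReal := by
      ext w
      rw [ENNReal.tsum_toReal_eq fun j => by finiteness]
      simp
    rw [e]
    exact (Measurable.tsum fun j => (h1 j).enorm.pow_const 2).ennreal_toReal
  have e : scale φ U = fun w => if w ∈ U ∩ {w | 0 < ∑' j, ‖U.indicator (φ j) w‖ ^ 2} then
      ∑' j, ‖U.indicator (φ j) w‖ ^ 2 else 1 := by
    ext w
    by_cases hw : w ∈ U
    · simp [scale, hw]
    · simp [scale, hw]
  rw [e]
  exact Measurable.ite (h.isOpen.measurableSet.inter (measurableSet_lt measurable_const h2)) h2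
    measurable_const

/-- The truncated logarithm of the series, at the scale `β² ∑ |φ_j|²`. -/
noncomputable def truncField (T β : ℝ) (φ : J → ℂ → ℂ) (U : Set ℂ) (f : ℂ → ℂ) (w : ℂ) : ℝ :=
  truncLog T (β ^ 2 * scale φ U w) (U.indicator f w)

variable {T β : ℝ}

lemma abs_truncField_le (hT : 0 ≤ T) (f : ℂ → ℂ) (w : ℂ) : |truncField T β φ U f w| ≤ T :=
  abs_truncLog_le hT _

lemma IsAnalyticSeries.measurable_truncField [Countable J]
    (h : IsAnalyticSeries τ ε μ ξ φ s U F) :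
    Measurable fun p : Ω × ℂ => truncField T β φ U (F p.1) p.2 := by
  unfold truncField truncLog
  have h1 := h.measurable_indicator
  have h2 : Measurable fun p : Ω × ℂ => scale φ U p.2 := h.measurable_scale.comp measurable_snd
  exact (measurable_sin.comp (((measurable_log.comp ((h1.norm.pow_const 2).add
    (h2.const_mul _))).const_mul _).div_const _)).const_mul _

/-- The bound of Lindeberg's argument for `m` pairs of points and at most `N` exceptional indices. -/
noncomputable def exchangeError (m N : ℕ) (τ ε T β η : ℝ) : ℝ :=
  (400 * T) ^ m * (4 * τ * (√(2 * m) * η / β) ^ ε * (2 * m / β ^ 2) +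
    N * (2 + τ) * (√(2 * m) * η / β))

variable {ι : Type*} [Fintype ι] {z : ι → ℂ} {Λ η R : ℝ} {Γ : (ι → ℂ) → ℂ}

/-- Universality of the smoothed sums of truncated logarithms. -/
lemma norm_integral_smoothSum_truncField_sub_le [Countable J]
    (h : IsAnalyticSeries τ ε μ ξ φ s U F) (h' : IsAnalyticSeries τ ε μ' ξ' φ s U F') (hτ : 0 < τ)
    (hε₀ : 0 < ε) (hε₁ : ε < 1) (hT : 1 ≤ T) (hβ : 0 < β) (hη : 0 ≤ η)
    (hz : ∀ i, ball (z i) 2 ⊆ U) (hd : ∀ i, IsDelocalized φ η (z i)) (X : Finset J)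
    (hX : ∀ j ∉ X, ∫ x, x ∂(μ.map (ξ j)) = ∫ x, x ∂(μ'.map (ξ' j)))
    (hX' : ∀ j ∈ X, |∫ x, x ∂(μ.map (ξ j)) - ∫ x, x ∂(μ'.map (ξ' j))| ≤ τ)
    (hΓ : IsTestFunction z Λ Γ) (hR : 0 < R) (hR' : R ≤ 1 / 10) :
    ‖∫ ω, smoothSum Γ R (truncField T β φ U (F ω)) ∂μ -
        ∫ ω, smoothSum Γ R (truncField T β φ U (F' ω)) ∂μ'‖ ≤
      2 * ((logMass * R ^ 2)⁻¹ ^ Fintype.card ι *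
        exchangeError (Fintype.card ι) X.card τ ε T β η) := by
  have hT0 : 0 ≤ T := by linarith
  refine norm_integral_smoothSum_sub_le hΓ h.measurable_truncField h'.measurable_truncField
    (fun ω => abs_truncField_le hT0 _) (fun ω => abs_truncField_le hT0 _) hR
    (by unfold exchangeError; positivity) fun c hc θ => ?_
  -- the `2 m` points at which the series enter
  set p : ι × Bool → ℂ := fun q => if q.2 then circleMap (c q.1) R (θ q.1) else c q.1 with hp
  have hpz : ∀ q, p q ∈ ball (z q.1) 1 := by
    intro q
    have h1 := hc q.1
    simp only [hp]
    split_ifs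
    · have h2 : circleMap (c q.1) R (θ q.1) ∈ closedBall (c q.1) R :=
        circleMap_mem_closedBall _ hR.le _
      rw [mem_ball] at h1
      exact closedBall_subset_ball' (by linarith) h2
    · exact ball_subset_ball (by norm_num) h1
  have hpU : ∀ q, p q ∈ U := fun q => hz q.1 (ball_subset_ball (by norm_num) (hpz q))
  have hsq : ∀ q, √(∑' i, ‖φ i (p q)‖ ^ 2) ≤ √(scale φ U (p q)) := fun q =>
    sqrt_le_sqrt (le_scale (hpU q))
  have key := abs_integral_truncLogProd_sub_le h.normalized h'.normalized hτ hε₀ hε₁ hT hβ hη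
    (a := fun j q => φ j (p q)) (V := fun q => scale φ U (p q)) (fun q => scale_pos _)
    (fun q t => (((hd q.1).summable _ (hpz q)).sum_le_tsum t fun j _ => by positivity).trans
      (le_scale (hpU q)))
    (fun j q => ((hd q.1).norm_le _ (hpz q) j).trans (mul_le_mul_of_nonneg_left (hsq q) hη))
    X hX hX' (s := s) (F := fun ω q => F ω (p q)) (F' := fun ω q => F' ω (p q))
    (fun ω q => h.tendsto ω _ (hpU q)) (fun ω q => h'.tendsto ω _ (hpU q))
  have e : ∀ f : ℂ → ℂ, incrProd R (truncField T β φ U f) c θ =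
      truncLogProd T (fun q => β ^ 2 * scale φ U (p q)) fun q => f (p q) := by
    intro f
    refine Finset.prod_congr rfl fun i _ => ?_
    have h1 := hpU (i, true)
    have h2 := hpU (i, false)
    simp only [hp, if_true, Bool.false_eq_true, if_false] at h1 h2
    simp [truncField, hp, h1, h2]
  simp only [e]
  exact key

end TruncField

/-! ### Comparison of root sums and smoothed sums on a good event -/

section GoodEvent

open Metric Real

variable {J Ω : Type*} [MeasurableSpace Ω] {μ : Measure Ω} [IsProbabilityMeasure μ] {ξ : J → Ω → ℝ}
  {τ ε : ℝ} {φ : J → ℂ → ℂ} {s : ℕ → Finset J} {U : Set ℂ} {F : Ω → ℂ → ℂ} {z : ℂ} {Q η : ℝ}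
  {E : Set Ω}

omit [IsProbabilityMeasure μ] in
lemma IsAnalyticSeries.ae_tsum_pos (h : IsAnalyticSeries τ ε μ ξ φ s U F) (hz : ball z 2 ⊆ U)
    (hd : IsDelocalized φ η z) {ω : Ω} (hω : LogBounded (F ω) z Q) :
    ∀ᵐ w ∂volume.restrict (ball z (1 / 5)), 0 < ∑' j, ‖φ j w‖ ^ 2 := by
  filter_upwards [hω.ae_ne_zero_fifth, ae_restrict_mem measurableSet_ball] with w hw hwz
  by_contra hV
  have hw1 : w ∈ ball z 1 := ball_subset_ball (by norm_num) hwz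
  have h0 : ∑' j, ‖φ j w‖ ^ 2 = 0 := le_antisymm (not_lt.1 hV) (tsum_nonneg fun _ => by positivity)
  have h1 : ∀ j, φ j w = 0 := fun j => by
    have := ((hd.summable w hw1).hasSum_iff.2 h0)
    have := (hasSum_zero_iff_of_nonneg (fun _ => by positivity)).1 this
    simpa using congrFun this j
  have h2 := h.tendsto ω w (hz (ball_subset_ball (by norm_num) hwz))
  simp only [h1, mul_zero, Finset.sum_const_zero] at h2
  exact hw (tendsto_nhds_unique h2 tendsto_const_nhds)

omit [IsProbabilityMeasure μ] in
lemma IsAnalyticSeries.small_ball (h : IsAnalyticSeries τ ε μ ξ φ s U F) (hz : ball z 2 ⊆ U)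
    (hd : IsDelocalized φ η z) (hτ : 0 < τ) (hε₀ : 0 < ε) (hε₁ : ε < 1) (hη : 0 < η) {w : ℂ}
    (hw : w ∈ ball z 1) (hV : 0 < ∑' j, ‖φ j w‖ ^ 2) {r : ℝ} (hr : 0 < r) :
    μ.real {ω | ‖F ω w‖ ≤ r * √(scale φ U w)} ≤
      12 * r + (η / (charFunRadius τ ε * r)) ^ 2 := by
  have hwU := hz (ball_subset_ball (by norm_num) hw)
  rw [scale_eq hwU hV]
  exact h.normalized.measureReal_norm_le hτ hε₀ hε₁ h.tendsto_s (fun j => φ j w)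
    (fun ω => h.tendsto ω w hwU) (hd.summable w hw) rfl hV hη hr (hd.norm_le w hw)

/-- The scale of the series is bounded by its size on an event of probability at least one half, for
otherwise the series would be too small with too large a probability. -/
lemma IsAnalyticSeries.scale_le (h : IsAnalyticSeries τ ε μ ξ φ s U F) (hz : ball z 2 ⊆ U)
    (hd : IsDelocalized φ η z) (hτ : 0 < τ) (hε₀ : 0 < ε) (hε₁ : ε < 1) (hη : 0 < η)
    (hη' : η ≤ charFunRadius τ ε / 100) (hE : ∀ ω ∈ E, LogBounded (F ω) z Q)
    (hμ : 1 / 2 ≤ μ.real E) {w : ℂ} (hw : w ∈ ball z (1 / 5)) :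
    scale φ U w ≤ exp (2 * (Q + 4)) := by
  have hs := charFunRadius_pos (ε := ε) hτ
  have hne : E.Nonempty := by
    rw [Set.nonempty_iff_ne_empty]
    rintro rfl
    norm_num at hμ
  obtain ⟨ω₀, hω₀⟩ := hne
  have hQ := (hE ω₀ hω₀).one_le
  by_cases hV : 0 < ∑' j, ‖φ j w‖ ^ 2
  · by_contra! hlt
    have h1 := h.small_ball hz hd hτ hε₀ hε₁ hη (ball_subset_ball (by norm_num) hw) hV
      (r := 1 / 48) (by norm_num)
    have h2 : exp Q ≤ 1 / 48 * √(scale φ U w) := by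
      have h3 : exp (Q + 4) ≤ √(scale φ U w) := by
        refine le_sqrt_of_sq_le (le_trans (le_of_eq ?_) hlt.le)
        rw [← exp_nat_mul]
        norm_num
      have h4 : (48 : ℝ) ≤ exp 4 := by
        have : exp 4 = exp 1 ^ 4 := by rw [← exp_nat_mul]; norm_num
        rw [this]
        calc (48 : ℝ) ≤ 2.7 ^ 4 := by norm_num
          _ ≤ exp 1 ^ 4 := by
            gcongr
            exact (by norm_num : (2.7 : ℝ) ≤ 2.7182818283).trans exp_one_gt_d9.le
      rw [exp_add] at h3
      nlinarith [exp_pos Q]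
    have h5 : E ⊆ {ω | ‖F ω w‖ ≤ 1 / 48 * √(scale φ U w)} := fun ω hω =>
      ((hE ω hω).le w (ball_subset_ball (by norm_num) hw)).trans h2
    have h6 := measureReal_mono (μ := μ) h5
    have h7 : η / (charFunRadius τ ε * (1 / 48)) ≤ 48 / 100 := by
      rw [div_le_iff₀ (by positivity)]
      linarith
    have h8 : (η / (charFunRadius τ ε * (1 / 48))) ^ 2 ≤ (48 / 100) ^ 2 :=
      pow_le_pow_left₀ (by positivity) h7 2
    norm_num at h1 h8 hμ h6
    linarith
  · rw [scale, if_neg (fun h => hV h.2)]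
    exact one_le_exp (by linarith)

lemma IsAnalyticSeries.measurableSet_small [Countable J] (h : IsAnalyticSeries τ ε μ ξ φ s U F)
    (r : ℝ) : MeasurableSet {p : Ω × ℂ | p.2 ∈ ball z (1 / 5) ∧
      ‖U.indicator (F p.1) p.2‖ ≤ r * √(scale φ U p.2)} :=
  (measurable_snd measurableSet_ball).inter (measurableSet_le h.measurable_indicator.norm
    ((h.measurable_scale.comp measurable_snd).sqrt.const_mul r))

/-- The expected area of the region where the series is small. -/
lemma IsAnalyticSeries.integral_volume_small_le [Countable J]
    (h : IsAnalyticSeries τ ε μ ξ φ s U F) (hz : ball z 2 ⊆ U) (hd : IsDelocalized φ η z)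
    (hτ : 0 < τ) (hε₀ : 0 < ε) (hε₁ : ε < 1) (hη : 0 < η) {ω₀ : Ω} (hω₀ : LogBounded (F ω₀) z Q)
    {r : ℝ} (hr : 0 < r) :
    ∫ ω, volume.real {w | w ∈ ball z (1 / 5) ∧ ‖U.indicator (F ω) w‖ ≤ r * √(scale φ U w)} ∂μ ≤
      12 * r + (η / (charFunRadius τ ε * r)) ^ 2 := by
  set e := 12 * r + (η / (charFunRadius τ ε * r)) ^ 2 with he
  have he0 : 0 ≤ e := by positivity
  have hm := h.measurableSet_small (z := z) r
  set S := {p : Ω × ℂ | p.2 ∈ ball z (1 / 5) ∧ ‖U.indicator (F p.1) p.2‖ ≤ r * √(scale φ U p.2)}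
  have h1 : ∫⁻ ω, volume (Prod.mk ω ⁻¹' S) ∂μ ≤ ENNReal.ofReal e := by
    rw [← Measure.prod_apply hm, Measure.prod_apply_symm hm]
    calc _ ≤ ∫⁻ w, (ball z (1 / 5)).indicator (fun w => ENNReal.ofReal e) w := by
          refine lintegral_mono_ae ?_
          filter_upwards [(ae_restrict_iff' measurableSet_ball).1 (h.ae_tsum_pos hz hd hω₀)]
            with w hw
          by_cases hwz : w ∈ ball z (1 / 5)
          · rw [Set.indicator_of_mem hwz, ← ENNReal.ofReal_toReal (measure_ne_top μ _)]
            refine ENNReal.ofReal_le_ofReal (le_trans ?_ (h.small_ball hz hd hτ hε₀ hε₁ hη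
              (ball_subset_ball (by norm_num) hwz) (hw hwz) hr))
            refine measureReal_mono fun ω hω => ?_
            have := hω.2
            rwa [Set.indicator_of_mem (hz (ball_subset_ball (by norm_num) hwz))] at this
          · rw [Set.indicator_of_notMem hwz, nonpos_iff_eq_zero]
            convert measure_empty (μ := μ)
            exact Set.eq_empty_of_forall_notMem fun ω hω => hwz hω.1
      _ = ENNReal.ofReal e * volume (ball z (1 / 5)) := by
          rw [lintegral_indicator_const measurableSet_ball]
      _ ≤ ENNReal.ofReal e * 1 := by
          gcongr
          rw [← ENNReal.ofReal_toReal measure_ball_lt_top.ne, ← ENNReal.ofReal_one]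
          exact ENNReal.ofReal_le_ofReal (volume_real_ball_fifth_le z)
      _ = _ := mul_one _
  have h2 : Measurable fun ω => volume.real (Prod.mk ω ⁻¹' S) :=
    (measurable_measure_prodMk_left hm).ennreal_toReal
  rw [show (fun ω => volume.real {w | w ∈ ball z (1 / 5) ∧
    ‖U.indicator (F ω) w‖ ≤ r * √(scale φ U w)}) = fun ω => volume.real (Prod.mk ω ⁻¹' S) from rfl,
    integral_eq_lintegral_of_nonneg_ae (ae_of_all _ fun _ => measureReal_nonneg)
    h2.aestronglyMeasurable]
  refine ENNReal.toReal_le_of_le_ofReal he0 (le_trans (lintegral_mono fun ω => ?_) h1)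
  exact ENNReal.ofReal_toReal_le

variable {ι : Type*} [Fintype ι] {c : ι → ℂ} {Λ R T β : ℝ} {Γ : (ι → ℂ) → ℂ}

/-- The error of replacing root sums by smoothed sums of truncated logarithms, for `m`-tuples. The
number `s` stands for `charFunRadius τ ε`. -/
noncomputable def smoothError (m : ℕ) (s Λ R Q T β η : ℝ) : ℝ :=
  Λ * R * (5 * Q) ^ m + 2 * (2 / (logMass * R ^ 2)) ^ m * (2 * (2 * 10 ^ 6 * Q)) ^ (m - 1) *
    (m * (β + 10 ^ 7 * Q ^ 2 / T + 2 * T * (12 * √β + (η / (s * √β)) ^ 2)))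

lemma LogBounded.norm_smoothSum_log_sub_le (h : IsAnalyticSeries τ ε μ ξ φ s U F) [Countable J]
    (hz : ∀ i, ball (c i) 2 ⊆ U) (hΓ : IsTestFunction c Λ Γ) (hR : 0 < R) (hR' : R ≤ 1 / 10)
    (hT : 1 ≤ T) (hβ : 0 < β) (hβ' : β ≤ 1) {ω : Ω} (hω : ∀ i, LogBounded (F ω) (c i) Q)
    (hsc : ∀ i, ∀ w ∈ ball (c i) (1 / 5), scale φ U w ≤ exp (2 * (Q + 4))) :
    ‖smoothSum Γ R (fun w => log ‖F ω w‖) - smoothSum Γ R (truncField T β φ U (F ω))‖ ≤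
      2 * (2 / (logMass * R ^ 2)) ^ Fintype.card ι *
        (2 * (2 * 10 ^ 6 * Q)) ^ (Fintype.card ι - 1) * ∑ i, (β + 10 ^ 7 * Q ^ 2 / T + 2 * T *
          volume.real {w | w ∈ ball (c i) (1 / 5) ∧
            ‖U.indicator (F ω) w‖ ≤ √β * √(scale φ U w)}) := by
  have hJ := logMass_pos
  have hT0 : 0 ≤ T := by linarith
  have hsub : ∀ i, ball (c i) (1 / 5) ⊆ U := fun i =>
    (ball_subset_ball (by norm_num)).trans (hz i)
  have hu : Measurable fun w => log ‖U.indicator (F ω) w‖ :=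
    measurable_log.comp ((h.measurable_indicator.comp measurable_prodMk_left).norm)
  have hv : Measurable (truncField T β φ U (F ω)) := by
    have h1 : Measurable fun w : ℂ => (ω, w) := measurable_prodMk_left
    have h2 := (h.measurable_truncField (T := T) (β := β)).comp h1
    simpa only [Function.comp_def] using h2
  have hvb : ∀ w, |truncField T β φ U (F ω) w| ≤ T := fun w => abs_truncField_le hT0 _ _
  have heq : ∀ i, Set.EqOn (fun w => log ‖U.indicator (F ω) w‖) (fun w => log ‖F ω w‖)
      (ball (c i) (1 / 5)) := fun i w hw => by
    simp only
    rw [Set.indicator_of_mem (hsub i hw)]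
  have heq' : ∀ i, ∀ w ∈ ball (c i) (1 / 5), truncField T β φ U (F ω) w =
      truncLog T (β ^ 2 * scale φ U w) (F ω w) := fun i w hw => by
    rw [truncField, Set.indicator_of_mem (hsub i hw)]
  have hvi : ∀ i, IntegrableOn (truncField T β φ U (F ω)) (ball (c i) (1 / 5)) := fun i =>
    Integrable.mono' (integrableOn_const_ball (c i) (1 / 5) T) hv.aestronglyMeasurable
      (ae_of_all _ hvb)
  have hvi' : ∀ i, IntegrableOn (fun w => truncLog T (β ^ 2 * scale φ U w) (F ω w))
      (ball (c i) (1 / 5)) := fun i =>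
    (integrableOn_congr_fun (heq' i) measurableSet_ball).1 (hvi i)
  have hseteq : ∀ i, {w | w ∈ ball (c i) (1 / 5) ∧
      ‖U.indicator (F ω) w‖ ≤ √β * √(scale φ U w)} =
      {w | w ∈ ball (c i) (1 / 5) ∧ ‖F ω w‖ ≤ √β * √(scale φ U w)} := fun i => by
    ext w
    refine and_congr_right fun hw => ?_
    rw [Set.indicator_of_mem (hsub i hw)]
  rw [smoothSum_congr hΓ (v := fun w => log ‖U.indicator (F ω) w‖)
    (fun i w hw => (heq i hw).symm) hR hR']
  refine (norm_smoothSum_sub_le hΓ hu hv hR hR'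
    (fun i => (integrableOn_congr_fun (heq i) measurableSet_ball).2 (hω i).integrableOn_log) hvi
    (fun i x hx => ?_) (fun i x hx => ?_) (a := 2 * 10 ^ 6 * Q) (fun i => ?_) (fun i => ?_)).trans ?_
  · have hx' : closedBall x R ⊆ ball (c i) (1 / 5) :=
      closedBall_subset_ball' (by have := mem_ball.1 hx; linarith)
    refine (circleIntegrable_log_norm hR ((hω i).analytic.mono
      (hx'.trans (ball_subset_ball (by norm_num))))).congr fun t _ => ?_
    exact (heq i (hx' (circleMap_mem_closedBall x hR.le t))).symm
  · refine (intervalIntegrable_const (c := T)).mono_fun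
      (hv.comp (continuous_circleMap _ _).measurable).aestronglyMeasurable (ae_of_all _ fun t => ?_)
    exact (hvb _).trans (le_abs_self T)
  · rw [setIntegral_congr_fun measurableSet_ball fun w hw => congrArg _ (heq i hw)]
    have := (hω i).one_le
    exact (hω i).integral_abs_log_le.trans (by linarith)
  · rw [setIntegral_congr_fun measurableSet_ball fun w hw => congrArg _ (heq' i w hw)]
    exact (hω i).integral_abs_truncLog_le hT hβ hβ' (fun w => scale_pos w) (hsc i) (hvi' i)
  · have hQ : 0 ≤ Q ∨ IsEmpty ι := by
      rcases isEmpty_or_nonempty ι with hι | ⟨⟨i⟩⟩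
      · exact Or.inr hι
      · exact Or.inl (by linarith [(hω i).one_le])
    have hpow : 0 ≤ (2 * (2 * 10 ^ 6 * Q)) ^ (Fintype.card ι - 1) := by
      rcases hQ with hQ | hι
      · positivity
      · simp
    refine mul_le_mul_of_nonneg_left (Finset.sum_le_sum fun i _ => ?_)
      (mul_nonneg (by positivity) hpow)
    rw [hseteq, setIntegral_congr_fun (g := fun w => |log ‖F ω w‖ -
      truncLog T (β ^ 2 * scale φ U w) (F ω w)|) measurableSet_ball fun w hw => ?_]
    · refine (hω i).integral_abs_log_sub_truncLog_le hT hβ hβ' (fun w => scale_pos w) (hvi' i) ?_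
      rw [← hseteq]
      exact (h.measurableSet_small (√β)).preimage measurable_prodMk_left
    · simp only
      rw [heq' i w hw, Set.indicator_of_mem (hsub i hw)]

/-- On a good event, the root sums are close to the smoothed sums of truncated logarithms in
expectation. -/
lemma IsAnalyticSeries.setIntegral_norm_rootSum_sub_le [Countable J]
    (h : IsAnalyticSeries τ ε μ ξ φ s U F) (hz : ∀ i, ball (c i) 2 ⊆ U)
    (hd : ∀ i, IsDelocalized φ η (c i)) (hτ : 0 < τ) (hε₀ : 0 < ε) (hε₁ : ε < 1) (hη : 0 < η)
    (hη' : η ≤ charFunRadius τ ε / 100) (hE : ∀ ω ∈ E, ∀ i, LogBounded (F ω) (c i) Q)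
    (hEm : MeasurableSet E) (hμ : 1 / 2 ≤ μ.real E) (hΓ : IsTestFunction c Λ Γ) (hΛ : 0 ≤ Λ)
    (hQ : 1 ≤ Q) (hR : 0 < R) (hR' : R ≤ 1 / 10) (hT : 1 ≤ T) (hβ : 0 < β) (hβ' : β ≤ 1) :
    ∫ ω in E, ‖rootSum Γ (F ω) - smoothSum Γ R (truncField T β φ U (F ω))‖ ∂μ ≤
      smoothError (Fintype.card ι) (charFunRadius τ ε) Λ R Q T β η := by
  have hJ := logMass_pos
  have hs := charFunRadius_pos (ε := ε) hτ
  have hne : E.Nonempty := by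
    rw [Set.nonempty_iff_ne_empty]
    rintro rfl
    norm_num at hμ
  obtain ⟨ω₀, hω₀⟩ := hne
  set m := Fintype.card ι with hm
  set q := 2 * (2 / (logMass * R ^ 2)) ^ m * (2 * (2 * 10 ^ 6 * Q)) ^ (m - 1) with hq
  have hq0 : 0 ≤ q := by positivity
  set a := β + 10 ^ 7 * Q ^ 2 / T with ha
  set v : ι → Ω → ℝ := fun i ω => volume.real {w | w ∈ ball (c i) (1 / 5) ∧
            ‖U.indicator (F ω) w‖ ≤ √β * √(scale φ U w)} with hv
  have hvi : ∀ i, Integrable (v i) μ := fun i => by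
    refine Integrable.of_bound (C := 1) (measurable_measure_prodMk_left
      (h.measurableSet_small (z := c i) √β)).ennreal_toReal.aestronglyMeasurable
      (ae_of_all _ fun ω => ?_)
    rw [norm_of_nonneg measureReal_nonneg]
    exact (measureReal_mono (fun w hw => hw.1) measure_ball_lt_top.ne).trans
      (volume_real_ball_fifth_le (c i))
  have hgi₁ : ∀ i, Integrable (fun ω => a + 2 * T * v i ω) μ := fun i =>
    (integrable_const _).add ((hvi i).const_mul _)
  have hgi₂ : Integrable (fun ω => q * ∑ i, (a + 2 * T * v i ω)) μ :=
    (integrable_finsetSum _ fun i _ => hgi₁ i).const_mul _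
  have hgi : Integrable (fun ω => Λ * R * (5 * Q) ^ m + q * ∑ i, (a + 2 * T * v i ω)) μ :=
    (integrable_const _).add hgi₂
  have hg0 : ∀ ω, 0 ≤ Λ * R * (5 * Q) ^ m + q * ∑ i, (a + 2 * T * v i ω) := fun ω => by
    have : ∀ i, 0 ≤ v i ω := fun i => measureReal_nonneg
    have := fun i => mul_nonneg (by linarith : 0 ≤ 2 * T) (this i)
    have h1 : 0 ≤ ∑ i, (a + 2 * T * v i ω) := Finset.sum_nonneg fun i _ =>
      add_nonneg (by positivity) (this i)
    positivity
  calc _ ≤ ∫ ω in E, (Λ * R * (5 * Q) ^ m + q * ∑ i, (a + 2 * T * v i ω)) ∂μ := by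
        refine integral_mono_of_nonneg (ae_of_all _ fun ω => norm_nonneg _) hgi.integrableOn
          ((ae_restrict_mem hEm).mono fun ω hω => ?_)
        refine (norm_sub_le_norm_sub_add_norm_sub _ (smoothSum Γ R fun w => log ‖F ω w‖) _).trans
          (add_le_add ?_ ?_)
        · refine (norm_rootSum_sub_smoothSum_le hΓ hΛ (fun i => (hE ω hω i).analytic) hR hR').trans
            (mul_le_mul_of_nonneg_left ?_ (by positivity))
          rw [hm, ← Finset.card_univ, ← Finset.prod_const]
          exact Finset.prod_le_prod (fun _ _ => Nat.cast_nonneg _) fun i _ =>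
            (hE ω hω i).card_rootsIn_le
        · exact LogBounded.norm_smoothSum_log_sub_le h hz hΓ hR hR' hT hβ hβ' (hE ω hω)
            fun i w hw => h.scale_le (hz i) (hd i) hτ hε₀ hε₁ hη hη' (fun ω hω => hE ω hω i) hμ hw
    _ ≤ ∫ ω, (Λ * R * (5 * Q) ^ m + q * ∑ i, (a + 2 * T * v i ω)) ∂μ :=
        setIntegral_le_integral hgi (ae_of_all _ hg0)
    _ = Λ * R * (5 * Q) ^ m + q * ∑ i, (a + 2 * T * ∫ ω, v i ω ∂μ) := by
        rw [integral_add (integrable_const _) hgi₂, integral_const_mul q,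
          integral_finsetSum _ fun i _ => hgi₁ i]
        simp only [integral_const, probReal_univ, one_smul]
        congr 2
        refine Finset.sum_congr rfl fun i _ => ?_
        rw [integral_add (integrable_const _) ((hvi i).const_mul _), integral_const_mul]
        simp
    _ ≤ Λ * R * (5 * Q) ^ m + q * ∑ _i : ι, (a + 2 * T *
          (12 * √β + (η / (charFunRadius τ ε * √β)) ^ 2)) := by
        gcongr with i
        exact h.integral_volume_small_le (hz i) (hd i) hτ hε₀ hε₁ hη (hE ω₀ hω₀ i)
          (sqrt_pos.2 hβ)
    _ = _ := by
        rw [Finset.sum_const, nsmul_eq_mul, smoothError, Finset.card_univ]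

end GoodEvent

/-! ### The contribution of bad events -/

section BumpCount

open Metric Real

/-- A Lipschitz function between the indicators of the disks of radius `1 / 50` and `3 / 100`. -/
noncomputable def bump (z c : ℂ) : ℝ := max 0 (min 1 (3 - 100 * ‖c - z‖))

lemma bump_nonneg (z c : ℂ) : 0 ≤ bump z c := le_max_left _ _

lemma bump_le_one (z c : ℂ) : bump z c ≤ 1 := max_le zero_le_one (min_le_left _ _)

lemma bump_eq_one {z c : ℂ} (hc : c ∈ ball z (1 / 50)) : bump z c = 1 := by
  rw [mem_ball, dist_eq_norm] at hc
  rw [bump, min_eq_left (by linarith), max_eq_right zero_le_one]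

lemma isTestFunction_bump (z : ℂ) :
    IsTestFunction (fun _ : Unit => z) 100 fun c => (bump z (c ()) : ℂ) where
  mem_ball c hc i := by
    have h0 : bump z (c ()) ≠ 0 := by exact_mod_cast hc
    rw [mem_ball, dist_eq_norm]
    by_contra! h
    refine h0 (max_eq_left ((min_le_right _ _).trans ?_))
    linarith
  norm_le c := by
    rw [Complex.norm_real, norm_of_nonneg (bump_nonneg _ _)]
    exact (bump_le_one _ _).trans one_le_two
  lipschitz c c' := by
    rw [← Complex.ofReal_sub, Complex.norm_real, norm_eq_abs, bump, bump]
    refine (abs_max_sub_max_le_max _ _ _ _).trans (max_le (by simp) ?_)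
    refine (abs_min_sub_min_le_max _ _ _ _).trans (max_le (by simp) ?_)
    have h1 : |‖c () - z‖ - ‖c' () - z‖| ≤ dist c c' := by
      refine (abs_norm_sub_norm_le _ _).trans ?_
      rw [sub_sub_sub_cancel_right, ← dist_eq_norm]
      exact dist_le_pi_dist c c' ()
    rw [sub_sub_sub_cancel_left, ← mul_sub, abs_mul, abs_sub_comm]
    norm_num
    linarith

/-- The number of roots near `z`, weighted by `bump`. -/
noncomputable def bumpCount (f : ℂ → ℂ) (z : ℂ) : ℝ :=
  ∑ r ∈ rootsIn f (closedBall z (4 / 5)), bump z r.loc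

variable {f : ℂ → ℂ} {z : ℂ}

lemma bumpCount_nonneg : 0 ≤ bumpCount f z := Finset.sum_nonneg fun _ _ => bump_nonneg _ _

lemma bumpCount_le : bumpCount f z ≤ nearCount f z := by
  refine (Finset.sum_le_sum fun r _ => bump_le_one z r.loc).trans (le_of_eq ?_)
  simp [nearCount]

lemma ofReal_bumpCount_le_rootCount (hf : AnalyticOnNhd ℂ f (ball z 2)) :
    ENNReal.ofReal (bumpCount f z) ≤ (rootCount f (ball z 1) : ℝ≥0∞) := by
  refine (ENNReal.ofReal_le_ofReal bumpCount_le).trans ?_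
  rw [ENNReal.ofReal_natCast]
  have h1 : (nearCount f z : ℕ∞) ≤ rootCount f (ball z 1) := by
    rw [nearCount, ← Set.encard_coe_eq_coe_finsetCard]
    refine Set.encard_le_encard fun r hr => ?_
    exact closedBall_subset_ball (by norm_num)
      ((mem_rootsIn (hf.mono (closedBall_subset_ball (by norm_num)))).1 hr)
  exact_mod_cast h1

lemma rootSum_bump (hf : AnalyticOnNhd ℂ f (ball z 2)) :
    rootSum (fun c : Unit → ℂ => (bump z (c ()) : ℂ)) f = bumpCount f z := by
  rw [rootSum_eq_sum (isTestFunction_bump z).mem_ball fun _ => hf, bumpCount]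
  have := Finset.prod_univ_sum (fun _ : Unit => rootsIn f (closedBall z (4 / 5)))
    (fun _ r => (bump z r.loc : ℂ))
  simpa using this.symm

variable {ι : Type*} [Fintype ι] {c : ι → ℂ} {Γ : (ι → ℂ) → ℂ}

lemma norm_rootSum_le (hΓ : ∀ x, Γ x ≠ 0 → ∀ i, x i ∈ ball (c i) (1 / 50)) (hΓ' : ∀ x, ‖Γ x‖ ≤ 2)
    (hf : ∀ i, AnalyticOnNhd ℂ f (ball (c i) 2)) :
    ‖rootSum Γ f‖ ≤ 2 * ∏ i, bumpCount f (c i) := by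
  classical
  rw [rootSum_eq_sum (fun x hx i => ball_subset_ball (by norm_num) (hΓ x hx i)) hf]
  simp only [bumpCount]
  rw [Finset.prod_univ_sum, Finset.mul_sum]
  refine norm_sum_le_of_le _ fun r _ => ?_
  by_cases h0 : Γ (fun i => (r i).loc) = 0
  · rw [h0, norm_zero]
    exact mul_nonneg zero_le_two (Finset.prod_nonneg fun i _ => bump_nonneg _ _)
  · rw [Finset.prod_eq_one fun i _ => bump_eq_one (hΓ _ h0 i), mul_one]
    exact hΓ' _

lemma prod_le_sum_pow [Nonempty ι] {y : ι → ℝ} (hy : ∀ i, 0 ≤ y i) :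
    ∏ i, y i ≤ ∑ i, y i ^ Fintype.card ι := by
  obtain ⟨i, -, hi⟩ := Finset.exists_max_image Finset.univ y Finset.univ_nonempty
  calc ∏ j, y j ≤ ∏ _j : ι, y i := Finset.prod_le_prod (fun j _ => hy j) hi
    _ = y i ^ Fintype.card ι := by rw [Finset.prod_const, Finset.card_univ]
    _ ≤ _ := Finset.single_le_sum (f := fun j => y j ^ Fintype.card ι)
      (fun j _ => pow_nonneg (hy j) _) (Finset.mem_univ i)

end BumpCount

section BadEvent

open Metric Real

variable {J Ω : Type*} [MeasurableSpace Ω] {μ : Measure Ω} [IsProbabilityMeasure μ] {ξ : J → Ω → ℝ}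
  {τ ε : ℝ} {φ : J → ℂ → ℂ} {s : ℕ → Finset J} {U : Set ℂ} {F : Ω → ℂ → ℂ} {z : ℂ} {Q η K C : ℝ}
  {E : Set Ω}

lemma IsAnalyticSeries.measurable_bumpCount (h : IsAnalyticSeries τ ε μ ξ φ s U F)
    (hz : ball z 2 ⊆ U) : Measurable fun ω => bumpCount (F ω) z := by
  have h1 := h.measurable_rootSum (fun _ => hz) (isTestFunction_bump z) (by norm_num)
  have h2 := Complex.measurable_re.comp h1
  simpa only [Function.comp_def, rootSum_bump ((h.analytic _).mono hz), Complex.ofReal_re] using h2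

/-- The number of roots of `F ω` near `z` is bounded by a random variable `N` with
`E N^{m + 2} 1_{N ≥ K} ≤ C`.  The variable `N` is not required to be measurable. -/
def HasRootMoment (μ : Measure Ω) (F : Ω → ℂ → ℂ) (m : ℕ) (K C : ℝ) (z : ℂ) : Prop :=
  ∃ N : Ω → ℝ≥0∞, (∀ᵐ ω ∂μ, ENNReal.ofReal (bumpCount (F ω) z) ≤ N ω) ∧
    ∫⁻ ω, {ω | ENNReal.ofReal K ≤ N ω}.indicator (fun ω => N ω ^ (m + 2)) ω ∂μ ≤ ENNReal.ofReal C

omit [IsProbabilityMeasure μ] in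
lemma HasRootMoment.setLIntegral_le {m : ℕ} (h : HasRootMoment μ F m K C z) (hK : 0 < K)
    (B : Set Ω) :
    ∫⁻ ω in B, ENNReal.ofReal (bumpCount (F ω) z) ^ m ∂μ ≤
      ENNReal.ofReal K ^ m * μ B + (ENNReal.ofReal K)⁻¹ ^ 2 * ENNReal.ofReal C := by
  obtain ⟨N, hN, hm⟩ := h
  have hK0 : ENNReal.ofReal K ≠ 0 := by simpa using hK
  calc _ ≤ ∫⁻ ω in B, (ENNReal.ofReal K ^ m + (ENNReal.ofReal K)⁻¹ ^ 2 *
          {ω | ENNReal.ofReal K ≤ N ω}.indicator (fun ω => N ω ^ (m + 2)) ω) ∂μ := by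
        refine lintegral_mono_ae (ae_restrict_of_ae (hN.mono fun ω hω => ?_))
        by_cases hc : ENNReal.ofReal K ≤ N ω
        · rw [Set.indicator_of_mem (show ω ∈ {ω | ENNReal.ofReal K ≤ N ω} from hc)]
          refine le_add_left ?_
          have h1 : 1 ≤ (ENNReal.ofReal K)⁻¹ * N ω := by
            rw [← ENNReal.inv_mul_cancel hK0 ENNReal.ofReal_ne_top]
            gcongr
          calc _ ≤ 1 ^ 2 * N ω ^ m := by
                rw [one_pow, one_mul]
                gcongr
            _ ≤ ((ENNReal.ofReal K)⁻¹ * N ω) ^ 2 * N ω ^ m := by gcongr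
            _ = _ := by ring
        · rw [Set.indicator_of_notMem (by simpa using hc), mul_zero, add_zero]
          exact pow_le_pow_left' (hω.trans (not_le.1 hc).le) m
    _ = ENNReal.ofReal K ^ m * μ B + (ENNReal.ofReal K)⁻¹ ^ 2 *
          ∫⁻ ω in B, {ω | ENNReal.ofReal K ≤ N ω}.indicator (fun ω => N ω ^ (m + 2)) ω ∂μ := by
        rw [lintegral_add_left measurable_const, setLIntegral_const,
          lintegral_const_mul' _ _ (by finiteness)]
    _ ≤ _ := by
        gcongr
        exact (setLIntegral_le_lintegral _ _).trans hm

variable {ι : Type*} [Fintype ι] [Nonempty ι] {c : ι → ℂ} {Λ R T β : ℝ} {Γ : (ι → ℂ) → ℂ}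

lemma IsAnalyticSeries.setLIntegral_prod_bumpCount_le (h : IsAnalyticSeries τ ε μ ξ φ s U F)
    (hz : ∀ i, ball (c i) 2 ⊆ U) (hm : ∀ i, HasRootMoment μ F (Fintype.card ι) K C (c i))
    (hK : 0 < K) (hC : 0 ≤ C) (B : Set Ω) :
    ∫⁻ ω in B, ENNReal.ofReal (∏ i, bumpCount (F ω) (c i)) ∂μ ≤
      ENNReal.ofReal (Fintype.card ι * (K ^ Fintype.card ι * μ.real B + C / K ^ 2)) := by
  calc _ ≤ ∫⁻ ω in B, ∑ i, ENNReal.ofReal (bumpCount (F ω) (c i)) ^ Fintype.card ι ∂μ := by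
        refine lintegral_mono fun ω => ?_
        refine (ENNReal.ofReal_le_ofReal (prod_le_sum_pow fun i => bumpCount_nonneg)).trans ?_
        rw [ENNReal.ofReal_sum_of_nonneg fun i _ => pow_nonneg bumpCount_nonneg _]
        simp only [ENNReal.ofReal_pow bumpCount_nonneg, le_refl]
    _ = ∑ i, ∫⁻ ω in B, ENNReal.ofReal (bumpCount (F ω) (c i)) ^ Fintype.card ι ∂μ :=
        lintegral_finsetSum _ fun i _ => (h.measurable_bumpCount (hz i)).ennreal_ofReal.pow_const _
    _ ≤ ∑ _i : ι, ENNReal.ofReal (K ^ Fintype.card ι * μ.real B + C / K ^ 2) := by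
        refine Finset.sum_le_sum fun i _ => ((hm i).setLIntegral_le hK B).trans (le_of_eq ?_)
        rw [ENNReal.ofReal_add (by positivity) (by positivity), ENNReal.ofReal_mul (by positivity),
          ENNReal.ofReal_pow hK.le, ofReal_measureReal, ENNReal.ofReal_div_of_pos (by positivity),
          ENNReal.ofReal_pow hK.le, ← ENNReal.inv_pow, ENNReal.div_eq_inv_mul]
    _ = _ := by
        rw [Finset.sum_const, nsmul_eq_mul, Finset.card_univ, ENNReal.ofReal_mul (by positivity),
          ENNReal.ofReal_natCast]

lemma IsAnalyticSeries.integrable_prod_bumpCount (h : IsAnalyticSeries τ ε μ ξ φ s U F)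
    (hz : ∀ i, ball (c i) 2 ⊆ U) (hm : ∀ i, HasRootMoment μ F (Fintype.card ι) K C (c i))
    (hK : 0 < K) (hC : 0 ≤ C) : Integrable (fun ω => ∏ i, bumpCount (F ω) (c i)) μ := by
  refine ⟨(Finset.measurable_prod _ fun i _ =>
    h.measurable_bumpCount (hz i)).aestronglyMeasurable, ?_⟩
  rw [hasFiniteIntegral_iff_ofReal (ae_of_all _ fun ω =>
    Finset.prod_nonneg fun i _ => bumpCount_nonneg)]
  have := h.setLIntegral_prod_bumpCount_le hz hm hK hC Set.univ
  rw [Measure.restrict_univ] at this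
  exact this.trans_lt ENNReal.ofReal_lt_top

lemma IsAnalyticSeries.setIntegral_prod_bumpCount_le (h : IsAnalyticSeries τ ε μ ξ φ s U F)
    (hz : ∀ i, ball (c i) 2 ⊆ U) (hm : ∀ i, HasRootMoment μ F (Fintype.card ι) K C (c i))
    (hK : 0 < K) (hC : 0 ≤ C) (B : Set Ω) :
    ∫ ω in B, ∏ i, bumpCount (F ω) (c i) ∂μ ≤
      Fintype.card ι * (K ^ Fintype.card ι * μ.real B + C / K ^ 2) := by
  rw [integral_eq_lintegral_of_nonneg_ae
    (ae_of_all _ fun ω => Finset.prod_nonneg fun i _ => bumpCount_nonneg)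
    (Finset.measurable_prod _ fun i _ => h.measurable_bumpCount (hz i)).aestronglyMeasurable]
  exact ENNReal.toReal_le_of_le_ofReal (by positivity)
    (h.setLIntegral_prod_bumpCount_le hz hm hK hC B)

variable {Γ₀ : (ι → ℂ) → ℂ}

lemma IsAnalyticSeries.integrable_rootSum (h : IsAnalyticSeries τ ε μ ξ φ s U F)
    (hz : ∀ i, ball (c i) 2 ⊆ U) (hm : ∀ i, HasRootMoment μ F (Fintype.card ι) K C (c i))
    (hK : 0 < K) (hC : 0 ≤ C) (hΓ : ∀ x, Γ x ≠ 0 → ∀ i, x i ∈ ball (c i) (1 / 50))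
    (hΓ' : ∀ x, ‖Γ x‖ ≤ 2) (hΓm : Measurable fun ω => rootSum Γ (F ω)) :
    Integrable (fun ω => rootSum Γ (F ω)) μ :=
  Integrable.mono' ((h.integrable_prod_bumpCount hz hm hK hC).const_mul 2)
    hΓm.aestronglyMeasurable
    (ae_of_all _ fun ω => norm_rootSum_le hΓ hΓ' fun i => (h.analytic ω).mono (hz i))

lemma IsAnalyticSeries.norm_integral_rootSum_le (h : IsAnalyticSeries τ ε μ ξ φ s U F)
    (hz : ∀ i, ball (c i) 2 ⊆ U) (hm : ∀ i, HasRootMoment μ F (Fintype.card ι) K C (c i))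
    (hK : 0 < K) (hC : 0 ≤ C) (hΓ : ∀ x, Γ x ≠ 0 → ∀ i, x i ∈ ball (c i) (1 / 50))
    (hΓ' : ∀ x, ‖Γ x‖ ≤ 2) :
    ‖∫ ω, rootSum Γ (F ω) ∂μ‖ ≤
      2 * (Fintype.card ι * (K ^ Fintype.card ι + C / K ^ 2)) := by
  refine (norm_integral_le_of_norm_le ((h.integrable_prod_bumpCount hz hm hK hC).const_mul 2)
    (ae_of_all _ fun ω => norm_rootSum_le hΓ hΓ' fun i => (h.analytic ω).mono (hz i))).trans ?_
  rw [integral_const_mul]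
  have := h.setIntegral_prod_bumpCount_le hz hm hK hC Set.univ
  simp only [Measure.restrict_univ, probReal_univ, mul_one] at this
  gcongr

/-- The expected root sum of `Γ₀`, compared with the expected smoothed sum of a test function `Γ`
which yields the same root sum with high probability. -/
lemma IsAnalyticSeries.norm_integral_rootSum_sub_smoothSum_le [Countable J]
    (h : IsAnalyticSeries τ ε μ ξ φ s U F) (hz : ∀ i, ball (c i) 2 ⊆ U)
    (hd : ∀ i, IsDelocalized φ η (c i)) (hτ : 0 < τ) (hε₀ : 0 < ε) (hε₁ : ε < 1) (hη : 0 < η)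
    (hη' : η ≤ charFunRadius τ ε / 100) (hE : ∀ ω ∈ E, ∀ i, LogBounded (F ω) (c i) Q)
    (hEm : MeasurableSet E) {p : ℝ} (hp : μ.real Eᶜ ≤ p) (hp' : p ≤ 1 / 2)
    (hm : ∀ i, HasRootMoment μ F (Fintype.card ι) K C (c i)) (hK : 0 < K) (hC : 0 ≤ C)
    (hΓ : IsTestFunction c Λ Γ) (hΓs : ∀ x, Γ x ≠ 0 → ∀ i, x i ∈ ball (c i) (1 / 50))
    (hΓ₀ : ∀ x, Γ₀ x ≠ 0 → ∀ i, x i ∈ ball (c i) (1 / 50)) (hΓ₀' : ∀ x, ‖Γ₀ x‖ ≤ 2)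
    (hΓ₀m : Measurable fun ω => rootSum Γ₀ (F ω)) {σ : ℝ}
    (hσ : μ.real {ω | rootSum Γ₀ (F ω) ≠ rootSum Γ (F ω)} ≤ σ) (hΛ : 0 ≤ Λ)
    (hQ : 1 ≤ Q) (hR : 0 < R) (hR' : R ≤ 1 / 10) (hT : 1 ≤ T) (hβ : 0 < β) (hβ' : β ≤ 1) :
    ‖∫ ω, rootSum Γ₀ (F ω) ∂μ - ∫ ω, smoothSum Γ R (truncField T β φ U (F ω)) ∂μ‖ ≤
      4 * (5 * Q) ^ Fintype.card ι * σ +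
        smoothError (Fintype.card ι) (charFunRadius τ ε) Λ R Q T β η +
        (2 * (Fintype.card ι * (K ^ Fintype.card ι * p + C / K ^ 2)) +
          2 * (2 * T / (logMass * R ^ 2)) ^ Fintype.card ι * p) := by
  have hJ := logMass_pos
  set m := Fintype.card ι with hmι
  have hEμ : 1 / 2 ≤ μ.real E := by
    have := probReal_add_probReal_compl (μ := μ) hEm
    linarith
  have hf : ∀ ω i, AnalyticOnNhd ℂ (F ω) (ball (c i) 2) := fun ω i => (h.analytic ω).mono (hz i)
  have hcount : ∀ ω ∈ E, ∏ i, bumpCount (F ω) (c i) ≤ (5 * Q) ^ m := fun ω hω => by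
    rw [hmι, ← Finset.card_univ, ← Finset.prod_const]
    exact Finset.prod_le_prod (fun i _ => bumpCount_nonneg) fun i _ =>
      bumpCount_le.trans (hE ω hω i).card_rootsIn_le
  have hΓm : Measurable fun ω => rootSum Γ (F ω) := h.measurable_rootSum hz hΓ hΛ
  have hLm : Measurable fun ω => smoothSum Γ R (truncField T β φ U (F ω)) :=
    measurable_smoothSum hΓ h.measurable_truncField
  have hLb : ∀ ω, ‖smoothSum Γ R (truncField T β φ U (F ω))‖ ≤
      2 * (2 * T / (logMass * R ^ 2)) ^ m := fun ω =>
    norm_smoothSum_le hΓ (fun w => abs_truncField_le (by linarith) _ _) hR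
  have hi0 := h.integrable_rootSum hz hm hK hC hΓ₀ hΓ₀' hΓ₀m
  have hi1 := h.integrable_rootSum hz hm hK hC hΓs hΓ.norm_le hΓm
  have hi2 : Integrable (fun ω => smoothSum Γ R (truncField T β φ U (F ω))) μ :=
    Integrable.of_bound hLm.aestronglyMeasurable _ (ae_of_all _ hLb)
  have hEE : ∫ ω in E, ‖rootSum Γ₀ (F ω) - smoothSum Γ R (truncField T β φ U (F ω))‖ ∂μ ≤
      4 * (5 * Q) ^ m * σ + smoothError m (charFunRadius τ ε) Λ R Q T β η := by
    have h1 : ∫ ω in E, ‖rootSum Γ₀ (F ω) - rootSum Γ (F ω)‖ ∂μ ≤ 4 * (5 * Q) ^ m * σ := by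
      set S := {ω | rootSum Γ₀ (F ω) ≠ rootSum Γ (F ω)} with hS
      have hSm : MeasurableSet S := (measurableSet_eq_fun hΓ₀m hΓm).compl
      calc _ ≤ ∫ ω in E, S.indicator (fun _ => 4 * (5 * Q) ^ m) ω ∂μ := by
            refine integral_mono_of_nonneg (ae_of_all _ fun _ => norm_nonneg _)
              ((integrable_const _).indicator hSm) ((ae_restrict_mem hEm).mono fun ω hω => ?_)
            by_cases hωS : ω ∈ S
            · rw [Set.indicator_of_mem hωS]
              have h2 := norm_rootSum_le hΓ₀ hΓ₀' (hf ω)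
              have h3 := norm_rootSum_le hΓs hΓ.norm_le (hf ω)
              have h4 := norm_sub_le (rootSum Γ₀ (F ω)) (rootSum Γ (F ω))
              simp only
              linarith [hcount ω hω]
            · rw [Set.indicator_of_notMem hωS]
              have : rootSum Γ₀ (F ω) = rootSum Γ (F ω) := not_not.1 hωS
              simp [this]
        _ ≤ ∫ ω, S.indicator (fun _ => 4 * (5 * Q) ^ m) ω ∂μ :=
            setIntegral_le_integral ((integrable_const _).indicator hSm)
              (ae_of_all _ fun ω => Set.indicator_nonneg (fun _ _ => by positivity) _)
        _ ≤ _ := by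
            rw [integral_indicator_const _ hSm, smul_eq_mul, mul_comm]
            gcongr
    calc _ ≤ ∫ ω in E, (‖rootSum Γ₀ (F ω) - rootSum Γ (F ω)‖ +
            ‖rootSum Γ (F ω) - smoothSum Γ R (truncField T β φ U (F ω))‖) ∂μ :=
          integral_mono (hi0.sub hi2).norm.integrableOn
            ((hi0.sub hi1).norm.add (hi1.sub hi2).norm).integrableOn
            fun ω => norm_sub_le_norm_sub_add_norm_sub _ _ _
      _ = _ := integral_add (hi0.sub hi1).norm.integrableOn (hi1.sub hi2).norm.integrableOn
      _ ≤ _ := add_le_add h1 (h.setIntegral_norm_rootSum_sub_le hz hd hτ hε₀ hε₁ hη hη' hE hEm hEμ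
          hΓ hΛ hQ hR hR' hT hβ hβ')
  have hEc : ∫ ω in Eᶜ, ‖rootSum Γ₀ (F ω) - smoothSum Γ R (truncField T β φ U (F ω))‖ ∂μ ≤
      2 * (m * (K ^ m * p + C / K ^ 2)) + 2 * (2 * T / (logMass * R ^ 2)) ^ m * p := by
    have hi3 := h.integrable_prod_bumpCount hz hm hK hC
    calc _ ≤ ∫ ω in Eᶜ, (2 * ∏ i, bumpCount (F ω) (c i) +
            2 * (2 * T / (logMass * R ^ 2)) ^ m) ∂μ := by
          refine integral_mono (hi0.sub hi2).norm.integrableOn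
            ((hi3.const_mul 2).add (integrable_const _)).integrableOn fun ω => ?_
          exact (norm_sub_le _ _).trans (add_le_add (norm_rootSum_le hΓ₀ hΓ₀' (hf ω)) (hLb ω))
      _ = 2 * (∫ ω in Eᶜ, ∏ i, bumpCount (F ω) (c i) ∂μ) +
            μ.real Eᶜ * (2 * (2 * T / (logMass * R ^ 2)) ^ m) := by
          rw [integral_add (hi3.const_mul 2).integrableOn (integrable_const _), integral_const_mul,
            setIntegral_const, smul_eq_mul]
      _ ≤ 2 * (m * (K ^ m * μ.real Eᶜ + C / K ^ 2)) +
            μ.real Eᶜ * (2 * (2 * T / (logMass * R ^ 2)) ^ m) := by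
          gcongr
          exact h.setIntegral_prod_bumpCount_le hz hm hK hC _
      _ ≤ 2 * (m * (K ^ m * p + C / K ^ 2)) + p * (2 * (2 * T / (logMass * R ^ 2)) ^ m) := by
          gcongr
      _ = _ := by ring
  rw [← integral_sub hi0 hi2]
  refine (norm_integral_le_integral_norm _).trans ?_
  have hsplit := integral_add_compl hEm (hi0.sub hi2).norm
  simp only [Pi.sub_apply] at hsplit
  rw [← hsplit]
  exact add_le_add hEE hEc

end BadEvent

/-! ### Correlation sums as sums over tuples of roots -/

section PartialDerivatives

variable {ι : Type*} [Fintype ι] [DecidableEq ι] {f : (ι → ℝ) → ℝ}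

lemma abs_le_one_of_partialsSup_zero_le (h : partialsSup 0 f ≤ 1) (t : ι → ℝ) : |f t| ≤ 1 := by
  have h1 := (le_iSup₂ (f := fun (t : ι → ℝ) (s : Fin 0 → ι) =>
    ‖iteratedFDeriv ℝ 0 f t (fun m => Pi.single (s m) 1)‖ₑ) t Fin.elim0).trans h
  rw [iteratedFDeriv_zero_apply, show (1 : ℝ≥0∞) = ‖(1 : ℝ)‖ₑ by simp, enorm_le_iff_norm_le] at h1
  simpa using h1

lemma abs_sub_le_of_partialsSup_one_le (hf : Differentiable ℝ f) (h : partialsSup 1 f ≤ 1)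
    (t t' : ι → ℝ) : |f t - f t'| ≤ Fintype.card ι * ‖t - t'‖ := by
  have h1 : ∀ u i, |fderiv ℝ f u (Pi.single i 1)| ≤ 1 := fun u i => by
    have h1 := (le_iSup₂ (f := fun (t : ι → ℝ) (s : Fin 1 → ι) =>
      ‖iteratedFDeriv ℝ 1 f t (fun m => Pi.single (s m) 1)‖ₑ) u fun _ => i).trans h
    rw [iteratedFDeriv_one_apply, show (1 : ℝ≥0∞) = ‖(1 : ℝ)‖ₑ by simp, enorm_le_iff_norm_le] at h1
    simpa using h1
  have h2 : ∀ u ∈ (Set.univ : Set (ι → ℝ)), ‖fderiv ℝ f u‖ ≤ Fintype.card ι := fun u _ => by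
    refine ContinuousLinearMap.opNorm_le_bound _ (by positivity) fun v => ?_
    have hv : v = ∑ i, v i • Pi.single i (1 : ℝ) := by
      conv_lhs => rw [← Finset.univ_sum_single v]
      refine Finset.sum_congr rfl fun i _ => ?_
      rw [← Pi.single_smul, smul_eq_mul, mul_one]
    calc ‖fderiv ℝ f u v‖ = ‖∑ i, v i • fderiv ℝ f u (Pi.single i 1)‖ := by
          conv_lhs => rw [hv]
          rw [map_sum]
          simp only [map_smul]
      _ ≤ ∑ _i : ι, ‖v‖ := norm_sum_le_of_le _ fun i _ => by
          rw [norm_smul]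
          calc _ ≤ ‖v‖ * 1 := mul_le_mul (norm_le_pi_norm v i) (h1 u i) (abs_nonneg _)
                (norm_nonneg _)
            _ = _ := mul_one _
      _ = _ := by rw [Finset.sum_const, nsmul_eq_mul, Finset.card_univ]
  exact convex_univ.norm_image_sub_le_of_norm_fderiv_le (fun u _ => hf u) h2 (Set.mem_univ _)
    (Set.mem_univ _)

end PartialDerivatives

section TestFunctions

open Metric Real

variable {k l : ℕ} {G : (Fin k → ℝ) × (Fin l → ℂ) → ℂ}

lemma norm_le_two_of_nablaNorm (h : nablaNorm 0 G ≤ 1) (p : (Fin k → ℝ) × (Fin l → ℂ)) :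
    ‖G p‖ ≤ 2 := by
  set t : Fin k ⊕ (Fin l ⊕ Fin l) → ℝ :=
    Sum.elim p.1 (Sum.elim (fun j => (p.2 j).re) fun j => (p.2 j).im) with ht
  have hp : ofRealCoords t = p := by ext <;> simp [ofRealCoords, ht]
  have h1 := abs_le_one_of_partialsSup_zero_le ((le_max_left _ _).trans h) t
  have h2 := abs_le_one_of_partialsSup_zero_le ((le_max_right _ _).trans h) t
  rw [hp] at h1 h2
  linarith [Complex.norm_le_abs_re_add_abs_im (G p)]

lemma contDiff_ofRealCoords {n : WithTop ℕ∞} :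
    ContDiff ℝ n (ofRealCoords : (Fin k ⊕ (Fin l ⊕ Fin l) → ℝ) → _) := by
  refine ContDiff.prodMk (by fun_prop) (contDiff_pi.2 fun j => ?_)
  have : (fun t : Fin k ⊕ (Fin l ⊕ Fin l) → ℝ =>
      (⟨t (Sum.inr (Sum.inl j)), t (Sum.inr (Sum.inr j))⟩ : ℂ)) =
      fun t => (Complex.ofRealCLM (t (Sum.inr (Sum.inl j))) +
        Complex.ofRealCLM (t (Sum.inr (Sum.inr j))) * Complex.I) := by
    ext t
    simp [Complex.mk_eq_add_mul_I]
  rw [this]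
  fun_prop

lemma norm_sub_le_of_nablaNorm (hG : ContDiff ℝ 1 G) (h : nablaNorm 1 G ≤ 1) {c c' : Fin k ⊕ Fin l → ℂ} :
    ‖G (fun i => (c (Sum.inl i)).re, fun j => c (Sum.inr j)) -
        G (fun i => (c' (Sum.inl i)).re, fun j => c' (Sum.inr j))‖ ≤
      2 * (k + 2 * l) * dist c c' := by
  have hd : Differentiable ℝ fun t : Fin k ⊕ (Fin l ⊕ Fin l) → ℝ => G (ofRealCoords t) :=
    (hG.comp contDiff_ofRealCoords).differentiable one_ne_zero
  set t : (Fin k ⊕ Fin l → ℂ) → Fin k ⊕ (Fin l ⊕ Fin l) → ℝ := fun c => Sum.elim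
    (fun i => (c (Sum.inl i)).re)
    (Sum.elim (fun j => (c (Sum.inr j)).re) fun j => (c (Sum.inr j)).im) with ht
  have hp : ∀ c, ofRealCoords (t c) =
      (fun i => (c (Sum.inl i)).re, fun j => c (Sum.inr j)) := fun c => by
    ext <;> simp [ofRealCoords, ht]
  have htd : ‖t c - t c'‖ ≤ dist c c' := by
    refine (pi_norm_le_iff_of_nonneg dist_nonneg).2 fun i => ?_
    have h1 := fun i => (dist_eq_norm (c i) (c' i)).symm.le.trans (dist_le_pi_dist c c' i)
    rcases i with i | i | i
    · exact (Complex.abs_re_le_norm _).trans (h1 _)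
    · exact (Complex.abs_re_le_norm _).trans (h1 _)
    · exact (Complex.abs_im_le_norm _).trans (h1 _)
  have h1 := abs_sub_le_of_partialsSup_one_le (Complex.reCLM.differentiable.comp hd)
    ((le_max_left _ _).trans h) (t c) (t c')
  have h2 := abs_sub_le_of_partialsSup_one_le (Complex.imCLM.differentiable.comp hd)
    ((le_max_right _ _).trans h) (t c) (t c')
  simp only [Function.comp_apply, Complex.reCLM_apply, Complex.imCLM_apply, hp,
    Fintype.card_sum, Fintype.card_fin] at h1 h2
  rw [← Complex.sub_re] at h1
  rw [← Complex.sub_im] at h2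
  have h3 := Complex.norm_le_abs_re_add_abs_im
    (G (fun i => (c (Sum.inl i)).re, fun j => c (Sum.inr j)) -
        G (fun i => (c' (Sum.inl i)).re, fun j => c' (Sum.inr j)))
  push_cast at h1 h2
  calc _ ≤ _ := h3
    _ ≤ 2 * (k + 2 * l) * ‖t c - t c'‖ := by linarith
    _ ≤ _ := by gcongr

/-- The function of `k + l` complex variables that equals `G` on the real parts of the first `k`
ones and on the last `l` ones, with weights depending on the imaginary parts. -/
noncomputable def weighted (G : (Fin k → ℝ) × (Fin l → ℂ) → ℂ) (χ : Fin k ⊕ Fin l → ℝ → ℝ)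
    (c : Fin k ⊕ Fin l → ℂ) : ℂ :=
  G (fun i => (c (Sum.inl i)).re, fun j => c (Sum.inr j)) * ∏ i, (χ i (c i).im : ℂ)

/-- The weights that select real numbers and the upper half plane. -/
noncomputable def sharpCutoff : Fin k ⊕ Fin l → ℝ → ℝ :=
  Sum.elim (fun _ y => if y = 0 then 1 else 0) fun _ y => if 0 < y then 1 else 0

/-- Continuous weights which agree with `sharpCutoff` off the strips `0 < |y| < γ`. -/
noncomputable def softCutoff (γ : ℝ) : Fin k ⊕ Fin l → ℝ → ℝ :=
  Sum.elim (fun _ y => max 0 (1 - |y / γ|)) fun _ y => min 1 (max 0 (y / γ))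

lemma sharpCutoff_mem (i : Fin k ⊕ Fin l) (y : ℝ) : sharpCutoff i y ∈ Set.Icc (0 : ℝ) 1 := by
  rcases i with i | i <;> simp only [sharpCutoff, Sum.elim_inl, Sum.elim_inr] <;> split_ifs <;> simp

variable {γ : ℝ}

lemma softCutoff_mem (i : Fin k ⊕ Fin l) (y : ℝ) : softCutoff γ i y ∈ Set.Icc (0 : ℝ) 1 := by
  rcases i with i | i
  · simp only [softCutoff, Sum.elim_inl]
    exact ⟨le_max_left _ _, max_le zero_le_one (by linarith [abs_nonneg (y / γ)])⟩
  · simp only [softCutoff, Sum.elim_inr]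
    exact ⟨le_min zero_le_one (le_max_left _ _), min_le_left _ _⟩

lemma abs_softCutoff_sub_le (hγ : 0 < γ) (i : Fin k ⊕ Fin l) (y y' : ℝ) :
    |softCutoff γ i y - softCutoff γ i y'| ≤ |y - y'| / γ := by
  have h0 : |y / γ - y' / γ| = |y - y'| / γ := by rw [← sub_div, abs_div, abs_of_pos hγ]
  have h1 : 0 ≤ |y - y'| / γ := by positivity
  rcases i with i | i
  · simp only [softCutoff, Sum.elim_inl]
    refine (abs_max_sub_max_le_max _ _ _ _).trans (max_le (by simpa using h1) ?_)
    rw [sub_sub_sub_cancel_left, abs_sub_comm, ← h0]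
    exact abs_abs_sub_abs_le_abs_sub _ _
  · simp only [softCutoff, Sum.elim_inr]
    refine (abs_min_sub_min_le_max _ _ _ _).trans (max_le (by simpa using h1) ?_)
    refine (abs_max_sub_max_le_max _ _ _ _).trans (max_le (by simpa using h1) h0.le)

lemma softCutoff_eq_sharpCutoff (hγ : 0 < γ) (i : Fin k ⊕ Fin l) {y : ℝ} (hy : y ≠ 0 → γ < |y|) :
    softCutoff γ i y = sharpCutoff i y := by
  by_cases h0 : y = 0
  · subst h0
    rcases i with i | i <;> simp [softCutoff, sharpCutoff]
  · have h1 := hy h0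
    rcases i with i | i
    · simp only [softCutoff, sharpCutoff, Sum.elim_inl, h0, if_false]
      have h2 : 1 ≤ |y / γ| := by
        rw [abs_div, abs_of_pos hγ, le_div_iff₀ hγ]
        linarith
      exact max_eq_left (by linarith)
    · simp only [softCutoff, sharpCutoff, Sum.elim_inr]
      rcases lt_or_gt_of_ne h0 with hn | hp
      · rw [if_neg hn.not_gt, max_eq_left (div_nonpos_of_nonpos_of_nonneg hn.le hγ.le)]
        simp
      · rw [abs_of_pos hp] at h1
        rw [if_pos hp, max_eq_right (by positivity), min_eq_left]
        rw [le_div_iff₀ hγ]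
        linarith

variable {x : Fin k → ℝ} {z : Fin l → ℂ} {χ : Fin k ⊕ Fin l → ℝ → ℝ}

lemma norm_weighted_le (hG : ∀ p, ‖G p‖ ≤ 2) (hχ : ∀ i y, χ i y ∈ Set.Icc (0 : ℝ) 1)
    (c : Fin k ⊕ Fin l → ℂ) : ‖weighted G χ c‖ ≤ 2 := by
  rw [weighted, norm_mul, norm_prod]
  have h1 : ∏ i, ‖(χ i (c i).im : ℂ)‖ ≤ 1 := Finset.prod_le_one (fun _ _ => norm_nonneg _)
    fun i _ => by
      rw [Complex.norm_real, norm_of_nonneg (hχ _ _).1]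
      exact (hχ _ _).2
  have h2 := hG (fun i => (c (Sum.inl i)).re, fun j => c (Sum.inr j))
  have h3 : 0 ≤ ∏ i, ‖(χ i (c i).im : ℂ)‖ := Finset.prod_nonneg fun _ _ => norm_nonneg _
  nlinarith [norm_nonneg (G (fun i => (c (Sum.inl i)).re, fun j => c (Sum.inr j)))]

/-- The centres of the supports, as one family. -/
noncomputable def centres (x : Fin k → ℝ) (z : Fin l → ℂ) : Fin k ⊕ Fin l → ℂ :=
  Sum.elim (fun i => (x i : ℂ)) z

lemma weighted_mem_ball
    (hG : ∀ p, G p ≠ 0 → (∀ i, p.1 i ∈ Set.Icc (x i - 1 / 100) (x i + 1 / 100)) ∧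
      ∀ j, p.2 j ∈ ball (z j) (1 / 100))
    (hχ : ∀ i y, χ (Sum.inl i) y ≠ 0 → |y| < 1 / 100) (c : Fin k ⊕ Fin l → ℂ)
    (hc : weighted G χ c ≠ 0) (i : Fin k ⊕ Fin l) : c i ∈ ball (centres x z i) (1 / 50) := by
  have h1 := left_ne_zero_of_mul hc
  have h2 := Finset.prod_ne_zero_iff.1 (right_ne_zero_of_mul hc) i (Finset.mem_univ i)
  obtain ⟨h3, h4⟩ := hG _ h1
  rcases i with i | j
  · have h5 := hχ i _ (by exact_mod_cast h2)
    have h6 := h3 i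
    simp only [Set.mem_Icc] at h6
    rw [mem_ball, dist_eq_norm, centres, Sum.elim_inl]
    refine (Complex.norm_le_abs_re_add_abs_im _).trans_lt ?_
    simp only [Complex.sub_re, Complex.ofReal_re, Complex.sub_im, Complex.ofReal_im, sub_zero]
    have h7 : |(c (Sum.inl i)).re - x i| ≤ 1 / 100 := abs_le.2 ⟨by linarith, by linarith⟩
    linarith
  · exact ball_subset_ball (by norm_num) (h4 j)

lemma abs_lt_of_sharpCutoff_ne_zero (i : Fin k) (y : ℝ)
    (h : (sharpCutoff : Fin k ⊕ Fin l → ℝ → ℝ) (Sum.inl i) y ≠ 0) : |y| < 1 / 100 := by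
  simp only [sharpCutoff, Sum.elim_inl, ne_eq, ite_eq_right_iff, one_ne_zero, imp_false,
    not_not] at h
  rw [h]
  norm_num

lemma abs_lt_of_softCutoff_ne_zero (hγ : 0 < γ) (hγ' : γ ≤ 1 / 100) (i : Fin k) (y : ℝ)
    (h : (softCutoff γ : Fin k ⊕ Fin l → ℝ → ℝ) (Sum.inl i) y ≠ 0) : |y| < 1 / 100 := by
  by_contra! hy
  refine h (max_eq_left ?_)
  have : 1 ≤ |y / γ| := by
    rw [abs_div, abs_of_pos hγ, le_div_iff₀ hγ]
    linarith
  linarith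

lemma abs_prod_sub_prod_le_sum {ι : Type*} (s : Finset ι) {a b : ι → ℝ}
    (ha : ∀ i, a i ∈ Set.Icc (0 : ℝ) 1) (hb : ∀ i, b i ∈ Set.Icc (0 : ℝ) 1) :
    |∏ i ∈ s, a i - ∏ i ∈ s, b i| ≤ ∑ i ∈ s, |a i - b i| := by
  classical
  induction s using Finset.induction_on with
  | empty => simp
  | insert i s hi ih =>
    rw [Finset.prod_insert hi, Finset.prod_insert hi, Finset.sum_insert hi,
      show a i * ∏ j ∈ s, a j - b i * ∏ j ∈ s, b j =
        (a i - b i) * ∏ j ∈ s, a j + b i * (∏ j ∈ s, a j - ∏ j ∈ s, b j) by ring]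
    refine (abs_add_le _ _).trans ?_
    rw [abs_mul, abs_mul, abs_of_nonneg (hb i).1,
      abs_of_nonneg (Finset.prod_nonneg fun j _ => (ha j).1)]
    refine add_le_add (mul_le_of_le_one_right (abs_nonneg _)
      (Finset.prod_le_one (fun j _ => (ha j).1) fun j _ => (ha j).2)) ?_
    exact (mul_le_of_le_one_left (abs_nonneg _) (hb i).2).trans ih

lemma isTestFunction_weighted_softCutoff (hγ : 0 < γ) (hγ' : γ ≤ 1 / 100)
    (hG : ∀ p, G p ≠ 0 → (∀ i, p.1 i ∈ Set.Icc (x i - 1 / 100) (x i + 1 / 100)) ∧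
      ∀ j, p.2 j ∈ ball (z j) (1 / 100))
    (hGd : ContDiff ℝ 1 G) (hG₀ : nablaNorm 0 G ≤ 1) (hG₁ : nablaNorm 1 G ≤ 1) :
    IsTestFunction (centres x z) (2 * (k + 2 * l) + 2 * (k + l) / γ)
      (weighted G (softCutoff γ)) where
  mem_ball c hc i := ball_subset_ball (by norm_num)
    (weighted_mem_ball hG (abs_lt_of_softCutoff_ne_zero hγ hγ') c hc i)
  norm_le := norm_weighted_le (norm_le_two_of_nablaNorm hG₀) softCutoff_mem
  lipschitz c c' := by
    have h1 := norm_sub_le_of_nablaNorm hGd hG₁ (c := c) (c' := c')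
    have h2 := norm_le_two_of_nablaNorm hG₀ (fun i => (c' (Sum.inl i)).re, fun j => c' (Sum.inr j))
    unfold weighted
    set g := G (fun i => (c (Sum.inl i)).re, fun j => c (Sum.inr j))
    set g' := G (fun i => (c' (Sum.inl i)).re, fun j => c' (Sum.inr j))
    set P : (Fin k ⊕ Fin l → ℂ) → ℝ := fun c => ∏ i, softCutoff γ i (c i).im with hP
    have hP1 : |P c| ≤ 1 := by
      rw [hP, Finset.abs_prod]
      exact Finset.prod_le_one (fun _ _ => abs_nonneg _) fun i _ => by
        rw [abs_of_nonneg (softCutoff_mem _ _).1]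
        exact (softCutoff_mem _ _).2
    have hP2 : |P c - P c'| ≤ (k + l) / γ * dist c c' := by
      refine (abs_prod_sub_prod_le_sum _ (fun i => softCutoff_mem i _)
        fun i => softCutoff_mem i _).trans ?_
      calc _ ≤ ∑ _i : Fin k ⊕ Fin l, dist c c' / γ := by
            refine Finset.sum_le_sum fun i _ => (abs_softCutoff_sub_le hγ i _ _).trans ?_
            gcongr
            rw [← Complex.sub_im]
            refine (Complex.abs_im_le_norm _).trans ?_
            rw [← dist_eq_norm]
            exact dist_le_pi_dist c c' i
        _ = _ := by
            rw [Finset.sum_const, nsmul_eq_mul, Finset.card_univ, Fintype.card_sum,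
              Fintype.card_fin, Fintype.card_fin]
            push_cast
            ring
    have e : ∀ c : Fin k ⊕ Fin l → ℂ, ∏ i, ((softCutoff γ i (c i).im : ℝ) : ℂ) = (P c : ℂ) :=
      fun c => by rw [hP]; push_cast; rfl
    rw [e, e, show g * (P c : ℂ) - g' * (P c' : ℂ) = (g - g') * (P c : ℂ) +
      g' * ((P c - P c' : ℝ) : ℂ) by push_cast; ring]
    refine (norm_add_le _ _).trans ?_
    rw [norm_mul, norm_mul, Complex.norm_real, Complex.norm_real, norm_eq_abs, norm_eq_abs]
    calc _ ≤ 2 * (k + 2 * l) * dist c c' * 1 + 2 * ((k + l) / γ * dist c c') := by gcongr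
      _ = _ := by ring

lemma correlationSum_eq_rootSum (f : ℂ → ℂ) :
    correlationSum G f = rootSum (weighted G sharpCutoff) f := by
  set e : (Fin k → RealRoot f) × (Fin l → UpperRoot f) → Fin k ⊕ Fin l → Root f :=
    fun p => Sum.elim (fun i => (p.1 i).1) fun j => (p.2 j).1 with he
  have hinj : Function.Injective e := fun p q hpq => by
    refine Prod.ext (funext fun i => Subtype.ext ?_) (funext fun j => Subtype.ext ?_)
    · exact congrFun hpq (Sum.inl i)
    · exact congrFun hpq (Sum.inr j)
  rw [rootSum, ← hinj.tsum_eq, correlationSum]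
  · refine tsum_congr fun p => ?_
    rw [weighted, Finset.prod_eq_one, mul_one]
    · simp [he]
    · rintro (i | j) -
      · simp [he, sharpCutoff, (p.1 i).2]
      · simp [he, sharpCutoff, (p.2 j).2]
  · intro r hr
    have h2 := Finset.prod_ne_zero_iff.1 (right_ne_zero_of_mul hr)
    have h3 : ∀ i, (r (Sum.inl i)).loc.im = 0 := fun i => by
      have := h2 (Sum.inl i) (Finset.mem_univ _)
      simpa [sharpCutoff] using this
    have h4 : ∀ j, 0 < (r (Sum.inr j)).loc.im := fun j => by
      have := h2 (Sum.inr j) (Finset.mem_univ _)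
      simpa [sharpCutoff] using this
    refine ⟨(fun i => ⟨_, h3 i⟩, fun j => ⟨_, h4 j⟩), ?_⟩
    ext1 i
    rcases i with i | j <;> simp [he]

/-- Without roots in the strips `0 < |Im| ≤ γ`, the cutoffs need not be distinguished. -/
lemma rootSum_weighted_eq (hγ : 0 < γ) (hγ' : γ ≤ 1 / 100)
    (hG : ∀ p, G p ≠ 0 → (∀ i, p.1 i ∈ Set.Icc (x i - 1 / 100) (x i + 1 / 100)) ∧
      ∀ j, p.2 j ∈ ball (z j) (1 / 100)) {f : ℂ → ℂ}
    (hf : ∀ i, ∀ r : Root f, r.loc ∈ ball (centres x z i) (1 / 50) → r.loc.im ≠ 0 →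
      γ < |r.loc.im|) :
    rootSum (weighted G sharpCutoff) f = rootSum (weighted G (softCutoff γ)) f := by
  refine tsum_congr fun r => ?_
  by_cases hr : ∀ i, (r i).loc ∈ ball (centres x z i) (1 / 50)
  · unfold weighted
    congr 1
    refine Finset.prod_congr rfl fun i _ => ?_
    rw [softCutoff_eq_sharpCutoff hγ i (hf i (r i) (hr i))]
  · obtain ⟨i, hi⟩ := not_forall.1 hr
    have h1 : weighted G sharpCutoff (fun i => (r i).loc) = 0 := by
      by_contra h
      exact hi (weighted_mem_ball hG abs_lt_of_sharpCutoff_ne_zero _ h i)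
    have h2 : weighted G (softCutoff γ) (fun i => (r i).loc) = 0 := by
      by_contra h
      exact hi (weighted_mem_ball hG (abs_lt_of_softCutoff_ne_zero hγ hγ') _ h i)
    rw [h1, h2]

lemma IsAnalyticSeries.measurable_correlationSum {J Ω : Type*} [MeasurableSpace Ω] {τ ε : ℝ}
    {μ : Measure Ω} [IsProbabilityMeasure μ] {ξ : J → Ω → ℝ} {φ : J → ℂ → ℂ} {s : ℕ → Finset J}
    {U : Set ℂ} {F : Ω → ℂ → ℂ} (h : IsAnalyticSeries τ ε μ ξ φ s U F)
    (hz : ∀ i, ball (centres x z i) 2 ⊆ U)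
    (hG : ∀ p, G p ≠ 0 → (∀ i, p.1 i ∈ Set.Icc (x i - 1 / 100) (x i + 1 / 100)) ∧
      ∀ j, p.2 j ∈ ball (z j) (1 / 100))
    (hGd : ContDiff ℝ 1 G) (hG₀ : nablaNorm 0 G ≤ 1) (hG₁ : nablaNorm 1 G ≤ 1) :
    Measurable fun ω => rootSum (weighted G sharpCutoff) (F ω) := by
  have hpos : ∀ N : ℕ, (0 : ℝ) < 1 / (N + 100) := fun N => by positivity
  have hle : ∀ N : ℕ, (1 : ℝ) / (N + 100) ≤ 1 / 100 := fun N =>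
    one_div_le_one_div_of_le (by norm_num) (by linarith [Nat.cast_nonneg (α := ℝ) N])
  refine measurable_of_tendsto_metrizable
    (f := fun (N : ℕ) ω => rootSum (weighted G (softCutoff (1 / (N + 100 : ℝ)))) (F ω))
    (fun N => h.measurable_rootSum hz (isTestFunction_weighted_softCutoff (hpos N) (hle N) hG hGd
      hG₀ hG₁) (by have := hpos N; positivity)) (tendsto_pi_nhds.2 fun ω => ?_)
  refine tendsto_const_nhds.congr' ?_
  have hlim : Tendsto (fun N : ℕ => (1 : ℝ) / (N + 100)) atTop (𝓝 0) :=
    tendsto_const_nhds.div_atTop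
      (tendsto_atTop_add_const_right _ _ tendsto_natCast_atTop_atTop)
  have h1 : ∀ᶠ N : ℕ in atTop, ∀ i, ∀ r ∈ rootsIn (F ω) (closedBall (centres x z i) (4 / 5)),
      r.loc.im ≠ 0 → (1 : ℝ) / (N + 100) < |r.loc.im| := by
    rw [eventually_all]
    intro i
    rw [Filter.eventually_all_finset]
    intro r _
    by_cases h0 : r.loc.im = 0
    · exact Eventually.of_forall fun N h => absurd h0 h
    · exact (hlim.eventually (gt_mem_nhds (abs_pos.2 h0))).mono fun N hN _ => hN
  filter_upwards [h1] with N hN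
  refine rootSum_weighted_eq (hpos N) (hle N) hG fun i r hr => hN i r ?_
  rw [mem_rootsIn (((h.analytic ω).mono (hz i)).mono (closedBall_subset_ball (by norm_num)))]
  exact ball_subset_closedBall (ball_subset_ball (by norm_num) hr)

end TestFunctions

/-! ### Consequences of the two conditions -/

section Summation

variable {J : Type*} {a : J → ℂ}

lemma enorm_sq_eq_ofReal (w : ℂ) : ‖w‖ₑ ^ 2 = ENNReal.ofReal (‖w‖ ^ 2) := by
  rw [ENNReal.ofReal_pow (norm_nonneg _), ofReal_norm]

lemma summable_of_tsum_enorm_sq (h : ∑' j, ‖a j‖ₑ ^ 2 ≠ ∞) : Summable fun j => ‖a j‖ ^ 2 := by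
  have := ENNReal.summable_toReal h
  simpa using this

lemma tsum_enorm_sq_eq (h : ∑' j, ‖a j‖ₑ ^ 2 ≠ ∞) :
    ∑' j, ‖a j‖ₑ ^ 2 = ENNReal.ofReal (∑' j, ‖a j‖ ^ 2) := by
  rw [ENNReal.ofReal_tsum_of_nonneg (fun _ => by positivity) (summable_of_tsum_enorm_sq h)]
  exact tsum_congr fun j => enorm_sq_eq_ofReal _

lemma ofReal_rpow_half {V : ℝ} (hV : 0 ≤ V) :
    ENNReal.ofReal V ^ (1 / 2 : ℝ) = ENNReal.ofReal √V := by
  rw [ENNReal.ofReal_rpow_of_nonneg hV (by norm_num), Real.sqrt_eq_rpow]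

end Summation

section Truncation

variable {n : ℕ∞}

/-- The indices up to `M`. -/
noncomputable def indicesUpTo (n : ℕ∞) (M : ℕ) : Finset (indices n) :=
  open Classical in (Finset.range (M + 1)).subtype (· ∈ indices n)

lemma tendsto_indicesUpTo : Tendsto (indicesUpTo n) atTop atTop := by
  classical
  refine tendsto_atTop_finset_of_monotone (fun M M' h j hj => ?_) fun j => ⟨j, ?_⟩
  · simp only [indicesUpTo, Finset.mem_subtype, Finset.mem_range] at hj ⊢
    omega
  · simp [indicesUpTo]

lemma partialSum_eq (φ : ℕ → ℂ → ℂ) (c : ℕ → ℂ) (M : ℕ) (w : ℂ) :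
    partialSum n φ c M w = ∑ j ∈ indicesUpTo n M, c j * φ j w := by
  classical
  rw [partialSum, Finset.sum_indicator_eq_sum_filter, indicesUpTo, ← Finset.subtype_map,
    Finset.sum_map]
  rfl

/-- The indices below `N`. -/
noncomputable def indicesBelow (n : ℕ∞) (N : ℕ) : Finset (indices n) :=
  open Classical in (Finset.range N).subtype (· ∈ indices n)

lemma mem_indicesBelow {N : ℕ} {j : indices n} : j ∈ indicesBelow n N ↔ (j : ℕ) < N := by
  simp [indicesBelow]

lemma card_indicesBelow_le (N : ℕ) : (indicesBelow n N).card ≤ N := by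
  classical
  rw [indicesBelow, Finset.card_subtype]
  exact (Finset.card_filter_le _ _).trans (by simp)

end Truncation

section Moments

variable {n : ℕ∞} {τ ε : ℝ} {Ω : Type*} [MeasurableSpace Ω] {μ : Measure Ω}
  [IsProbabilityMeasure μ] {ξ : ℕ → Ω → ℝ}

omit [IsProbabilityMeasure μ] in
lemma BoundedMoments.measurable_real (h : BoundedMoments n τ ε μ fun i ω => (ξ i ω : ℂ))
    (j : indices n) : Measurable (ξ j) := by
  simpa [Function.comp_def] using Complex.measurable_re.comp (h.measurable j j.2)

lemma BoundedMoments.indepNormalized (h : BoundedMoments n τ ε μ fun i ω => (ξ i ω : ℂ))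
    {ζ : indices n → Ω → ℝ} (hm : ∀ j, Measurable (ζ j)) (hζ : ∀ j : indices n, ζ j =ᵐ[μ] ξ j) :
    IndepNormalized τ ε μ ζ where
  measurable := hm
  indep := by
    have h1 := h.indep.comp (fun _ => Complex.re) fun _ => Complex.measurable_re
    exact iIndepFun.congr (fun j => (hζ j).symm) h1
  law j := by
    have hj := (h.measurable_real j).aemeasurable (μ := μ)
    rw [Measure.map_congr (hζ j)]
    have e : ∫ y, y ∂(μ.map (ξ j)) = ∫ ω, ξ j ω ∂μ :=
      integral_map hj aestronglyMeasurable_id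
    have hn : ∀ ω, ‖(ξ j ω : ℂ) - ∫ ω', (ξ j ω' : ℂ) ∂μ‖ = |ξ j ω - ∫ ω', ξ j ω' ∂μ| := fun ω => by
      rw [integral_complex_ofReal, ← Complex.ofReal_sub, Complex.norm_real, Real.norm_eq_abs]
    have h2 := h.variance j j.2
    have h3 := h.moment j j.2
    simp only [hn, sq_abs] at h2 h3
    refine ⟨Measure.isProbabilityMeasure_map hj, ?_, ?_, ?_⟩
    · rw [memLp_map_measure_iff aestronglyMeasurable_id hj]
      simpa using (h.memLp j j.2).re
    · rw [e, integral_map hj (by fun_prop)]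
      exact h2
    · rw [e, integral_map hj (Measurable.aestronglyMeasurable (by fun_prop))]
      exact h3

end Moments

section Conditions

open Metric Real

variable {n : ℕ∞} {τ ε δ C₁ α₁ A c₁ C : ℝ} {D : Set ℂ} {φ : ℕ → ℂ → ℂ} {m : ℕ} {Ω : Type*}
  [MeasurableSpace Ω] {μ : Measure Ω} [IsProbabilityMeasure μ] {ξ : ℕ → Ω → ℝ} {ι : Type*}
  [Fintype ι] {c : ι → ℂ}

/-- The variables and the random function, modified on a null set, form an analytic series. -/
lemma CondC2.exists_isAnalyticSeries (hm : BoundedMoments n τ ε μ fun i ω => (ξ i ω : ℂ))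
    (h : CondC2 n δ D φ μ (fun i ω => (ξ i ω : ℂ)) m C₁ α₁ A c₁ C) (hc : ∀ i, c i ∈ D) :
    ∃ (ζ : indices n → Ω → ℝ) (F : Ω → ℂ → ℂ), (∀ j : indices n, ζ j =ᵐ[μ] ξ j) ∧
      (∀ᵐ ω ∂μ, F ω = linComb n φ fun i => (ξ i ω : ℂ)) ∧
      IsAnalyticSeries τ ε μ ζ (fun j : indices n => φ j) (indicesUpTo n)
        (⋃ i, ball (c i) 2) F := by
  classical
  obtain ⟨S, hS, hSm, hSp⟩ := (ae_all_iff.2 fun i => h.analytic (c i) (hc i)).exists_measurable_mem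
  have hζ : ∀ j : indices n, S.indicator (ξ j) =ᵐ[μ] ξ j := fun j => by
    filter_upwards [hS] with ω hω
    rw [Set.indicator_of_mem hω]
  refine ⟨fun j => S.indicator (ξ j), fun ω => if ω ∈ S then linComb n φ fun i => (ξ i ω : ℂ) else 0,
    hζ, ?_, ?_⟩
  · filter_upwards [hS] with ω hω
    rw [if_pos hω]
  refine ⟨hm.indepNormalized (fun j => (hm.measurable_real j).indicator hSm) hζ,
    tendsto_indicesUpTo, isOpen_iUnion fun i => isOpen_ball, fun ω w hw => ?_, fun ω => ?_⟩
  · obtain ⟨i, hi⟩ := Set.mem_iUnion.1 hw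
    by_cases hω : ω ∈ S
    · simp only [Set.indicator_of_mem hω, if_pos hω, ← partialSum_eq φ fun i => (ξ i ω : ℂ)]
      exact tendsto_nhds_limUnder ((hSp ω hω i).1 w hi)
    · simp [hω]
  · by_cases hω : ω ∈ S
    · simp only [if_pos hω]
      rintro w hw
      obtain ⟨i, hi⟩ := Set.mem_iUnion.1 hw
      exact (hSp ω hω i).2 w hi
    · simp only [if_neg hω]
      exact analyticOnNhd_const

lemma ball_subset_add {z : ℂ} (hz : z ∈ D) : ball z 1 ⊆ D + ball (0 : ℂ) 1 := fun w hw =>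
  Set.mem_add.2 ⟨z, hz, w - z, by simpa [dist_eq_norm] using hw, by ring⟩

omit [IsProbabilityMeasure μ] in
lemma CondC2.isDelocalized (h : CondC2 n δ D φ μ (fun i ω => (ξ i ω : ℂ)) m C₁ α₁ A c₁ C)
    (hδ : 0 < δ) (hC : 0 ≤ C) {z : ℂ} (hz : z ∈ D) :
    IsDelocalized (fun j : indices n => φ j) (C * δ ^ α₁) z where
  summable w hw := summable_of_tsum_enorm_sq (h.summable w (ball_subset_add hz hw))
  norm_le w hw j := by
    have h1 := h.delocalization w (ball_subset_add hz hw) j j.2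
    rw [tsum_enorm_sq_eq (h.summable w (ball_subset_add hz hw)),
      ofReal_rpow_half (tsum_nonneg fun _ => by positivity), ← ENNReal.ofReal_mul (by positivity),
      ← ofReal_norm, ENNReal.ofReal_le_ofReal_iff (by positivity)] at h1
    exact h1

omit [IsProbabilityMeasure μ] in
lemma CondC2.growthAt (h : CondC2 n δ D φ μ (fun i ω => (ξ i ω : ℂ)) m C₁ α₁ A c₁ C)
    (hδ : 0 < δ) (hC : 0 ≤ C) {z : ℂ} (hz : z ∈ D) {ζ : indices n → Ω → ℝ}
    (hζ : ∀ j : indices n, ζ j =ᵐ[μ] ξ j) {K : ℝ} (hK : C * δ ^ (-c₁) ≤ K) {x : ℝ}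
    (hx : (x : ℂ) ∈ ball z 1) :
    GrowthAt μ ζ (fun j : indices n => φ j) K (C * δ ^ α₁) x := by
  have hd := h.isDelocalized hδ hC hz
  have hxD := ball_subset_add hz hx
  have hV := tsum_enorm_sq_eq (h.summable x hxD)
  set V := ∑' j : indices n, ‖φ j x‖ ^ 2 with hVdef
  have hV0 : 0 ≤ V := tsum_nonneg fun _ => by positivity
  have hK0 : 0 ≤ C * δ ^ (-c₁) := by positivity
  set S : indices n → ℝ≥0∞ := fun j =>
    ⨆ z ∈ ball (x : ℂ) 1, ‖iteratedDeriv 2 (φ j) z‖ₑ ^ 2 with hS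
  set b : indices n → ℝ≥0∞ := fun j => ⨆ z ∈ ball (x : ℂ) 1, ‖iteratedDeriv 2 (φ j) z‖ₑ with hb
  have hKV : ENNReal.ofReal (C * δ ^ (-c₁)) * ENNReal.ofReal V ≤ ENNReal.ofReal (K * V) := by
    rw [← ENNReal.ofReal_mul hK0]
    exact ENNReal.ofReal_le_ofReal (by gcongr)
  have hS1 : ∑' j, S j ≤ ENNReal.ofReal (K * V) := by
    have := h.derivGrowth₂ x hxD
    rw [hV] at this
    exact this.trans hKV
  have hbS : ∀ j, b j ^ 2 ≤ S j := fun j => by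
    have h1 : b j ≤ S j ^ (1 / 2 : ℝ) := iSup₂_le fun w hw => by
      have h2 : ‖iteratedDeriv 2 (φ j) w‖ₑ ^ 2 ≤ S j :=
        le_iSup₂ (f := fun z (_ : z ∈ ball (x : ℂ) 1) => ‖iteratedDeriv 2 (φ j) z‖ₑ ^ 2) w hw
      rw [one_div, ENNReal.le_rpow_inv_iff (by norm_num)]
      exact_mod_cast h2
    rw [one_div, ENNReal.le_rpow_inv_iff (by norm_num)] at h1
    exact_mod_cast h1
  have hbtop : ∀ j, b j ≠ ∞ := fun j hj => by
    have h1 := (hbS j).trans ((ENNReal.le_tsum j).trans hS1)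
    rw [hj] at h1
    simp at h1
  refine ⟨hd.summable x hx, hd.norm_le x hx, fun j => ?_, fun j => (b j).toReal,
    fun j w hw => ?_, fun t => ⟨?_, ?_⟩⟩
  · have h1 := (ENNReal.le_tsum j).trans (h.derivGrowth₁ x hxD)
    rw [hV, enorm_sq_eq_ofReal] at h1
    exact (ENNReal.ofReal_le_ofReal_iff (mul_nonneg (hK0.trans hK) hV0)).1 (h1.trans hKV)
  · have h1 : ‖iteratedDeriv 2 (φ j) w‖ₑ ≤ b j :=
      le_iSup₂ (f := fun z (_ : z ∈ ball (x : ℂ) 1) => ‖iteratedDeriv 2 (φ j) z‖ₑ) w hw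
    rw [iteratedDeriv_succ, iteratedDeriv_one] at h1
    have := ENNReal.toReal_mono (hbtop j) h1
    rwa [toReal_enorm] at this
  · rw [← ENNReal.ofReal_le_ofReal_iff (mul_nonneg (hK0.trans hK) hV0),
      ENNReal.ofReal_sum_of_nonneg fun _ _ => by positivity]
    refine le_trans (Finset.sum_le_sum fun j _ => ?_) ((ENNReal.sum_le_tsum t).trans hS1)
    rw [ENNReal.ofReal_pow ENNReal.toReal_nonneg, ENNReal.ofReal_toReal (hbtop j)]
    exact hbS j
  · rw [← ENNReal.ofReal_le_ofReal_iff (mul_nonneg (hK0.trans hK) (sqrt_nonneg _)),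
      ENNReal.ofReal_sum_of_nonneg fun _ _ => by positivity]
    have h3 := h.derivGrowth₃ x hxD
    rw [hV, ofReal_rpow_half hV0, ← ENNReal.ofReal_mul hK0] at h3
    refine le_trans (Finset.sum_le_sum fun j _ => ?_) ((ENNReal.sum_le_tsum t).trans
      (h3.trans (ENNReal.ofReal_le_ofReal (by gcongr))))
    rw [ENNReal.ofReal_mul (abs_nonneg _), ENNReal.ofReal_toReal (hbtop j),
      integral_congr_ae (hζ j), integral_complex_ofReal, ← ofReal_norm, Complex.norm_real,
      norm_eq_abs]

omit [IsProbabilityMeasure μ] in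
lemma CondC2.hasRootMoment (h : CondC2 n δ D φ μ (fun i ω => (ξ i ω : ℂ)) m C₁ α₁ A c₁ C)
    {F : Ω → ℂ → ℂ} (hF : ∀ᵐ ω ∂μ, F ω = linComb n φ fun i => (ξ i ω : ℂ)) {z : ℂ} (hz : z ∈ D) :
    HasRootMoment μ F m (δ ^ (-C₁)) C z := by
  refine ⟨_, ?_, h.rootMoment z hz⟩
  filter_upwards [hF, h.analytic z hz] with ω hω han
  rw [hω]
  exact ofReal_bumpCount_le_rootCount han.2

section Dense

variable {J : Type*} {ζ : J → Ω → ℝ} {ψ : J → ℂ → ℂ} {s : ℕ → Finset J} {U : Set ℂ}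
  {F : Ω → ℂ → ℂ} {z : ℂ}

lemma IsAnalyticSeries.measurableSet_norm_le (h : IsAnalyticSeries τ ε μ ζ ψ s U F)
    {r : ℝ} (hz : ball z r ⊆ U) (b : ℝ) : MeasurableSet {ω | ∀ w ∈ ball z r, ‖F ω w‖ ≤ b} := by
  have e : {ω | ∀ w ∈ ball z r, ‖F ω w‖ ≤ b} = ⋂ q : ℕ, {ω | TopologicalSpace.denseSeq ℂ q ∈ ball z r →
      ‖F ω (TopologicalSpace.denseSeq ℂ q)‖ ≤ b} := by
    ext ω
    simp only [Set.mem_ofPred_eq, Set.mem_iInter]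
    refine ⟨fun H q => H _, fun H w hw => ?_⟩
    by_contra! hlt
    have hc : ContinuousOn (fun w => ‖F ω w‖) (ball z r) :=
      ((h.analytic ω).continuousOn.mono hz).norm
    have ho := hc.isOpen_inter_preimage isOpen_ball (isOpen_Ioi (a := b))
    obtain ⟨w', hw', q, rfl⟩ := (TopologicalSpace.denseRange_denseSeq ℂ).inter_open_nonempty _ ho ⟨w, hw, hlt⟩
    exact absurd (H q hw'.1) (not_le.2 hw'.2)
  rw [e]
  refine MeasurableSet.iInter fun q => ?_
  by_cases hq : TopologicalSpace.denseSeq ℂ q ∈ ball z r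
  · simp only [hq, forall_true_left]
    exact measurableSet_le (h.measurable_apply (hz hq)).norm measurable_const
  · simp [hq]

lemma CondC2.exists_event (h : CondC2 n δ D φ μ (fun i ω => (ξ i ω : ℂ)) m C₁ α₁ A c₁ C)
    (hF : ∀ᵐ ω ∂μ, F ω = linComb n φ fun i => (ξ i ω : ℂ))
    (hs : IsAnalyticSeries τ ε μ ζ ψ s U F) (hδ : 0 < δ) (hδ' : δ ≤ 1) (hc₁ : 0 ≤ c₁)
    (hz : z ∈ D) (hU : ball z 2 ⊆ U) :
    ∃ E, MeasurableSet E ∧ μ.real Eᶜ ≤ 2 * (C * δ ^ A) ∧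
      ∀ ω ∈ E, LogBounded (F ω) z (δ ^ (-c₁)) := by
  set Q := δ ^ (-c₁) with hQ
  have hU' : ball z (1 / 100) ⊆ U := (ball_subset_ball (by norm_num)).trans hU
  have hm₁ := hs.measurableSet_norm_le hU (exp Q)
  have hm₂ := (hs.measurableSet_norm_le hU' (exp (-Q) / 2)).compl
  set E₁ := {ω | ∀ w ∈ ball z 2, ‖F ω w‖ ≤ exp Q}
  set E₂ := {ω | ∀ w ∈ ball z (1 / 100), ‖F ω w‖ ≤ exp (-Q) / 2}ᶜ
  have h1 : 1 - C * δ ^ A ≤ μ.real E₁ := by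
    refine (h.boundedness z hz).trans (ENNReal.toReal_mono (measure_ne_top _ _)
      (measure_mono_ae ?_))
    filter_upwards [hF] with ω hω hH
    change ∀ w ∈ ball z 2, ‖F ω w‖ ≤ exp Q
    rw [hω]
    exact hH
  have h2 : 1 - C * δ ^ A ≤ μ.real E₂ := by
    refine (h.antiConcentration z hz).trans (ENNReal.toReal_mono (measure_ne_top _ _)
      (measure_mono_ae ?_))
    filter_upwards [hF] with ω hω hH
    obtain ⟨z', hz', hle⟩ := hH
    change ¬ ∀ w ∈ ball z (1 / 100), ‖F ω w‖ ≤ exp (-Q) / 2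
    rw [hω]
    intro H
    have := H z' hz'
    have h0 := exp_pos (-Q)
    linarith
  refine ⟨E₁ ∩ E₂, hm₁.inter hm₂, ?_, fun ω hω => ⟨one_le_rpow_of_pos_of_le_one_of_nonpos hδ hδ'
    (by linarith), (hs.analytic ω).mono hU, hω.1, ?_⟩⟩
  · rw [Set.compl_inter]
    refine (measureReal_union_le _ _).trans ?_
    rw [probReal_compl_eq_one_sub hm₁, probReal_compl_eq_one_sub hm₂]
    linarith
  · have := hω.2
    simp only [E₂, Set.mem_compl_iff, Set.mem_ofPred_eq, not_forall, not_le] at this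
    obtain ⟨w, hw, hlt⟩ := this
    exact ⟨w, hw, hlt.le⟩

lemma CondC2.exists_good_event (h : CondC2 n δ D φ μ (fun i ω => (ξ i ω : ℂ)) m C₁ α₁ A c₁ C)
    (hF : ∀ᵐ ω ∂μ, F ω = linComb n φ fun i => (ξ i ω : ℂ))
    (hs : IsAnalyticSeries τ ε μ ζ ψ s U F) (hδ : 0 < δ) (hδ' : δ ≤ 1) (hc₁ : 0 ≤ c₁)
    (hc : ∀ i, c i ∈ D) (hU : ∀ i, ball (c i) 2 ⊆ U) :
    ∃ E, MeasurableSet E ∧ μ.real Eᶜ ≤ Fintype.card ι * (2 * (C * δ ^ A)) ∧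
      ∀ ω ∈ E, ∀ i, LogBounded (F ω) (c i) (δ ^ (-c₁)) := by
  choose E hEm hEp hE using fun i => h.exists_event hF hs hδ hδ' hc₁ (hc i) (hU i)
  refine ⟨⋂ i, E i, MeasurableSet.iInter hEm, ?_, fun ω hω i => hE i ω (Set.mem_iInter.1 hω i)⟩
  rw [Set.compl_iInter]
  calc _ ≤ ∑ i, μ.real (E i)ᶜ := measureReal_iUnion_fintype_le _
    _ ≤ ∑ _i : ι, 2 * (C * δ ^ A) := Finset.sum_le_sum fun i _ => hEp i
    _ = _ := by rw [Finset.sum_const, nsmul_eq_mul, Finset.card_univ]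

end Dense

end Conditions

/-! ### Comparison of the two random functions -/

section TwoSeries

open Metric Real

variable {n : ℕ∞} {τ ε δ C₁ α₁ A c₁ C : ℝ} {D : Set ℂ} {φ : ℕ → ℂ → ℂ} {Ω Ω' : Type*}
  [MeasurableSpace Ω] {μ : Measure Ω} [IsProbabilityMeasure μ] {ξ : ℕ → Ω → ℝ}
  [MeasurableSpace Ω'] {μ' : Measure Ω'} [IsProbabilityMeasure μ'] {ξ' : ℕ → Ω' → ℝ}
  {k l : ℕ} {G : (Fin k → ℝ) × (Fin l → ℂ) → ℂ} {x : Fin k → ℝ} {z : Fin l → ℂ}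
  {ζ : indices n → Ω → ℝ} {F : Ω → ℂ → ℂ}

/-- A bound for the probability of roots in the strips `0 < |Im| ≤ γ`, with free parameter `L`. The
number `s` stands for `charFunRadius τ ε`. -/
noncomputable def stripError (s K L γ η : ℝ) : ℝ :=
  1 / γ * (4 * K ^ 2 / L ^ 2 + (36 * γ ^ 2 * L + (η / (s * (3 * γ ^ 2 * L))) ^ 2))

/-- The distance between the expected correlation sum of one series and its expected smoothed sum of
truncated logarithms. Here `σ` bounds the probability of roots near the real axis, `p` that of the
bad event, and the root count enters through `K` and `C` as in `HasRootMoment`. -/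
noncomputable def smoothingError (m : ℕ) (s Λ R Q T β η σ K C p : ℝ) : ℝ :=
  4 * (5 * Q) ^ m * σ + smoothError m s Λ R Q T β η +
    (2 * (m * (K ^ m * p + C / K ^ 2)) + 2 * (2 * T / (logMass * R ^ 2)) ^ m * p)

lemma card_sum_fin (k l : ℕ) : Fintype.card (Fin k ⊕ Fin l) = k + l := by simp

lemma centres_mem (hx : ∀ i, (x i : ℂ) ∈ D) (hz : ∀ j, z j ∈ D) (i : Fin k ⊕ Fin l) :
    centres x z i ∈ D := by
  rcases i with i | j
  · exact hx i
  · exact hz j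

lemma measureReal_rootSum_ne_le
    (hs : IsAnalyticSeries τ ε μ ζ (fun j : indices n => φ j) (indicesUpTo n)
      (⋃ i, ball (centres x z i) 2) F)
    (h : CondC2 n δ D φ μ (fun i ω => (ξ i ω : ℂ)) (k + l) C₁ α₁ A c₁ C)
    (hζ : ∀ j : indices n, ζ j =ᵐ[μ] ξ j)
    (hτ : 0 < τ) (hε₀ : 0 < ε) (hε₁ : ε < 1) (hδ : 0 < δ) (hC : 0 < C)
    (hφ : ∀ i ∈ indices n, ∀ x : ℝ, (φ i (x : ℂ)).im = 0)
    (hx : ∀ i, (x i : ℂ) ∈ D) (hz : ∀ j, z j ∈ D)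
    (hG : ∀ p, G p ≠ 0 → (∀ i, p.1 i ∈ Set.Icc (x i - 1 / 100) (x i + 1 / 100)) ∧
      ∀ j, p.2 j ∈ ball (z j) (1 / 100)) {K L γ : ℝ} (hK : 1 ≤ K) (hK' : C * δ ^ (-c₁) ≤ K)
    (hL : 0 < L) (hγ : 0 < γ) (hγ' : γ ≤ 1 / 100) :
    μ.real {ω | rootSum (weighted G sharpCutoff) (F ω) ≠ rootSum (weighted G (softCutoff γ)) (F ω)} ≤
      (k + l : ℕ) * stripError (charFunRadius τ ε) K L γ (C * δ ^ α₁) := by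
  have hs0 := charFunRadius_pos (ε := ε) hτ
  set S : Fin k ⊕ Fin l → Set Ω := fun i => {ω | ∃ r : Root (F ω),
    r.loc ∈ ball (centres x z i) (1 / 50) ∧ r.loc.im ≠ 0 ∧ |r.loc.im| ≤ γ} with hS
  have hSμ : ∀ i, μ.real (S i) ≤ stripError (charFunRadius τ ε) K L γ (C * δ ^ α₁) := fun i => by
    refine ENNReal.toReal_le_of_le_ofReal (by unfold stripError; positivity) ?_
    exact measure_root_near_real_le hs (Set.subset_iUnion (fun i => ball (centres x z i) 2) i)
      (fun t ht => h.growthAt hδ hC.le (centres_mem hx hz i) hζ hK' ht) hτ hε₀ hε₁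
      (fun j t => hφ j j.2 t) hK (by positivity) hγ (by linarith) hL
  calc _ ≤ μ.real (⋃ i, S i) := by
        refine measureReal_mono fun ω hω => ?_
        by_contra hn
        simp only [hS, Set.mem_iUnion, Set.mem_ofPred_eq, not_exists, not_and, not_le] at hn
        exact hω (rootSum_weighted_eq hγ hγ' hG hn)
    _ ≤ ∑ i, μ.real (S i) := measureReal_iUnion_fintype_le _
    _ ≤ ∑ _i : Fin k ⊕ Fin l, stripError (charFunRadius τ ε) K L γ (C * δ ^ α₁) :=
        Finset.sum_le_sum fun i _ => hSμ i
    _ = _ := by rw [Finset.sum_const, nsmul_eq_mul, Finset.card_univ, card_sum_fin]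

lemma norm_integral_sub_smoothSum_le
    (hs : IsAnalyticSeries τ ε μ ζ (fun j : indices n => φ j) (indicesUpTo n)
      (⋃ i, ball (centres x z i) 2) F)
    (h : CondC2 n δ D φ μ (fun i ω => (ξ i ω : ℂ)) (k + l) C₁ α₁ A c₁ C)
    (hζ : ∀ j : indices n, ζ j =ᵐ[μ] ξ j)
    (hF : ∀ᵐ ω ∂μ, F ω = linComb n φ fun i => (ξ i ω : ℂ)) (hkl : 1 ≤ k + l)
    (hτ : 0 < τ) (hε₀ : 0 < ε) (hε₁ : ε < 1) (hδ : 0 < δ) (hδ' : δ ≤ 1) (hC : 0 < C) (hc₁ : 0 ≤ c₁)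
    (hφ : ∀ i ∈ indices n, ∀ x : ℝ, (φ i (x : ℂ)).im = 0)
    (hx : ∀ i, (x i : ℂ) ∈ D) (hz : ∀ j, z j ∈ D)
    (hG : ∀ p, G p ≠ 0 → (∀ i, p.1 i ∈ Set.Icc (x i - 1 / 100) (x i + 1 / 100)) ∧
      ∀ j, p.2 j ∈ ball (z j) (1 / 100))
    (hGd : ContDiff ℝ 1 G) (hG₀ : nablaNorm 0 G ≤ 1) (hG₁ : nablaNorm 1 G ≤ 1)
    (hη : C * δ ^ α₁ ≤ charFunRadius τ ε / 100)
    (hp : (k + l : ℕ) * (2 * (C * δ ^ A)) ≤ 1 / 2) {K L γ R T β : ℝ} (hK : 1 ≤ K)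
    (hK' : C * δ ^ (-c₁) ≤ K) (hL : 0 < L) (hγ : 0 < γ) (hγ' : γ ≤ 1 / 100) (hR : 0 < R)
    (hR' : R ≤ 1 / 10) (hT : 1 ≤ T) (hβ : 0 < β) (hβ' : β ≤ 1) :
    ‖∫ ω, rootSum (weighted G sharpCutoff) (F ω) ∂μ -
        ∫ ω, smoothSum (weighted G (softCutoff γ)) R (truncField T β (fun j : indices n => φ j)
          (⋃ i, ball (centres x z i) 2) (F ω)) ∂μ‖ ≤
      smoothingError (k + l) (charFunRadius τ ε) (2 * (k + 2 * l) + 2 * (k + l) / γ) R (δ ^ (-c₁))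
        T β (C * δ ^ α₁) ((k + l : ℕ) * stripError (charFunRadius τ ε) K L γ (C * δ ^ α₁))
        (δ ^ (-C₁)) C ((k + l : ℕ) * (2 * (C * δ ^ A))) := by
  have hU : ∀ i, ball (centres x z i) 2 ⊆ ⋃ i, ball (centres x z i) 2 := fun i =>
    Set.subset_iUnion (fun i => ball (centres x z i) 2) i
  have hc := centres_mem hx hz
  have : Nonempty (Fin k ⊕ Fin l) := Fintype.card_pos_iff.1 (by rw [card_sum_fin]; omega)
  obtain ⟨E, hEm, hEp, hE⟩ := h.exists_good_event hF hs hδ hδ' hc₁ hc hU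
  rw [card_sum_fin] at hEp
  have key := hs.norm_integral_rootSum_sub_smoothSum_le hU
    (fun i => h.isDelocalized hδ hC.le (hc i)) hτ hε₀ hε₁ (by positivity) hη hE hEm hEp hp
    (K := δ ^ (-C₁)) (C := C) (fun i => by rw [card_sum_fin]; exact h.hasRootMoment hF (hc i))
    (by positivity) hC.le (isTestFunction_weighted_softCutoff hγ hγ' hG hGd hG₀ hG₁)
    (weighted_mem_ball hG (abs_lt_of_softCutoff_ne_zero hγ hγ'))
    (weighted_mem_ball hG abs_lt_of_sharpCutoff_ne_zero)
    (norm_weighted_le (norm_le_two_of_nablaNorm hG₀) sharpCutoff_mem)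
    (hs.measurable_correlationSum hU hG hGd hG₀ hG₁)
    (measureReal_rootSum_ne_le hs h hζ hτ hε₀ hε₁ hδ hC hφ hx hz hG hK hK' hL hγ hγ')
    (by positivity) (one_le_rpow_of_pos_of_le_one_of_nonpos hδ hδ' (by linarith)) hR hR' hT hβ hβ'
  rw [card_sum_fin] at key
  exact key

/-- Integrability of the correlation sums, and the bound that does not use the smallness of `δ`. -/
lemma CondC2.integrable_correlationSum (hm : BoundedMoments n τ ε μ fun i ω => (ξ i ω : ℂ))
    (h : CondC2 n δ D φ μ (fun i ω => (ξ i ω : ℂ)) (k + l) C₁ α₁ A c₁ C) (hkl : 1 ≤ k + l)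
    (hδ : 0 < δ) (hC : 0 < C) (hx : ∀ i, (x i : ℂ) ∈ D) (hz : ∀ j, z j ∈ D)
    (hG : ∀ p, G p ≠ 0 → (∀ i, p.1 i ∈ Set.Icc (x i - 1 / 100) (x i + 1 / 100)) ∧
      ∀ j, p.2 j ∈ ball (z j) (1 / 100))
    (hGd : ContDiff ℝ 1 G) (hG₀ : nablaNorm 0 G ≤ 1) (hG₁ : nablaNorm 1 G ≤ 1) :
    Integrable (fun ω => correlationSum G (linComb n φ fun i => (ξ i ω : ℂ))) μ ∧
      ‖∫ ω, correlationSum G (linComb n φ fun i => (ξ i ω : ℂ)) ∂μ‖ ≤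
        2 * ((k + l : ℕ) * ((δ ^ (-C₁)) ^ (k + l) + C / (δ ^ (-C₁)) ^ 2)) := by
  have : Nonempty (Fin k ⊕ Fin l) := Fintype.card_pos_iff.1 (by rw [card_sum_fin]; omega)
  have hc := centres_mem hx hz
  obtain ⟨ζ, F, -, hF, hs⟩ := h.exists_isAnalyticSeries hm hc
  have hU : ∀ i, ball (centres x z i) 2 ⊆ ⋃ i, ball (centres x z i) 2 := fun i =>
    Set.subset_iUnion (fun i => ball (centres x z i) 2) i
  have hroot : ∀ i, HasRootMoment μ F (Fintype.card (Fin k ⊕ Fin l)) (δ ^ (-C₁)) C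
      (centres x z i) := fun i => by
    rw [card_sum_fin]
    exact h.hasRootMoment hF (hc i)
  have hsupp := weighted_mem_ball hG abs_lt_of_sharpCutoff_ne_zero
  have hbd := norm_weighted_le (norm_le_two_of_nablaNorm hG₀) (sharpCutoff_mem (k := k) (l := l))
  have hae : (fun ω => correlationSum G (linComb n φ fun i => (ξ i ω : ℂ))) =ᵐ[μ]
      fun ω => rootSum (weighted G sharpCutoff) (F ω) := by
    filter_upwards [hF] with ω hω
    rw [correlationSum_eq_rootSum, hω]
  refine ⟨(integrable_congr hae).2 (hs.integrable_rootSum hU hroot (by positivity) hC.le hsupp hbd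
    (hs.measurable_correlationSum hU hG hGd hG₀ hG₁)), ?_⟩
  rw [integral_congr_ae hae]
  have := hs.norm_integral_rootSum_le hU hroot (by positivity) hC.le hsupp hbd
  rwa [card_sum_fin] at this

/-- The comparison of the expected correlation sums, with free parameters. -/
lemma norm_integral_correlationSum_sub_le {N₀ : ℕ}
    (hC1 : CondC1 n N₀ τ ε μ μ' (fun i ω => (ξ i ω : ℂ)) (fun i ω => (ξ' i ω : ℂ)))
    (h : CondC2 n δ D φ μ (fun i ω => (ξ i ω : ℂ)) (k + l) C₁ α₁ A c₁ C)
    (h' : CondC2 n δ D φ μ' (fun i ω => (ξ' i ω : ℂ)) (k + l) C₁ α₁ A c₁ C) (hkl : 1 ≤ k + l)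
    (hτ : 0 < τ) (hε₀ : 0 < ε) (hε₁ : ε < 1) (hδ : 0 < δ) (hδ' : δ ≤ 1) (hC : 0 < C) (hc₁ : 0 ≤ c₁)
    (hφ : ∀ i ∈ indices n, ∀ x : ℝ, (φ i (x : ℂ)).im = 0)
    (hx : ∀ i, (x i : ℂ) ∈ D) (hz : ∀ j, z j ∈ D)
    (hG : ∀ p, G p ≠ 0 → (∀ i, p.1 i ∈ Set.Icc (x i - 1 / 100) (x i + 1 / 100)) ∧
      ∀ j, p.2 j ∈ ball (z j) (1 / 100))
    (hGd : ContDiff ℝ 1 G) (hG₀ : nablaNorm 0 G ≤ 1) (hG₁ : nablaNorm 1 G ≤ 1)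
    (hη : C * δ ^ α₁ ≤ charFunRadius τ ε / 100)
    (hp : (k + l : ℕ) * (2 * (C * δ ^ A)) ≤ 1 / 2) {K L γ R T β : ℝ} (hK : 1 ≤ K)
    (hK' : C * δ ^ (-c₁) ≤ K) (hL : 0 < L) (hγ : 0 < γ) (hγ' : γ ≤ 1 / 100) (hR : 0 < R)
    (hR' : R ≤ 1 / 10) (hT : 1 ≤ T) (hβ : 0 < β) (hβ' : β ≤ 1) :
    ‖(∫ ω, correlationSum G (linComb n φ fun i => (ξ i ω : ℂ)) ∂μ) -
        ∫ ω, correlationSum G (linComb n φ fun i => (ξ' i ω : ℂ)) ∂μ'‖ ≤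
      2 * smoothingError (k + l) (charFunRadius τ ε) (2 * (k + 2 * l) + 2 * (k + l) / γ) R
        (δ ^ (-c₁)) T β (C * δ ^ α₁)
        ((k + l : ℕ) * stripError (charFunRadius τ ε) K L γ (C * δ ^ α₁))
        (δ ^ (-C₁)) C ((k + l : ℕ) * (2 * (C * δ ^ A))) +
      2 * ((logMass * R ^ 2)⁻¹ ^ (k + l) * exchangeError (k + l) N₀ τ ε T β (C * δ ^ α₁)) := by
  have hJ := logMass_pos
  have hc := centres_mem hx hz
  have hU : ∀ i, ball (centres x z i) 2 ⊆ ⋃ i, ball (centres x z i) 2 := fun i =>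
    Set.subset_iUnion (fun i => ball (centres x z i) 2) i
  obtain ⟨ζ, F, hζ, hF, hs⟩ := h.exists_isAnalyticSeries hC1.left hc
  obtain ⟨ζ', F', hζ', hF', hs'⟩ := h'.exists_isAnalyticSeries hC1.right hc
  have h1 := norm_integral_sub_smoothSum_le hs h hζ hF hkl hτ hε₀ hε₁ hδ hδ' hC hc₁ hφ hx hz hG
    hGd hG₀ hG₁ hη hp hK hK' hL hγ hγ' hR hR' hT hβ hβ'
  have h2 := norm_integral_sub_smoothSum_le hs' h' hζ' hF' hkl hτ hε₀ hε₁ hδ hδ' hC hc₁ hφ hx hz hG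
    hGd hG₀ hG₁ hη hp hK hK' hL hγ hγ' hR hR' hT hβ hβ'
  have hmean : ∀ j : indices n, ∫ t, t ∂(μ.map (ζ j)) = ∫ ω, ξ j ω ∂μ := fun j =>
    (integral_map (hs.normalized.measurable j).aemeasurable
      aestronglyMeasurable_id).trans (integral_congr_ae (hζ j))
  have hmean' : ∀ j : indices n, ∫ t, t ∂(μ'.map (ζ' j)) = ∫ ω, ξ' j ω ∂μ' := fun j =>
    (integral_map (hs'.normalized.measurable j).aemeasurable
      aestronglyMeasurable_id).trans (integral_congr_ae (hζ' j))
  have h3 := norm_integral_smoothSum_truncField_sub_le hs hs' hτ hε₀ hε₁ hT hβ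
    (η := C * δ ^ α₁) (by positivity) hU (fun i => h.isDelocalized hδ hC.le (hc i))
    (indicesBelow n N₀) (fun j hj => ?_) (fun j hj => ?_)
    (isTestFunction_weighted_softCutoff hγ hγ' hG hGd hG₀ hG₁) hR hR'
  rotate_left
  · rw [hmean, hmean']
    have := hC1.matching j j.2 (not_lt.1 fun hlt => hj (mem_indicesBelow.2 hlt)) 1 0 (by norm_num)
    simpa using this
  · rw [hmean, hmean']
    have := hC1.exceptions j j.2 (mem_indicesBelow.1 hj)
    rwa [integral_complex_ofReal, integral_complex_ofReal, ← Complex.ofReal_sub, Complex.norm_real,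
      norm_eq_abs] at this
  rw [card_sum_fin] at h3
  have h4 : exchangeError (k + l) (indicesBelow n N₀).card τ ε T β (C * δ ^ α₁) ≤
      exchangeError (k + l) N₀ τ ε T β (C * δ ^ α₁) := by
    unfold exchangeError
    have : ((indicesBelow n N₀).card : ℝ) ≤ N₀ := by exact_mod_cast card_indicesBelow_le N₀
    gcongr
  have hae : (fun ω => correlationSum G (linComb n φ fun i => (ξ i ω : ℂ))) =ᵐ[μ]
      fun ω => rootSum (weighted G sharpCutoff) (F ω) := by
    filter_upwards [hF] with ω hω
    rw [correlationSum_eq_rootSum, hω]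
  have hae' : (fun ω => correlationSum G (linComb n φ fun i => (ξ' i ω : ℂ))) =ᵐ[μ']
      fun ω => rootSum (weighted G sharpCutoff) (F' ω) := by
    filter_upwards [hF'] with ω hω
    rw [correlationSum_eq_rootSum, hω]
  rw [integral_congr_ae hae, integral_congr_ae hae']
  set S := ∫ ω, rootSum (weighted G sharpCutoff) (F ω) ∂μ
  set S' := ∫ ω, rootSum (weighted G sharpCutoff) (F' ω) ∂μ'
  set X := ∫ ω, smoothSum (weighted G (softCutoff γ)) R (truncField T β
    (fun j : indices n => φ j) (⋃ i, ball (centres x z i) 2) (F ω)) ∂μ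
  set X' := ∫ ω, smoothSum (weighted G (softCutoff γ)) R (truncField T β
    (fun j : indices n => φ j) (⋃ i, ball (centres x z i) 2) (F' ω)) ∂μ'
  have h5 : ‖S - S'‖ ≤ ‖S - X‖ + ‖X - X'‖ + ‖S' - X'‖ := by
    rw [norm_sub_rev S' X', show S - S' = (S - X) + (X - X') + (X' - S') by ring]
    exact norm_add₃_le
  have h6 := h3.trans (mul_le_mul_of_nonneg_left (mul_le_mul_of_nonneg_left h4 (by positivity))
    zero_le_two)
  linarith

end TwoSeries

/-! ### The choice of the parameters -/

section Powers

open Real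

/-- `f δ` is a positive multiple of `δ ^ e`. -/
def IsMonomial (f : ℝ → ℝ) (e : ℝ) : Prop := ∃ a, 0 < a ∧ ∀ δ, 0 < δ → f δ = a * δ ^ e

/-- `f` is nonnegative and at most of the order of `δ ^ e` on the unit interval. -/
def IsBigPower (f : ℝ → ℝ) (e : ℝ) : Prop :=
  ∃ a, 0 ≤ a ∧ ∀ δ, 0 < δ → δ < 1 → 0 ≤ f δ ∧ f δ ≤ a * δ ^ e

variable {f g : ℝ → ℝ} {e e' : ℝ}

lemma isMonomial_rpow (e : ℝ) : IsMonomial (fun δ => δ ^ e) e :=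
  ⟨1, one_pos, fun _ _ => (one_mul _).symm⟩

lemma isMonomial_const {a : ℝ} (ha : 0 < a) : IsMonomial (fun _ => a) 0 :=
  ⟨a, ha, fun _ _ => by simp⟩

lemma IsMonomial.mul (hf : IsMonomial f e) (hg : IsMonomial g e') :
    IsMonomial (fun δ => f δ * g δ) (e + e') := by
  obtain ⟨a, ha, h⟩ := hf
  obtain ⟨b, hb, h'⟩ := hg
  refine ⟨a * b, by positivity, fun δ hδ => ?_⟩
  simp only [h δ hδ, h' δ hδ, rpow_add hδ]
  ring

lemma IsMonomial.div (hf : IsMonomial f e) (hg : IsMonomial g e') :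
    IsMonomial (fun δ => f δ / g δ) (e - e') := by
  obtain ⟨a, ha, h⟩ := hf
  obtain ⟨b, hb, h'⟩ := hg
  refine ⟨a / b, by positivity, fun δ hδ => ?_⟩
  simp only [h δ hδ, h' δ hδ, rpow_sub hδ]
  field_simp

lemma IsMonomial.inv (hf : IsMonomial f e) : IsMonomial (fun δ => (f δ)⁻¹) (-e) := by
  simpa using (isMonomial_const one_pos).div hf

lemma IsMonomial.rpow (hf : IsMonomial f e) (r : ℝ) : IsMonomial (fun δ => f δ ^ r) (r * e) := by
  obtain ⟨a, ha, h⟩ := hf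
  refine ⟨a ^ r, by positivity, fun δ hδ => ?_⟩
  simp only [h δ hδ]
  rw [mul_rpow ha.le (by positivity), ← rpow_mul hδ.le, mul_comm e]

lemma IsMonomial.pow (hf : IsMonomial f e) (n : ℕ) : IsMonomial (fun δ => f δ ^ n) (n * e) := by
  simpa using hf.rpow n

lemma IsMonomial.sqrt (hf : IsMonomial f e) : IsMonomial (fun δ => √(f δ)) (1 / 2 * e) := by
  simpa only [sqrt_eq_rpow] using hf.rpow (1 / 2)

lemma IsMonomial.isBigPower (hf : IsMonomial f e) (h : e' ≤ e) : IsBigPower f e' := by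
  obtain ⟨a, ha, hfa⟩ := hf
  refine ⟨a, ha.le, fun δ hδ hδ' => ?_⟩
  rw [hfa δ hδ]
  exact ⟨by positivity, mul_le_mul_of_nonneg_left (rpow_le_rpow_of_exponent_ge hδ hδ'.le h) ha.le⟩

lemma isBigPower_const {a : ℝ} (ha : 0 ≤ a) : IsBigPower (fun _ => a) 0 :=
  ⟨a, ha, fun δ _ _ => by simpa using ha⟩

lemma IsBigPower.mono (hf : IsBigPower f e) (h : e' ≤ e) : IsBigPower f e' := by
  obtain ⟨a, ha, hfa⟩ := hf
  exact ⟨a, ha, fun δ hδ hδ' => ⟨(hfa δ hδ hδ').1, (hfa δ hδ hδ').2.trans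
    (mul_le_mul_of_nonneg_left (rpow_le_rpow_of_exponent_ge hδ hδ'.le h) ha)⟩⟩

lemma IsBigPower.add (hf : IsBigPower f e) (hg : IsBigPower g e) :
    IsBigPower (fun δ => f δ + g δ) e := by
  obtain ⟨a, ha, h⟩ := hf
  obtain ⟨b, hb, h'⟩ := hg
  refine ⟨a + b, by positivity, fun δ hδ hδ' => ⟨add_nonneg (h δ hδ hδ').1 (h' δ hδ hδ').1, ?_⟩⟩
  rw [add_mul]
  exact add_le_add (h δ hδ hδ').2 (h' δ hδ hδ').2

lemma IsBigPower.mul (hf : IsBigPower f e) (hg : IsBigPower g e') :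
    IsBigPower (fun δ => f δ * g δ) (e + e') := by
  obtain ⟨a, ha, h⟩ := hf
  obtain ⟨b, hb, h'⟩ := hg
  refine ⟨a * b, by positivity, fun δ hδ hδ' => ⟨mul_nonneg (h δ hδ hδ').1 (h' δ hδ hδ').1, ?_⟩⟩
  rw [rpow_add hδ, mul_mul_mul_comm]
  exact mul_le_mul (h δ hδ hδ').2 (h' δ hδ hδ').2 (h' δ hδ hδ').1 (by positivity)

lemma IsBigPower.const_mul (hf : IsBigPower f e) {a : ℝ} (ha : 0 ≤ a) :
    IsBigPower (fun δ => a * f δ) e := by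
  simpa using (isBigPower_const ha).mul hf

end Powers

section Parameters

open Real

variable {k l m N₀ : ℕ} {τ ε C C₁ α₁ A c₁ a g h t b : ℝ}

/-- All errors are bounded by a positive power of `δ`. In terms of `a = α₁ ε`, the exponent of the
width `γ` of the strips is `g`, of order `a / m²`, and the smoothing radius `R` is `γ²` up to a
constant.  The truncation level `T = δ ^ (-t)` is large compared with `R ^ (-2m)`, while `T ^ m` is
small compared with the gain `δ ^ a` of Lindeberg's argument. -/
lemma isBigPower_error (hkl : m = k + l) (hm : 1 ≤ m) (hτ : 0 < τ) (hε₀ : 0 < ε) (hε₁ : ε < 1)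
    (hC : 0 < C) (hg : 0 < g) (hh : h = m * g) (hah : 10 ^ 4 * h ≤ a)
    (ht : t = 100 * h) (hmt : m * t = a / 100) (hb : b = a / 10) (hc₁ : 0 ≤ c₁)
    (hmc : m * c₁ ≤ g / 10 ^ 5) (haα : a ≤ α₁) (hεα : ε * α₁ = a) (hA : g / 10 ≤ A - m * C₁)
    (hA' : a / 60 ≤ A) :
    IsBigPower (fun δ => 2 * smoothingError m (charFunRadius τ ε)
        (2 * (k + 2 * l) + 2 * (k + l) / (1 / 100 * δ ^ g)) (1 / 10 * δ ^ (2 * g))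
        (δ ^ (-c₁)) (δ ^ (-t)) (δ ^ b) (C * δ ^ α₁)
        (m * stripError (charFunRadius τ ε) (max 1 C * δ ^ (-c₁)) (δ ^ (-(3 / 4 * g)))
          (1 / 100 * δ ^ g) (C * δ ^ α₁))
        (δ ^ (-C₁)) C (m * (2 * (C * δ ^ A))) +
      2 * ((logMass * (1 / 10 * δ ^ (2 * g)) ^ 2)⁻¹ ^ m *
        exchangeError m N₀ τ ε (δ ^ (-t)) (δ ^ b) (C * δ ^ α₁)))
      (min (g / 10) (2 * C₁)) := by
  have hJ := logMass_pos
  have hs0 := charFunRadius_pos (ε := ε) hτ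
  have hm1 : (1 : ℝ) ≤ m := by exact_mod_cast hm
  have hm0 : (0 : ℝ) < m := by linarith
  have hkl' : (m : ℝ) = k + l := by rw [hkl]; push_cast; ring
  have hgh : g ≤ h := by rw [hh]; nlinarith
  have hcm : c₁ ≤ m * c₁ := by nlinarith
  have htmt : t ≤ m * t := by nlinarith
  have hεb : ε * b ≤ b := by nlinarith
  have hcmin : min (g / 10) (2 * C₁) ≤ g / 10 := min_le_left _ _
  have hcmin' : min (g / 10) (2 * C₁) ≤ 2 * C₁ := min_le_right _ _
  set c := min (g / 10) (2 * C₁)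
  set s := charFunRadius τ ε
  have hmono : ∀ {e : ℝ} {d : ℝ}, 0 < d → IsMonomial (fun δ => d * δ ^ e) e := fun {e d} hd => by
    simpa using (isMonomial_const hd).mul (isMonomial_rpow e)
  have hγ : IsMonomial (fun δ : ℝ => 1 / 100 * δ ^ g) g := hmono (by norm_num)
  have hR : IsMonomial (fun δ : ℝ => 1 / 10 * δ ^ (2 * g)) (2 * g) := hmono (by norm_num)
  have hT := isMonomial_rpow (-t)
  have hQ := isMonomial_rpow (-c₁)
  have hβ := isMonomial_rpow b
  have hη : IsMonomial (fun δ : ℝ => C * δ ^ α₁) α₁ := hmono hC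
  have hK : IsMonomial (fun δ : ℝ => max 1 C * δ ^ (-c₁)) (-c₁) :=
    hmono (lt_of_lt_of_le one_pos (le_max_left _ _))
  have hL := isMonomial_rpow (-(3 / 4 * g))
  have hP := isMonomial_rpow (-C₁)
  have hp : IsMonomial (fun δ : ℝ => m * (2 * (C * δ ^ A))) A := by
    simpa using (isMonomial_const hm0).mul ((isMonomial_const two_pos).mul (hmono (e := A) hC))
  have hJR := (isMonomial_const hJ).mul (hR.pow 2)
  have hconst : ∀ {d : ℝ}, 0 < d → IsMonomial (fun _ => d) 0 := fun hd => isMonomial_const hd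
  have hQm := ((hconst (by norm_num : (0 : ℝ) < 5)).mul hQ).pow m
  -- the strips
  have hstrip : IsBigPower (fun δ => stripError s (max 1 C * δ ^ (-c₁)) (δ ^ (-(3 / 4 * g)))
      (1 / 100 * δ ^ g) (C * δ ^ α₁)) (g / 5) := by
    have h1 := ((hconst four_pos).mul (hK.pow 2)).div (hL.pow 2)
    have h2 := ((hconst (by norm_num : (0 : ℝ) < 36)).mul (hγ.pow 2)).mul hL
    have h3 := (hη.div ((hconst hs0).mul
      (((hconst three_pos).mul (hγ.pow 2)).mul hL))).pow 2
    have h4 := (h1.isBigPower (e' := 6 / 5 * g) (by push_cast; linarith)).add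
      ((h2.isBigPower (e' := 6 / 5 * g) (by push_cast; linarith)).add
        (h3.isBigPower (e' := 6 / 5 * g) (by push_cast; linarith)))
    exact ((((hconst one_pos).div hγ).isBigPower le_rfl).mul h4).mono (by linarith)
  have hs1 : IsBigPower (fun δ => 4 * (5 * δ ^ (-c₁)) ^ m * (m * stripError s
      (max 1 C * δ ^ (-c₁)) (δ ^ (-(3 / 4 * g))) (1 / 100 * δ ^ g) (C * δ ^ α₁))) c :=
    ((((hconst four_pos).mul hQm).isBigPower le_rfl).mul (hstrip.const_mul hm0.le)).mono
      (by linarith)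
  -- the smoothing
  have hΛ : IsBigPower (fun δ => 2 * ((k : ℝ) + 2 * l) + 2 * (k + l) / (1 / 100 * δ ^ g)) (-g) := by
    refine IsBigPower.add ((isBigPower_const (by positivity)).mono (by linarith))
      (((hconst ?_).div hγ).isBigPower (by linarith))
    rw [← hkl']
    positivity
  have hs2 : IsBigPower (fun δ => smoothError m s
      (2 * ((k : ℝ) + 2 * l) + 2 * (k + l) / (1 / 100 * δ ^ g)) (1 / 10 * δ ^ (2 * g))
      (δ ^ (-c₁)) (δ ^ (-t)) (δ ^ b) (C * δ ^ α₁)) c := by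
    unfold smoothError
    refine IsBigPower.add (((hΛ.mul (hR.isBigPower le_rfl)).mul
      (hQm.isBigPower le_rfl)).mono (by linarith)) ?_
    have h1 := ((hconst (by norm_num : (0 : ℝ) < 10 ^ 7)).mul (hQ.pow 2)).div hT
    have h2 := (hconst (by norm_num : (0 : ℝ) < 12)).mul hβ.sqrt
    have h3 := (hη.div ((hconst hs0).mul hβ.sqrt)).pow 2
    have h4 := (h2.isBigPower (e' := 200 * h) (by linarith)).add
      (h3.isBigPower (e' := 200 * h) (by push_cast; linarith))
    have h5 := (((hconst two_pos).mul hT).isBigPower le_rfl).mul h4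
    have h6 := ((hβ.isBigPower (e' := 50 * h) (by linarith)).add
      (h1.isBigPower (e' := 50 * h) (by push_cast; linarith))).add
      (h5.mono (e' := 50 * h) (by linarith))
    have h7 := (((hconst two_pos).div hJR).pow m)
    have h8 := ((hconst two_pos).mul
      ((hconst (by norm_num : (0 : ℝ) < 2 * 10 ^ 6)).mul hQ)).pow (m - 1)
    have h9 := (((hconst two_pos).mul h7).mul h8).isBigPower le_rfl
    refine (h9.mul (h6.const_mul hm0.le)).mono ?_
    rw [Nat.cast_sub hm]
    push_cast
    linarith
  -- the bad event
  have hs3 : IsBigPower (fun δ : ℝ => 2 * (m * ((δ ^ (-C₁)) ^ m * (m * (2 * (C * δ ^ A))) +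
      C / (δ ^ (-C₁)) ^ 2)) + 2 * (2 * δ ^ (-t) / (logMass * (1 / 10 * δ ^ (2 * g)) ^ 2)) ^ m *
        (m * (2 * (C * δ ^ A)))) c := by
    have h1 := (((hP.pow m).mul hp).isBigPower (e' := c) (by linarith)).add
      (((hconst hC).div (hP.pow 2)).isBigPower (e' := c) (by push_cast; linarith))
    have h2 := (((hconst two_pos).mul ((((hconst two_pos).mul hT).div hJR).pow m)).mul hp)
    exact ((h1.const_mul hm0.le).const_mul two_pos.le).add
      (h2.isBigPower (by push_cast; linarith))
  -- the exchange of the variables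
  have hs4 : IsBigPower (fun δ : ℝ => (logMass * (1 / 10 * δ ^ (2 * g)) ^ 2)⁻¹ ^ m *
      exchangeError m N₀ τ ε (δ ^ (-t)) (δ ^ b) (C * δ ^ α₁)) c := by
    have h0 : (0 : ℝ) < √(2 * m) := by positivity
    have h1 := ((hconst h0).mul hη).div hβ
    have h2 := (((hconst (by positivity : 0 < 4 * τ)).mul (h1.rpow ε)).mul
      ((hconst (by positivity : (0 : ℝ) < 2 * m)).div (hβ.pow 2)))
    have h3 := (h2.isBigPower (e' := a / 2) (by push_cast; linarith)).add
      (((h1.isBigPower (e' := a / 2) (by linarith)).const_mul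
        (by positivity : (0 : ℝ) ≤ N₀ * (2 + τ))))
    have h4 := (((hconst (by norm_num : (0 : ℝ) < 400)).mul hT).pow m).isBigPower le_rfl
    exact (((hJR.inv.pow m).isBigPower le_rfl).mul (h4.mul h3)).mono (by push_cast; linarith)
  exact (((hs1.add hs2).add hs3).const_mul two_pos.le).add (hs4.const_mul two_pos.le)

lemma exists_forall_rpow_le {e r : ℝ} (he : 0 < e) (hr : 0 < r) :
    ∃ δ₀, 0 < δ₀ ∧ ∀ δ : ℝ, 0 < δ → δ ≤ δ₀ → δ ^ e ≤ r := by
  refine ⟨r ^ e⁻¹, by positivity, fun δ hδ hδ' => ?_⟩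
  calc δ ^ e ≤ (r ^ e⁻¹) ^ e := rpow_le_rpow hδ.le hδ' he.le
    _ = r := rpow_inv_rpow hr.le he.ne'

end Parameters

end RandomRoots

open RandomRoots Real

theorem theorem2p4 (N₀ : ℕ) (τ ε : ℝ) (hτ : 0 < τ) (hε₀ : 0 < ε) (hε₁ : ε < 1)
    (α₁ C₁ C : ℝ) (hα₁ : 0 < α₁) (hC₁ : 0 < C₁) (hC : 0 < C)
    (k l : ℕ) (hkl : 1 ≤ k + l) :
    ∃ C' c : ℝ, 0 < C' ∧ 0 < c ∧
      ∀ (n : ℕ∞) (δ : ℝ) (D : Set ℂ) (φ : ℕ → ℂ → ℂ)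
        (Ω : Type*) (_ : MeasurableSpace Ω) (μ : Measure Ω) (_ : IsProbabilityMeasure μ)
        (Ω' : Type*) (_ : MeasurableSpace Ω') (μ' : Measure Ω') (_ : IsProbabilityMeasure μ')
        (ξ : ℕ → Ω → ℝ) (ξ' : ℕ → Ω' → ℝ),
        0 < δ → δ < 1 →
        (∀ i ∈ RandomRoots.indices n, ∀ x : ℝ, (φ i (x : ℂ)).im = 0) →
        RandomRoots.CondC1 n N₀ τ ε μ μ' (fun i ω => (ξ i ω : ℂ)) (fun i ω => (ξ' i ω : ℂ)) →
        RandomRoots.CondC2 n δ D φ μ (fun i ω => (ξ i ω : ℂ)) (k + l) C₁ α₁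
          (2 * ((k : ℝ) + l + 2) * (C₁ + 2) + α₁ * ε / 60)
          (α₁ * ε / (10 ^ 9 * ((k : ℝ) + l) ^ 4)) C →
        RandomRoots.CondC2 n δ D φ μ' (fun i ω => (ξ' i ω : ℂ)) (k + l) C₁ α₁
          (2 * ((k : ℝ) + l + 2) * (C₁ + 2) + α₁ * ε / 60)
          (α₁ * ε / (10 ^ 9 * ((k : ℝ) + l) ^ 4)) C →
        ∀ (x : Fin k → ℝ) (z : Fin l → ℂ), (∀ i, (x i : ℂ) ∈ D) → (∀ j, z j ∈ D) →
        ∀ G : (Fin k → ℝ) × (Fin l → ℂ) → ℂ,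
          (∀ p, G p ≠ 0 → (∀ i, p.1 i ∈ Set.Icc (x i - 1 / 100) (x i + 1 / 100)) ∧
            ∀ j, p.2 j ∈ Metric.ball (z j) (1 / 100)) →
          ContDiff ℝ ((2 * (k + l) + 4 : ℕ) : WithTop ℕ∞) G →
          (∀ a ≤ 2 * (k + l) + 4, RandomRoots.nablaNorm a G ≤ 1) →
          Integrable (fun ω => RandomRoots.correlationSum G
            (RandomRoots.linComb n φ (fun i => (ξ i ω : ℂ)))) μ ∧
          Integrable (fun ω => RandomRoots.correlationSum G
            (RandomRoots.linComb n φ (fun i => (ξ' i ω : ℂ)))) μ' ∧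
          ‖(∫ ω, RandomRoots.correlationSum G
                (RandomRoots.linComb n φ (fun i => (ξ i ω : ℂ))) ∂μ) -
              ∫ ω, RandomRoots.correlationSum G
                (RandomRoots.linComb n φ (fun i => (ξ' i ω : ℂ))) ∂μ'‖ ≤ C' * δ ^ c := by
  have hm : (1 : ℝ) ≤ (k + l : ℕ) := by exact_mod_cast hkl
  have hm0 : (0 : ℝ) < (k + l : ℕ) := by linarith
  have hcast : (k : ℝ) + l = (k + l : ℕ) := by push_cast; rfl
  set m : ℝ := ((k + l : ℕ) : ℝ) with hmdef
  set a := α₁ * ε with ha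
  have ha0 : 0 < a := by positivity
  -- the exponent of the width of the strips around the real axis
  set g := a / (10 ^ 4 * m ^ 2) with hg
  have hg0 : 0 < g := by positivity
  set c₁ := a / (10 ^ 9 * ((k : ℝ) + l) ^ 4) with hc₁
  set A := 2 * ((k : ℝ) + l + 2) * (C₁ + 2) + a / 60 with hA
  have hmg : 10 ^ 4 * (m * g) = a / m := by rw [hg]; field_simp
  have ham : a / m ≤ a := div_le_self ha0.le hm
  have hgm : g ≤ m * g := le_mul_of_one_le_left hg0.le hm
  have hc₁0 : 0 ≤ c₁ := by positivity
  have hA' : a / 60 ≤ A := by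
    rw [hA]
    have : 0 ≤ 2 * ((k : ℝ) + l + 2) * (C₁ + 2) := by positivity
    linarith
  have hA0 : 0 < A := by linarith
  have hs0 := charFunRadius_pos (ε := ε) hτ
  obtain ⟨M, hM, hMle⟩ := isBigPower_error (N₀ := N₀) (m := k + l) (C := C) (C₁ := C₁)
    (α₁ := α₁) (A := A) (c₁ := c₁) (a := a) (g := g) (h := m * g) (t := 100 * (m * g))
    (b := a / 10) rfl hkl hτ hε₀ hε₁ hC hg0 rfl (by linarith) rfl
    (by rw [← hmdef, hg]; field_simp; norm_num) rfl hc₁0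
    (by
      rw [← hmdef, hc₁, hcast, hg, mul_div_assoc', div_div, div_le_div_iff₀ (by positivity)
        (by positivity)]
      have : m ^ 3 ≤ m ^ 4 := pow_le_pow_right₀ hm (by norm_num)
      nlinarith)
    (by rw [ha]; nlinarith) (by rw [ha]; ring)
    (by
      rw [← hmdef, hA, hcast]
      nlinarith [mul_pos hm0 hC₁])
    hA'
  -- for small `δ`, no coefficient dominates and the bad events have probability at most `1 / 2`
  obtain ⟨δ₁, hδ₁, h₁⟩ := exists_forall_rpow_le hα₁
    (show 0 < charFunRadius τ ε / 100 / C by positivity)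
  obtain ⟨δ₂, hδ₂, h₂⟩ := exists_forall_rpow_le hA0
    (show 0 < 1 / 2 / (m * (2 * C)) by positivity)
  set c := min (g / 10) (2 * C₁) with hc
  have hc0 : 0 < c := lt_min (by positivity) (by positivity)
  set δ₀ := min δ₁ δ₂ with hδ₀
  have hδ₀0 : 0 < δ₀ := lt_min hδ₁ hδ₂
  set B := 2 * (m * ((δ₀ ^ (-C₁)) ^ (k + l) + C)) with hB
  have hB0 : 0 < B := by positivity
  refine ⟨M + 2 * B * δ₀ ^ (-c), c, by positivity, hc0, ?_⟩
  intro n δ D φ Ω _ μ _ Ω' _ μ' _ ξ ξ' hδ hδ' hφ hC1 h h' x z hx hz G hG hGd hGn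
  have hGd₁ : ContDiff ℝ 1 G := hGd.of_le (by exact_mod_cast (by omega : 1 ≤ 2 * (k + l) + 4))
  have hG₀ := hGn 0 (by omega)
  have hG₁ := hGn 1 (by omega)
  obtain ⟨hi, hb⟩ := h.integrable_correlationSum hC1.left hkl hδ hC hx hz hG hGd₁ hG₀ hG₁
  obtain ⟨hi', hb'⟩ := h'.integrable_correlationSum hC1.right hkl hδ hC hx hz hG hGd₁ hG₀ hG₁
  refine ⟨hi, hi', ?_⟩
  rcases le_or_gt δ δ₀ with hle | hgt
  · have e₁ := h₁ δ hδ (hle.trans (min_le_left _ _))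
    have e₂ := h₂ δ hδ (hle.trans (min_le_right _ _))
    rw [le_div_iff₀ hC] at e₁
    rw [le_div_iff₀ (by positivity)] at e₂
    have hone : ∀ e : ℝ, 0 ≤ e → δ ^ e ≤ 1 := fun e he => rpow_le_one hδ.le hδ'.le he
    have hone' : ∀ e : ℝ, e ≤ 0 → 1 ≤ δ ^ e := fun e he =>
      one_le_rpow_of_pos_of_le_one_of_nonpos hδ hδ'.le he
    have key := norm_integral_correlationSum_sub_le hC1 h h' hkl hτ hε₀ hε₁ hδ hδ'.le hC hc₁0 hφ hx
      hz hG hGd₁ hG₀ hG₁ (by linarith) (by rw [← hmdef]; linarith)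
      (K := max 1 C * δ ^ (-c₁)) (L := δ ^ (-(3 / 4 * g))) (γ := 1 / 100 * δ ^ g)
      (R := 1 / 10 * δ ^ (2 * g)) (T := δ ^ (-(100 * (m * g)))) (β := δ ^ (a / 10))
      (one_le_mul_of_one_le_of_one_le (le_max_left _ _) (hone' _ (by linarith)))
      (mul_le_mul_of_nonneg_right (le_max_right _ _) (by positivity)) (by positivity)
      (by positivity) (by linarith [hone g hg0.le]) (by positivity)
      (by linarith [hone (2 * g) (by positivity)]) (hone' _ (by nlinarith)) (by positivity)
      (hone _ (by positivity))
    refine (key.trans (hMle δ hδ hδ').2).trans ?_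
    gcongr
    have : 0 ≤ 2 * B * δ₀ ^ (-c) := by positivity
    linarith
  · -- for large `δ`, the expectations are bounded
    have hP : δ ^ (-C₁) ≤ δ₀ ^ (-C₁) := rpow_le_rpow_of_nonpos hδ₀0 hgt.le (by linarith)
    have hP' : 1 ≤ δ ^ (-C₁) := one_le_rpow_of_pos_of_le_one_of_nonpos hδ hδ'.le (by linarith)
    have hBle : 2 * (m * ((δ ^ (-C₁)) ^ (k + l) + C / (δ ^ (-C₁)) ^ 2)) ≤ B := by
      rw [hB]
      gcongr
      exact div_le_self hC.le (one_le_pow₀ hP')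
    have hone : 1 ≤ δ₀ ^ (-c) * δ ^ c := by
      rw [rpow_neg hδ₀0.le, ← div_eq_inv_mul, one_le_div (by positivity)]
      exact rpow_le_rpow hδ₀0.le hgt.le hc0.le
    calc _ ≤ B + B := (norm_sub_le _ _).trans (add_le_add (hb.trans hBle) (hb'.trans hBle))
      _ = 2 * B := (two_mul B).symm
      _ ≤ 2 * B * (δ₀ ^ (-c) * δ ^ c) := le_mul_of_one_le_right (by positivity) hone
      _ ≤ M * δ ^ c + 2 * B * (δ₀ ^ (-c) * δ ^ c) := by
          have : 0 ≤ M * δ ^ c := by positivity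
          linarith
      _ = _ := by ring
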